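/- Let $S$ be an inverse semigroup with unit $1$ and let $A$ be a $C^*$-algebra. An \emph{action} $\mathcal E$ of $S$ on $A$ by Hilbert bimodules consists of Hilbert $A$-bimodules $\mathcal E_t$ ($t\in S$) and Hilbert bimodule isomorphisms $\mu_{t,u}\colon \mathcal E_t\otimes_A\mathcal E_u\to\mathcal E_{tu}$ that are associative, such that $\mathcal E_1=A$ and $\mu_{1,t}$, $\mu_{t,1}$ are the maps $a\otimes\xi\mapsto a\xi$, $\xi\otimes a\mapsto \xi a$. A \emph{representation} of $\mathcal E$ in a $C^*$-algebra $B$ is a family of linear maps $\pi_t\colon\mathcal E_t\to B$ with $\pi_{tu}(\mu_{t,u}(\xi\otimes\eta))=\pi_t(\xi)\pi_u(\eta)$, $\pi_t(\xi)^*\pi_t(\xi')=\pi_1(\langle\xi,\xi'\rangle)$ and $\pi_t(\xi)\pi_t(\xi')^*=\pi_1(\langle\!\langle\xi,\xi'\rangle\!\rangle)$, where $\langle\cdot,\cdot\rangle$ and $\langle\!\langle\cdot,\cdot\rangle\!\rangle$ are the right and left inner products. The \emph{full crossed product} $A\rtimes S$ is the universal $C^*$-algebra for representations of $\mathcal E$;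 write $\xi\mapsto\xi\delta_t$ for the canonical maps $\mathcal E_t\to A\rtimes S$. For $t\in S$, let $I_{1,t}$ be the closed ideal of $A$ generated by the right inner products of elements of $\mathcal E_v$ for $v\le 1,t$, and let $\vartheta_{1,t}\colon\mathcal E_t\cdot I_{1,t}\to I_{1,t}\subseteq A$ be the canonical isomorphism, which identifies the copies of $\mathcal E_v$ in $\mathcal E_t$ and in $\mathcal E_1=A$ for all $v\le 1,t$. The \emph{canonical weak conditional expectation} is the bounded linear map $E\colon A\rtimes S\to A''$ with $E(\xi\delta_t)=\lim_i\vartheta_{1,t}(\xi u_i)$ for $\xi\in\mathcal E_t$ and any contractive approximate unit $(u_i)$ of $I_{1,t}$ (weak-$*$ limit in the bidual $A''$). The \emph{reduced crossed product} is $A\rtimes_{\mathrm r}S=(A\rtimes S)/\mathcal N_E$ with $\mathcal N_E=\{b : E(b^*b)=0\}$, and $\Lambda\colon A\rtimes S\to A\rtimes_{\mathrm r}S$ is the quotient map. Let $I$ be a closed two-sided ideal of $A$ that is invariant, that is, $I\mathcal E_t=\mathcal E_tI$ (closed linear spans) for all $t\in S$. Then $\mathcal E$ restricts to the action $(\mathcal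 E_tI)_{t\in S}$ on $I$ and to the action $(\mathcal E_t/\mathcal E_tI)_{t\in S}$ on $A/I$. Let $\iota\rtimes S\colon I\rtimes S\to A\rtimes S$ and $\kappa\rtimes S\colon A\rtimes S\to A/I\rtimes S$ be the $*$-homomorphisms induced by the inclusions $\iota_t\colon\mathcal E_tI\to\mathcal E_t$ and the quotient maps $\kappa_t\colon\mathcal E_t\to\mathcal E_t/\mathcal E_tI$. Then: 1. The sequence $0\to I\rtimes S\xrightarrow{\iota\rtimes S}A\rtimes S\xrightarrow{\kappa\rtimes S}A/I\rtimes S\to0$ is exact. 2. For each of the three actions, on $I$, $A$ and $A/I$, the canonical weak conditional expectation exists and the kernel of $\Lambda$ is exactly $\mathcal N_E$, so that $\mathcal N_E$ is a closed two-sided ideal. The maps $\iota\rtimes S$ and $\kappa\rtimes S$ intertwine these weak expectations, that is, $E^A\circ(\iota\rtimes S)=\iota_1''\circ E^I$ and $E^{A/I}\circ(\kappa\rtimes S)=\kappa_1''\circ E^A$. They descend to $*$-homomorphisms $\iota\rtimes_{\mathrm r}S$ and $\kappa\rtimes_{\mathrm r}S$ between the reduced crossed products, that is, $(\iota\rtimes_{\mathrm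 r}S)\circ\Lambda=\Lambda\circ(\iota\rtimes S)$ and $(\kappa\rtimes_{\mathrm r}S)\circ\Lambda=\Lambda\circ(\kappa\rtimes S)$. 3. The resulting sequence $0\to I\rtimes_{\mathrm r}S\to A\rtimes_{\mathrm r}S\to A/I\rtimes_{\mathrm r}S\to0$ may fail to be exact only in the middle: $\iota\rtimes_{\mathrm r}S$ is injective, $\kappa\rtimes_{\mathrm r}S$ is surjective, and the range of $\iota\rtimes_{\mathrm r}S$ is contained in the kernel of $\kappa\rtimes_{\mathrm r}S$. -/

import Mathlib

universe u v

namespace ISG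

open Filter Topology
open scoped ComplexConjugate

/-! ### Inverse monoids -/

/-- An inverse semigroup with unit. -/
class InverseMonoid (S : Type u) extends Monoid S, Inv S where
  mul_inv_mul_self : ∀ s : S, s * s⁻¹ * s = s
  inv_mul_inv_self : ∀ s : S, s⁻¹ * s * s⁻¹ = s⁻¹
  inv_unique : ∀ s r : S, s * r * s = s → r * s * r = r → r = s⁻¹

/-- The natural partial order of an inverse semigroup: `v ≤ t` iff `v = t v⁻¹ v`. -/
def NatLE {S : Type u} [InverseMonoid S] (v t : S) : Prop := v = t * (v⁻¹ * v)

lemma NatLE.idem {S : Type u} [InverseMonoid S] {e : S} (h : NatLE e 1) : e * e = e := by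
  have h1 : e = e⁻¹ * e := by simpa [NatLE] using h
  calc e * e = e⁻¹ * e * e := by rw [← h1]
    _ = e⁻¹ * e * (e⁻¹ * e) := by rw [← h1]
    _ = (e⁻¹ * e * e⁻¹) * e := by simp only [mul_assoc]
    _ = e := by rw [InverseMonoid.inv_mul_inv_self, ← h1]

lemma NatLE.mul_eq {S : Type u} [InverseMonoid S] {e t : S} (h : NatLE e 1) (h' : NatLE e t) :
    t * e = e := by
  have h1 : e = e⁻¹ * e := by simpa [NatLE] using h
  have h2 : e = t * (e⁻¹ * e) := h'
  rw [← h1] at h2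
  exact h2.symm

/-! ### Closed two-sided ideals of C⋆-algebras, as C⋆-algebras, and the quotients by them -/

section Approx

variable {A : Type u} [NonUnitalCStarAlgebra A]

lemma norm_sub_mul_le_of_nonneg [PartialOrder A] [StarOrderedRing A] {e : A} (h0 : 0 ≤ e)
    (h1 : ‖e‖ ≤ 1) (y : A) : ‖y - y * e‖ ≤ ‖y‖ ∧ ‖y - e * y‖ ≤ ‖y‖ := by
  let _ := CStarAlgebra.spectralOrder (Unitization ℂ A)
  have := CStarAlgebra.spectralOrderedRing (Unitization ℂ A)
  have h0' : 0 ≤ (e : Unitization ℂ A) := by rwa [Unitization.inr_nonneg_iff]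
  have h1' : (e : Unitization ℂ A) ≤ 1 := by
    rw [← CStarAlgebra.norm_le_one_iff_of_nonneg _ h0', Unitization.norm_inr]
    exact h1
  have h2 : ‖(1 : Unitization ℂ A) - e‖ ≤ 1 := by
    rw [CStarAlgebra.norm_le_one_iff_of_nonneg _ (sub_nonneg.mpr h1')]
    simpa using h0'
  constructor
  · rw [← Unitization.norm_inr (𝕜 := ℂ) (y - y * e), ← Unitization.norm_inr (𝕜 := ℂ) y]
    have : ((y - y * e : A) : Unitization ℂ A) = y * (1 - e) := by
      rw [mul_sub, mul_one, Unitization.inr_sub, Unitization.inr_mul]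
    rw [this]
    calc _ ≤ ‖(y : Unitization ℂ A)‖ * ‖(1 : Unitization ℂ A) - e‖ := norm_mul_le _ _
      _ ≤ _ := mul_le_of_le_one_right (norm_nonneg _) h2
  · rw [← Unitization.norm_inr (𝕜 := ℂ) (y - e * y), ← Unitization.norm_inr (𝕜 := ℂ) y]
    have : ((y - e * y : A) : Unitization ℂ A) = (1 - e) * y := by
      rw [sub_mul, one_mul, Unitization.inr_sub, Unitization.inr_mul]
    rw [this]
    calc _ ≤ ‖(1 : Unitization ℂ A) - e‖ * ‖(y : Unitization ℂ A)‖ := norm_mul_le _ _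
      _ ≤ _ := mul_le_of_le_one_left (norm_nonneg _) h2

lemma exists_approx_of_closed {T : Type v} [SetLike T A] [NonUnitalSubringClass T A]
    [SMulMemClass T ℂ A] [StarMemClass T A] (B : T) (hB : IsClosed (B : Set A)) {x : A}
    (hx : x ∈ B) {ε : ℝ} (hε : 0 < ε) :
    ∃ e ∈ B, star e = e ∧ (∀ y : A, ‖y - y * e‖ ≤ ‖y‖ ∧ ‖y - e * y‖ ≤ ‖y‖) ∧
      ‖x - x * e‖ < ε ∧ ‖x - e * x‖ < ε := by
  have := hB
  let _ := CStarAlgebra.spectralOrder A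
  have := CStarAlgebra.spectralOrderedRing A
  let _ := CStarAlgebra.spectralOrder B
  have := CStarAlgebra.spectralOrderedRing B
  have H := CStarAlgebra.increasingApproximateUnit (A := B)
  have hne := H.neBot
  have e1 := (Metric.tendsto_nhds.mp (H.tendsto_mul_left ⟨x, hx⟩)) ε hε
  have e2 := (Metric.tendsto_nhds.mp (H.tendsto_mul_right ⟨x, hx⟩)) ε hε
  obtain ⟨e, ⟨⟨h1, h2⟩, h3⟩, h4⟩ :=
    ((e1.and e2).and (H.eventually_nonneg) |>.and H.eventually_norm).exists
  rw [dist_comm, dist_eq_norm] at h1 h2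
  have hpos : (0 : A) ≤ (e : A) := by
    obtain ⟨s, hs⟩ := CStarAlgebra.nonneg_iff_eq_star_mul_self.mp h3
    rw [hs]
    exact star_mul_self_nonneg (s : A)
  exact ⟨e, e.2, (IsSelfAdjoint.of_nonneg hpos).star_eq,
    fun y => norm_sub_mul_le_of_nonneg hpos h4 y, h1, h2⟩

end Approx

/-- A closed two-sided ideal of a C⋆-algebra. -/
structure ClosedIdeal (A : Type u) [NonUnitalCStarAlgebra A] extends Submodule ℂ A where
  isClosed' : IsClosed carrier
  mul_mem_left' : ∀ (a : A) {x : A}, x ∈ carrier → a * x ∈ carrier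
  mul_mem_right' : ∀ (a : A) {x : A}, x ∈ carrier → x * a ∈ carrier

namespace ClosedIdeal

variable {A : Type u} [NonUnitalCStarAlgebra A]

instance : SetLike (ClosedIdeal A) A where
  coe I := I.carrier
  coe_injective I J h := by
    cases I; cases J; congr; exact SetLike.coe_injective h

variable (I : ClosedIdeal A)

lemma mem_toSubmodule {x : A} : x ∈ I.toSubmodule ↔ x ∈ I := Iff.rfl

lemma mul_mem_left (a : A) {x : A} (hx : x ∈ I) : a * x ∈ I := I.mul_mem_left' a hx

lemma mul_mem_right (a : A) {x : A} (hx : x ∈ I) : x * a ∈ I := I.mul_mem_right' a hx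

instance : NonUnitalSubringClass (ClosedIdeal A) A where
  add_mem {I _ _} ha hb := I.toSubmodule.add_mem ha hb
  zero_mem I := I.toSubmodule.zero_mem
  neg_mem {I _} ha := I.toSubmodule.neg_mem ha
  mul_mem {I a _} _ hb := I.mul_mem_left a hb

instance : SMulMemClass (ClosedIdeal A) ℂ A where
  smul_mem {I} c _ ha := I.toSubmodule.smul_mem c ha

instance isClosed : IsClosed (I : Set A) := I.isClosed'

instance isClosed_toSubmodule : IsClosed (I.toSubmodule : Set A) := I.isClosed'

instance : StarMemClass (ClosedIdeal A) A where
  star_mem {I x} hx := by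
    let B : NonUnitalStarSubalgebra ℂ A :=
      { carrier := {y | y ∈ I ∧ star y ∈ I}
        add_mem' := fun ha hb => ⟨add_mem ha.1 hb.1, by rw [star_add]; exact add_mem ha.2 hb.2⟩
        zero_mem' := ⟨zero_mem I, by rw [star_zero]; exact zero_mem I⟩
        mul_mem' := fun ha hb => ⟨mul_mem ha.1 hb.1, by rw [star_mul]; exact mul_mem hb.2 ha.2⟩
        smul_mem' := fun c y hy => ⟨SMulMemClass.smul_mem c hy.1, by
          rw [star_smul]; exact SMulMemClass.smul_mem _ hy.2⟩
        star_mem' := fun {a} ha => ⟨ha.2, by rw [star_star]; exact ha.1⟩ }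
    have hB : IsClosed (B : Set A) :=
      I.isClosed.inter (I.isClosed.preimage continuous_star)
    have hxx : x * star x ∈ B := ⟨I.mul_mem_right _ hx, by
      rw [star_mul, star_star]; exact I.mul_mem_right _ hx⟩
    have hcl : star x ∈ closure (I : Set A) := by
      rw [Metric.mem_closure_iff]
      intro ε hε
      obtain ⟨e, heB, hes, hec, he1, -⟩ :=
        exists_approx_of_closed B hB hxx (ε := ε ^ 2) (by positivity)
      refine ⟨star x * e, I.mul_mem_left _ heB.1, ?_⟩
      rw [dist_eq_norm]
      have h1 : ‖star x - star x * e‖ ^ 2 < ε ^ 2 := by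
        rw [sq, ← CStarRing.norm_star_mul_self]
        have : star (star x - star x * e) * (star x - star x * e)
            = (x * star x - x * star x * e) - e * (x * star x - x * star x * e) := by
          simp only [star_sub, star_mul, star_star, hes]
          noncomm_ring
        rw [this]
        exact lt_of_le_of_lt (hec _).2 he1
      exact lt_of_pow_lt_pow_left₀ 2 hε.le h1
    rwa [I.isClosed.closure_eq] at hcl

/-- The smallest closed two-sided ideal that contains a given set. -/
def generated (s : Set A) : ClosedIdeal A where
  carrier := {x | ∀ J : ClosedIdeal A, s ⊆ J → x ∈ J}
  add_mem' ha hb J hJ := add_mem (ha J hJ) (hb J hJ)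
  zero_mem' J _ := zero_mem J
  smul_mem' c _ hx J hJ := SMulMemClass.smul_mem c (hx J hJ)
  isClosed' := by
    have : {x | ∀ J : ClosedIdeal A, s ⊆ J → x ∈ J} =
        ⋂ (J : ClosedIdeal A) (_ : s ⊆ J), (J : Set A) := by ext; simp
    rw [this]
    exact isClosed_iInter fun J => isClosed_iInter fun _ => J.isClosed
  mul_mem_left' a _ hx J hJ := J.mul_mem_left a (hx J hJ)
  mul_mem_right' a _ hx J hJ := J.mul_mem_right a (hx J hJ)

lemma exists_approx {x : A} (hx : x ∈ I) {ε : ℝ} (hε : 0 < ε) :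
    ∃ e ∈ I, star e = e ∧ (∀ y : A, ‖y - y * e‖ ≤ ‖y‖ ∧ ‖y - e * y‖ ≤ ‖y‖) ∧
      ‖x - x * e‖ < ε ∧ ‖x - e * x‖ < ε :=
  exists_approx_of_closed I I.isClosed hx hε

/-- A positive element of an ideal has a square root in the ideal. -/
lemma exists_star_mul_self {a : A} (h : star a * a ∈ I) :
    ∃ b ∈ I, star a * a = star b * b := by
  let _ := CStarAlgebra.spectralOrder A
  have := CStarAlgebra.spectralOrderedRing A
  have hp : 0 ≤ star a * a := star_mul_self_nonneg a
  refine ⟨CFC.sqrt (star a * a), ?_, ?_⟩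
  · rw [CFC.sqrt_eq_real_sqrt _ hp]
    exact cfcₙ_mem (s := I) _ h
  · rw [(IsSelfAdjoint.of_nonneg (CFC.sqrt_nonneg (star a * a))).star_eq, CFC.sqrt_mul_sqrt_self _ hp]

/-- The quotient `A / I`, with the quotient norm. -/
def Quot : Type u := A ⧸ I.toSubmodule

namespace Quot

noncomputable instance : NormedAddCommGroup I.Quot :=
  inferInstanceAs (NormedAddCommGroup (A ⧸ I.toSubmodule))

noncomputable instance : NormedSpace ℂ I.Quot :=
  inferInstanceAs (NormedSpace ℂ (A ⧸ I.toSubmodule))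

instance : CompleteSpace I.Quot := inferInstanceAs (CompleteSpace (A ⧸ I.toSubmodule))

/-- The quotient map `A → A / I` as a linear map. -/
def mk : A →ₗ[ℂ] I.Quot := I.toSubmodule.mkQ

variable {I}

lemma mk_surjective : Function.Surjective (mk I) := Submodule.mkQ_surjective _

lemma mk_eq_zero {a : A} : mk I a = 0 ↔ a ∈ I := Submodule.Quotient.mk_eq_zero _

lemma mk_eq_mk {a b : A} : mk I a = mk I b ↔ a - b ∈ I := Submodule.Quotient.eq _

lemma norm_mk_le (a : A) : ‖mk I a‖ ≤ ‖a‖ := Submodule.Quotient.norm_mk_le _ _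

lemma exists_norm_lt (a : A) {ε : ℝ} (hε : 0 < ε) : ∃ b ∈ I, ‖a + b‖ < ‖mk I a‖ + ε := by
  obtain ⟨m, hm, h⟩ := Submodule.Quotient.norm_mk_lt (S := I.toSubmodule) (mk I a) hε
  refine ⟨m - a, mk_eq_mk.mp hm, ?_⟩
  rw [add_sub_cancel]
  exact h

lemma norm_compress_lt (a : A) {ε : ℝ} (hε : 0 < ε) :
    ∃ e ∈ I, star e = e ∧ ‖a - a * e - e * (a - a * e)‖ < ‖mk I a‖ + ε := by
  obtain ⟨b, hb, hab⟩ := exists_norm_lt (I := I) a (half_pos hε)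
  obtain ⟨e, he, hes, hec, he1, -⟩ := I.exists_approx hb (half_pos hε)
  refine ⟨e, he, hes, ?_⟩
  refine lt_of_le_of_lt (hec _).2 ?_
  have : a - a * e = ((a + b) - (a + b) * e) - (b - b * e) := by noncomm_ring
  rw [this]
  calc _ ≤ ‖(a + b) - (a + b) * e‖ + ‖b - b * e‖ := norm_sub_le _ _
    _ ≤ ‖a + b‖ + ‖b - b * e‖ := by gcongr; exact (hec _).1
    _ < _ := by linarith

variable (I) in
/-- Multiplication on `A / I`. -/
noncomputable def mulBilin : I.Quot →ₗ[ℂ] I.Quot →ₗ[ℂ] I.Quot :=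
  LinearMap.liftQ₂ I.toSubmodule I.toSubmodule ((LinearMap.mul ℂ A).compr₂ (mk I))
    (fun _ hx => LinearMap.ext fun y => mk_eq_zero.mpr (I.mul_mem_right y hx))
    (fun _ hx => LinearMap.ext fun y => mk_eq_zero.mpr (I.mul_mem_left y hx))

noncomputable instance : Mul I.Quot := ⟨fun x y => mulBilin I x y⟩

lemma mk_mul (a b : A) : mk I (a * b) = mk I a * mk I b := rfl

variable (I) in
/-- The involution of `A / I`. -/
noncomputable def starMap : I.Quot →ₗ⋆[ℂ] I.Quot :=
  I.toSubmodule.liftQ ((mk I).comp (starLinearEquiv ℂ (A := A)).toLinearMap)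
    (fun _ hx => mk_eq_zero.mpr (star_mem (S := ClosedIdeal A) hx))

noncomputable instance : Star I.Quot := ⟨fun x => starMap I x⟩

lemma mk_star (a : A) : mk I (star a) = star (mk I a) := rfl

noncomputable instance instNonUnitalRing : NonUnitalRing I.Quot where
  left_distrib x y z := (mulBilin I x).map_add y z
  right_distrib x y z := (mulBilin I).map_add₂ x y z
  zero_mul x := (mulBilin I).map_zero₂ x
  mul_zero x := (mulBilin I x).map_zero
  mul_assoc x y z := by
    obtain ⟨a, rfl⟩ := mk_surjective x
    obtain ⟨b, rfl⟩ := mk_surjective y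
    obtain ⟨c, rfl⟩ := mk_surjective z
    simp only [← mk_mul, mul_assoc]

noncomputable instance : StarRing I.Quot where
  star_involutive x := by
    obtain ⟨a, rfl⟩ := mk_surjective x
    simp only [← mk_star, star_star]
  star_add x y := (starMap I).map_add x y
  star_mul x y := by
    obtain ⟨a, rfl⟩ := mk_surjective x
    obtain ⟨b, rfl⟩ := mk_surjective y
    simp only [← mk_mul, ← mk_star, star_mul]

lemma norm_sq_le (x : I.Quot) : ‖x‖ * ‖x‖ ≤ ‖star x * x‖ := by
  obtain ⟨a, rfl⟩ := mk_surjective x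
  refine le_of_forall_pos_le_add fun ε hε => ?_
  rw [← mk_star, ← mk_mul]
  obtain ⟨e, he, hes, h⟩ := norm_compress_lt (I := I) (star a * a) hε
  have h1 : mk I a = mk I (a - a * e) := by
    rw [mk_eq_mk]; simpa using I.mul_mem_left a he
  have h2 : star (a - a * e) * (a - a * e)
      = star a * a - star a * a * e - e * (star a * a - star a * a * e) := by
    simp only [star_sub, star_mul, hes]; noncomm_ring
  rw [h1]
  refine le_trans ?_ h.le
  rw [← h2, CStarRing.norm_star_mul_self]
  gcongr <;> exact norm_mk_le _

noncomputable instance : NonUnitalCStarAlgebra I.Quot where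
  __ := instNonUnitalRing
  __ := (inferInstance : NormedAddCommGroup I.Quot)
  __ := (inferInstance : NormedSpace ℂ I.Quot)
  __ := (inferInstance : StarRing I.Quot)
  __ := (inferInstance : CompleteSpace I.Quot)
  norm_mul_le x y := by
    refine le_of_forall_pos_lt_add fun ε hε => ?_
    have hc : Continuous fun δ : ℝ => (‖x‖ + δ) * (‖y‖ + δ) := by fun_prop
    have h0 := (Metric.continuousAt_iff.mp (hc.continuousAt (x := 0))) ε hε
    obtain ⟨δ, hδ, h⟩ := h0
    have h' := @h (δ / 2) (by simp [abs_of_pos hδ, hδ])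
    obtain ⟨a, rfl⟩ := mk_surjective x
    obtain ⟨b, rfl⟩ := mk_surjective y
    obtain ⟨i, hi, hai⟩ := exists_norm_lt (I := I) a (half_pos hδ)
    obtain ⟨j, hj, hbj⟩ := exists_norm_lt (I := I) b (half_pos hδ)
    have e1 : mk I a = mk I (a + i) := by rw [mk_eq_mk]; simpa using hi
    have e2 : mk I b = mk I (b + j) := by rw [mk_eq_mk]; simpa using hj
    have h3 : ‖mk I a * mk I b‖ ≤ (‖mk I a‖ + δ / 2) * (‖mk I b‖ + δ / 2) := by
      calc ‖mk I a * mk I b‖ = ‖mk I ((a + i) * (b + j))‖ := by rw [mk_mul, ← e1, ← e2]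
        _ ≤ ‖(a + i) * (b + j)‖ := norm_mk_le _
        _ ≤ ‖a + i‖ * ‖b + j‖ := norm_mul_le _ _
        _ ≤ _ := by gcongr
    rw [Real.dist_eq] at h'
    have := (abs_lt.mp h').2
    simp only [add_zero] at this
    linarith
  norm_mul_self_le x := norm_sq_le x
  smul_assoc c x y := (mulBilin I).map_smul₂ c x y
  smul_comm c x y := ((mulBilin I x).map_smul c y).symm
  star_smul c x := (starMap I).map_smulₛₗ c x

end Quot

/-- The quotient map `A → A / I` as a `⋆`-homomorphism. -/
noncomputable def mkHom : A →⋆ₙₐ[ℂ] I.Quot where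
  toFun := Quot.mk I
  map_smul' := (Quot.mk I).map_smul
  map_zero' := (Quot.mk I).map_zero
  map_add' := (Quot.mk I).map_add
  map_mul' := Quot.mk_mul
  map_star' := Quot.mk_star

/-- The quotient map `A → A / I` as a bounded linear map. -/
noncomputable def mkL : A →L[ℂ] I.Quot := (Quot.mk I).mkContinuous 1 (by
  intro x; simpa using Quot.norm_mk_le x)

/-- The inclusion `I → A` as a bounded linear map. -/
noncomputable def inclL : I →L[ℂ] A where
  toFun x := x
  map_add' _ _ := rfl
  map_smul' _ _ := rfl
  cont := continuous_subtype_val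

end ClosedIdeal

/-! ### Hilbert bimodules and actions by Hilbert bimodules -/

/-- A Hilbert `A`-bimodule: a Banach space with commuting left and right `A`-module structures and
left and right `A`-valued inner products, each of which makes it a Hilbert `A`-module
(for the given norm), subject to `⟪ξ, η⟫ ζ = ξ ⟨η, ζ⟩`. No fullness is required.
`lsmul a ξ` is `a ξ`, `rsmul ξ a` is `ξ a`; `linner ξ η` is the left inner product `⟪ξ, η⟫`
(linear in `ξ`), and `rinner ξ η` is the right inner product `⟨ξ, η⟩` (linear in `η`).
Positivity of `p` in the C⋆-algebra `A` is expressed as `p = a⋆ a`. -/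
class HilbertBimodule (A : Type u) [NonUnitalCStarAlgebra A] (E : Type u)
    [NormedAddCommGroup E] [NormedSpace ℂ E] where
  complete : CompleteSpace E
  lsmul : A →ₗ[ℂ] E →ₗ[ℂ] E
  rsmul : E →ₗ[ℂ] A →ₗ[ℂ] E
  linner : E →ₗ[ℂ] E →ₗ⋆[ℂ] A
  rinner : E →ₗ⋆[ℂ] E →ₗ[ℂ] A
  mul_lsmul : ∀ a b ξ, lsmul (a * b) ξ = lsmul a (lsmul b ξ)
  rsmul_mul : ∀ ξ a b, rsmul ξ (a * b) = rsmul (rsmul ξ a) b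
  lsmul_rsmul : ∀ a ξ b, rsmul (lsmul a ξ) b = lsmul a (rsmul ξ b)
  linner_lsmul : ∀ a ξ η, linner (lsmul a ξ) η = a * linner ξ η
  rinner_rsmul : ∀ ξ η a, rinner ξ (rsmul η a) = rinner ξ η * a
  star_linner : ∀ ξ η, star (linner ξ η) = linner η ξ
  star_rinner : ∀ ξ η, star (rinner ξ η) = rinner η ξ
  linner_self_nonneg : ∀ ξ, ∃ a, linner ξ ξ = star a * a
  rinner_self_nonneg : ∀ ξ, ∃ a, rinner ξ ξ = star a * a
  norm_linner_self : ∀ ξ, ‖linner ξ ξ‖ = ‖ξ‖ * ‖ξ‖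
  norm_rinner_self : ∀ ξ, ‖rinner ξ ξ‖ = ‖ξ‖ * ‖ξ‖
  linner_lsmul_eq : ∀ ξ η ζ, lsmul (linner ξ η) ζ = rsmul ξ (rinner η ζ)

/-- A bounded sesquilinear form on the diagonal is bounded. -/
lemma norm_sesq_le {E X : Type u} [NormedAddCommGroup E] [NormedSpace ℂ E]
    [NormedAddCommGroup X] [NormedSpace ℂ X] (f : E →ₗ⋆[ℂ] E →ₗ[ℂ] X)
    (hf : ∀ x, ‖f x x‖ ≤ ‖x‖ * ‖x‖) (ξ η : E) : ‖f ξ η‖ ≤ 4 * (‖ξ‖ * ‖η‖) := by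
  have aux : ∀ ξ η : E, ‖f ξ η‖ ≤ (‖ξ‖ + ‖η‖) * (‖ξ‖ + ‖η‖) := by
    intro ξ η
    have key : (4 : ℂ) • f ξ η
        = f (ξ + η) (ξ + η) - f (ξ - η) (ξ - η)
          - Complex.I • f (ξ + Complex.I • η) (ξ + Complex.I • η)
          + Complex.I • f (ξ - Complex.I • η) (ξ - Complex.I • η) := by
      simp only [map_add, map_sub, LinearMap.add_apply, LinearMap.sub_apply, map_smulₛₗ,
        LinearMap.smul_apply, smul_add, smul_sub, smul_smul, Complex.conj_I, RingHom.id_apply]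
      simp only [mul_neg, Complex.I_mul_I, neg_neg, neg_smul, one_smul]
      module
    have hb : ∀ x : E, ‖x‖ ≤ ‖ξ‖ + ‖η‖ → ‖f x x‖ ≤ (‖ξ‖ + ‖η‖) * (‖ξ‖ + ‖η‖) := fun x hx => by
      refine (hf x).trans ?_; gcongr
    have hI : ‖Complex.I • η‖ = ‖η‖ := by rw [norm_smul]; simp
    have h4 : ‖(4 : ℂ) • f ξ η‖ = 4 * ‖f ξ η‖ := by
      rw [norm_smul]; simp
    have h1 := hb _ (norm_add_le ξ η)
    have h2 := hb _ (norm_sub_le ξ η)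
    have h3 := hb (ξ + Complex.I • η) ((norm_add_le _ _).trans (by rw [hI]))
    have h5 := hb (ξ - Complex.I • η) ((norm_sub_le _ _).trans (by rw [hI]))
    have h6 : ‖(4 : ℂ) • f ξ η‖ ≤ 4 * ((‖ξ‖ + ‖η‖) * (‖ξ‖ + ‖η‖)) := by
      rw [key]
      refine (norm_add_le _ _).trans ?_
      refine (add_le_add_left ((norm_sub_le _ _).trans
        (add_le_add_left (norm_sub_le _ _) _)) _).trans ?_
      simp only [norm_smul, Complex.norm_I, one_mul]
      linarith
    linarith
  rcases eq_or_ne ξ 0 with rfl | hξ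
  · simp
  rcases eq_or_ne η 0 with rfl | hη
  · simp
  have h1 : 0 < ‖ξ‖ := norm_pos_iff.mpr hξ
  have h2 : 0 < ‖η‖ := norm_pos_iff.mpr hη
  have := aux (((‖ξ‖⁻¹ : ℝ) : ℂ) • ξ) (((‖η‖⁻¹ : ℝ) : ℂ) • η)
  simp only [map_smulₛₗ, LinearMap.smul_apply, norm_smul, Complex.conj_ofReal, RingHom.id_apply,
    Complex.norm_real, norm_inv, norm_norm, inv_mul_cancel₀ h1.ne', inv_mul_cancel₀ h2.ne'] at this
  rw [← mul_assoc, ← mul_inv, inv_mul_le_iff₀ (by positivity)] at this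
  linarith

namespace HilbertBimodule

variable {A : Type u} [NonUnitalCStarAlgebra A] {E : Type u} [NormedAddCommGroup E]
  [NormedSpace ℂ E] [HilbertBimodule A E]

lemma rinner_rsmul_left (ξ η : E) (a : A) :
    rinner (rsmul ξ a) η = star a * rinner (A := A) ξ η := by
  rw [← star_rinner, rinner_rsmul, star_mul, star_rinner]

lemma linner_lsmul_right (ξ η : E) (a : A) :
    linner ξ (lsmul a η) = linner (A := A) ξ η * star a := by
  rw [← star_linner, linner_lsmul, star_mul, star_linner]

lemma norm_rsmul_le (ξ : E) (a : A) : ‖rsmul ξ a‖ ≤ ‖ξ‖ * ‖a‖ := by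
  refine le_of_sq_le_sq ?_ (by positivity)
  rw [sq, ← norm_rinner_self (A := A), rinner_rsmul, rinner_rsmul_left]
  calc ‖star a * rinner ξ ξ * a‖ ≤ ‖star a‖ * ‖rinner (A := A) ξ ξ‖ * ‖a‖ := by
        refine (norm_mul_le _ _).trans ?_
        gcongr
        exact norm_mul_le _ _
    _ = _ := by rw [norm_star, norm_rinner_self]; ring

lemma norm_lsmul_le (a : A) (ξ : E) : ‖lsmul a ξ‖ ≤ ‖a‖ * ‖ξ‖ := by
  refine le_of_sq_le_sq ?_ (by positivity)
  rw [sq, ← norm_linner_self (A := A), linner_lsmul, linner_lsmul_right]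
  calc ‖a * (linner ξ ξ * star a)‖ ≤ ‖a‖ * (‖linner (A := A) ξ ξ‖ * ‖star a‖) := by
        refine (norm_mul_le _ _).trans ?_
        gcongr
        exact norm_mul_le _ _
    _ = _ := by rw [norm_star, norm_linner_self]; ring

lemma continuous_lsmul (a : A) : Continuous (lsmul (E := E) a) :=
  AddMonoidHomClass.continuous_of_bound _ ‖a‖ fun ξ => norm_lsmul_le a ξ

lemma continuous_rsmul (a : A) : Continuous fun ξ : E => rsmul ξ a :=
  AddMonoidHomClass.continuous_of_bound ((rsmul (A := A) (E := E)).flip a) ‖a‖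
    fun ξ => (norm_rsmul_le ξ a).trans (mul_comm _ _).le

lemma continuous_rsmul_left (ξ : E) : Continuous (rsmul (A := A) ξ) :=
  AddMonoidHomClass.continuous_of_bound _ ‖ξ‖ fun a => norm_rsmul_le ξ a

lemma continuous_lsmul_left (ξ : E) : Continuous fun a : A => lsmul a ξ :=
  AddMonoidHomClass.continuous_of_bound ((lsmul (A := A) (E := E)).flip ξ) ‖ξ‖
    fun a => (norm_lsmul_le a ξ).trans (mul_comm _ _).le

lemma norm_rinner_le (ξ η : E) : ‖rinner (A := A) ξ η‖ ≤ 4 * (‖ξ‖ * ‖η‖) :=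
  norm_sesq_le (rinner (A := A)) (fun ξ => (norm_rinner_self ξ).le) ξ η

lemma continuous_rinner (ξ : E) : Continuous (rinner (A := A) ξ) :=
  AddMonoidHomClass.continuous_of_bound _ (4 * ‖ξ‖) fun η =>
    (norm_rinner_le ξ η).trans (by rw [mul_assoc])

lemma continuous_linner (η : E) : Continuous fun ξ : E => linner (A := A) ξ η :=
  AddMonoidHomClass.continuous_of_bound ((linner (A := A) (E := E)).flip η) (4 * ‖η‖)
    fun ξ => (norm_sesq_le (linner (A := A) (E := E)).flip
      (fun ξ => (norm_linner_self ξ).le) η ξ).trans (by rw [mul_assoc])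

end HilbertBimodule

open HilbertBimodule

/-- An action of the inverse monoid `S` on the C⋆-algebra `A` by Hilbert bimodules.

* `fib t` is the Hilbert bimodule at `t`.
* The Hilbert bimodule isomorphism `μ_{t,u} : fib t ⊗_A fib u ≅ fib (t u)` is recorded by the map
  `mul : (ξ, η) ↦ μ_{t,u} (ξ ⊗ η)`. As the inner products of the (completed, interior) tensor
  product are `⟨ξ ⊗ η, ξ' ⊗ η'⟩ = ⟨η, ⟨ξ, ξ'⟩ η'⟩` and `⟪ξ ⊗ η, ξ' ⊗ η'⟫ = ⟪ξ ⟪η, η'⟫, ξ'⟫`,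
  such isomorphisms are the same thing as `A`-balanced bimodule maps that transform the inner
  products in this way and whose range has dense linear span. To have no casts between `fib (t u)`
  and `fib v` for `v = t u`, the map takes a proof of `t * u = v` as an argument.
* `unit` identifies `fib 1` with the identity Hilbert bimodule `A`. -/
structure Action (S A : Type u) [InverseMonoid S] [NonUnitalCStarAlgebra A] where
  fib : S → Type u
  [normedAddCommGroup : ∀ t, NormedAddCommGroup (fib t)]
  [normedSpace : ∀ t, NormedSpace ℂ (fib t)]
  [hilbertBimodule : ∀ t, HilbertBimodule A (fib t)]
  mul : ∀ {t u v : S}, t * u = v → fib t →ₗ[ℂ] fib u →ₗ[ℂ] fib v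
  mul_balanced : ∀ {t u v : S} (h : t * u = v) (ξ : fib t) (a : A) (η : fib u),
    mul h (rsmul ξ a) η = mul h ξ (lsmul a η)
  mul_lsmul_left : ∀ {t u v : S} (h : t * u = v) (a : A) (ξ : fib t) (η : fib u),
    mul h (lsmul a ξ) η = lsmul a (mul h ξ η)
  mul_rsmul_right : ∀ {t u v : S} (h : t * u = v) (ξ : fib t) (η : fib u) (a : A),
    mul h ξ (rsmul η a) = rsmul (mul h ξ η) a
  rinner_mul : ∀ {t u v : S} (h : t * u = v) (ξ ξ' : fib t) (η η' : fib u),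
    rinner (A := A) (mul h ξ η) (mul h ξ' η') = rinner η (lsmul (rinner (A := A) ξ ξ') η')
  linner_mul : ∀ {t u v : S} (h : t * u = v) (ξ ξ' : fib t) (η η' : fib u),
    linner (A := A) (mul h ξ η) (mul h ξ' η') = linner (rsmul ξ (linner (A := A) η η')) ξ'
  mul_dense : ∀ {t u v : S} (h : t * u = v),
    (Submodule.span ℂ {ζ | ∃ ξ η, ζ = mul h ξ η}).topologicalClosure = ⊤
  mul_assoc : ∀ {t u v tu uv tuv : S} (h₁ : t * u = tu) (h₂ : tu * v = tuv) (h₃ : u * v = uv)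
    (h₄ : t * uv = tuv) (ξ : fib t) (η : fib u) (ζ : fib v),
    mul h₂ (mul h₁ ξ η) ζ = mul h₄ ξ (mul h₃ η ζ)
  unit : A ≃ₗ[ℂ] fib 1
  lsmul_unit : ∀ a b, lsmul a (unit b) = unit (a * b)
  rsmul_unit : ∀ a b, rsmul (unit a) b = unit (a * b)
  linner_unit : ∀ a b, linner (unit a) (unit b) = a * star b
  rinner_unit : ∀ a b, rinner (unit a) (unit b) = star a * b
  unit_mul : ∀ {t : S} (h : 1 * t = t) (a : A) (ξ : fib t), mul h (unit a) ξ = lsmul a ξ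
  mul_unit : ∀ {t : S} (h : t * 1 = t) (ξ : fib t) (a : A), mul h ξ (unit a) = rsmul ξ a

attribute [instance] Action.normedAddCommGroup Action.normedSpace Action.hilbertBimodule

namespace Action

variable {S A : Type u} [InverseMonoid S] [NonUnitalCStarAlgebra A]

section basic

variable (Γ : Action S A)

lemma norm_mul_le {t u v : S} (h : t * u = v) (ξ : Γ.fib t) (η : Γ.fib u) :
    ‖Γ.mul h ξ η‖ ≤ 2 * (‖ξ‖ * ‖η‖) := by
  refine le_of_sq_le_sq ?_ (by positivity)
  rw [sq, ← norm_rinner_self (A := A), Γ.rinner_mul]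
  refine (norm_rinner_le _ _).trans ?_
  calc 4 * (‖η‖ * ‖lsmul (rinner (A := A) ξ ξ) η‖)
      ≤ 4 * (‖η‖ * (‖rinner (A := A) ξ ξ‖ * ‖η‖)) := by gcongr; exact norm_lsmul_le _ _
    _ = _ := by rw [norm_rinner_self]; ring

lemma continuous_mul_left {t u v : S} (h : t * u = v) (η : Γ.fib u) :
    Continuous fun ξ => Γ.mul h ξ η :=
  AddMonoidHomClass.continuous_of_bound ((Γ.mul h).flip η) (2 * ‖η‖) fun ξ =>
    (Γ.norm_mul_le h ξ η).trans (by rw [mul_comm ‖ξ‖, _root_.mul_assoc])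

lemma continuous_mul_right {t u v : S} (h : t * u = v) (ξ : Γ.fib t) :
    Continuous (Γ.mul h ξ) :=
  AddMonoidHomClass.continuous_of_bound _ (2 * ‖ξ‖) fun η =>
    (Γ.norm_mul_le h ξ η).trans (by rw [_root_.mul_assoc])

lemma norm_unit (a : A) : ‖Γ.unit a‖ = ‖a‖ := by
  have h := norm_rinner_self (A := A) (Γ.unit a)
  rw [Γ.rinner_unit, CStarRing.norm_star_mul_self] at h
  exact ((mul_self_inj (norm_nonneg _) (norm_nonneg _)).mp h).symm

lemma continuous_unit : Continuous Γ.unit :=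
  AddMonoidHomClass.continuous_of_bound Γ.unit 1 fun a => by rw [one_mul, Γ.norm_unit]

lemma continuous_unit_symm : Continuous Γ.unit.symm :=
  AddMonoidHomClass.continuous_of_bound Γ.unit.symm 1 fun ξ => by
    rw [one_mul, ← Γ.norm_unit, LinearEquiv.apply_symm_apply]

end basic

/-! ### Invariant ideals and the restrictions of an action to `I` and to `A / I` -/

section ideal

variable (Γ : Action S A) (I : ClosedIdeal A)

/-- `fib t · I`, the closed linear span of the products `ξ a` with `a ∈ I`. -/
def fibMulIdeal (t : S) : Submodule ℂ (Γ.fib t) :=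
  (Submodule.span ℂ {ζ | ∃ ξ : Γ.fib t, ∃ a ∈ I, ζ = rsmul ξ a}).topologicalClosure

/-- `I · fib t`, the closed linear span of the products `a ξ` with `a ∈ I`. -/
def idealMulFib (t : S) : Submodule ℂ (Γ.fib t) :=
  (Submodule.span ℂ {ζ | ∃ a ∈ I, ∃ ξ : Γ.fib t, ζ = lsmul a ξ}).topologicalClosure

/-- The ideal `I` is invariant: `I · fib t = fib t · I` for all `t`. -/
def IsInvariant : Prop := ∀ t, Γ.idealMulFib I t = Γ.fibMulIdeal I t

instance isClosed_fibMulIdeal (t : S) : IsClosed (Γ.fibMulIdeal I t : Set (Γ.fib t)) :=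
  Submodule.isClosed_topologicalClosure _

variable {Γ I}

lemma rsmul_mem {t : S} (ξ : Γ.fib t) {a : A} (ha : a ∈ I) :
    rsmul ξ a ∈ Γ.fibMulIdeal I t :=
  Submodule.le_topologicalClosure _ (Submodule.subset_span ⟨ξ, a, ha, rfl⟩)

/-- A closed linear condition holds on `fib t · I` if it holds for products. -/
lemma fibMulIdeal_induction {t : S} {p : Γ.fib t → Prop}
    (zero : p 0) (add : ∀ x y, p x → p y → p (x + y)) (smul : ∀ (c : ℂ) x, p x → p (c • x))
    (closed : IsClosed {x | p x}) (prod : ∀ (ξ : Γ.fib t), ∀ a ∈ I, p (rsmul ξ a))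
    {ξ : Γ.fib t} (h : ξ ∈ Γ.fibMulIdeal I t) : p ξ := by
  let P : Submodule ℂ (Γ.fib t) :=
    { carrier := {x | p x}, add_mem' := add _ _, zero_mem' := zero, smul_mem' := smul }
  have : Γ.fibMulIdeal I t ≤ P :=
    Submodule.topologicalClosure_minimal _ (Submodule.span_le.mpr (by
      rintro _ ⟨ξ, a, ha, rfl⟩; exact prod ξ a ha)) closed
  exact this h

lemma idealMulFib_induction {t : S} {p : Γ.fib t → Prop}
    (zero : p 0) (add : ∀ x y, p x → p y → p (x + y)) (smul : ∀ (c : ℂ) x, p x → p (c • x))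
    (closed : IsClosed {x | p x}) (prod : ∀ (ξ : Γ.fib t), ∀ a ∈ I, p (lsmul a ξ))
    (hI : Γ.IsInvariant I) {ξ : Γ.fib t} (h : ξ ∈ Γ.fibMulIdeal I t) : p ξ := by
  let P : Submodule ℂ (Γ.fib t) :=
    { carrier := {x | p x}, add_mem' := add _ _, zero_mem' := zero, smul_mem' := smul }
  have : Γ.idealMulFib I t ≤ P :=
    Submodule.topologicalClosure_minimal _ (Submodule.span_le.mpr (by
      rintro _ ⟨a, ha, ξ, rfl⟩; exact prod ξ a ha)) closed
  rw [← hI t] at h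
  exact this h

lemma lsmul_mem (hI : Γ.IsInvariant I) {t : S} {a : A} (ha : a ∈ I) (ξ : Γ.fib t) :
    lsmul a ξ ∈ Γ.fibMulIdeal I t := by
  rw [← hI t]
  exact Submodule.le_topologicalClosure _ (Submodule.subset_span ⟨a, ha, ξ, rfl⟩)

lemma lsmul_mem_of_mem {t : S} (a : A) {ξ : Γ.fib t} (hξ : ξ ∈ Γ.fibMulIdeal I t) :
    lsmul a ξ ∈ Γ.fibMulIdeal I t := by
  refine fibMulIdeal_induction (p := fun ξ => lsmul a ξ ∈ Γ.fibMulIdeal I t) ?_ ?_ ?_ ?_ ?_ hξ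
  · simp
  · intro x y hx hy; rw [map_add]; exact add_mem hx hy
  · intro c x hx; rw [map_smul]; exact Submodule.smul_mem _ _ hx
  · exact (Γ.isClosed_fibMulIdeal I t).preimage (continuous_lsmul a)
  · intro ξ b hb; rw [← lsmul_rsmul]; exact rsmul_mem _ hb

lemma rinner_mem {t : S} (ξ : Γ.fib t) {η : Γ.fib t} (hη : η ∈ Γ.fibMulIdeal I t) :
    rinner ξ η ∈ I := by
  refine fibMulIdeal_induction (p := fun η => rinner ξ η ∈ I) ?_ ?_ ?_ ?_ ?_ hη
  · simp
  · intro x y hx hy; rw [map_add]; exact add_mem hx hy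
  · intro c x hx; rw [map_smul]; exact SMulMemClass.smul_mem _ hx
  · exact I.isClosed.preimage (continuous_rinner ξ)
  · intro ζ b hb; rw [rinner_rsmul]; exact I.mul_mem_left _ hb

lemma rinner_mem' {t : S} {ξ : Γ.fib t} (hξ : ξ ∈ Γ.fibMulIdeal I t) (η : Γ.fib t) :
    rinner ξ η ∈ I := by
  rw [← star_rinner]; exact star_mem (rinner_mem η hξ)

lemma linner_mem (hI : Γ.IsInvariant I) {t : S} {ξ : Γ.fib t} (hξ : ξ ∈ Γ.fibMulIdeal I t)
    (η : Γ.fib t) : linner ξ η ∈ I := by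
  refine idealMulFib_induction (p := fun ξ => linner ξ η ∈ I) ?_ ?_ ?_ ?_ ?_ hI hξ
  · simp
  · intro x y hx hy; rw [map_add]; exact add_mem hx hy
  · intro c x hx; rw [map_smul]; exact SMulMemClass.smul_mem _ hx
  · exact I.isClosed.preimage (continuous_linner η)
  · intro ζ b hb; rw [linner_lsmul]; exact I.mul_mem_right _ hb

lemma linner_mem' (hI : Γ.IsInvariant I) {t : S} (ξ : Γ.fib t) {η : Γ.fib t}
    (hη : η ∈ Γ.fibMulIdeal I t) : linner ξ η ∈ I := by
  rw [← star_linner]; exact star_mem (linner_mem hI hη ξ)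

lemma mul_mem {t u v : S} (h : t * u = v) (ξ : Γ.fib t) {η : Γ.fib u}
    (hη : η ∈ Γ.fibMulIdeal I u) : Γ.mul h ξ η ∈ Γ.fibMulIdeal I v := by
  refine fibMulIdeal_induction (p := fun η => Γ.mul h ξ η ∈ Γ.fibMulIdeal I v) ?_ ?_ ?_ ?_ ?_ hη
  · simp
  · intro x y hx hy; rw [map_add]; exact add_mem hx hy
  · intro c x hx; rw [map_smul]; exact Submodule.smul_mem _ _ hx
  · exact (Γ.isClosed_fibMulIdeal I v).preimage (Γ.continuous_mul_right h ξ)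
  · intro ζ b hb; rw [Γ.mul_rsmul_right]; exact rsmul_mem _ hb

lemma mul_mem' (hI : Γ.IsInvariant I) {t u v : S} (h : t * u = v) {ξ : Γ.fib t}
    (hξ : ξ ∈ Γ.fibMulIdeal I t) (η : Γ.fib u) : Γ.mul h ξ η ∈ Γ.fibMulIdeal I v := by
  refine fibMulIdeal_induction (p := fun ξ => Γ.mul h ξ η ∈ Γ.fibMulIdeal I v) ?_ ?_ ?_ ?_ ?_ hξ
  · simp
  · intro x y hx hy; rw [map_add]; exact add_mem hx hy
  · intro c x hx; rw [map_smul]; exact Submodule.smul_mem _ _ hx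
  · exact (Γ.isClosed_fibMulIdeal I v).preimage (Γ.continuous_mul_left h η)
  · intro ζ b hb; rw [Γ.mul_balanced]; exact mul_mem h ζ (lsmul_mem hI hb η)

lemma unit_mem {a : A} : Γ.unit a ∈ Γ.fibMulIdeal I 1 ↔ a ∈ I := by
  constructor
  · intro h
    rw [← Γ.unit.symm_apply_apply a]
    refine fibMulIdeal_induction (p := fun ξ => Γ.unit.symm ξ ∈ I) ?_ ?_ ?_ ?_ ?_ h
    · simp
    · intro x y hx hy; rw [map_add]; exact add_mem hx hy
    · intro c x hx; rw [map_smul]; exact SMulMemClass.smul_mem _ hx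
    · exact I.isClosed.preimage Γ.continuous_unit_symm
    · intro ζ b hb
      obtain ⟨c, rfl⟩ := Γ.unit.surjective ζ
      rw [Γ.rsmul_unit, Γ.unit.symm_apply_apply]
      exact I.mul_mem_left _ hb
  · intro h
    rw [← SetLike.mem_coe, ← (Γ.isClosed_fibMulIdeal I 1).closure_eq, Metric.mem_closure_iff]
    intro ε hε
    obtain ⟨e, he, -, -, h1, -⟩ := I.exists_approx h hε
    refine ⟨Γ.unit (a * e), ?_, ?_⟩
    · rw [← Γ.rsmul_unit]; exact rsmul_mem _ he
    · rwa [dist_eq_norm, ← map_sub, Γ.norm_unit]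

/-- The Hilbert `I`-bimodule `fib t · I`. -/
noncomputable abbrev idealBimodule (hI : Γ.IsInvariant I) (t : S) :
    HilbertBimodule I (Γ.fibMulIdeal I t) where
  complete :=
    haveI := HilbertBimodule.complete A (E := Γ.fib t)
    (Γ.isClosed_fibMulIdeal I t).completeSpace_coe
  lsmul := LinearMap.mk₂ ℂ (fun a ξ => ⟨lsmul (a : A) (ξ : Γ.fib t), lsmul_mem_of_mem _ ξ.2⟩)
    (fun _ _ _ => Subtype.ext (by simp)) (fun _ _ _ => Subtype.ext (by simp))
    (fun _ _ _ => Subtype.ext (by simp)) (fun _ _ _ => Subtype.ext (by simp))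
  rsmul := LinearMap.mk₂ ℂ (fun ξ a => ⟨rsmul (ξ : Γ.fib t) (a : A), rsmul_mem _ a.2⟩)
    (fun _ _ _ => Subtype.ext (by simp)) (fun _ _ _ => Subtype.ext (by simp))
    (fun _ _ _ => Subtype.ext (by simp)) (fun _ _ _ => Subtype.ext (by simp))
  linner := LinearMap.mk₂'ₛₗ (RingHom.id ℂ) (starRingEnd ℂ)
    (fun ξ η => ⟨linner (ξ : Γ.fib t) (η : Γ.fib t), linner_mem hI ξ.2 _⟩)
    (fun _ _ _ => Subtype.ext (by simp)) (fun _ _ _ => Subtype.ext (by simp))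
    (fun _ _ _ => Subtype.ext (by simp)) (fun _ _ _ => Subtype.ext (by simp))
  rinner := LinearMap.mk₂'ₛₗ (starRingEnd ℂ) (RingHom.id ℂ)
    (fun ξ η => ⟨rinner (ξ : Γ.fib t) (η : Γ.fib t), rinner_mem _ η.2⟩)
    (fun _ _ _ => Subtype.ext (by simp)) (fun _ _ _ => Subtype.ext (by simp))
    (fun _ _ _ => Subtype.ext (by simp)) (fun _ _ _ => Subtype.ext (by simp))
  mul_lsmul a b ξ := Subtype.ext (mul_lsmul (a : A) (b : A) (ξ : Γ.fib t))
  rsmul_mul ξ a b := Subtype.ext (rsmul_mul (ξ : Γ.fib t) (a : A) (b : A))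
  lsmul_rsmul a ξ b := Subtype.ext (lsmul_rsmul (a : A) (ξ : Γ.fib t) (b : A))
  linner_lsmul a ξ η := Subtype.ext (linner_lsmul (a : A) (ξ : Γ.fib t) (η : Γ.fib t))
  rinner_rsmul ξ η a := Subtype.ext (rinner_rsmul (ξ : Γ.fib t) (η : Γ.fib t) (a : A))
  star_linner ξ η := Subtype.ext (star_linner (ξ : Γ.fib t) (η : Γ.fib t))
  star_rinner ξ η := Subtype.ext (star_rinner (ξ : Γ.fib t) (η : Γ.fib t))
  linner_self_nonneg ξ := by
    obtain ⟨a, ha⟩ := linner_self_nonneg (A := A) (ξ : Γ.fib t)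
    obtain ⟨b, hb, hab⟩ := I.exists_star_mul_self (a := a) (ha ▸ linner_mem hI ξ.2 _)
    exact ⟨⟨b, hb⟩, Subtype.ext (ha.trans hab)⟩
  rinner_self_nonneg ξ := by
    obtain ⟨a, ha⟩ := rinner_self_nonneg (A := A) (ξ : Γ.fib t)
    obtain ⟨b, hb, hab⟩ := I.exists_star_mul_self (a := a) (ha ▸ rinner_mem _ ξ.2)
    exact ⟨⟨b, hb⟩, Subtype.ext (ha.trans hab)⟩
  norm_linner_self ξ := norm_linner_self (A := A) (ξ : Γ.fib t)
  norm_rinner_self ξ := norm_rinner_self (A := A) (ξ : Γ.fib t)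
  linner_lsmul_eq ξ η ζ :=
    Subtype.ext (linner_lsmul_eq (A := A) (ξ : Γ.fib t) (η : Γ.fib t) (ζ : Γ.fib t))

/-- Elements of `fib t · I` are approximated by `e ξ` with `e ∈ I`. -/
lemma mem_closure_of_approx (hI : Γ.IsInvariant I) {t : S} {P : Submodule ℂ (Γ.fib t)}
    (hP : IsClosed (P : Set (Γ.fib t)))
    (h : ∀ b ∈ I, ∀ ξ ∈ Γ.fibMulIdeal I t, lsmul b ξ ∈ P) {ξ : Γ.fib t}
    (hξ : ξ ∈ Γ.fibMulIdeal I t) : ξ ∈ P := by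
  refine idealMulFib_induction (p := fun ξ => ξ ∈ P) (zero_mem P) (fun _ _ => add_mem)
    (fun c x hx => P.smul_mem c hx) hP ?_ hI hξ
  intro ξ b hb
  rw [← SetLike.mem_coe, ← hP.closure_eq, Metric.mem_closure_iff]
  intro ε hε
  obtain ⟨e, he, -, -, -, h1⟩ := I.exists_approx hb (ε := ε / (‖ξ‖ + 1)) (by positivity)
  refine ⟨lsmul e (lsmul b ξ), h e he _ (lsmul_mem hI hb ξ), ?_⟩
  rw [dist_eq_norm, ← mul_lsmul, ← LinearMap.sub_apply, ← map_sub]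
  refine (norm_lsmul_le _ _).trans_lt ?_
  rw [lt_div_iff₀ (by positivity)] at h1
  nlinarith [norm_nonneg (b - e * b), norm_nonneg ξ]

lemma dense_induction (Γ : Action S A) {t u v : S} (h : t * u = v) {P : Submodule ℂ (Γ.fib v)}
    (hP : IsClosed (P : Set (Γ.fib v))) (hm : ∀ ξ η, Γ.mul h ξ η ∈ P) (ζ : Γ.fib v) : ζ ∈ P := by
  have : (⊤ : Submodule ℂ (Γ.fib v)) ≤ P := by
    rw [← Γ.mul_dense h]
    refine Submodule.topologicalClosure_minimal _ (Submodule.span_le.mpr ?_) hP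
    rintro _ ⟨ξ, η, rfl⟩
    exact hm ξ η
  exact this trivial

lemma mul_dense_aux (hI : Γ.IsInvariant I) {t u v : S} (h : t * u = v) :
    Γ.fibMulIdeal I v ≤ (Submodule.span ℂ {ζ | ∃ ξ ∈ Γ.fibMulIdeal I t,
      ∃ η ∈ Γ.fibMulIdeal I u, ζ = Γ.mul h ξ η}).topologicalClosure := by
  set Q := (Submodule.span ℂ {ζ | ∃ ξ ∈ Γ.fibMulIdeal I t,
      ∃ η ∈ Γ.fibMulIdeal I u, ζ = Γ.mul h ξ η}).topologicalClosure with hQdef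
  have hQ : IsClosed (Q : Set (Γ.fib v)) := Submodule.isClosed_topologicalClosure _
  intro ζ hζ
  refine fibMulIdeal_induction (p := fun ζ => ζ ∈ Q) (zero_mem Q) (fun _ _ => add_mem)
    (fun c x hx => Q.smul_mem c hx) hQ ?_ hζ
  intro ζ b hb
  refine Γ.dense_induction h (P := Q.comap ((rsmul (A := A) (E := Γ.fib v)).flip b))
    (hQ.preimage (continuous_rsmul b)) ?_ ζ
  intro ξ η
  change rsmul (Γ.mul h ξ η) b ∈ Q
  rw [← Γ.mul_rsmul_right]
  refine mem_closure_of_approx hI (P := Q.comap (Γ.mul h ξ))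
    (hQ.preimage (Γ.continuous_mul_right h ξ)) ?_ (rsmul_mem η hb)
  intro c hc ω hω
  change Γ.mul h ξ (lsmul c ω) ∈ Q
  rw [← Γ.mul_balanced]
  exact Submodule.le_topologicalClosure _
    (Submodule.subset_span ⟨_, rsmul_mem ξ hc, ω, hω, rfl⟩)

lemma mem_topologicalClosure_span {E : Type u} [NormedAddCommGroup E] [NormedSpace ℂ E]
    {p : Submodule ℂ E} (s : Set p) {x : p}
    (hx : (x : E) ∈ (Submodule.span ℂ (p.subtype '' s)).topologicalClosure) :
    x ∈ (Submodule.span ℂ s).topologicalClosure := by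
  rw [← SetLike.mem_coe, Submodule.topologicalClosure_coe, closure_subtype]
  rw [← SetLike.mem_coe, Submodule.topologicalClosure_coe, ← Submodule.map_span] at hx
  exact hx

/-- The restriction of an action to an invariant ideal `I`, with fibres `fib t · I`. -/
noncomputable def restrictIdeal (Γ : Action S A) (I : ClosedIdeal A) (hI : Γ.IsInvariant I) :
    Action S I where
  fib t := Γ.fibMulIdeal I t
  hilbertBimodule t := idealBimodule hI t
  mul {t u v} h := LinearMap.mk₂ ℂ
    (fun ξ η => ⟨Γ.mul h (ξ : Γ.fib t) (η : Γ.fib u), mul_mem h _ η.2⟩)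
    (fun _ _ _ => Subtype.ext (by simp)) (fun _ _ _ => Subtype.ext (by simp))
    (fun _ _ _ => Subtype.ext (by simp)) (fun _ _ _ => Subtype.ext (by simp))
  mul_balanced h ξ a η := Subtype.ext (Γ.mul_balanced h _ (a : A) _)
  mul_lsmul_left h a ξ η := Subtype.ext (Γ.mul_lsmul_left h (a : A) _ _)
  mul_rsmul_right h ξ η a := Subtype.ext (Γ.mul_rsmul_right h _ _ (a : A))
  rinner_mul h ξ ξ' η η' := Subtype.ext (Γ.rinner_mul h _ _ _ _)
  linner_mul h ξ ξ' η η' := Subtype.ext (Γ.linner_mul h _ _ _ _)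
  mul_dense {t u v} h := by
    have H := mul_dense_aux hI h
    rw [eq_top_iff]
    rintro x -
    refine mem_topologicalClosure_span _ ?_
    convert H x.2 using 3
    ext ζ
    constructor
    · rintro ⟨_, ⟨ξ, η, rfl⟩, rfl⟩
      exact ⟨ξ, ξ.2, η, η.2, rfl⟩
    · rintro ⟨ξ, hξ, η, hη, rfl⟩
      exact ⟨_, ⟨⟨ξ, hξ⟩, ⟨η, hη⟩, rfl⟩, rfl⟩
  mul_assoc h₁ h₂ h₃ h₄ ξ η ζ := Subtype.ext (Γ.mul_assoc h₁ h₂ h₃ h₄ _ _ _)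
  unit :=
    { toFun := fun a => ⟨Γ.unit a, unit_mem.mpr a.2⟩
      map_add' := fun _ _ => Subtype.ext (by simp)
      map_smul' := fun _ _ => Subtype.ext (by simp)
      invFun := fun ξ => ⟨Γ.unit.symm ξ, unit_mem.mp (by
        rw [LinearEquiv.apply_symm_apply]; exact ξ.2)⟩
      left_inv := fun _ => Subtype.ext (by simp)
      right_inv := fun _ => Subtype.ext (by simp) }
  lsmul_unit a b := Subtype.ext (Γ.lsmul_unit a b)
  rsmul_unit a b := Subtype.ext (Γ.rsmul_unit a b)
  linner_unit a b := Subtype.ext (Γ.linner_unit a b)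
  rinner_unit a b := Subtype.ext (Γ.rinner_unit a b)
  unit_mul h a ξ := Subtype.ext (Γ.unit_mul h a _)
  mul_unit h ξ a := Subtype.ext (Γ.mul_unit h _ _)


section quotient

/-- The fibre `fib t / fib t · I`. -/
abbrev quotFib (Γ : Action S A) (I : ClosedIdeal A) (t : S) : Type u :=
  Γ.fib t ⧸ Γ.fibMulIdeal I t

variable (Γ I) in
/-- The quotient map `fib t → fib t / fib t · I`. -/
def quotMk (t : S) : Γ.fib t →ₗ[ℂ] Γ.quotFib I t := (Γ.fibMulIdeal I t).mkQ

lemma quotMk_surjective (t : S) : Function.Surjective (Γ.quotMk I t) := Submodule.mkQ_surjective _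

lemma quotMk_eq_zero {t : S} {ξ : Γ.fib t} : Γ.quotMk I t ξ = 0 ↔ ξ ∈ Γ.fibMulIdeal I t :=
  Submodule.Quotient.mk_eq_zero _

lemma quotMk_eq {t : S} {ξ η : Γ.fib t} :
    Γ.quotMk I t ξ = Γ.quotMk I t η ↔ ξ - η ∈ Γ.fibMulIdeal I t :=
  Submodule.Quotient.eq _

lemma norm_quotMk_le {t : S} (ξ : Γ.fib t) : ‖Γ.quotMk I t ξ‖ ≤ ‖ξ‖ :=
  Submodule.Quotient.norm_mk_le _ _

/-- The left `A / I`-module structure on `fib t / fib t · I`. -/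
noncomputable def quotLsmul (hI : Γ.IsInvariant I) (t : S) :
    I.Quot →ₗ[ℂ] Γ.quotFib I t →ₗ[ℂ] Γ.quotFib I t :=
  LinearMap.liftQ₂ I.toSubmodule (Γ.fibMulIdeal I t) ((lsmul (A := A)).compr₂ (Γ.quotMk I t))
    (fun _ ha => LinearMap.ext fun ξ => quotMk_eq_zero.mpr (lsmul_mem hI ha ξ))
    (fun _ hξ => LinearMap.ext fun a => quotMk_eq_zero.mpr (lsmul_mem_of_mem a hξ))

lemma rsmul_mem_of_mem {t : S} {ξ : Γ.fib t} (hξ : ξ ∈ Γ.fibMulIdeal I t) (a : A) :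
    rsmul ξ a ∈ Γ.fibMulIdeal I t := by
  refine fibMulIdeal_induction (p := fun ξ => rsmul ξ a ∈ Γ.fibMulIdeal I t) ?_ ?_ ?_ ?_ ?_ hξ
  · simp
  · intro x y hx hy; rw [map_add]; exact add_mem hx hy
  · intro c x hx; rw [map_smul]; exact Submodule.smul_mem _ _ hx
  · exact (Γ.isClosed_fibMulIdeal I t).preimage (continuous_rsmul a)
  · intro ξ b hb; rw [← rsmul_mul]; exact rsmul_mem _ (I.mul_mem_right _ hb)

variable (Γ I) in
/-- The right `A / I`-module structure on `fib t / fib t · I`. -/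
noncomputable def quotRsmul (t : S) :
    Γ.quotFib I t →ₗ[ℂ] I.Quot →ₗ[ℂ] Γ.quotFib I t :=
  LinearMap.liftQ₂ (Γ.fibMulIdeal I t) I.toSubmodule ((rsmul (A := A)).compr₂ (Γ.quotMk I t))
    (fun _ hξ => LinearMap.ext fun a => quotMk_eq_zero.mpr (rsmul_mem_of_mem hξ a))
    (fun _ ha => LinearMap.ext fun ξ => quotMk_eq_zero.mpr (rsmul_mem ξ ha))

/-- The left inner product on `fib t / fib t · I`. -/
noncomputable def quotLinner (hI : Γ.IsInvariant I) (t : S) :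
    Γ.quotFib I t →ₗ[ℂ] Γ.quotFib I t →ₗ⋆[ℂ] I.Quot :=
  LinearMap.liftQ₂ (Γ.fibMulIdeal I t) (Γ.fibMulIdeal I t)
    (LinearMap.mk₂'ₛₗ (RingHom.id ℂ) (starRingEnd ℂ)
      (fun ξ η => ClosedIdeal.Quot.mk I (linner (A := A) ξ η))
      (by simp) (by simp) (by simp) (by simp))
    (fun _ hξ => LinearMap.ext fun η => ClosedIdeal.Quot.mk_eq_zero.mpr (linner_mem hI hξ η))
    (fun _ hη => LinearMap.ext fun ξ => ClosedIdeal.Quot.mk_eq_zero.mpr (linner_mem' hI ξ hη))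

variable (Γ I) in
/-- The right inner product on `fib t / fib t · I`. -/
noncomputable def quotRinner (t : S) :
    Γ.quotFib I t →ₗ⋆[ℂ] Γ.quotFib I t →ₗ[ℂ] I.Quot :=
  LinearMap.liftQ₂ (Γ.fibMulIdeal I t) (Γ.fibMulIdeal I t)
    (LinearMap.mk₂'ₛₗ (starRingEnd ℂ) (RingHom.id ℂ)
      (fun ξ η => ClosedIdeal.Quot.mk I (rinner (A := A) ξ η))
      (by simp) (by simp) (by simp) (by simp))
    (fun _ hξ => LinearMap.ext fun η => ClosedIdeal.Quot.mk_eq_zero.mpr (rinner_mem' hξ η))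
    (fun _ hη => LinearMap.ext fun ξ => ClosedIdeal.Quot.mk_eq_zero.mpr (rinner_mem ξ hη))

lemma norm_quotMk_sq {t : S} (ξ : Γ.fib t) :
    ‖ClosedIdeal.Quot.mk I (rinner ξ ξ)‖ = ‖Γ.quotMk I t ξ‖ * ‖Γ.quotMk I t ξ‖ := by
  apply le_antisymm
  · refine le_of_forall_pos_lt_add fun ε hε => ?_
    have hc : Continuous fun δ : ℝ => (‖Γ.quotMk I t ξ‖ + δ) * (‖Γ.quotMk I t ξ‖ + δ) := by
      fun_prop
    obtain ⟨δ, hδ, h⟩ := (Metric.continuousAt_iff.mp (hc.continuousAt (x := 0))) ε hε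
    have h' := @h (δ / 2) (by simp [abs_of_pos hδ, hδ])
    obtain ⟨η, hη, hn⟩ := Submodule.Quotient.norm_mk_lt (S := Γ.fibMulIdeal I t)
      (Γ.quotMk I t ξ) (half_pos hδ)
    have hη' : ξ - η ∈ Γ.fibMulIdeal I t := quotMk_eq.mp hη.symm
    have e : ClosedIdeal.Quot.mk I (rinner ξ ξ) = ClosedIdeal.Quot.mk I (rinner η η) := by
      rw [ClosedIdeal.Quot.mk_eq_mk]
      have : rinner (A := A) ξ ξ - rinner η η = rinner (ξ - η) ξ + rinner η (ξ - η) := by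
        simp
      rw [this]
      exact add_mem (rinner_mem' hη' _) (rinner_mem _ hη')
    have h3 : ‖ClosedIdeal.Quot.mk I (rinner ξ ξ)‖ ≤
        (‖Γ.quotMk I t ξ‖ + δ / 2) * (‖Γ.quotMk I t ξ‖ + δ / 2) := by
      rw [e]
      refine (ClosedIdeal.Quot.norm_mk_le _).trans ?_
      rw [norm_rinner_self]
      gcongr
    rw [Real.dist_eq] at h'
    have := (abs_lt.mp h').2
    simp only [add_zero] at this
    linarith
  · refine le_of_forall_pos_le_add fun ε hε => ?_
    obtain ⟨e, he, hes, h⟩ := ClosedIdeal.Quot.norm_compress_lt (I := I) (rinner ξ ξ) hε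
    have h1 : Γ.quotMk I t ξ = Γ.quotMk I t (ξ - rsmul ξ e) := by
      rw [quotMk_eq]; simpa using rsmul_mem ξ he
    have h2 : rinner (ξ - rsmul ξ e) (ξ - rsmul ξ e)
        = rinner ξ ξ - rinner ξ ξ * e - e * (rinner (A := A) ξ ξ - rinner ξ ξ * e) := by
      simp only [map_sub, LinearMap.sub_apply, rinner_rsmul, rinner_rsmul_left, hes]
      noncomm_ring
    rw [h1]
    refine le_trans ?_ h.le
    rw [← h2, norm_rinner_self]
    gcongr <;> exact norm_quotMk_le _

lemma norm_quotMk_sq' (hI : Γ.IsInvariant I) {t : S} (ξ : Γ.fib t) :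
    ‖ClosedIdeal.Quot.mk I (linner ξ ξ)‖ = ‖Γ.quotMk I t ξ‖ * ‖Γ.quotMk I t ξ‖ := by
  apply le_antisymm
  · refine le_of_forall_pos_lt_add fun ε hε => ?_
    have hc : Continuous fun δ : ℝ => (‖Γ.quotMk I t ξ‖ + δ) * (‖Γ.quotMk I t ξ‖ + δ) := by
      fun_prop
    obtain ⟨δ, hδ, h⟩ := (Metric.continuousAt_iff.mp (hc.continuousAt (x := 0))) ε hε
    have h' := @h (δ / 2) (by simp [abs_of_pos hδ, hδ])
    obtain ⟨η, hη, hn⟩ := Submodule.Quotient.norm_mk_lt (S := Γ.fibMulIdeal I t)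
      (Γ.quotMk I t ξ) (half_pos hδ)
    have hη' : ξ - η ∈ Γ.fibMulIdeal I t := quotMk_eq.mp hη.symm
    have e : ClosedIdeal.Quot.mk I (linner ξ ξ) = ClosedIdeal.Quot.mk I (linner η η) := by
      rw [ClosedIdeal.Quot.mk_eq_mk]
      have : linner (A := A) ξ ξ - linner η η = linner (ξ - η) ξ + linner η (ξ - η) := by
        simp
      rw [this]
      exact add_mem (linner_mem hI hη' _) (linner_mem' hI _ hη')
    have h3 : ‖ClosedIdeal.Quot.mk I (linner ξ ξ)‖ ≤
        (‖Γ.quotMk I t ξ‖ + δ / 2) * (‖Γ.quotMk I t ξ‖ + δ / 2) := by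
      rw [e]
      refine (ClosedIdeal.Quot.norm_mk_le _).trans ?_
      rw [norm_linner_self]
      gcongr
    rw [Real.dist_eq] at h'
    have := (abs_lt.mp h').2
    simp only [add_zero] at this
    linarith
  · refine le_of_forall_pos_le_add fun ε hε => ?_
    obtain ⟨e, he, hes, h⟩ := ClosedIdeal.Quot.norm_compress_lt (I := I) (linner ξ ξ) hε
    have h1 : Γ.quotMk I t ξ = Γ.quotMk I t (ξ - lsmul e ξ) := by
      rw [quotMk_eq]; simpa using lsmul_mem hI he ξ
    have h2 : linner (ξ - lsmul e ξ) (ξ - lsmul e ξ)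
        = linner ξ ξ - linner ξ ξ * e - e * (linner (A := A) ξ ξ - linner ξ ξ * e) := by
      simp only [map_sub, LinearMap.sub_apply, linner_lsmul, linner_lsmul_right, hes]
      noncomm_ring
    rw [h1]
    refine le_trans ?_ h.le
    rw [← h2, norm_linner_self]
    gcongr <;> exact norm_quotMk_le _

lemma quot_ind {t : S} {p : Γ.quotFib I t → Prop} (h : ∀ ξ, p (Γ.quotMk I t ξ)) (x) : p x := by
  obtain ⟨ξ, rfl⟩ := quotMk_surjective t x
  exact h ξ

lemma ideal_quot_ind {p : I.Quot → Prop} (h : ∀ a, p (ClosedIdeal.Quot.mk I a)) (x) : p x := by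
  obtain ⟨a, rfl⟩ := ClosedIdeal.Quot.mk_surjective x
  exact h a

/-- The Hilbert `A / I`-bimodule `fib t / fib t · I`. -/
noncomputable abbrev quotBimodule (hI : Γ.IsInvariant I) (t : S) :
    HilbertBimodule I.Quot (Γ.quotFib I t) where
  complete :=
    haveI := HilbertBimodule.complete A (E := Γ.fib t)
    inferInstance
  lsmul := quotLsmul hI t
  rsmul := Γ.quotRsmul I t
  linner := quotLinner hI t
  rinner := Γ.quotRinner I t
  mul_lsmul := ideal_quot_ind fun a => ideal_quot_ind fun b => quot_ind fun ξ =>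
    congrArg (Γ.quotMk I t) (mul_lsmul a b ξ)
  rsmul_mul := quot_ind fun ξ => ideal_quot_ind fun a => ideal_quot_ind fun b =>
    congrArg (Γ.quotMk I t) (rsmul_mul ξ a b)
  lsmul_rsmul := ideal_quot_ind fun a => quot_ind fun ξ => ideal_quot_ind fun b =>
    congrArg (Γ.quotMk I t) (lsmul_rsmul a ξ b)
  linner_lsmul := ideal_quot_ind fun a => quot_ind fun ξ => quot_ind fun η =>
    congrArg (ClosedIdeal.Quot.mk I) (linner_lsmul a ξ η)
  rinner_rsmul := quot_ind fun ξ => quot_ind fun η => ideal_quot_ind fun a =>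
    congrArg (ClosedIdeal.Quot.mk I) (rinner_rsmul ξ η a)
  star_linner := quot_ind fun ξ => quot_ind fun η =>
    congrArg (ClosedIdeal.Quot.mk I) (star_linner ξ η)
  star_rinner := quot_ind fun ξ => quot_ind fun η =>
    congrArg (ClosedIdeal.Quot.mk I) (star_rinner ξ η)
  linner_self_nonneg := quot_ind fun ξ => by
    obtain ⟨a, ha⟩ := linner_self_nonneg (A := A) ξ
    exact ⟨ClosedIdeal.Quot.mk I a, congrArg (ClosedIdeal.Quot.mk I) ha⟩
  rinner_self_nonneg := quot_ind fun ξ => by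
    obtain ⟨a, ha⟩ := rinner_self_nonneg (A := A) ξ
    exact ⟨ClosedIdeal.Quot.mk I a, congrArg (ClosedIdeal.Quot.mk I) ha⟩
  norm_linner_self := quot_ind fun ξ => norm_quotMk_sq' hI ξ
  norm_rinner_self := quot_ind fun ξ => norm_quotMk_sq ξ
  linner_lsmul_eq := quot_ind fun ξ => quot_ind fun η => quot_ind fun ζ =>
    congrArg (Γ.quotMk I t) (linner_lsmul_eq (A := A) ξ η ζ)

/-- The multiplication maps on the fibres `fib t / fib t · I`. -/
noncomputable def quotMul (hI : Γ.IsInvariant I) {t u v : S} (h : t * u = v) :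
    Γ.quotFib I t →ₗ[ℂ] Γ.quotFib I u →ₗ[ℂ] Γ.quotFib I v :=
  LinearMap.liftQ₂ (Γ.fibMulIdeal I t) (Γ.fibMulIdeal I u) ((Γ.mul h).compr₂ (Γ.quotMk I v))
    (fun _ hξ => LinearMap.ext fun η => quotMk_eq_zero.mpr (mul_mem' hI h hξ η))
    (fun _ hη => LinearMap.ext fun ξ => quotMk_eq_zero.mpr (mul_mem h ξ hη))

/-- The restriction of an action to the quotient `A / I` by an invariant ideal, with fibres
`fib t / fib t · I`. -/
noncomputable def restrictQuot (Γ : Action S A) (I : ClosedIdeal A) (hI : Γ.IsInvariant I) :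
    Action S I.Quot where
  fib t := Γ.quotFib I t
  hilbertBimodule t := quotBimodule hI t
  mul h := quotMul hI h
  mul_balanced {t u v} h := quot_ind fun ξ => ideal_quot_ind fun a => quot_ind fun η =>
    congrArg (Γ.quotMk I v) (Γ.mul_balanced h ξ a η)
  mul_lsmul_left {t u v} h := ideal_quot_ind fun a => quot_ind fun ξ => quot_ind fun η =>
    congrArg (Γ.quotMk I v) (Γ.mul_lsmul_left h a ξ η)
  mul_rsmul_right {t u v} h := quot_ind fun ξ => quot_ind fun η => ideal_quot_ind fun a =>
    congrArg (Γ.quotMk I v) (Γ.mul_rsmul_right h ξ η a)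
  rinner_mul h := quot_ind fun ξ => quot_ind fun ξ' => quot_ind fun η => quot_ind fun η' =>
    congrArg (ClosedIdeal.Quot.mk I) (Γ.rinner_mul h ξ ξ' η η')
  linner_mul h := quot_ind fun ξ => quot_ind fun ξ' => quot_ind fun η => quot_ind fun η' =>
    congrArg (ClosedIdeal.Quot.mk I) (Γ.linner_mul h ξ ξ' η η')
  mul_dense {t u v} h := by
    rw [eq_top_iff]
    rintro x -
    revert x
    refine quot_ind fun ζ => ?_
    refine Γ.dense_induction h (P := (Submodule.topologicalClosure _).comap (Γ.quotMk I v)) ?_ ?_ ζ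
    · have hc : Continuous (Γ.quotMk I v) :=
        AddMonoidHomClass.continuous_of_bound (Γ.quotMk I v) 1 fun ξ => by
          rw [one_mul]; exact norm_quotMk_le ξ
      exact (Submodule.isClosed_topologicalClosure (Submodule.span ℂ _)).preimage hc
    · intro ξ η
      exact Submodule.le_topologicalClosure _
        (Submodule.subset_span ⟨Γ.quotMk I t ξ, Γ.quotMk I u η, rfl⟩)
  mul_assoc {t u v tu uv tuv} h₁ h₂ h₃ h₄ := quot_ind fun ξ => quot_ind fun η => quot_ind fun ζ =>
    congrArg (Γ.quotMk I tuv) (Γ.mul_assoc h₁ h₂ h₃ h₄ ξ η ζ)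
  unit := Submodule.Quotient.equiv I.toSubmodule (Γ.fibMulIdeal I 1) Γ.unit (by
    ext ξ
    constructor
    · rintro ⟨a, ha, rfl⟩; exact unit_mem.mpr ha
    · intro h
      refine ⟨Γ.unit.symm ξ, (unit_mem (Γ := Γ)).mp ?_, by simp⟩
      rwa [LinearEquiv.apply_symm_apply])
  lsmul_unit := ideal_quot_ind fun a => ideal_quot_ind fun b =>
    congrArg (Γ.quotMk I 1) (Γ.lsmul_unit a b)
  rsmul_unit := ideal_quot_ind fun a => ideal_quot_ind fun b =>
    congrArg (Γ.quotMk I 1) (Γ.rsmul_unit a b)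
  linner_unit := ideal_quot_ind fun a => ideal_quot_ind fun b =>
    congrArg (ClosedIdeal.Quot.mk I) (Γ.linner_unit a b)
  rinner_unit := ideal_quot_ind fun a => ideal_quot_ind fun b =>
    congrArg (ClosedIdeal.Quot.mk I) (Γ.rinner_unit a b)
  unit_mul {t} h := ideal_quot_ind fun a => quot_ind fun ξ =>
    congrArg (Γ.quotMk I t) (Γ.unit_mul h a ξ)
  mul_unit {t} h := quot_ind fun ξ => ideal_quot_ind fun a =>
    congrArg (Γ.quotMk I t) (Γ.mul_unit h ξ a)

end quotient

end ideal

/-! ### Homomorphisms and representations of actions, and the full crossed product -/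

/-- A homomorphism between two actions of `S`: linear maps between the fibres that are compatible
with the multiplication maps and with the left and right inner products. -/
structure Hom {B : Type u} [NonUnitalCStarAlgebra B] (Γ : Action S A) (Δ : Action S B) where
  map : ∀ t, Γ.fib t →ₗ[ℂ] Δ.fib t
  map_mul : ∀ {t u v : S} (h : t * u = v) (ξ : Γ.fib t) (η : Γ.fib u),
    map v (Γ.mul h ξ η) = Δ.mul h (map t ξ) (map u η)
  map_rinner : ∀ (t : S) (ξ η : Γ.fib t),
    Δ.unit (rinner (map t ξ) (map t η)) = map 1 (Γ.unit (rinner ξ η))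
  map_linner : ∀ (t : S) (ξ η : Γ.fib t),
    Δ.unit (linner (map t ξ) (map t η)) = map 1 (Γ.unit (linner ξ η))

/-- The homomorphism given by the inclusions `fib t · I ⊆ fib t`. -/
noncomputable def inclHom (Γ : Action S A) (I : ClosedIdeal A) (hI : Γ.IsInvariant I) :
    Hom (Γ.restrictIdeal I hI) Γ where
  map t := (Γ.fibMulIdeal I t).subtype
  map_mul _ _ _ := rfl
  map_rinner _ _ _ := rfl
  map_linner _ _ _ := rfl

/-- The homomorphism given by the quotient maps `fib t → fib t / fib t · I`. -/
noncomputable def quotHom (Γ : Action S A) (I : ClosedIdeal A) (hI : Γ.IsInvariant I) :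
    Hom Γ (Γ.restrictQuot I hI) where
  map t := Γ.quotMk I t
  map_mul _ _ _ := rfl
  map_rinner _ _ _ := rfl
  map_linner _ _ _ := rfl

/-- A representation of an action in a C⋆-algebra `B`. -/
structure Rep (Γ : Action S A) (B : Type v) [NonUnitalCStarAlgebra B] where
  map : ∀ t, Γ.fib t →ₗ[ℂ] B
  map_mul : ∀ {t u v : S} (h : t * u = v) (ξ : Γ.fib t) (η : Γ.fib u),
    map v (Γ.mul h ξ η) = map t ξ * map u η
  map_rinner : ∀ (t : S) (ξ η : Γ.fib t),
    star (map t ξ) * map t η = map 1 (Γ.unit (rinner ξ η))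
  map_linner : ∀ (t : S) (ξ η : Γ.fib t),
    map t ξ * star (map t η) = map 1 (Γ.unit (linner ξ η))

namespace Rep

variable {Γ : Action S A} {B : Type v} [NonUnitalCStarAlgebra B] (ρ : Rep Γ B)

/-- The restriction of a representation to the unit fibre `A` is a `⋆`-homomorphism. -/
noncomputable def unitHom : A →⋆ₙₐ[ℂ] B where
  toFun a := ρ.map 1 (Γ.unit a)
  map_smul' c a := by simp
  map_zero' := by simp
  map_add' a b := by simp
  map_mul' a b := by
    rw [← ρ.map_mul (mul_one 1), Γ.unit_mul, Γ.lsmul_unit]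
  map_star' a := by
    have hm : ∀ x y : A, ρ.map 1 (Γ.unit (x * y)) = ρ.map 1 (Γ.unit x) * ρ.map 1 (Γ.unit y) := by
      intro x y; rw [← ρ.map_mul (mul_one 1), Γ.unit_mul, Γ.lsmul_unit]
    have hr : ∀ x y : A, star (ρ.map 1 (Γ.unit x)) * ρ.map 1 (Γ.unit y)
        = ρ.map 1 (Γ.unit (star x * y)) := by
      intro x y; rw [ρ.map_rinner, Γ.rinner_unit]
    have hl : ∀ x y : A, ρ.map 1 (Γ.unit x) * star (ρ.map 1 (Γ.unit y))
        = ρ.map 1 (Γ.unit (x * star y)) := by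
      intro x y; rw [ρ.map_linner, Γ.linner_unit]
    have h1 : star (ρ.map 1 (Γ.unit (star a * a))) = ρ.map 1 (Γ.unit (star a * a)) := by
      rw [← hr]; simp
    rw [← sub_eq_zero, ← CStarRing.mul_star_self_eq_zero_iff]
    rw [star_sub, star_star, sub_mul, mul_sub, mul_sub, ← star_mul, ← hm, hr, hl, h1]
    simp

lemma norm_map_le (t : S) (ξ : Γ.fib t) : ‖ρ.map t ξ‖ ≤ ‖ξ‖ := by
  refine le_of_sq_le_sq ?_ (norm_nonneg _)
  rw [sq, ← CStarRing.norm_star_mul_self, ρ.map_rinner, sq, ← norm_rinner_self (A := A)]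
  exact NonUnitalStarAlgHom.norm_apply_le ρ.unitHom _

end Rep

/-- A C⋆-algebra together with a representation of the action in it. -/
structure BundledRep (Γ : Action S A) where
  B : Type u
  [inst : NonUnitalCStarAlgebra B]
  rep : Rep Γ B

attribute [instance] BundledRep.inst

/-- The bounded families of elements of the targets of all representations. -/
abbrev RepProd (Γ : Action S A) : Type (u + 1) := lp (fun π : BundledRep Γ => π.B) ⊤

/-- The direct product of all representations. -/
noncomputable def prodRep (Γ : Action S A) (t : S) : Γ.fib t →ₗ[ℂ] Γ.RepProd where
  toFun ξ := ⟨fun π => π.rep.map t ξ, memℓp_infty ⟨‖ξ‖, by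
    rintro _ ⟨π, rfl⟩; exact π.rep.norm_map_le t ξ⟩⟩
  map_add' ξ η := by ext π; exact map_add _ _ _
  map_smul' c ξ := by ext π; exact map_smul _ _ _

/-- The C⋆-subalgebra generated by the range of the direct product of all representations. -/
noncomputable def fullSubalgebra (Γ : Action S A) : NonUnitalStarSubalgebra ℂ Γ.RepProd :=
  (NonUnitalStarAlgebra.adjoin ℂ {x | ∃ t ξ, x = Γ.prodRep t ξ}).topologicalClosure

/-- The full crossed product `A ⋊ S`: the C⋆-algebra that is universal for representations of the
action, built as the C⋆-algebra generated by the direct product of all representations. In other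
words, it is the completion in the largest C⋆-seminorm that comes from representations. -/
def Full (Γ : Action S A) : Type (u + 1) := Γ.fullSubalgebra

noncomputable instance (Γ : Action S A) : NonUnitalCStarAlgebra Γ.Full :=
  NonUnitalStarSubalgebra.nonUnitalCStarAlgebra Γ.fullSubalgebra
    (h_closed := NonUnitalStarSubalgebra.isClosed_topologicalClosure _)

/-- The canonical maps `fib t → A ⋊ S`, `ξ ↦ ξ δ_t`. -/
noncomputable def delta (Γ : Action S A) (t : S) : Γ.fib t →ₗ[ℂ] Γ.Full where
  toFun ξ := ⟨Γ.prodRep t ξ, NonUnitalStarSubalgebra.le_topologicalClosure _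
    (NonUnitalStarAlgebra.subset_adjoin ℂ _ ⟨t, ξ, rfl⟩)⟩
  map_add' ξ η := Subtype.ext (map_add _ ξ η)
  map_smul' c ξ := Subtype.ext (map_smul _ c ξ)

/-- The canonical maps `fib t → A ⋊ S` form a representation. -/
noncomputable def deltaRep (Γ : Action S A) : Rep Γ Γ.Full where
  map := Γ.delta
  map_mul h ξ η := Subtype.ext (lp.ext (funext fun π => π.rep.map_mul h ξ η))
  map_rinner t ξ η := Subtype.ext (lp.ext (funext fun π => π.rep.map_rinner t ξ η))
  map_linner t ξ η := Subtype.ext (lp.ext (funext fun π => π.rep.map_linner t ξ η))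

/-- The integrated form `A ⋊ S → B` of a representation in `B`. -/
noncomputable def integrate {Γ : Action S A} {B : Type u} [NonUnitalCStarAlgebra B]
    (ρ : Rep Γ B) : Γ.Full →⋆ₙₐ[ℂ] B where
  toFun x := x.1 (⟨B, ρ⟩ : BundledRep Γ)
  map_smul' _ _ := rfl
  map_zero' := rfl
  map_add' _ _ := rfl
  map_mul' _ _ := rfl
  map_star' _ := rfl

lemma integrate_delta {Γ : Action S A} {B : Type u} [NonUnitalCStarAlgebra B]
    (ρ : Rep Γ B) (t : S) (ξ : Γ.fib t) : integrate ρ (Γ.delta t ξ) = ρ.map t ξ := rfl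

namespace Hom

variable {B : Type u} [NonUnitalCStarAlgebra B] {Γ : Action S A} {Δ : Action S B}

/-- The composite of a representation and a homomorphism of actions. -/
def compRep (ψ : Hom Γ Δ) (π : BundledRep Δ) : BundledRep Γ where
  B := π.B
  rep :=
    { map := fun t => (π.rep.map t).comp (ψ.map t)
      map_mul := fun h ξ η => by
        simp only [LinearMap.comp_apply, ψ.map_mul, π.rep.map_mul]
      map_rinner := fun t ξ η => by
        simp only [LinearMap.comp_apply, π.rep.map_rinner, ψ.map_rinner]
      map_linner := fun t ξ η => by
        simp only [LinearMap.comp_apply, π.rep.map_linner, ψ.map_linner] }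

/-- The map between the products of all representations induced by a homomorphism. -/
noncomputable def prodMap (ψ : Hom Γ Δ) : Γ.RepProd →⋆ₙₐ[ℂ] Δ.RepProd where
  toFun x := ⟨fun π => x (ψ.compRep π), memℓp_infty ⟨‖x‖, by
    rintro _ ⟨π, rfl⟩; exact lp.norm_apply_le_norm (by simp) x (ψ.compRep π)⟩⟩
  map_smul' _ _ := rfl
  map_zero' := rfl
  map_add' _ _ := rfl
  map_mul' _ _ := rfl
  map_star' _ := rfl

lemma prodMap_prodRep (ψ : Hom Γ Δ) (t : S) (ξ : Γ.fib t) :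
    ψ.prodMap (Γ.prodRep t ξ) = Δ.prodRep t (ψ.map t ξ) := rfl

lemma continuous_prodMap (ψ : Hom Γ Δ) : Continuous ψ.prodMap :=
  AddMonoidHomClass.continuous_of_bound ψ.prodMap 1 fun x => by
    rw [one_mul]; exact NonUnitalStarAlgHom.norm_apply_le ψ.prodMap x

lemma prodMap_mem (ψ : Hom Γ Δ) {x : Γ.RepProd} (hx : x ∈ Γ.fullSubalgebra) :
    ψ.prodMap x ∈ Δ.fullSubalgebra := by
  have : Γ.fullSubalgebra ≤ Δ.fullSubalgebra.comap ψ.prodMap := by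
    refine NonUnitalStarSubalgebra.topologicalClosure_minimal _ ?_ ?_
    · refine NonUnitalStarAlgebra.adjoin_le ?_
      rintro _ ⟨t, ξ, rfl⟩
      exact NonUnitalStarSubalgebra.le_topologicalClosure _
        (NonUnitalStarAlgebra.subset_adjoin ℂ _ ⟨t, ψ.map t ξ, rfl⟩)
    · exact (NonUnitalStarSubalgebra.isClosed_topologicalClosure _).preimage ψ.continuous_prodMap
  exact this hx

/-- The `⋆`-homomorphism `ψ ⋊ S : A ⋊ S → B ⋊ S` induced by a homomorphism `ψ` of actions. -/
noncomputable def full (ψ : Hom Γ Δ) : Γ.Full →⋆ₙₐ[ℂ] Δ.Full where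
  toFun x := ⟨ψ.prodMap x.1, ψ.prodMap_mem x.2⟩
  map_smul' _ _ := rfl
  map_zero' := rfl
  map_add' _ _ := rfl
  map_mul' _ _ := rfl
  map_star' _ := rfl

lemma full_delta (ψ : Hom Γ Δ) (t : S) (ξ : Γ.fib t) :
    ψ.full (Γ.delta t ξ) = Δ.delta t (ψ.map t ξ) := rfl

end Hom

/-! ### The weak conditional expectation and the reduced crossed product -/

section reduced

variable (Γ : Action S A)

/-- The ideal `r(fib t)` generated by the left inner products of elements of `fib t`. -/
def rangeIdeal (t : S) : ClosedIdeal A :=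
  ClosedIdeal.generated {a | ∃ ξ η : Γ.fib t, a = linner ξ η}

/-- The ideal `s(fib t)` generated by the right inner products of elements of `fib t`. -/
def sourceIdeal (t : S) : ClosedIdeal A :=
  ClosedIdeal.generated {a | ∃ ξ η : Γ.fib t, a = rinner ξ η}

/-- The ideal `I_{t,u}`, generated by the ideals `s(fib v)` for `v ≤ t, u`. -/
def commonIdeal (t u : S) : ClosedIdeal A :=
  ClosedIdeal.generated {a | ∃ v, NatLE v t ∧ NatLE v u ∧ a ∈ Γ.sourceIdeal v}

/-- For an idempotent `e ≤ 1`, the canonical inclusion `j_{1,e}` embeds `fib e` into `A` as the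
ideal `r(fib e)`, such that the multiplication `fib e × fib e → fib e` becomes the left module
structure. `Γ.IsUnitIncl h ξ a` says that `j_{1,e} ξ = a`. -/
def IsUnitIncl {e : S} (h : NatLE e 1) (ξ : Γ.fib e) (a : A) : Prop :=
  a ∈ Γ.rangeIdeal e ∧ ∀ η : Γ.fib e, lsmul a η = Γ.mul h.idem ξ η

/-- The graph of the canonical isomorphism `ϑ_{1,t} : fib t · I_{1,t} → I_{1,t} ⊆ A`, which
identifies the images of `fib e` in `fib t` and in `A` for all `e ≤ 1, t`. As `t e = e`,
elements of `fib e` are limits of sums of products `ξ · ζ` with `ξ ∈ fib t`, `ζ ∈ fib e`, and the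
inclusions `j_{t,e} : fib e → fib t` and `j_{1,e} : fib e → A` map such a product to
`ξ · j_{1,e} ζ` and to `j_{1,e} (ξ · ζ)`, respectively. -/
def thetaGraph (t : S) : Submodule ℂ (Γ.fib t × A) :=
  (Submodule.span ℂ {p | ∃ (e : S) (h₁ : NatLE e 1) (h : NatLE e t) (ξ : Γ.fib t) (ζ : Γ.fib e)
    (b c : A), Γ.IsUnitIncl h₁ ζ b ∧ Γ.IsUnitIncl h₁ (Γ.mul (h₁.mul_eq h) ξ ζ) c ∧
    p = (rsmul ξ b, c)}).topologicalClosure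

/-- `W` is the canonical weak conditional expectation `A ⋊ S → A''`: for `ξ ∈ fib t` and any
contractive approximate unit `(u_i)` of `I_{1,t}`, `W (ξ δ_t)` is the limit of `ϑ_{1,t} (ξ u_i)`.
The bidual `A''` is the second dual Banach space of `A`, and the limit is taken in its
weak-⋆ topology; a strict limit in the multiplier algebra of `I_{1,t}`, embedded into `A''`, of a
bounded net is also its weak-⋆ limit. -/
def IsWeakExpectation (W : Γ.Full →L[ℂ] StrongDual ℂ (StrongDual ℂ A)) : Prop :=
  ∀ (t : S) (ξ : Γ.fib t) (l : Filter (Γ.commonIdeal 1 t)), l.IsApproximateUnit →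
    (∀ᶠ u in l, ‖u‖ ≤ 1) → ∀ (φ : StrongDual ℂ A) (ε : ℝ), 0 < ε →
      ∀ᶠ u : Γ.commonIdeal 1 t in l, ∃ a : A, (rsmul ξ (u : A), a) ∈ Γ.thetaGraph t ∧ ‖φ a - W (Γ.delta t ξ) φ‖ < ε

open Classical in
/-- The canonical weak conditional expectation `A ⋊ S → A''`. -/
noncomputable def weakExpectation : Γ.Full →L[ℂ] StrongDual ℂ (StrongDual ℂ A) :=
  if h : ∃ W, Γ.IsWeakExpectation W then h.choose else 0

/-- The closed ideal generated by the set `{b | E (b⋆ b) = 0}`, where `E` is the canonical weak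
conditional expectation. -/
noncomputable def nullIdeal : ClosedIdeal Γ.Full :=
  ClosedIdeal.generated {b | Γ.weakExpectation (star b * b) = 0}

/-- The reduced crossed product. -/
def Reduced : Type (u + 1) := Γ.nullIdeal.Quot

noncomputable instance : NonUnitalCStarAlgebra Γ.Reduced :=
  inferInstanceAs (NonUnitalCStarAlgebra Γ.nullIdeal.Quot)

/-- The canonical surjection from the full onto the reduced crossed product. -/
noncomputable def regular : Γ.Full →⋆ₙₐ[ℂ] Γ.Reduced := Γ.nullIdeal.mkHom

end reduced

end Action

end ISG

open ISG

/-!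
The formula `⟨ξ δ_t, η δ_u⟩ = E ((ξ δ_t)⋆ (η δ_u))` defines an `A''`-valued inner product on the
direct sum of the fibres. Everything rests on its positivity, which is proved directly, without
first constructing `E`.

*The kernel.* On the set of idempotents `f` with `t f = u f`, parts of `fib t` and `fib u` are
identified with each other (`rel`, `exists_rel`). The canonical isomorphism `ϑ_{1,t}` is the case
where one of the two elements is `1`. For `ξ ∈ fib t` and `η ∈ fib u`, the map `d ↦ ⟨ξ, ϑ (η d)⟩` is
a multiplier of the ideal of these idempotents. A bounded functional `φ` on `A` has a canonical
value at such a multiplier, the limit of its values along an approximate unit (`multEval`,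
`IsMult.tendsto_multEval`); this replaces calculations in the von Neumann algebra `A''`. The limit
exists because a functional on an ideal is the norm limit of its translates by an approximate unit
(`IsGoodApproximateUnit.eventually_norm_apply_sub_mul_le`). The result is the kernel `ker ξ η φ`.
For positive `φ` it is positive definite (`ker_sum_nonneg`), by induction on the number of fibres:
for a fixed fibre `n`, the parts of the other vectors where `n` and `j` agree are moved to `fib n`,
and the remaining parts are orthogonal to them.

*Representations.* A positive definite kernel on the fibres that is compatible with the action gives
a representation of the action on a Hilbert space (`PosKernel.exists_rep`). This is used for three
kinds of kernels.

- For the kernel of a positive functional on `(A ⋊ S) / (I ⋊ S)`, the representation factors through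
  the action on `A / I`. This gives exactness in the middle (`exact_full`).
- For the kernel `τ ((ξ c)⋆ (η c))`, where `c ∈ I` and `τ` is a positive functional on `I ⋊ S`, the
  representation is one of `A ⋊ S`. This gives injectivity of `ι ⋊ S` (`inclHom_full_injective`).
- For `ker · · ψ` with a positive functional `ψ` on `A`, the values of `E` at the functionals
  `ψ (a⋆ · e)` are matrix coefficients of the representation. As these functionals approximate all
  others (`exists_isPositive_approx`), the map `E` is contractive (`norm_algExp_le`), and it extends
  to the full crossed product (`isWeakExpectation_weakExpectation`).

*The null space of `E`.* If `E (b⋆ b) = 0`, then `b` acts by zero in the representations for all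
positive functionals `ψ` on `A`, because all their diagonal coefficients, not only those for vectors
in the unit fibre, factor through `E` (`ker_mul_eq_fibExp`, `integrate_eq_zero`). Hence
`E (x b y) = 0` for all `x` and `y`, and the null space is an ideal (`mem_expNull`).

*Naturality.* The weak expectations are compatible with `ι ⋊ S` and `κ ⋊ S` on the fibres and thus
everywhere (`weakExpectation_inclHom`, `weakExpectation_quotHom`). The maps therefore descend to the
reduced crossed products, and `ι ⋊ᵣ S` is injective because functionals on `I` extend to `A`
(`regular_inclHom_full_eq_zero_iff`). Surjectivity of `κ ⋊ᵣ S` and the vanishing of the composite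
are inherited from the full crossed products.
-/

namespace ISG

open Filter Topology
open scoped ComplexConjugate ComplexOrder

/-! ### Approximate units and functionals on ideals -/

section Cstar

variable {A : Type u} [NonUnitalCStarAlgebra A]

/-- The properties of the members of an increasing approximate unit that are used below: `e` is
selfadjoint and contractive, and both `e` and `e - e²` are positive. -/
structure IsGoodUnit (e : A) : Prop where
  star_eq : star e = e
  norm_le : ‖e‖ ≤ 1
  nonneg : ∃ s, e = star s * s
  sub_sq_nonneg : ∃ r, e - e * e = star r * r

lemma IsGoodUnit.of_nonneg [PartialOrder A] [StarOrderedRing A] {e : A} (h0 : 0 ≤ e)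
    (h1 : ‖e‖ ≤ 1) : IsGoodUnit e := by
  have hs : star (CFC.sqrt e) = CFC.sqrt e := (IsSelfAdjoint.of_nonneg (CFC.sqrt_nonneg e)).star_eq
  have hsq : CFC.sqrt e * CFC.sqrt e = e := CFC.sqrt_mul_sqrt_self e h0
  refine ⟨(IsSelfAdjoint.of_nonneg h0).star_eq, h1, ⟨CFC.sqrt e, by rw [hs, hsq]⟩, ?_⟩
  have h2 : e * e ≤ e := by
    have h3 := CStarAlgebra.star_left_conjugate_le_norm_smul (a := CFC.sqrt e) (b := e)
      (hb := IsSelfAdjoint.of_nonneg h0)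
    rw [hs, hsq] at h3
    have h4 : CFC.sqrt e * e * CFC.sqrt e = e * e := by
      calc CFC.sqrt e * e * CFC.sqrt e
          = CFC.sqrt e * (CFC.sqrt e * CFC.sqrt e) * CFC.sqrt e := by rw [hsq]
        _ = (CFC.sqrt e * CFC.sqrt e) * (CFC.sqrt e * CFC.sqrt e) := by simp only [mul_assoc]
        _ = _ := by rw [hsq]
    rw [h4] at h3
    refine h3.trans ?_
    calc ‖e‖ • e ≤ (1 : ℝ) • e := smul_le_smul_of_nonneg_right h1 h0
      _ = e := one_smul _ _
  exact CStarAlgebra.nonneg_iff_eq_star_mul_self.mp (sub_nonneg.mpr h2)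

/-- With `z = a e + x (1 - e)`, the element `a a⋆ + x x⋆ - z z⋆` is a sum of positive elements. The
square root of `1 + s²` is what makes this better than the triangle inequality for small `s`. -/
lemma IsGoodUnit.norm_le_of_combination {e : A} (he : IsGoodUnit e) {a x : A} {s : ℝ}
    (ha : ‖a‖ ≤ 1) (hx : ‖x‖ ≤ s) :
    ‖a * e + (x - x * e)‖ * ‖a * e + (x - x * e)‖ ≤ 1 + s * s := by
  let _ := CStarAlgebra.spectralOrder A
  have := CStarAlgebra.spectralOrderedRing A
  obtain ⟨hes, hen, ⟨r, hr⟩, ⟨q, hq⟩⟩ := he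
  have hs : 0 ≤ s := (norm_nonneg _).trans hx
  set z := a * e + (x - x * e) with hz
  have h0 : 0 ≤ e := hr ▸ star_mul_self_nonneg r
  have h1 : 0 ≤ e - e * e := hq ▸ star_mul_self_nonneg q
  have h2 : a * e * star a ≤ a * star a := by
    have h3 := CStarAlgebra.star_right_conjugate_le_norm_smul (a := a) (b := e)
      (hb := IsSelfAdjoint.of_nonneg h0)
    refine h3.trans ?_
    calc ‖e‖ • (a * star a) ≤ (1 : ℝ) • (a * star a) :=
          smul_le_smul_of_nonneg_right hen (mul_star_self_nonneg a)
      _ = _ := one_smul _ _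
  have key : a * star a + x * star x - z * star z
      = (a * star a - a * e * star a) + x * e * star x
        + (a - x) * (e - e * e) * star (a - x) := by
    rw [hz]; simp only [star_add, star_sub, star_mul, hes]; noncomm_ring
  have h4 : z * star z ≤ a * star a + x * star x := by
    rw [← sub_nonneg, key]
    refine add_nonneg (add_nonneg (sub_nonneg.mpr h2) ?_) ?_
    · exact star_right_conjugate_nonneg h0 x
    · exact star_right_conjugate_nonneg h1 _
  have h5 := CStarAlgebra.norm_le_norm_of_nonneg_of_le (mul_star_self_nonneg z) h4
  rw [CStarRing.norm_self_mul_star] at h5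
  refine h5.trans ((norm_add_le _ _).trans ?_)
  rw [CStarRing.norm_self_mul_star, CStarRing.norm_self_mul_star]
  nlinarith [norm_nonneg a, norm_nonneg x]

/-- A contractive approximate unit of the ideal `J`, as a filter on `J`, that eventually consists
of good elements. -/
structure IsGoodApproximateUnit (J : ClosedIdeal A) (l : Filter J) : Prop where
  isApproximateUnit : l.IsApproximateUnit
  good : ∀ᶠ e : J in l, IsGoodUnit (e : A)

lemma exists_isGoodApproximateUnit (J : ClosedIdeal A) :
    ∃ l : Filter J, IsGoodApproximateUnit J l := by
  let _ := CStarAlgebra.spectralOrder A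
  have := CStarAlgebra.spectralOrderedRing A
  let _ := CStarAlgebra.spectralOrder J
  have := CStarAlgebra.spectralOrderedRing J
  have H := CStarAlgebra.increasingApproximateUnit (A := J)
  refine ⟨_, H.toIsApproximateUnit, ?_⟩
  filter_upwards [H.eventually_nonneg, H.eventually_norm] with e h0 h1
  have hpos : (0 : A) ≤ (e : A) := by
    obtain ⟨s, hs⟩ := CStarAlgebra.nonneg_iff_eq_star_mul_self.mp h0
    rw [hs]
    exact star_mul_self_nonneg (s : A)
  exact IsGoodUnit.of_nonneg hpos h1

variable {J : ClosedIdeal A} {l : Filter J}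

lemma _root_.Filter.IsApproximateUnit.tendsto_mul_coe (hl : l.IsApproximateUnit) {a : A}
    (ha : a ∈ J) : Tendsto (fun e : J => a * (e : A)) l (𝓝 a) :=
  (continuous_subtype_val.tendsto _).comp (hl.tendsto_mul_left ⟨a, ha⟩)

lemma _root_.Filter.IsApproximateUnit.tendsto_coe_mul (hl : l.IsApproximateUnit) {a : A}
    (ha : a ∈ J) : Tendsto (fun e : J => (e : A) * a) l (𝓝 a) :=
  (continuous_subtype_val.tendsto _).comp (hl.tendsto_mul_right ⟨a, ha⟩)

/-- A functional `φ` on an ideal is the norm limit of the functionals `φ(· e)`, where `e` runs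
through an approximate unit: if `a` almost norms `φ`, so does `a e`, and `a e + x (1 - e)`
has norm at most `√(1 + ‖x‖²)`, which leaves no room for `φ(x (1 - e))`. -/
theorem IsGoodApproximateUnit.eventually_norm_apply_sub_mul_le (hl : IsGoodApproximateUnit J l)
    (φ : StrongDual ℂ A) {ε : ℝ} (hε : 0 < ε) :
    ∀ᶠ e : J in l, ∀ x ∈ J, ‖φ (x - x * e)‖ ≤ ε * ‖x‖ := by
  set f : J →L[ℂ] ℂ := φ.comp J.inclL with hf
  set N := ‖f‖ with hN
  have hN0 : 0 ≤ N := norm_nonneg f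
  have hbound : ∀ z ∈ J, ‖φ z‖ ≤ N * ‖z‖ := fun z hz => f.le_opNorm ⟨z, hz⟩
  rcases hN0.eq_or_lt with h0 | hNpos
  · refine Eventually.of_forall fun e x hx => ?_
    have h1 := hbound _ (sub_mem hx (J.mul_mem_right (e : A) hx))
    rw [← h0, zero_mul] at h1
    exact h1.trans (by positivity)
  set s := ε / (N + 1) with hs
  have hspos : 0 < s := by positivity
  set δ := s * ε / (2 * (N + 1)) with hδ
  have hδpos : 0 < δ := by positivity
  obtain ⟨a, ha1, ha2⟩ : ∃ a : J, ‖a‖ < 1 ∧ N - δ < ‖f a‖ :=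
    f.exists_lt_apply_of_lt_opNorm (by linarith)
  have e1 := (Metric.tendsto_nhds.mp (hl.isApproximateUnit.tendsto_mul_coe a.2)) δ hδpos
  filter_upwards [e1, hl.good] with e he hg x hx
  rw [dist_eq_norm] at he
  have haN : ‖φ (a * e)‖ ≥ N - δ - N * δ := by
    have h1 : ‖φ (a * e - a)‖ ≤ N * δ :=
      (hbound _ (sub_mem (J.mul_mem_right (e : A) a.2) a.2)).trans (by gcongr)
    have h2 : ‖φ (a : A)‖ ≤ ‖φ (a * e)‖ + ‖φ (a * e - a)‖ := by
      have : φ (a : A) = φ (a * e) - φ (a * e - a) := by rw [map_sub]; ring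
      rw [this]; exact norm_sub_le _ _
    have h3 : N - δ < ‖φ (a : A)‖ := ha2
    linarith
  -- replace `x` by a multiple `y` of norm `s` such that the values of `φ` at `a e` and `y (1 - e)`
  -- have the same argument
  rcases eq_or_ne x 0 with rfl | hx0
  · simp
  have hxn : 0 < ‖x‖ := norm_pos_iff.mpr hx0
  obtain ⟨c, hc1, hc2⟩ : ∃ c : ℂ, ‖c‖ = 1 ∧ ‖φ (a * e) + c * φ (x - x * e) * (s / ‖x‖ : ℝ)‖
      = ‖φ (a * e)‖ + ‖φ (x - x * e)‖ * (s / ‖x‖) := by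
    rcases eq_or_ne (φ (x - x * e)) 0 with h | h
    · exact ⟨1, by simp, by simp [h]⟩
    rcases eq_or_ne (φ (a * e)) 0 with h' | h'
    · refine ⟨1, by simp, ?_⟩
      simp only [h', zero_add, one_mul, norm_zero, norm_mul, Complex.norm_real]
      rw [Real.norm_of_nonneg (by positivity)]
    set u := φ (a * e)
    set w := φ (x - x * e)
    refine ⟨(u / ‖u‖) / (w / ‖w‖), ?_, ?_⟩
    · simp [h, h']
    · have hw : (‖w‖ : ℂ) ≠ 0 := by simpa using h
      have hu : (‖u‖ : ℂ) ≠ 0 := by simpa using h'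
      have : u + u / ‖u‖ / (w / ‖w‖) * w * (s / ‖x‖ : ℝ)
          = (u / ‖u‖) * ((‖u‖ + ‖w‖ * (s / ‖x‖) : ℝ) : ℂ) := by
        push_cast
        field_simp
      rw [this, norm_mul, Complex.norm_real, Real.norm_of_nonneg (by positivity)]
      simp [h']
  set y : A := (c * (s / ‖x‖ : ℝ)) • x with hy
  have hyJ : y ∈ J := SMulMemClass.smul_mem _ hx
  have hyn : ‖y‖ ≤ s := by
    rw [hy, norm_smul, norm_mul, hc1, Complex.norm_real, Real.norm_of_nonneg (by positivity)]
    field_simp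
    rfl
  have hz := hg.norm_le_of_combination (a := (a : A)) (x := y) ha1.le hyn
  set z := (a : A) * e + (y - y * e) with hzdef
  have hzJ : z ∈ J := add_mem (J.mul_mem_right _ a.2) (sub_mem hyJ (J.mul_mem_right _ hyJ))
  have hφz : φ z = φ (a * e) + c * φ (x - x * e) * (s / ‖x‖ : ℝ) := by
    have : y - y * e = (c * (s / ‖x‖ : ℝ)) • (x - x * e) := by
      rw [hy, smul_sub, smul_mul_assoc]
    rw [hzdef, map_add, this, map_smul, smul_eq_mul]; ring
  have hzn : ‖z‖ ≤ 1 + s * s / 2 := by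
    nlinarith [norm_nonneg z, sq_nonneg (s * s)]
  have h6 : ‖φ (a * e)‖ + ‖φ (x - x * e)‖ * (s / ‖x‖) ≤ N * (1 + s * s / 2) := by
    rw [← hc2, ← hφz]
    exact (hbound z hzJ).trans (by gcongr)
  have h7 : ‖φ (x - x * e)‖ * (s / ‖x‖) ≤ N * (s * s / 2) + δ * (1 + N) := by linarith
  have h8 : N * (s * s / 2) + δ * (1 + N) ≤ ε * s := by
    have : δ * (1 + N) = s * ε / 2 := by rw [hδ]; field_simp; ring
    rw [this]
    have h9 : N * s ≤ ε := by
      rw [hs]; rw [mul_div_assoc', div_le_iff₀ (by positivity)]; nlinarith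
    nlinarith
  have h10 : ‖φ (x - x * e)‖ * s / ‖x‖ ≤ ε * s := by
    rw [mul_div_assoc]; exact h7.trans h8
  rw [div_le_iff₀ hxn] at h10
  nlinarith

end Cstar

/-! ### Evaluating functionals on multipliers of an ideal -/

section Mult

variable {A : Type u} [NonUnitalCStarAlgebra A]

/-- The functional `a ↦ φ (a b)`. -/
noncomputable def rightShift (φ : StrongDual ℂ A) (b : A) : StrongDual ℂ A :=
  φ.comp ((ContinuousLinearMap.mul ℂ A).flip b)

/-- The functional `a ↦ φ (b a)`. -/
noncomputable def leftShift (φ : StrongDual ℂ A) (b : A) : StrongDual ℂ A :=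
  φ.comp (ContinuousLinearMap.mul ℂ A b)

@[simp] lemma rightShift_apply (φ : StrongDual ℂ A) (a b : A) : rightShift φ b a = φ (a * b) := rfl

/-- `m` restricts to a bounded right module map `J → J`, that is, to a left multiplier of `J`.
The values of `m` outside `J` are irrelevant. -/
structure IsMult (J : ClosedIdeal A) (m : A → A) : Prop where
  sub : ∀ a ∈ J, ∀ b ∈ J, m (a - b) = m a - m b
  mul : ∀ a ∈ J, ∀ b, m (a * b) = m a * b
  mem : ∀ a ∈ J, m a ∈ J
  bound : ∃ C, 0 ≤ C ∧ ∀ a ∈ J, ‖m a‖ ≤ C * ‖a‖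

/-- A chosen approximate unit of an ideal. -/
noncomputable def ClosedIdeal.approxUnit (J : ClosedIdeal A) : Filter J :=
  (exists_isGoodApproximateUnit J).choose

lemma ClosedIdeal.isGood_approxUnit (J : ClosedIdeal A) : IsGoodApproximateUnit J J.approxUnit :=
  (exists_isGoodApproximateUnit J).choose_spec

instance (J : ClosedIdeal A) : J.approxUnit.NeBot :=
  J.isGood_approxUnit.isApproximateUnit.neBot

lemma IsGoodApproximateUnit.norm_le {J : ClosedIdeal A} {l : Filter J}
    (hl : IsGoodApproximateUnit J l) : ∀ᶠ e in l, ‖e‖ ≤ 1 :=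
  hl.good.mono fun _ h => h.norm_le

/-- The value of the functional `φ`, or rather of its canonical extension, at the multiplier `m` of
the ideal `J`. -/
noncomputable def multEval (J : ClosedIdeal A) (m : A → A) (φ : StrongDual ℂ A) : ℂ :=
  limUnder J.approxUnit fun e : J => φ (m e)

variable {J : ClosedIdeal A} {m n : A → A}

/-- A Cauchy condition that is uniform in the approximate unit: for `u` far out, `φ (m u)` is close
to `φ (m u e) = φ (m (u e))` for a fixed good `e`, and `u e` is close to `e`. -/
lemma IsMult.eventually_near (hm : IsMult J m) (φ : StrongDual ℂ A) {ε : ℝ} (hε : 0 < ε) :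
    ∃ z : ℂ, ∀ l : Filter J, l.IsApproximateUnit → (∀ᶠ u in l, ‖u‖ ≤ 1) →
      ∀ᶠ u : J in l, ‖φ (m u) - z‖ < ε := by
  obtain ⟨C, hC0, hC⟩ := hm.bound
  obtain ⟨e, he⟩ := (J.isGood_approxUnit.eventually_norm_apply_sub_mul_le φ
    (ε := ε / (2 * (C + 1))) (by positivity)).exists
  refine ⟨φ (m e), fun l hl hn => ?_⟩
  have h1 : Tendsto (fun u : J => ‖φ‖ * (C * ‖(u : A) * e - e‖)) l (𝓝 0) := by
    have := (tendsto_iff_norm_sub_tendsto_zero.mp (hl.tendsto_coe_mul e.2))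
    simpa using (this.const_mul C).const_mul ‖φ‖
  filter_upwards [hn, h1.eventually (gt_mem_nhds (half_pos hε))] with u hu h2
  have hue : (u : A) * e ∈ J := J.mul_mem_right _ u.2
  have h3 : φ (m u) - φ (m e) = φ (m u - m u * e) + φ (m (u * e - e)) := by
    rw [hm.sub _ hue _ e.2, hm.mul _ u.2, ← map_sub, ← map_add]; congr 1; abel
  rw [h3]
  have h4 : ‖φ (m u - m u * e)‖ ≤ ε / (2 * (C + 1)) * C := by
    refine (he _ (hm.mem _ u.2)).trans ?_
    gcongr
    refine (hC _ u.2).trans ?_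
    calc C * ‖(u : A)‖ ≤ C * 1 := by gcongr; exact hu
      _ = C := mul_one C
  have h5 : ε / (2 * (C + 1)) * C ≤ ε / 2 := by
    rw [div_mul_eq_mul_div, div_le_div_iff₀ (by positivity) (by positivity)]
    nlinarith
  have h6 : ‖φ (m (u * e - e))‖ ≤ ‖φ‖ * (C * ‖(u : A) * e - e‖) :=
    (φ.le_opNorm _).trans (by gcongr; exact hC _ (sub_mem hue e.2))
  calc _ ≤ ‖φ (m u - m u * e)‖ + ‖φ (m (u * e - e))‖ := norm_add_le _ _
    _ < _ := by linarith

/-- The limit that defines `multEval` exists along any contractive approximate unit. -/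
theorem IsMult.tendsto_multEval (hm : IsMult J m) (φ : StrongDual ℂ A) {l : Filter J}
    (hl : l.IsApproximateUnit) (hn : ∀ᶠ u in l, ‖u‖ ≤ 1) :
    Tendsto (fun u : J => φ (m u)) l (𝓝 (multEval J m φ)) := by
  have hstd := J.isGood_approxUnit
  have hcau : ∃ z, Tendsto (fun u : J => φ (m u)) J.approxUnit (𝓝 z) := by
    refine cauchy_map_iff_exists_tendsto.mp ?_
    rw [Metric.cauchy_iff]
    refine ⟨inferInstance, fun ε hε => ?_⟩
    obtain ⟨z, hz⟩ := hm.eventually_near φ (half_pos hε)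
    refine ⟨_, image_mem_map (hz _ hstd.isApproximateUnit hstd.norm_le), ?_⟩
    rintro _ ⟨u, hu, rfl⟩ _ ⟨v, hv, rfl⟩
    have h1 : ‖φ (m u) - z‖ < ε / 2 := hu
    have h2 : ‖φ (m v) - z‖ < ε / 2 := hv
    rw [← dist_eq_norm] at h1 h2
    linarith [dist_triangle_right (φ (m u)) (φ (m v)) z]
  have hlim : Tendsto (fun u : J => φ (m u)) J.approxUnit (𝓝 (multEval J m φ)) :=
    tendsto_nhds_limUnder hcau
  rw [Metric.tendsto_nhds]
  intro ε hε
  obtain ⟨z, hz⟩ := hm.eventually_near φ (ε := ε / 2) (by positivity)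
  have h1 : ‖multEval J m φ - z‖ ≤ ε / 2 := by
    refine le_of_tendsto (hlim.sub_const z).norm ?_
    exact (hz _ hstd.isApproximateUnit hstd.norm_le).mono fun u hu => hu.le
  filter_upwards [hz l hl hn] with u hu
  rw [← dist_eq_norm] at h1 hu
  linarith [dist_triangle_right (φ (m u)) (multEval J m φ) z]

lemma IsMult.tendsto_approxUnit (hm : IsMult J m) (φ : StrongDual ℂ A) :
    Tendsto (fun u : J => φ (m u)) J.approxUnit (𝓝 (multEval J m φ)) :=
  hm.tendsto_multEval φ J.isGood_approxUnit.isApproximateUnit J.isGood_approxUnit.norm_le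

lemma multEval_congr (h : ∀ d ∈ J, m d = n d) (φ : StrongDual ℂ A) :
    multEval J m φ = multEval J n φ := by
  unfold multEval
  congr 1
  ext e
  rw [h _ e.2]

lemma IsMult.add (hm : IsMult J m) (hn : IsMult J n) : IsMult J (fun d => m d + n d) where
  sub a ha b hb := by rw [hm.sub a ha b hb, hn.sub a ha b hb]; abel
  mul a ha b := by rw [hm.mul a ha, hn.mul a ha, add_mul]
  mem a ha := add_mem (hm.mem a ha) (hn.mem a ha)
  bound := by
    obtain ⟨C, hC, h⟩ := hm.bound
    obtain ⟨D, hD, h'⟩ := hn.bound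
    refine ⟨C + D, by positivity, fun a ha => (norm_add_le _ _).trans ?_⟩
    rw [add_mul]; exact add_le_add (h a ha) (h' a ha)

lemma IsMult.smul (hm : IsMult J m) (c : ℂ) : IsMult J (fun d => c • m d) where
  sub a ha b hb := by rw [hm.sub a ha b hb, smul_sub]
  mul a ha b := by rw [hm.mul a ha, smul_mul_assoc]
  mem a ha := SMulMemClass.smul_mem c (hm.mem a ha)
  bound := by
    obtain ⟨C, hC, h⟩ := hm.bound
    refine ⟨‖c‖ * C, by positivity, fun a ha => ?_⟩
    rw [norm_smul, mul_assoc]; gcongr; exact h a ha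

lemma IsMult.comp_mul_left (hm : IsMult J m) (b : A) : IsMult J (fun d => m (b * d)) where
  sub a ha c hc := by
    rw [mul_sub, hm.sub _ (J.mul_mem_left b ha) _ (J.mul_mem_left b hc)]
  mul a ha c := by rw [← mul_assoc, hm.mul _ (J.mul_mem_left b ha)]
  mem a ha := hm.mem _ (J.mul_mem_left b ha)
  bound := by
    obtain ⟨C, hC, h⟩ := hm.bound
    refine ⟨C * ‖b‖, by positivity, fun a ha => (h _ (J.mul_mem_left b ha)).trans ?_⟩
    rw [mul_assoc]; gcongr; exact norm_mul_le _ _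

lemma IsMult.of_le (hm : IsMult J m) {L : ClosedIdeal A} (hL : ∀ a ∈ L, a ∈ J)
    (h : ∀ a ∈ J, m a ∈ L) : IsMult L m where
  sub a ha b hb := hm.sub a (hL a ha) b (hL b hb)
  mul a ha := hm.mul a (hL a ha)
  mem a ha := h a (hL a ha)
  bound := by
    obtain ⟨C, hC, h⟩ := hm.bound
    exact ⟨C, hC, fun a ha => h a (hL a ha)⟩

lemma IsMult.multEval_add (hm : IsMult J m) (hn : IsMult J n) (φ : StrongDual ℂ A) :
    multEval J (fun d => m d + n d) φ = multEval J m φ + multEval J n φ := by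
  refine tendsto_nhds_unique ((hm.add hn).tendsto_approxUnit φ) ?_
  simpa only [map_add] using (hm.tendsto_approxUnit φ).add (hn.tendsto_approxUnit φ)

lemma IsMult.multEval_smul (hm : IsMult J m) (c : ℂ) (φ : StrongDual ℂ A) :
    multEval J (fun d => c • m d) φ = c * multEval J m φ := by
  refine tendsto_nhds_unique ((hm.smul c).tendsto_approxUnit φ) ?_
  simpa only [map_smul, smul_eq_mul] using (hm.tendsto_approxUnit φ).const_mul c

lemma IsMult.multEval_functional_add (hm : IsMult J m) (φ ψ : StrongDual ℂ A) :
    multEval J m (φ + ψ) = multEval J m φ + multEval J m ψ :=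
  tendsto_nhds_unique (hm.tendsto_approxUnit _)
    ((hm.tendsto_approxUnit φ).add (hm.tendsto_approxUnit ψ))

lemma IsMult.multEval_functional_smul (hm : IsMult J m) (c : ℂ) (φ : StrongDual ℂ A) :
    multEval J m (c • φ) = c * multEval J m φ :=
  tendsto_nhds_unique (hm.tendsto_approxUnit _) ((hm.tendsto_approxUnit φ).const_mul c)

lemma multEval_mul_left (b : A) (φ : StrongDual ℂ A) :
    multEval J (fun d => b * m d) φ = multEval J m (leftShift φ b) := rfl

/-- If the multiplier is left multiplication by `c ∈ J`, then it is evaluated like `c`. -/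
lemma multEval_eq_apply {c : A} (hc : c ∈ J) (h : ∀ d ∈ J, m d = c * d) (φ : StrongDual ℂ A) :
    multEval J m φ = φ c := by
  refine Tendsto.limUnder_eq ?_
  have := (φ.continuous.tendsto c).comp
    (J.isGood_approxUnit.isApproximateUnit.tendsto_mul_coe hc)
  refine this.congr fun e => ?_
  simp [h _ e.2]

lemma IsMult.norm_multEval_le (hm : IsMult J m) (φ : StrongDual ℂ A) {N : ℝ}
    (h : ∀ d ∈ J, ‖d‖ ≤ 1 → ‖φ (m d)‖ ≤ N) : ‖multEval J m φ‖ ≤ N := by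
  refine le_of_tendsto (hm.tendsto_approxUnit φ).norm ?_
  exact J.isGood_approxUnit.norm_le.mono fun e he => h e e.2 he

/-- Evaluation of functionals does not depend on the ideal on which a multiplier is considered. -/
lemma IsMult.multEval_eq_of_le (hm : IsMult J m) {L : ClosedIdeal A} (hL : ∀ a ∈ L, a ∈ J)
    (h : ∀ a ∈ J, m a ∈ L) (φ : StrongDual ℂ A) : multEval L m φ = multEval J m φ := by
  have hmL := hm.of_le hL h
  obtain ⟨C, hC0, hC⟩ := hm.bound
  refine eq_of_forall_dist_le fun ε hε => ?_
  obtain ⟨e, he1, he2⟩ := ((L.isGood_approxUnit.eventually_norm_apply_sub_mul_le φ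
    (ε := ε / (2 * (C + 1))) (by positivity)).and
    ((Metric.tendsto_nhds.mp (hmL.tendsto_approxUnit φ)) (ε / 2) (half_pos hε))).exists
  have h1 : Tendsto (fun u : J => φ (m u * e)) J.approxUnit (𝓝 (φ (m e))) := by
    have h2 : Tendsto (fun u : J => m ((u : A) * e)) J.approxUnit (𝓝 (m e)) := by
      rw [tendsto_iff_norm_sub_tendsto_zero]
      have h3 := (tendsto_iff_norm_sub_tendsto_zero.mp
        (J.isGood_approxUnit.isApproximateUnit.tendsto_coe_mul (hL _ e.2))).const_mul C
      rw [mul_zero] at h3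
      refine squeeze_zero (fun _ => norm_nonneg _) (fun u => ?_) h3
      rw [← hm.sub _ (J.mul_mem_right _ u.2) _ (hL _ e.2)]
      exact hC _ (sub_mem (J.mul_mem_right _ u.2) (hL _ e.2))
    refine ((φ.continuous.tendsto _).comp h2).congr fun u => ?_
    simp [hm.mul _ u.2]
  have h4 : ‖multEval J m φ - φ (m e)‖ ≤ ε / 2 := by
    refine le_of_tendsto ((hm.tendsto_approxUnit φ).sub h1).norm ?_
    filter_upwards [J.isGood_approxUnit.norm_le] with u hu
    rw [← map_sub]
    refine (he1 _ (h _ u.2)).trans ?_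
    have h5 : ‖m u‖ ≤ C := (hC _ u.2).trans (by
      calc C * ‖(u : A)‖ ≤ C * 1 := by gcongr; exact hu
        _ = C := mul_one C)
    calc ε / (2 * (C + 1)) * ‖m u‖ ≤ ε / (2 * (C + 1)) * (C + 1) := by gcongr; linarith
      _ = ε / 2 := by field_simp
  rw [← dist_eq_norm] at h4
  rw [dist_comm] at he2
  linarith [dist_triangle_right (multEval L m φ) (multEval J m φ) (φ (m e)),
    dist_comm (multEval L m φ) (φ (m e))]

/-- A multiplier `m`, composed with an element `b` on the right, is evaluated by `φ` like `m`
is evaluated by `φ (· b)`. -/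
lemma IsMult.multEval_comp_mul_left (hm : IsMult J m) (b : A) (φ : StrongDual ℂ A) :
    multEval J (fun d => m (b * d)) φ = multEval J m (rightShift φ b) := by
  have hn := hm.comp_mul_left b
  obtain ⟨C, hC0, hC⟩ := hm.bound
  refine eq_of_forall_dist_le fun ε hε => ?_
  obtain ⟨e, he1, he2⟩ := ((J.isGood_approxUnit.eventually_norm_apply_sub_mul_le φ
    (ε := ε / (2 * (C * ‖b‖ + 1))) (by positivity)).and
    ((Metric.tendsto_nhds.mp (hn.tendsto_approxUnit φ)) (ε / 2) (half_pos hε))).exists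
  have hbe : b * (e : A) ∈ J := J.mul_mem_left b e.2
  have h1 : Tendsto (fun u : J => φ (m u * b * e)) J.approxUnit (𝓝 (φ (m (b * e)))) := by
    have h2 : Tendsto (fun u : J => m ((u : A) * (b * e))) J.approxUnit (𝓝 (m (b * e))) := by
      rw [tendsto_iff_norm_sub_tendsto_zero]
      have h3 := (tendsto_iff_norm_sub_tendsto_zero.mp
        (J.isGood_approxUnit.isApproximateUnit.tendsto_coe_mul hbe)).const_mul C
      rw [mul_zero] at h3
      refine squeeze_zero (fun _ => norm_nonneg _) (fun u => ?_) h3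
      rw [← hm.sub _ (J.mul_mem_right _ u.2) _ hbe]
      exact hC _ (sub_mem (J.mul_mem_right _ u.2) hbe)
    refine ((φ.continuous.tendsto _).comp h2).congr fun u => ?_
    simp [hm.mul _ u.2, mul_assoc]
  have h4 : ‖multEval J m (rightShift φ b) - φ (m (b * e))‖ ≤ ε / 2 := by
    refine le_of_tendsto ((hm.tendsto_approxUnit (rightShift φ b)).sub h1).norm ?_
    filter_upwards [J.isGood_approxUnit.norm_le] with u hu
    rw [rightShift_apply, ← map_sub]
    refine (he1 _ (J.mul_mem_right b (hm.mem _ u.2))).trans ?_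
    have h5 : ‖m u * b‖ ≤ C * ‖b‖ := (norm_mul_le _ _).trans (by
      gcongr
      calc ‖m u‖ ≤ C * ‖(u : A)‖ := hC _ u.2
        _ ≤ C * 1 := by gcongr; exact hu
        _ = C := mul_one C)
    calc ε / (2 * (C * ‖b‖ + 1)) * ‖m u * b‖
        ≤ ε / (2 * (C * ‖b‖ + 1)) * (C * ‖b‖ + 1) := by gcongr; linarith
      _ = ε / 2 := by field_simp
  rw [← dist_eq_norm] at h4
  linarith [dist_triangle_right (multEval J (fun d => m (b * d)) φ)
    (multEval J m (rightShift φ b)) (φ (m (b * e))),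
    dist_comm (multEval J (fun d => m (b * d)) φ) (φ (m (b * e)))]

end Mult

/-! ### Positive functionals that dominate a given functional -/

section Dominate

variable {A : Type u} [NonUnitalCStarAlgebra A]

/-- A bounded functional is positive if it is nonnegative on the elements `a⋆ a`. -/
def IsPositive (ψ : StrongDual ℂ A) : Prop := ∀ a, 0 ≤ ψ (star a * a)

/-- The sum of the elements `a⋆ a` for `a` in a list. -/
def sumStarMul (l : List A) : A := (l.map fun a => star a * a).sum

/-- The sum of the numbers `‖φ a‖²` for `a` in a list. -/
noncomputable def sumNormSq (φ : StrongDual ℂ A) (l : List A) : ℝ :=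
  (l.map fun a => ‖φ a‖ ^ 2).sum

lemma sumNormSq_nonneg (φ : StrongDual ℂ A) (l : List A) : 0 ≤ sumNormSq φ l :=
  List.sum_nonneg (by simp only [List.mem_map]; rintro _ ⟨a, -, rfl⟩; positivity)

/-- A bounded functional is bounded on columns: this is the Cauchy–Schwarz inequality for
`∑ c a` with `c = conj (φ a)`. -/
lemma sumNormSq_le (φ : StrongDual ℂ A) (l : List A) :
    sumNormSq φ l ≤ ‖φ‖ ^ 2 * ‖sumStarMul l‖ := by
  let _ := CStarAlgebra.spectralOrder A
  have := CStarAlgebra.spectralOrderedRing A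
  have key : ∀ l : List A, ∃ z : A, φ z = sumNormSq φ l ∧ 0 ≤ sumStarMul l ∧
      star z * z ≤ sumNormSq φ l • sumStarMul l := by
    intro l
    induction l with
    | nil => exact ⟨0, by simp [sumNormSq], by simp [sumStarMul], by simp [sumStarMul]⟩
    | cons a l ih =>
      obtain ⟨z, hz1, hP, hz2⟩ := ih
      set c := conj (φ a) with hc
      set T := sumNormSq φ l with hT
      set P := sumStarMul l with hPdef
      have hTn : 0 ≤ T := sumNormSq_nonneg φ l
      have hT' : sumNormSq φ (a :: l) = ‖c‖ ^ 2 + T := by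
        simp [sumNormSq, hT, hc]
      have hP' : sumStarMul (a :: l) = star a * a + P := by simp [sumStarMul, hPdef]
      have hcc : ((‖c‖ ^ 2 : ℝ) : ℂ) = conj c * c := by
        rw [mul_comm, Complex.mul_conj, Complex.normSq_eq_norm_sq]
      have haa : 0 ≤ star a * a := star_mul_self_nonneg a
      refine ⟨z + c • a, ?_, ?_, ?_⟩
      · rw [hT', map_add, map_smul, hz1, smul_eq_mul]
        push_cast
        rw [show ((‖c‖ : ℂ)) ^ 2 = ((‖c‖ ^ 2 : ℝ) : ℂ) by push_cast; rfl, hcc, hc]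
        simp; ring
      · rw [hP']; exact add_nonneg haa hP
      · rw [hT', hP']
        have cross : star z * (c • a) + star (c • a) * z ≤ (‖c‖ ^ 2) • P + T • (star a * a) := by
          rcases hTn.eq_or_lt with h0 | hpos
          · rw [← h0, zero_smul] at hz2
            have hz0 : star z * z = 0 := le_antisymm hz2 (star_mul_self_nonneg z)
            rw [CStarRing.star_mul_self_eq_zero_iff] at hz0
            rw [← h0, hz0]
            simpa using smul_nonneg (by positivity : (0:ℝ) ≤ ‖c‖ ^ 2) hP
          · have hw := star_mul_self_nonneg (conj c • z - (T : ℂ) • a)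
            have e1 : star (conj c • z - (T : ℂ) • a) * (conj c • z - (T : ℂ) • a)
                = (‖c‖ ^ 2) • (star z * z) + T • (T • (star a * a))
                  - T • (star z * (c • a) + star (c • a) * z) := by
              rw [← Complex.coe_smul (‖c‖ ^ 2), hcc]
              simp only [← Complex.coe_smul, star_sub, star_smul, sub_mul, mul_sub,
                smul_mul_assoc, mul_smul_comm, smul_smul, Complex.star_def,
                Complex.conj_conj, Complex.conj_ofReal, smul_add]
              module
            rw [e1, sub_nonneg] at hw
            have h1 : T • (star z * (c • a) + star (c • a) * z)
                ≤ T • ((‖c‖ ^ 2) • P + T • (star a * a)) := by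
              refine hw.trans ?_
              rw [smul_add]
              gcongr
              rw [smul_comm]
              exact smul_le_smul_of_nonneg_left hz2 (by positivity)
            exact (smul_le_smul_iff_of_pos_left hpos).mp h1
        have e2 : star (z + c • a) * (z + c • a) = star z * z
            + (star z * (c • a) + star (c • a) * z) + (‖c‖ ^ 2) • (star a * a) := by
          rw [← Complex.coe_smul (‖c‖ ^ 2), hcc]
          simp only [star_add, star_smul, add_mul, mul_add, smul_mul_assoc, mul_smul_comm,
            Complex.star_def]
          module
        rw [e2]
        calc _ ≤ T • P + ((‖c‖ ^ 2) • P + T • (star a * a)) + (‖c‖ ^ 2) • (star a * a) := by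
              gcongr
          _ = _ := by module
  obtain ⟨z, hz1, hP, hz2⟩ := key l
  set T := sumNormSq φ l
  have hTn : 0 ≤ T := sumNormSq_nonneg φ l
  have h1 : ‖z‖ ^ 2 ≤ T * ‖sumStarMul l‖ := by
    rw [sq, ← CStarRing.norm_star_mul_self]
    refine (CStarAlgebra.norm_le_norm_of_nonneg_of_le (star_mul_self_nonneg z) hz2).trans ?_
    rw [norm_smul, Real.norm_of_nonneg hTn]
  have h2 : T ≤ ‖φ‖ * ‖z‖ := by
    have := φ.le_opNorm z
    rwa [hz1, Complex.norm_real, Real.norm_of_nonneg hTn] at this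
  rcases hTn.eq_or_lt with h0 | hpos
  · rw [← h0]; positivity
  · have h3 : T * T ≤ T * (‖φ‖ ^ 2 * ‖sumStarMul l‖) := by
      calc T * T ≤ (‖φ‖ * ‖z‖) * (‖φ‖ * ‖z‖) := by gcongr
        _ = ‖φ‖ ^ 2 * ‖z‖ ^ 2 := by ring
        _ ≤ ‖φ‖ ^ 2 * (T * ‖sumStarMul l‖) := by gcongr
        _ = _ := by ring
    exact le_of_mul_le_mul_left h3 hpos

lemma sumStarMul_smul (c : ℝ) (l : List A) :
    sumStarMul (l.map fun a => (c : ℂ) • a) = (c * c) • sumStarMul l := by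
  induction l with
  | nil => simp [sumStarMul]
  | cons a l ih =>
    simp only [sumStarMul, List.map_cons, List.sum_cons, smul_add] at ih ⊢
    rw [ih]
    simp only [star_smul, Complex.star_def, Complex.conj_ofReal, smul_mul_assoc, mul_smul_comm,
      smul_smul, ← Complex.coe_smul, Complex.ofReal_mul]

lemma sumNormSq_smul (φ : StrongDual ℂ A) (c : ℝ) (l : List A) :
    sumNormSq φ (l.map fun a => (c : ℂ) • a) = (c * c) * sumNormSq φ l := by
  induction l with
  | nil => simp [sumNormSq]
  | cons a l ih =>
    simp only [sumNormSq, List.map_cons, List.sum_cons, mul_add] at ih ⊢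
    rw [ih, map_smul, norm_smul, Complex.norm_real, mul_pow, Real.norm_eq_abs, sq_abs]
    ring

/-- Every bounded functional `φ` satisfies `‖φ a‖² ≤ ψ (a⋆ a)` for a positive functional `ψ`, of
norm at most `‖φ‖²`. The functional `ψ` comes from the Hahn–Banach theorem for the sublinear
functional `x ↦ inf (‖φ‖² ‖x + ∑ a⋆ a‖ - ∑ ‖φ a‖²)`, the infimum being over finite families. -/
theorem exists_isPositive_dominating (φ : StrongDual ℂ A) :
    ∃ ψ : StrongDual ℂ A, IsPositive ψ ∧ ‖ψ‖ ≤ ‖φ‖ ^ 2 ∧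
      ∀ a, ‖φ a‖ ^ 2 ≤ (ψ (star a * a)).re := by
  set M := ‖φ‖ ^ 2 with hM
  have hM0 : 0 ≤ M := by positivity
  let q : A → List A → ℝ := fun x l => M * ‖x + sumStarMul l‖ - sumNormSq φ l
  have hq : ∀ x l, -(M * ‖x‖) ≤ q x l := by
    intro x l
    have h1 := sumNormSq_le φ l
    have h2 : ‖sumStarMul l‖ ≤ ‖x + sumStarMul l‖ + ‖x‖ := by
      have := norm_sub_le (x + sumStarMul l) x
      rwa [add_sub_cancel_left] at this
    have h3 : M * ‖sumStarMul l‖ ≤ M * (‖x + sumStarMul l‖ + ‖x‖) := by gcongr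
    simp only [q]; linarith
  have hbdd : ∀ x, BddBelow (Set.range (q x)) := fun x =>
    ⟨-(M * ‖x‖), by rintro _ ⟨l, rfl⟩; exact hq x l⟩
  let N : A → ℝ := fun x => ⨅ l, q x l
  have hN_le : ∀ x l, N x ≤ q x l := fun x l => ciInf_le (hbdd x) l
  have hN_norm : ∀ x, N x ≤ M * ‖x‖ := fun x => by
    refine (hN_le x []).trans ?_
    simp [q, sumStarMul, sumNormSq]
  have hN_neg : ∀ x, -(M * ‖x‖) ≤ N x := fun x => le_ciInf (hq x)
  have hqs : ∀ c : ℝ, 0 < c → ∀ x l,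
      q (c • x) (l.map fun a => ((√c : ℝ) : ℂ) • a) = c * q x l := by
    intro c hc x l
    simp only [q]
    rw [sumStarMul_smul, sumNormSq_smul, Real.mul_self_sqrt hc.le, ← smul_add, norm_smul,
      Real.norm_of_nonneg hc.le]
    ring
  have hN_le_smul : ∀ c : ℝ, 0 < c → ∀ x, N (c • x) ≤ c * N x := by
    intro c hc x
    rw [← div_le_iff₀' hc]
    refine le_ciInf fun l => ?_
    rw [div_le_iff₀' hc, ← hqs c hc]
    exact hN_le _ _
  have hN_hom : ∀ c : ℝ, 0 < c → ∀ x, N (c • x) = c * N x := by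
    intro c hc x
    refine le_antisymm (hN_le_smul c hc x) ?_
    have := hN_le_smul c⁻¹ (inv_pos.mpr hc) (c • x)
    rw [smul_smul, inv_mul_cancel₀ hc.ne', one_smul] at this
    rwa [← div_eq_inv_mul, le_div_iff₀' hc] at this
  have hN_add : ∀ x y, N (x + y) ≤ N x + N y := by
    intro x y
    refine le_ciInf_add_ciInf fun l l' => ?_
    refine (hN_le (x + y) (l ++ l')).trans ?_
    have h1 : sumStarMul (l ++ l') = sumStarMul l + sumStarMul l' := by simp [sumStarMul]
    have h2 : sumNormSq φ (l ++ l') = sumNormSq φ l + sumNormSq φ l' := by simp [sumNormSq]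
    simp only [q]
    rw [h1, h2, add_add_add_comm]
    have := norm_add_le (x + sumStarMul l) (y + sumStarMul l')
    nlinarith
  obtain ⟨g, -, hg⟩ := exists_extension_of_le_sublinear (⊥ : A →ₗ.[ℝ] ℝ) N hN_hom hN_add (by
    rintro ⟨x, hx⟩
    have hx0 : x = 0 := (Submodule.mem_bot ℝ).mp hx
    subst hx0
    have h0 : (⊥ : A →ₗ.[ℝ] ℝ) ⟨0, hx⟩ = 0 := LinearPMap.map_zero _
    rw [h0]
    simpa using hN_neg 0)
  have hg_abs : ∀ x, |g x| ≤ M * ‖x‖ := by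
    intro x
    rw [abs_le]
    constructor
    · have := (hg (-x)).trans (hN_norm (-x))
      rw [map_neg, norm_neg] at this; linarith
    · exact (hg x).trans (hN_norm x)
  have hg_pos : ∀ a, ‖φ a‖ ^ 2 ≤ g (star a * a) := by
    intro a
    have h1 := (hg (-(star a * a))).trans (hN_le _ [a])
    simp [q, sumStarMul, sumNormSq] at h1
    linarith
  -- symmetrize, so that the complex extension is real on selfadjoint elements
  let g' : A →ₗ[ℝ] ℝ :=
    { toFun := fun x => (g x + g (star x)) / 2
      map_add' := fun x y => by rw [star_add, map_add, map_add]; ring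
      map_smul' := fun c x => by
        rw [star_smul, star_trivial, map_smul, map_smul]
        simp only [smul_eq_mul, RingHom.id_apply]; ring }
  have hg'_abs : ∀ x, |g' x| ≤ M * ‖x‖ := by
    intro x
    have h1 := abs_le.mp (hg_abs x)
    have h2 := abs_le.mp (hg_abs (star x))
    rw [norm_star] at h2
    change |(g x + g (star x)) / 2| ≤ _
    rw [abs_le]; constructor <;> linarith
  let ψ₀ : A →ₗ[ℂ] ℂ := (show Module.Dual ℝ A from g').extendRCLike
  have hψ₀ : ∀ x, ψ₀ x = (g' x : ℂ) - Complex.I * (g' (Complex.I • x) : ℂ) := fun x =>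
    Module.Dual.extendRCLike_apply _ x
  let p : Seminorm ℂ A := Seminorm.of (fun x => M * ‖x‖)
    (fun x y => by rw [← mul_add]; gcongr; exact norm_add_le x y)
    (fun c x => by rw [norm_smul]; ring)
  have hψ₀n : ∀ x, ‖ψ₀ x‖ ≤ M * ‖x‖ := fun x =>
    Module.Dual.norm_extendRCLike_le_seminorm (𝕜 := ℂ) (show Module.Dual ℝ A from g') (p := p)
      (fun x => hg'_abs x) x
  let ψ : StrongDual ℂ A := ψ₀.mkContinuous M hψ₀n
  have hval : ∀ a, ψ (star a * a) = (g (star a * a) : ℂ) := by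
    intro a
    change ψ₀ _ = _
    rw [hψ₀]
    have h1 : g' (star a * a) = g (star a * a) := by
      change (g _ + g (star _)) / 2 = _
      rw [star_mul, star_star]; ring
    have h2 : g' (Complex.I • (star a * a)) = 0 := by
      change (g _ + g (star _)) / 2 = _
      rw [star_smul, star_mul, star_star, Complex.star_def, Complex.conj_I, neg_smul, map_neg]
      ring
    rw [h1, h2]; simp
  refine ⟨ψ, fun a => ?_, LinearMap.mkContinuous_norm_le _ hM0 _, fun a => ?_⟩
  · rw [hval, Complex.zero_le_real]
    exact (sq_nonneg _).trans (hg_pos a)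
  · rw [hval, Complex.ofReal_re]; exact hg_pos a

lemma IsPositive.apply_star {ψ : StrongDual ℂ A} (h : IsPositive ψ) (a : A) :
    ψ (star a) = conj (ψ a) := by
  let _ := CStarAlgebra.spectralOrder A
  have := CStarAlgebra.spectralOrderedRing A
  let f : A →ₚ[ℂ] ℂ := PositiveLinearMap.mk₀ (ψ : A →ₗ[ℂ] ℂ) (by
    intro x hx
    obtain ⟨s, rfl⟩ := CStarAlgebra.nonneg_iff_eq_star_mul_self.mp hx
    exact h s)
  exact map_star f a

end Dominate

/-! ### Hilbert spaces from positive sesquilinear forms, and ranges of homomorphisms -/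

/-- A positive sesquilinear form on a vector space defines a Hilbert space. -/
theorem exists_hilbertSpace_of_form {V : Type u} [AddCommGroup V] [Module ℂ V]
    (B : V →ₗ⋆[ℂ] V →ₗ[ℂ] ℂ) (hB : ∀ v, 0 ≤ B v v) :
    ∃ (K : Type u) (_ : NormedAddCommGroup K) (_ : InnerProductSpace ℂ K) (_ : CompleteSpace K)
      (j : V →ₗ[ℂ] K), DenseRange j ∧ ∀ v w, inner ℂ (j v) (j w) = B v w := by
  have hsymm : ∀ v w, conj (B w v) = B v w := by
    intro v w
    have h0 : ∀ x, (B x x).im = 0 := fun x => ((Complex.le_def.mp (hB x)).2).symm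
    have h1 := h0 (v + w)
    have h2 := h0 (v + Complex.I • w)
    simp only [map_add, LinearMap.add_apply, map_smulₛₗ, LinearMap.smul_apply, Complex.conj_I,
      RingHom.id_apply, smul_eq_mul, Complex.add_im, Complex.mul_im, Complex.I_re, Complex.I_im,
      h0 v, h0 w, Complex.neg_re, Complex.neg_im, Complex.add_re, Complex.mul_re] at h1 h2
    apply Complex.ext
    · rw [Complex.conj_re]; linarith
    · rw [Complex.conj_im]; linarith
  let core : PreInnerProductSpace.Core ℂ V :=
    { inner := fun v w => B v w
      conj_inner_symm := fun v w => hsymm v w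
      re_inner_nonneg := fun v => (Complex.le_def.mp (hB v)).1
      add_left := fun u v w => by simp
      smul_left := fun u v c => by simp }
  let i1 : SeminormedAddCommGroup V := InnerProductSpace.Core.toSeminormedAddCommGroup (c := core)
  let i2 : InnerProductSpace ℂ V := InnerProductSpace.ofCore core
  refine ⟨UniformSpace.Completion V, inferInstance, inferInstance, inferInstance,
    (UniformSpace.Completion.toComplL (𝕜 := ℂ) (E := V)).toLinearMap, ?_, fun v w => ?_⟩
  · exact UniformSpace.Completion.denseRange_coe
  · exact UniformSpace.Completion.inner_coe v w

/-- The range of a `⋆`-homomorphism is that of an injective, hence isometric, `⋆`-homomorphism on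
the quotient by its kernel. -/
lemma isClosed_range_starHom {B C : Type*} [NonUnitalCStarAlgebra B] [NonUnitalCStarAlgebra C]
    (f : B →⋆ₙₐ[ℂ] C) : IsClosed (Set.range f) := by
  have hf : Continuous f := AddMonoidHomClass.continuous_of_bound f 1 fun x => by
    rw [one_mul]; exact NonUnitalStarAlgHom.norm_apply_le f x
  let I : ClosedIdeal B :=
    { carrier := {x | f x = 0}
      add_mem' := fun {a b} ha hb => by
        rw [Set.mem_ofPred_eq] at *; rw [map_add, ha, hb, add_zero]
      zero_mem' := map_zero f
      smul_mem' := fun c x hx => by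
        rw [Set.mem_ofPred_eq] at *; rw [map_smul, hx, smul_zero]
      isClosed' := isClosed_eq hf continuous_const
      mul_mem_left' := fun a x hx => by
        rw [Set.mem_ofPred_eq] at *; rw [map_mul, hx, mul_zero]
      mul_mem_right' := fun a x hx => by
        rw [Set.mem_ofPred_eq] at *; rw [map_mul, hx, zero_mul] }
  let f₀ : I.Quot →ₗ[ℂ] C := I.toSubmodule.liftQ (f : B →ₗ[ℂ] C) (fun x hx => hx)
  have hf₀ : ∀ x, f₀ (ClosedIdeal.Quot.mk I x) = f x := fun x => rfl
  let g : I.Quot →⋆ₙₐ[ℂ] C :=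
    { toFun := f₀
      map_smul' := f₀.map_smul
      map_zero' := f₀.map_zero
      map_add' := f₀.map_add
      map_mul' := fun x y => by
        obtain ⟨a, rfl⟩ := ClosedIdeal.Quot.mk_surjective x
        obtain ⟨b, rfl⟩ := ClosedIdeal.Quot.mk_surjective y
        rw [← ClosedIdeal.Quot.mk_mul, hf₀, hf₀, hf₀, map_mul]
      map_star' := fun x => by
        obtain ⟨a, rfl⟩ := ClosedIdeal.Quot.mk_surjective x
        rw [← ClosedIdeal.Quot.mk_star, hf₀, hf₀, map_star] }
  have hinj : Function.Injective g := by
    rw [injective_iff_map_eq_zero]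
    intro x hx
    obtain ⟨a, rfl⟩ := ClosedIdeal.Quot.mk_surjective x
    exact ClosedIdeal.Quot.mk_eq_zero.mpr hx
  have hcl := (NonUnitalStarAlgHom.isometry g hinj).isClosedEmbedding.isClosed_range
  convert hcl using 1
  ext y
  constructor
  · rintro ⟨x, rfl⟩; exact ⟨ClosedIdeal.Quot.mk I x, rfl⟩
  · rintro ⟨x, rfl⟩
    obtain ⟨a, rfl⟩ := ClosedIdeal.Quot.mk_surjective x
    exact ⟨a, rfl⟩

/-! ### Idempotents of inverse monoids -/

namespace InverseMonoid

variable {S : Type u} [InverseMonoid S]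

lemma inv_eq_self_of_idem {e : S} (he : e * e = e) : e⁻¹ = e :=
  (inv_unique e e (by rw [he, he]) (by rw [he, he])).symm

lemma inv_mul_idem (t : S) : t⁻¹ * t * (t⁻¹ * t) = t⁻¹ * t := by
  rw [← mul_assoc, inv_mul_inv_self]

lemma mul_inv_idem (t : S) : t * t⁻¹ * (t * t⁻¹) = t * t⁻¹ := by
  rw [← mul_assoc, mul_inv_mul_self]

/-- Idempotents in an inverse semigroup commute. -/
lemma idem_comm {e f : S} (he : e * e = e) (hf : f * f = f) : e * f = f * e := by
  have idem : ∀ {e f : S}, e * e = e → f * f = f → e * f * (e * f) = e * f := by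
    intro e f he hf
    set x := (e * f)⁻¹ with hx
    have h1 : e * f * x * (e * f) = e * f := mul_inv_mul_self _
    have h2 : x * (e * f) * x = x := inv_mul_inv_self _
    have h3 : f * x * e = x := by
      refine inv_unique (e * f) (f * x * e) ?_ ?_
      · calc e * f * (f * x * e) * (e * f) = e * (f * f) * x * (e * e) * f := by
              simp only [mul_assoc]
          _ = e * f * x * (e * f) := by rw [he, hf]; simp only [mul_assoc]
          _ = _ := h1
      · calc f * x * e * (e * f) * (f * x * e) = f * x * (e * e) * (f * f) * x * e := by
              simp only [mul_assoc]
          _ = f * (x * (e * f) * x) * e := by rw [he, hf]; simp only [mul_assoc]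
          _ = _ := by rw [h2]
    have h4 : x * x = x := by
      calc x * x = (f * x * e) * (f * x * e) := by rw [h3]
        _ = f * (x * (e * f) * x) * e := by simp only [mul_assoc]
        _ = x := by rw [h2, h3]
    have h5 : e * f = x := by
      rw [← inv_eq_self_of_idem h4]
      exact inv_unique x (e * f) h2 h1
    rw [h5, h4]
  have h1 : f * e = (e * f)⁻¹ := by
    refine inv_unique (e * f) (f * e) ?_ ?_
    · calc e * f * (f * e) * (e * f) = e * (f * f) * (e * e) * f := by simp only [mul_assoc]
        _ = e * f * (e * f) := by rw [he, hf]; simp only [mul_assoc]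
        _ = _ := idem he hf
    · calc f * e * (e * f) * (f * e) = f * (e * e) * (f * f) * e := by simp only [mul_assoc]
        _ = f * e * (f * e) := by rw [he, hf]; simp only [mul_assoc]
        _ = _ := idem hf he
  rw [h1, inv_eq_self_of_idem (idem he hf)]

lemma idem_mul {e f : S} (he : e * e = e) (hf : f * f = f) : e * f * (e * f) = e * f := by
  calc e * f * (e * f) = e * (f * e) * f := by simp only [mul_assoc]
    _ = e * (e * f) * f := by rw [idem_comm he hf]
    _ = (e * e) * (f * f) := by simp only [mul_assoc]
    _ = _ := by rw [he, hf]

lemma mul_inv_rev' (a b : S) : (a * b)⁻¹ = b⁻¹ * a⁻¹ := by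
  have hc : b * b⁻¹ * (a⁻¹ * a) = a⁻¹ * a * (b * b⁻¹) :=
    idem_comm (mul_inv_idem b) (inv_mul_idem a)
  refine (inv_unique (a * b) (b⁻¹ * a⁻¹) ?_ ?_).symm
  · calc a * b * (b⁻¹ * a⁻¹) * (a * b) = a * (b * b⁻¹ * (a⁻¹ * a)) * b := by
          simp only [mul_assoc]
      _ = (a * a⁻¹ * a) * (b * b⁻¹ * b) := by rw [hc]; simp only [mul_assoc]
      _ = _ := by rw [mul_inv_mul_self, mul_inv_mul_self]
  · calc b⁻¹ * a⁻¹ * (a * b) * (b⁻¹ * a⁻¹) = b⁻¹ * (a⁻¹ * a * (b * b⁻¹)) * a⁻¹ := by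
          simp only [mul_assoc]
      _ = (b⁻¹ * b * b⁻¹) * (a⁻¹ * a * a⁻¹) := by rw [← hc]; simp only [mul_assoc]
      _ = _ := by rw [inv_mul_inv_self, inv_mul_inv_self]

lemma inv_mul_idem_mul {e : S} (he : e * e = e) (u : S) :
    u⁻¹ * e * u * (u⁻¹ * e * u) = u⁻¹ * e * u := by
  calc u⁻¹ * e * u * (u⁻¹ * e * u) = u⁻¹ * (e * (u * u⁻¹)) * (e * u) := by simp only [mul_assoc]
    _ = (u⁻¹ * u * u⁻¹) * (e * e) * u := by
        rw [idem_comm he (mul_inv_idem u)]; simp only [mul_assoc]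
    _ = _ := by rw [inv_mul_inv_self, he]

lemma inv_mul_of_idem_mul {e : S} (he : e * e = e) (u : S) :
    (e * u)⁻¹ * (e * u) = u⁻¹ * e * u := by
  rw [mul_inv_rev', inv_eq_self_of_idem he]
  calc u⁻¹ * e * (e * u) = u⁻¹ * (e * e) * u := by simp only [mul_assoc]
    _ = _ := by rw [he]

lemma natLE_one_iff {e : S} : NatLE e 1 ↔ e * e = e := by
  refine ⟨fun h => h.idem, fun h => ?_⟩
  rw [NatLE, inv_eq_self_of_idem h, h, one_mul]

lemma natLE_iff_of_idem {e t : S} (he : e * e = e) : NatLE e t ↔ t * e = e := by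
  rw [NatLE, inv_eq_self_of_idem he, he, eq_comm]

end InverseMonoid

/-! ### Closed ideals and Hilbert bimodules -/

namespace ClosedIdeal

variable {A : Type u} [NonUnitalCStarAlgebra A]

lemma subset_generated {s : Set A} {x : A} (hx : x ∈ s) : x ∈ generated s :=
  fun _ hJ => hJ hx

lemma generated_le {s : Set A} {J : ClosedIdeal A} (h : ∀ x ∈ s, x ∈ J) {x : A}
    (hx : x ∈ generated s) : x ∈ J := hx J h

/-- A closed linear condition that is preserved by multiplications holds on the closed ideal
generated by a set if it holds on the set. -/
lemma generated_induction {s : Set A} {p : A → Prop} (zero : p 0)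
    (add : ∀ x y, p x → p y → p (x + y)) (smul : ∀ (c : ℂ) x, p x → p (c • x))
    (closed : IsClosed {x | p x}) (left : ∀ a x, p x → p (a * x))
    (right : ∀ a x, p x → p (x * a)) (mem : ∀ x ∈ s, p x) {x : A} (hx : x ∈ generated s) : p x :=
  hx { carrier := {x | p x}, add_mem' := add _ _, zero_mem' := zero, smul_mem' := smul,
       isClosed' := closed, mul_mem_left' := fun a _ h => left a _ h,
       mul_mem_right' := fun a _ h => right a _ h } mem

end ClosedIdeal

namespace HilbertBimodule

variable {A : Type u} [NonUnitalCStarAlgebra A] {E : Type u} [NormedAddCommGroup E]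
  [NormedSpace ℂ E] [HilbertBimodule A E]

lemma eq_zero_of_rinner {ζ : E} (h : rinner (A := A) ζ ζ = 0) : ζ = 0 := by
  have h1 := norm_rinner_self (A := A) ζ
  rw [h, norm_zero, eq_comm, mul_self_eq_zero, norm_eq_zero] at h1
  exact h1

variable {I : ClosedIdeal A}

/-- If `⟨ξ, ξ⟩` lies in `I`, then so does `ξ`, in the sense that `ξ e → ξ` along an approximate unit
of `I`. -/
lemma tendsto_rsmul {ξ : E} (h : rinner ξ ξ ∈ I) :
    Tendsto (fun e : I => rsmul ξ (e : A)) I.approxUnit (𝓝 ξ) := by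
  rw [tendsto_iff_norm_sub_tendsto_zero]
  set p : A := rinner ξ ξ with hp
  have h1 : Tendsto (fun e : I => ‖p * (e : A) - p‖ + ‖p * (e : A) - p‖) I.approxUnit (𝓝 0) := by
    have := tendsto_iff_norm_sub_tendsto_zero.mp
      (I.isGood_approxUnit.isApproximateUnit.tendsto_mul_coe h)
    simpa using this.add this
  have h2 : Tendsto (fun e : I => ‖rsmul ξ (e : A) - ξ‖ ^ 2) I.approxUnit (𝓝 0) := by
    refine squeeze_zero' (Eventually.of_forall fun _ => by positivity) ?_ h1
    filter_upwards [I.isGood_approxUnit.good] with e he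
    have h3 : rinner (A := A) (rsmul ξ (e : A) - ξ) (rsmul ξ (e : A) - ξ)
        = e * (p * e - p) - (p * e - p) := by
      simp only [map_sub, LinearMap.sub_apply, rinner_rsmul, rinner_rsmul_left, he.star_eq, ← hp]
      noncomm_ring
    rw [sq, ← norm_rinner_self (A := A), h3]
    refine (norm_sub_le _ _).trans ?_
    gcongr
    refine (norm_mul_le _ _).trans ?_
    exact mul_le_of_le_one_left (norm_nonneg _) he.norm_le
  have h4 := h2.sqrt
  simpa using h4

lemma tendsto_lsmul {ξ : E} (h : linner ξ ξ ∈ I) :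
    Tendsto (fun e : I => lsmul (e : A) ξ) I.approxUnit (𝓝 ξ) := by
  rw [tendsto_iff_norm_sub_tendsto_zero]
  set p : A := linner ξ ξ with hp
  have h1 : Tendsto (fun e : I => ‖(e : A) * p - p‖ + ‖(e : A) * p - p‖) I.approxUnit (𝓝 0) := by
    have := tendsto_iff_norm_sub_tendsto_zero.mp
      (I.isGood_approxUnit.isApproximateUnit.tendsto_coe_mul h)
    simpa using this.add this
  have h2 : Tendsto (fun e : I => ‖lsmul (e : A) ξ - ξ‖ ^ 2) I.approxUnit (𝓝 0) := by
    refine squeeze_zero' (Eventually.of_forall fun _ => by positivity) ?_ h1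
    filter_upwards [I.isGood_approxUnit.good] with e he
    have h3 : linner (A := A) (lsmul (e : A) ξ - ξ) (lsmul (e : A) ξ - ξ)
        = (e * p - p) * e - (e * p - p) := by
      simp only [map_sub, LinearMap.sub_apply, linner_lsmul, linner_lsmul_right, he.star_eq, ← hp]
      noncomm_ring
    rw [sq, ← norm_linner_self (A := A), h3]
    refine (norm_sub_le _ _).trans ?_
    gcongr
    refine (norm_mul_le _ _).trans ?_
    exact mul_le_of_le_one_right (norm_nonneg _) he.norm_le
  have h4 := h2.sqrt
  simpa using h4

lemma continuous_rinner_left (η : E) : Continuous fun ξ : E => rinner (A := A) ξ η := by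
  have : (fun ξ : E => rinner (A := A) ξ η) = fun ξ => star (rinner (A := A) η ξ) := by
    ext ξ; rw [star_rinner]
  rw [this]
  exact continuous_star.comp (continuous_rinner η)

lemma continuous_linner_right (ξ : E) : Continuous fun η : E => linner (A := A) ξ η := by
  have : (fun η : E => linner (A := A) ξ η) = fun η => star (linner (A := A) η ξ) := by
    ext η; rw [star_linner]
  rw [this]
  exact continuous_star.comp (continuous_linner ξ)

/-- The left action is by adjointable operators on the right Hilbert module. -/
lemma rinner_lsmul (ξ η : E) (a : A) :
    rinner ξ (lsmul a η) = rinner (A := A) (lsmul (star a) ξ) η := by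
  let R : ClosedIdeal A := ClosedIdeal.generated {a | ∃ x y : E, a = linner x y}
  have hR : ∀ b ∈ R, ∀ ξ η : E, rinner ξ (lsmul b η) = rinner (A := A) (lsmul (star b) ξ) η := by
    intro b hb
    -- products with elements on both sides are part of the induction hypothesis, as the condition
    -- itself is not visibly inherited by `c b` and `b d`
    refine (ClosedIdeal.generated_induction (p := fun b => (∀ ξ η : E,
      rinner ξ (lsmul b η) = rinner (A := A) (lsmul (star b) ξ) η) ∧
      (∀ (c : A) (ξ η : E), rinner ξ (lsmul (c * b) η)
        = rinner (A := A) (lsmul (star (c * b)) ξ) η) ∧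
      (∀ (d : A) (ξ η : E), rinner ξ (lsmul (b * d) η)
        = rinner (A := A) (lsmul (star (b * d)) ξ) η) ∧
      (∀ (c d : A) (ξ η : E), rinner ξ (lsmul (c * b * d) η)
        = rinner (A := A) (lsmul (star (c * b * d)) ξ) η)) ?_ ?_ ?_ ?_ ?_ ?_ ?_ hb).1
    · simp
    · rintro x y ⟨h1, h2, h3, h4⟩ ⟨h1', h2', h3', h4'⟩
      refine ⟨fun ξ η => ?_, fun c ξ η => ?_, fun d ξ η => ?_, fun c d ξ η => ?_⟩
      · simp only [map_add, LinearMap.add_apply, star_add, h1, h1']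
      · simp only [mul_add, map_add, LinearMap.add_apply, star_add, h2, h2']
      · simp only [add_mul, map_add, LinearMap.add_apply, star_add, h3, h3']
      · simp only [mul_add, add_mul, map_add, LinearMap.add_apply, star_add, h4, h4']
    · rintro z x ⟨h1, h2, h3, h4⟩
      refine ⟨fun ξ η => ?_, fun c ξ η => ?_, fun d ξ η => ?_, fun c d ξ η => ?_⟩
      · simp only [map_smul, LinearMap.smul_apply, star_smul, h1]; simp
      · simp only [mul_smul_comm, map_smul, LinearMap.smul_apply, star_smul, h2]; simp
      · simp only [smul_mul_assoc, map_smul, LinearMap.smul_apply, star_smul, h3]; simp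
      · simp only [mul_smul_comm, smul_mul_assoc, map_smul, LinearMap.smul_apply, star_smul, h4]
        simp
    · have hcl : ∀ (f : A → A), Continuous f → ∀ ξ η : E, IsClosed {b | rinner ξ (lsmul (f b) η)
          = rinner (A := A) (lsmul (star (f b)) ξ) η} := fun f hf ξ η =>
        isClosed_eq ((continuous_rinner ξ).comp ((continuous_lsmul_left η).comp hf))
          ((continuous_rinner_left η).comp ((continuous_lsmul_left ξ).comp
            (continuous_star.comp hf)))
      simp only [Set.ofPred_and, Set.ofPred_forall]
      refine IsClosed.inter ?_ (IsClosed.inter ?_ (IsClosed.inter ?_ ?_))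
      · exact isClosed_iInter fun ξ => isClosed_iInter fun η => hcl id continuous_id ξ η
      · exact isClosed_iInter fun c => isClosed_iInter fun ξ => isClosed_iInter fun η =>
          hcl (fun b => c * b) (by fun_prop) ξ η
      · exact isClosed_iInter fun c => isClosed_iInter fun ξ => isClosed_iInter fun η =>
          hcl (fun b => b * c) (by fun_prop) ξ η
      · exact isClosed_iInter fun c => isClosed_iInter fun d => isClosed_iInter fun ξ =>
          isClosed_iInter fun η => hcl (fun b => c * b * d) (by fun_prop) ξ η
    · rintro a x ⟨h1, h2, h3, h4⟩
      refine ⟨h2 a, fun c ξ η => ?_, fun d ξ η => h4 a d ξ η, fun c d ξ η => ?_⟩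
      · rw [← mul_assoc]; exact h2 _ _ _
      · rw [← mul_assoc]; exact h4 _ _ _ _
    · rintro a x ⟨h1, h2, h3, h4⟩
      refine ⟨h3 a, fun c ξ η => ?_, fun d ξ η => ?_, fun c d ξ η => ?_⟩
      · rw [← mul_assoc]; exact h4 _ _ _ _
      · rw [mul_assoc]; exact h3 _ _ _
      · rw [← mul_assoc, mul_assoc]; exact h4 _ _ _ _
    · rintro _ ⟨x, y, rfl⟩
      refine ⟨fun ξ η => ?_, fun c ξ η => ?_, fun d ξ η => ?_, fun c d ξ η => ?_⟩
      · simp only [star_linner, linner_lsmul_eq, rinner_rsmul, rinner_rsmul_left, star_rinner]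
      · rw [← linner_lsmul, star_linner]
        simp only [linner_lsmul_eq, rinner_rsmul, rinner_rsmul_left, star_rinner]
      · have : linner x y * d = linner (A := A) x (lsmul (star d) y) := by
          rw [linner_lsmul_right, star_star]
        rw [this, star_linner]
        simp only [linner_lsmul_eq, rinner_rsmul, rinner_rsmul_left, star_rinner]
      · have : c * linner x y * d = linner (A := A) (lsmul c x) (lsmul (star d) y) := by
          rw [linner_lsmul_right, star_star, linner_lsmul]
        rw [this, star_linner]
        simp only [linner_lsmul_eq, rinner_rsmul, rinner_rsmul_left, star_rinner]
  have hη : linner η η ∈ R := ClosedIdeal.subset_generated ⟨η, η, rfl⟩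
  have h1 : Tendsto (fun e : R => rinner (A := A) ξ (lsmul a (lsmul (e : A) η))) R.approxUnit
      (𝓝 (rinner ξ (lsmul a η))) :=
    (((continuous_rinner ξ).comp (continuous_lsmul a)).tendsto η).comp (tendsto_lsmul hη)
  have h2 : Tendsto (fun e : R => rinner (A := A) (lsmul (star a) ξ) (lsmul (e : A) η))
      R.approxUnit (𝓝 (rinner (lsmul (star a) ξ) η)) :=
    ((continuous_rinner _).tendsto η).comp (tendsto_lsmul hη)
  refine tendsto_nhds_unique h1 (h2.congr fun e => ?_)
  rw [← mul_lsmul, hR _ (R.mul_mem_left a e.2), hR _ e.2, star_mul, mul_lsmul]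

end HilbertBimodule

/-- The right action is by adjointable operators on the left Hilbert module. The difference `D` of
the two sides acts by zero on the bimodule, and `D D⋆` is a combination of inner products
`⟨⟨D ζ, ω⟩⟩`. -/
lemma HilbertBimodule.linner_rsmul {A : Type u} [NonUnitalCStarAlgebra A] {E : Type u}
    [NormedAddCommGroup E] [NormedSpace ℂ E] [HilbertBimodule A E] (ξ η : E) (a : A) :
    linner (rsmul ξ a) η = linner (A := A) ξ (rsmul η (star a)) := by
  set D : A := linner (rsmul ξ a) η - linner ξ (rsmul η (star a)) with hD
  have h1 : ∀ ζ : E, lsmul D ζ = 0 := by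
    intro ζ
    rw [hD, map_sub, LinearMap.sub_apply, linner_lsmul_eq, linner_lsmul_eq, rinner_rsmul_left,
      star_star, rsmul_mul, sub_self]
  have h2 : D * star D = 0 := by
    conv_lhs => rw [hD, star_sub, star_linner, star_linner, mul_sub, ← linner_lsmul,
      ← linner_lsmul, ← hD]
    rw [h1, h1]
    simp
  rw [← sub_eq_zero, ← hD]
  exact (CStarRing.mul_star_self_eq_zero_iff D).mp h2

/-- The second coordinates of a closed linear relation form a closed set if they control the first
coordinates. -/
lemma isClosed_setOf_exists_mem {E F : Type*} [NormedAddCommGroup E] [NormedSpace ℂ E]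
    [NormedAddCommGroup F] [NormedSpace ℂ F] [CompleteSpace E] [CompleteSpace F]
    (R : Submodule ℂ (E × F)) (hR : IsClosed (R : Set (E × F))) (C : ℝ)
    (h : ∀ x y, (x, y) ∈ R → ‖x‖ ≤ C * ‖y‖) : IsClosed {y | ∃ x, (x, y) ∈ R} := by
  have hc : CompleteSpace R := hR.completeSpace_coe
  let f : R →ₗ[ℂ] F := (LinearMap.snd ℂ E F).comp R.subtype
  have hf : Continuous f := continuous_snd.comp continuous_subtype_val
  have ha : AntilipschitzWith (max C 1).toNNReal f := by
    refine AddMonoidHomClass.antilipschitz_of_bound f fun p => ?_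
    rw [Real.coe_toNNReal _ (zero_le_one.trans (le_max_right _ _))]
    obtain ⟨⟨x, y⟩, hp⟩ := p
    change (max ‖x‖ ‖y‖ : ℝ) ≤ (max C 1 : ℝ) * ‖y‖
    refine max_le ((h x y hp).trans ?_) ?_
    · gcongr; exact le_max_left _ _
    · exact le_mul_of_one_le_left (norm_nonneg _) (le_max_right _ _)
  have hu : UniformContinuous f := by
    refine (AddMonoidHomClass.lipschitz_of_bound f 1 fun p => ?_).uniformContinuous
    rw [one_mul]
    exact norm_snd_le p.1
  have := ha.isClosed_range hu
  convert this using 1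
  ext y
  constructor
  · rintro ⟨x, hx⟩; exact ⟨⟨(x, y), hx⟩, rfl⟩
  · rintro ⟨⟨⟨x, y'⟩, hx⟩, rfl⟩; exact ⟨x, hx⟩

namespace Action

open InverseMonoid HilbertBimodule

variable {S A : Type u} [InverseMonoid S] [NonUnitalCStarAlgebra A] (Γ : Action S A)

instance (t : S) : CompleteSpace (Γ.fib t) := HilbertBimodule.complete A

/-! ### The ideals of an action -/

variable {Γ}

lemma mem_fibMulIdeal_iff {I : ClosedIdeal A} {t : S} {ξ : Γ.fib t} :
    ξ ∈ Γ.fibMulIdeal I t ↔ rinner ξ ξ ∈ I := by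
  refine ⟨fun h => rinner_mem ξ h, fun h => ?_⟩
  exact (Γ.isClosed_fibMulIdeal I t).mem_of_tendsto (tendsto_rsmul h)
    (Eventually.of_forall fun e => rsmul_mem ξ e.2)

lemma fibMulIdeal_mono {I J : ClosedIdeal A} (h : ∀ a ∈ I, a ∈ J) {t : S} {ξ : Γ.fib t}
    (hξ : ξ ∈ Γ.fibMulIdeal I t) : ξ ∈ Γ.fibMulIdeal J t :=
  mem_fibMulIdeal_iff.mpr (h _ (mem_fibMulIdeal_iff.mp hξ))

lemma linner_mem_rangeIdeal {t : S} (ξ η : Γ.fib t) : linner ξ η ∈ Γ.rangeIdeal t :=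
  ClosedIdeal.subset_generated ⟨ξ, η, rfl⟩

lemma rinner_mem_sourceIdeal {t : S} (ξ η : Γ.fib t) : rinner ξ η ∈ Γ.sourceIdeal t :=
  ClosedIdeal.subset_generated ⟨ξ, η, rfl⟩

lemma isClosed_setOf_mem {I : ClosedIdeal A} {X : Type*} [TopologicalSpace X] {f : X → A}
    (hf : Continuous f) : IsClosed {x | f x ∈ I} := I.isClosed.preimage hf

lemma linner_rsmul_mem {t u v : S} (h : t * u = v) {b : A} (hb : b ∈ Γ.rangeIdeal u)
    (ξ ξ' : Γ.fib t) : linner (rsmul ξ b) ξ' ∈ Γ.rangeIdeal v := by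
  refine ClosedIdeal.generated_induction
    (p := fun b => ∀ ξ ξ' : Γ.fib t, linner (rsmul ξ b) ξ' ∈ Γ.rangeIdeal v)
    ?_ ?_ ?_ ?_ ?_ ?_ ?_ hb ξ ξ'
  · simp [zero_mem]
  · intro x y hx hy ξ ξ'
    simpa using add_mem (hx ξ ξ') (hy ξ ξ')
  · intro c x hx ξ ξ'
    simpa using SMulMemClass.smul_mem c (hx ξ ξ')
  · simp only [Set.ofPred_forall]
    exact isClosed_iInter fun ξ => isClosed_iInter fun ξ' => isClosed_setOf_mem
      ((continuous_linner ξ').comp (continuous_rsmul_left ξ))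
  · intro a x hx ξ ξ'
    rw [rsmul_mul]; exact hx _ _
  · intro a x hx ξ ξ'
    rw [rsmul_mul, linner_rsmul]; exact hx _ _
  · rintro _ ⟨η, η', rfl⟩ ξ ξ'
    rw [← Γ.linner_mul h]
    exact linner_mem_rangeIdeal _ _

lemma rinner_lsmul_mem {t u v : S} (h : t * u = v) {a : A} (ha : a ∈ Γ.sourceIdeal t)
    (η η' : Γ.fib u) : rinner η (lsmul a η') ∈ Γ.sourceIdeal v := by
  refine ClosedIdeal.generated_induction
    (p := fun a => ∀ η η' : Γ.fib u, rinner η (lsmul a η') ∈ Γ.sourceIdeal v)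
    ?_ ?_ ?_ ?_ ?_ ?_ ?_ ha η η'
  · simp [zero_mem]
  · intro x y hx hy ξ ξ'
    simpa using add_mem (hx ξ ξ') (hy ξ ξ')
  · intro c x hx ξ ξ'
    simpa using SMulMemClass.smul_mem c (hx ξ ξ')
  · simp only [Set.ofPred_forall]
    exact isClosed_iInter fun ξ => isClosed_iInter fun ξ' => isClosed_setOf_mem
      ((continuous_rinner ξ).comp (continuous_lsmul_left ξ'))
  · intro a x hx ξ ξ'
    rw [mul_lsmul, rinner_lsmul]; exact hx _ _
  · intro a x hx ξ ξ'
    rw [mul_lsmul]; exact hx _ _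
  · rintro _ ⟨η, η', rfl⟩ ξ ξ'
    rw [← Γ.rinner_mul h]
    exact rinner_mem_sourceIdeal _ _

/-- A closed ideal contains the inner products of all elements of `fib (t u)` if it contains the
inner products of products. -/
lemma rinner_mem_of_mul {t u v : S} (h : t * u = v) {I : ClosedIdeal A}
    (hI : ∀ (ξ ξ' : Γ.fib t) (η η' : Γ.fib u), rinner (Γ.mul h ξ η) (Γ.mul h ξ' η') ∈ I)
    (ζ ζ' : Γ.fib v) : rinner ζ ζ' ∈ I := by
  have h1 : ∀ (ξ : Γ.fib t) (η : Γ.fib u) ζ', rinner (Γ.mul h ξ η) ζ' ∈ I := by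
    intro ξ η ζ'
    refine Γ.dense_induction h (P := I.toSubmodule.comap (rinner (Γ.mul h ξ η))) ?_ ?_ ζ'
    · exact I.isClosed.preimage (continuous_rinner _)
    · exact fun ξ' η' => hI ξ ξ' η η'
  have h2 : ∀ ζ', rinner ζ' ζ ∈ I := by
    intro ζ'
    refine Γ.dense_induction h (P := I.toSubmodule.comap (rinner ζ')) ?_ ?_ ζ
    · exact I.isClosed.preimage (continuous_rinner _)
    · intro ξ η
      change rinner ζ' (Γ.mul h ξ η) ∈ I
      rw [← star_rinner]
      exact star_mem (h1 ξ η ζ')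
  rw [← star_rinner]
  exact star_mem (h2 ζ')

lemma linner_mem_of_mul {t u v : S} (h : t * u = v) {I : ClosedIdeal A}
    (hI : ∀ (ξ ξ' : Γ.fib t) (η η' : Γ.fib u), linner (Γ.mul h ξ η) (Γ.mul h ξ' η') ∈ I)
    (ζ ζ' : Γ.fib v) : linner ζ ζ' ∈ I := by
  have h1 : ∀ (ξ : Γ.fib t) (η : Γ.fib u) ζ', linner ζ' (Γ.mul h ξ η) ∈ I := by
    intro ξ η ζ'
    refine Γ.dense_induction h (P := I.toSubmodule.comap (linner.flip (Γ.mul h ξ η))) ?_ ?_ ζ'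
    · exact I.isClosed.preimage (continuous_linner _)
    · exact fun ξ' η' => hI ξ' ξ η' η
  have h2 : ∀ ζ', linner ζ ζ' ∈ I := by
    intro ζ'
    refine Γ.dense_induction h (P := I.toSubmodule.comap (linner.flip ζ')) ?_ ?_ ζ
    · exact I.isClosed.preimage (continuous_linner _)
    · intro ξ η
      change linner (Γ.mul h ξ η) ζ' ∈ I
      rw [← star_linner]
      exact star_mem (h1 ξ η ζ')
  exact h2 ζ'

lemma sourceIdeal_mul_le {t u v : S} (h : t * u = v) {a : A} (ha : a ∈ Γ.sourceIdeal v) :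
    a ∈ Γ.sourceIdeal u := by
  refine ClosedIdeal.generated_le ?_ ha
  rintro _ ⟨ξ, η, rfl⟩
  refine rinner_mem_of_mul h (fun ξ ξ' η η' => ?_) ξ η
  rw [Γ.rinner_mul h]
  exact mem_fibMulIdeal_iff (I := Γ.sourceIdeal u) |>.mpr (rinner_mem_sourceIdeal _ _) |>
    fun hm => rinner_mem _ hm

lemma rangeIdeal_mul_le {t u v : S} (h : t * u = v) {a : A} (ha : a ∈ Γ.rangeIdeal v) :
    a ∈ Γ.rangeIdeal t := by
  refine ClosedIdeal.generated_le ?_ ha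
  rintro _ ⟨ξ, η, rfl⟩
  refine linner_mem_of_mul h (fun ξ ξ' η η' => ?_) ξ η
  rw [Γ.linner_mul h]
  exact linner_mem_rangeIdeal _ _

variable {e : S}

/-- For an idempotent `e`, the right inner products on `fib e` lie in the ideal generated by the
left inner products, because `fib e` is spanned by the products of its elements. -/
lemma rinner_mem_rangeIdeal (he : e * e = e) (ξ η : Γ.fib e) : rinner ξ η ∈ Γ.rangeIdeal e := by
  have key : ∀ x y ξ η : Γ.fib e, rinner ξ (lsmul (linner (A := A) x y) η) ∈ Γ.rangeIdeal e := by
    intro x y ξ η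
    refine Γ.dense_induction he (P := (Γ.rangeIdeal e).toSubmodule.comap
      ((rinner ξ).comp ((lsmul.flip η).comp (linner.flip y)))) ?_ ?_ x
    · exact (Γ.rangeIdeal e).isClosed.preimage
        ((continuous_rinner ξ).comp ((continuous_lsmul_left η).comp (continuous_linner y)))
    · intro ζ κ
      change rinner ξ (lsmul (linner (A := A) (Γ.mul he ζ κ) y) η) ∈ Γ.rangeIdeal e
      rw [linner_lsmul_eq]
      refine Γ.dense_induction he (P := (Γ.rangeIdeal e).toSubmodule.comap
        ((rinner ξ).comp ((rsmul (Γ.mul he ζ κ)).comp (rinner.flip η)))) ?_ ?_ y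
      · exact (Γ.rangeIdeal e).isClosed.preimage ((continuous_rinner ξ).comp
          ((continuous_rsmul_left _).comp (continuous_rinner_left η)))
      · intro ζ' κ'
        change rinner ξ (rsmul _ (rinner (A := A) (Γ.mul he ζ' κ') η)) ∈ Γ.rangeIdeal e
        rw [← linner_lsmul_eq, Γ.linner_mul, linner_lsmul_eq, ← rsmul_mul, rinner_rsmul]
        exact ClosedIdeal.mul_mem_left _ _
          (ClosedIdeal.mul_mem_right _ _ (linner_mem_rangeIdeal _ _))
  have key2 : ∀ a ∈ Γ.rangeIdeal e, ∀ ξ η : Γ.fib e, rinner ξ (lsmul a η) ∈ Γ.rangeIdeal e := by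
    intro a ha
    refine ClosedIdeal.generated_induction (p := fun a => ∀ ξ η : Γ.fib e,
      rinner ξ (lsmul a η) ∈ Γ.rangeIdeal e) ?_ ?_ ?_ ?_ ?_ ?_ ?_ ha
    · simp [zero_mem]
    · intro x y hx hy ξ η
      simpa using add_mem (hx ξ η) (hy ξ η)
    · intro c x hx ξ η
      simpa using SMulMemClass.smul_mem c (hx ξ η)
    · simp only [Set.ofPred_forall]
      exact isClosed_iInter fun ξ => isClosed_iInter fun ξ' => isClosed_setOf_mem
        ((continuous_rinner ξ).comp (continuous_lsmul_left ξ'))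
    · intro a x hx ξ η
      rw [mul_lsmul, rinner_lsmul]; exact hx _ _
    · intro a x hx ξ η
      rw [mul_lsmul]; exact hx _ _
    · rintro _ ⟨x, y, rfl⟩ ξ η
      exact key x y ξ η
  exact (Γ.rangeIdeal e).isClosed.mem_of_tendsto
    (((continuous_rinner ξ).tendsto _).comp (tendsto_lsmul (linner_mem_rangeIdeal η η)))
    (Eventually.of_forall fun a => key2 a a.2 ξ η)

lemma linner_mem_sourceIdeal (he : e * e = e) (ξ η : Γ.fib e) :
    linner ξ η ∈ Γ.sourceIdeal e := by
  have key : ∀ x y ξ η : Γ.fib e, linner (rsmul ξ (rinner (A := A) x y)) η ∈ Γ.sourceIdeal e := by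
    intro x y ξ η
    refine Γ.dense_induction he (P := (Γ.sourceIdeal e).toSubmodule.comap
      ((linner.flip η).comp ((rsmul ξ).comp (rinner x)))) ?_ ?_ y
    · exact (Γ.sourceIdeal e).isClosed.preimage
        ((continuous_linner η).comp ((continuous_rsmul_left ξ).comp (continuous_rinner x)))
    · intro ζ κ
      change linner (rsmul ξ (rinner (A := A) x (Γ.mul he ζ κ))) η ∈ Γ.sourceIdeal e
      rw [← linner_lsmul_eq]
      refine Γ.dense_induction he (P := (Γ.sourceIdeal e).toSubmodule.comap
        ((linner.flip η).comp ((lsmul.flip (Γ.mul he ζ κ)).comp (linner ξ)))) ?_ ?_ x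
      · exact (Γ.sourceIdeal e).isClosed.preimage ((continuous_linner η).comp
          ((continuous_lsmul_left _).comp (continuous_linner_right ξ)))
      · intro ζ' κ'
        change linner (lsmul (linner (A := A) ξ (Γ.mul he ζ' κ')) (Γ.mul he ζ κ)) η
          ∈ Γ.sourceIdeal e
        rw [linner_lsmul_eq, Γ.rinner_mul, ← linner_lsmul_eq, ← mul_lsmul, linner_lsmul]
        exact ClosedIdeal.mul_mem_right _ _
          (ClosedIdeal.mul_mem_left _ _ (rinner_mem_sourceIdeal _ _))
  have key2 : ∀ a ∈ Γ.sourceIdeal e, ∀ ξ η : Γ.fib e, linner (rsmul ξ a) η ∈ Γ.sourceIdeal e := by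
    intro a ha
    refine ClosedIdeal.generated_induction (p := fun a => ∀ ξ η : Γ.fib e,
      linner (rsmul ξ a) η ∈ Γ.sourceIdeal e) ?_ ?_ ?_ ?_ ?_ ?_ ?_ ha
    · simp [zero_mem]
    · intro x y hx hy ξ η
      simpa using add_mem (hx ξ η) (hy ξ η)
    · intro c x hx ξ η
      simpa using SMulMemClass.smul_mem c (hx ξ η)
    · simp only [Set.ofPred_forall]
      exact isClosed_iInter fun ξ => isClosed_iInter fun ξ' => isClosed_setOf_mem
        ((continuous_linner ξ').comp (continuous_rsmul_left ξ))
    · intro a x hx ξ η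
      rw [rsmul_mul]; exact hx _ _
    · intro a x hx ξ η
      rw [rsmul_mul, linner_rsmul]; exact hx _ _
    · rintro _ ⟨x, y, rfl⟩ ξ η
      exact key x y ξ η
  exact (Γ.sourceIdeal e).isClosed.mem_of_tendsto
    (((continuous_linner η).tendsto _).comp (tendsto_rsmul (rinner_mem_sourceIdeal ξ ξ)))
    (Eventually.of_forall fun a => key2 a a.2 ξ η)

lemma sourceIdeal_eq_rangeIdeal (he : e * e = e) : Γ.sourceIdeal e = Γ.rangeIdeal e := by
  refine SetLike.ext fun a => ⟨ClosedIdeal.generated_le ?_, ClosedIdeal.generated_le ?_⟩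
  · rintro _ ⟨ξ, η, rfl⟩; exact rinner_mem_rangeIdeal he ξ η
  · rintro _ ⟨ξ, η, rfl⟩; exact linner_mem_sourceIdeal he ξ η

lemma sourceIdeal_le_rangeIdeal {v : S} {a : A} (ha : a ∈ Γ.sourceIdeal v) :
    a ∈ Γ.rangeIdeal (v⁻¹ * v) := by
  rw [← sourceIdeal_eq_rangeIdeal (inv_mul_idem v)]
  exact sourceIdeal_mul_le (t := v) (by rw [← _root_.mul_assoc, mul_inv_mul_self]) ha

lemma rangeIdeal_le_mul_inv {v : S} {a : A} (ha : a ∈ Γ.rangeIdeal v) :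
    a ∈ Γ.rangeIdeal (v * v⁻¹) :=
  rangeIdeal_mul_le (u := v) (mul_inv_mul_self v) ha

/-- The product of the ideals of two idempotents is contained in the ideal of their product. -/
lemma mul_mem_rangeIdeal {f : S} (he : e * e = e) (hf : f * f = f) {a b : A}
    (ha : a ∈ Γ.rangeIdeal e) (hb : b ∈ Γ.rangeIdeal f) : a * b ∈ Γ.rangeIdeal (e * f) := by
  have hef := idem_mul he hf
  have key : ∀ (κ κ' : Γ.fib e), ∀ b ∈ Γ.rangeIdeal f,
      rinner κ κ' * b ∈ Γ.rangeIdeal (e * f) := by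
    intro κ κ' b hb
    rw [← rinner_rsmul]
    refine (Γ.rangeIdeal (e * f)).isClosed.mem_of_tendsto
      (((continuous_rinner κ).tendsto _).comp (tendsto_lsmul (I := Γ.rangeIdeal (e * f))
        (linner_rsmul_mem rfl hb κ' (rsmul κ' b)))) (Eventually.of_forall fun d => ?_)
    have hd : (d : A) ∈ Γ.sourceIdeal (e * f) := by
      rw [sourceIdeal_eq_rangeIdeal hef]
      exact d.2
    have := rinner_lsmul_mem (v := e * f) (by rw [idem_comm he hf, _root_.mul_assoc, he]) hd κ
      (rsmul κ' b)
    rwa [sourceIdeal_eq_rangeIdeal hef] at this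
  rw [← sourceIdeal_eq_rangeIdeal he] at ha
  refine ClosedIdeal.generated_induction (p := fun a => ∀ b ∈ Γ.rangeIdeal f,
    a * b ∈ Γ.rangeIdeal (e * f)) ?_ ?_ ?_ ?_ ?_ ?_ ?_ ha b hb
  · simp [zero_mem]
  · intro x y hx hy b hb; rw [add_mul]; exact add_mem (hx b hb) (hy b hb)
  · intro c x hx b hb; rw [smul_mul_assoc]; exact SMulMemClass.smul_mem c (hx b hb)
  · simp only [Set.ofPred_forall]
    exact isClosed_iInter fun b => isClosed_iInter fun _ => isClosed_setOf_mem (by fun_prop)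
  · intro a x hx b hb; rw [_root_.mul_assoc]; exact ClosedIdeal.mul_mem_left _ _ (hx b hb)
  · intro a x hx b hb; rw [_root_.mul_assoc]; exact hx _ (ClosedIdeal.mul_mem_left _ _ hb)
  · rintro _ ⟨κ, κ', rfl⟩ b hb
    exact key κ κ' b hb

/-! ### The ideal of a set of idempotents -/

variable (Γ) in
/-- The closed ideal generated by the ideals `r(fib f)` for `f` in a set of idempotents. -/
def idealOf (F : Set S) : ClosedIdeal A :=
  ClosedIdeal.generated {a | ∃ f ∈ F, ∃ κ κ' : Γ.fib f, a = linner κ κ'}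

lemma idealOf_mono {F G : Set S} (h : F ⊆ G) {a : A} (ha : a ∈ Γ.idealOf F) : a ∈ Γ.idealOf G := by
  refine ClosedIdeal.generated_le ?_ ha
  rintro _ ⟨f, hf, κ, κ', rfl⟩
  exact ClosedIdeal.subset_generated ⟨f, h hf, κ, κ', rfl⟩

lemma rangeIdeal_le_idealOf {F : Set S} {f : S} (hf : f ∈ F) {a : A} (ha : a ∈ Γ.rangeIdeal f) :
    a ∈ Γ.idealOf F := by
  refine ClosedIdeal.generated_le ?_ ha
  rintro _ ⟨κ, κ', rfl⟩
  exact ClosedIdeal.subset_generated ⟨f, hf, κ, κ', rfl⟩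

lemma idealOf_singleton (f : S) : Γ.idealOf {f} = Γ.rangeIdeal f := by
  refine SetLike.ext fun a => ⟨ClosedIdeal.generated_le ?_,
    rangeIdeal_le_idealOf (Set.mem_singleton f)⟩
  rintro _ ⟨f, rfl, κ, κ', rfl⟩
  exact linner_mem_rangeIdeal κ κ'

lemma mem_of_forall_mul_mem {I J : ClosedIdeal A} {a : A} (ha : a ∈ I)
    (h : ∀ b ∈ I, a * b ∈ J) : a ∈ J :=
  J.isClosed.mem_of_tendsto (I.isGood_approxUnit.isApproximateUnit.tendsto_mul_coe ha)
    (Eventually.of_forall fun b => h b b.2)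

/-- The intersection of two closed ideals is the closed span of their products, so that the
intersection of the ideals of `F` and `G` is contained in the ideal of `F G`. -/
lemma mem_idealOf_inter {F G : Set S} (hF : ∀ f ∈ F, f * f = f) (hG : ∀ f ∈ G, f * f = f)
    {H : Set S} (hH : ∀ f ∈ F, ∀ g ∈ G, f * g ∈ H) {a : A} (haF : a ∈ Γ.idealOf F)
    (haG : a ∈ Γ.idealOf G) : a ∈ Γ.idealOf H := by
  have key : ∀ f ∈ F, ∀ b ∈ Γ.idealOf G, ∀ a ∈ Γ.rangeIdeal f, a * b ∈ Γ.idealOf H := by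
    intro f hf b hb
    refine ClosedIdeal.generated_induction (p := fun b => ∀ a ∈ Γ.rangeIdeal f,
      a * b ∈ Γ.idealOf H) ?_ ?_ ?_ ?_ ?_ ?_ ?_ hb
    · simp [zero_mem]
    · intro x y hx hy b hb; rw [mul_add]; exact add_mem (hx b hb) (hy b hb)
    · intro c x hx b hb; rw [mul_smul_comm]; exact SMulMemClass.smul_mem c (hx b hb)
    · simp only [Set.ofPred_forall]
      exact isClosed_iInter fun b => isClosed_iInter fun _ => isClosed_setOf_mem (by fun_prop)
    · intro a x hx b hb; rw [← _root_.mul_assoc]; exact hx _ (ClosedIdeal.mul_mem_right _ _ hb)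
    · intro a x hx b hb; rw [← _root_.mul_assoc]; exact ClosedIdeal.mul_mem_right _ _ (hx b hb)
    · rintro _ ⟨g, hg, κ, κ', rfl⟩ a ha
      exact rangeIdeal_le_idealOf (hH f hf g hg)
        (mul_mem_rangeIdeal (hF f hf) (hG g hg) ha (linner_mem_rangeIdeal _ _))
  refine mem_of_forall_mul_mem haG fun b hb => ?_
  refine ClosedIdeal.generated_induction (p := fun a => ∀ b ∈ Γ.idealOf G,
      a * b ∈ Γ.idealOf H) ?_ ?_ ?_ ?_ ?_ ?_ ?_ haF b hb
  · simp [zero_mem]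
  · intro x y hx hy b hb; rw [add_mul]; exact add_mem (hx b hb) (hy b hb)
  · intro c x hx b hb; rw [smul_mul_assoc]; exact SMulMemClass.smul_mem c (hx b hb)
  · simp only [Set.ofPred_forall]
    exact isClosed_iInter fun b => isClosed_iInter fun _ => isClosed_setOf_mem (by fun_prop)
  · intro a x hx b hb; rw [_root_.mul_assoc]; exact ClosedIdeal.mul_mem_left _ _ (hx b hb)
  · intro a x hx b hb; rw [_root_.mul_assoc]; exact hx _ (ClosedIdeal.mul_mem_left _ _ hb)
  · rintro _ ⟨f, hf, κ, κ', rfl⟩ b hb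
    exact key f hf b hb _ (linner_mem_rangeIdeal _ _)

/-- An element of the ideal of `F` vanishes if it acts by zero on `fib f` for all `f ∈ F`. -/
lemma eq_zero_of_lsmul_eq_zero {F : Set S} {D : A} (hD : D ∈ Γ.idealOf F)
    (h : ∀ f ∈ F, ∀ κ : Γ.fib f, lsmul D κ = 0) : D = 0 := by
  have h1 : ∀ a ∈ Γ.idealOf F, D * a = 0 ∧ ∀ x, D * x * a = 0 := by
    intro a ha
    refine ClosedIdeal.generated_induction (p := fun a => D * a = 0 ∧ ∀ x, D * x * a = 0)
      ?_ ?_ ?_ ?_ ?_ ?_ ?_ ha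
    · simp
    · rintro x y ⟨hx, hx'⟩ ⟨hy, hy'⟩
      exact ⟨by rw [mul_add, hx, hy, add_zero], fun z => by rw [mul_add, hx', hy', add_zero]⟩
    · rintro c x ⟨hx, hx'⟩
      exact ⟨by rw [mul_smul_comm, hx, smul_zero], fun z => by rw [mul_smul_comm, hx', smul_zero]⟩
    · simp only [Set.ofPred_forall, Set.ofPred_and]
      exact (isClosed_eq (by fun_prop) continuous_const).inter
        (isClosed_iInter fun x => isClosed_eq (by fun_prop) continuous_const)
    · rintro a x ⟨hx, hx'⟩
      exact ⟨by rw [← _root_.mul_assoc, hx'], fun z => by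
        rw [← _root_.mul_assoc, _root_.mul_assoc D, hx']⟩
    · rintro a x ⟨hx, hx'⟩
      exact ⟨by rw [← _root_.mul_assoc, hx, zero_mul], fun z => by
        rw [← _root_.mul_assoc, hx', zero_mul]⟩
    · rintro _ ⟨f, hf, κ, κ', rfl⟩
      refine ⟨?_, fun x => ?_⟩
      · rw [← linner_lsmul, h f hf, map_zero, LinearMap.zero_apply]
      · rw [_root_.mul_assoc, ← linner_lsmul, ← linner_lsmul, h f hf, map_zero,
          LinearMap.zero_apply]
  exact (CStarRing.mul_star_self_eq_zero_iff D).mp (h1 _ (star_mem hD)).1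

end Action

namespace Action

open InverseMonoid HilbertBimodule

variable {S A : Type u} [InverseMonoid S] [NonUnitalCStarAlgebra A] {Γ : Action S A}

/-! ### Identification of parts of different fibres -/

/-- The idempotents `f` with `t f = u f`. -/
def agree (t u : S) : Set S := {f | f * f = f ∧ t * f = u * f}

lemma agree_symm {t u : S} : agree t u = agree u t := by
  ext f; exact and_congr_right fun _ => eq_comm

variable (Γ) in
/-- The pairs `(x, y)` in `fib t · I_F × fib u · I_F` that are identified with each other through
`fib (t f) = fib (u f)` for `f ∈ F`. As the inclusions of these fibres are only implicit, the
condition is that `x κ = y κ` for all `κ ∈ fib f`. -/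
def rel (F : Set S) (t u : S) : Submodule ℂ (Γ.fib t × Γ.fib u) where
  carrier := {p | p.1 ∈ Γ.fibMulIdeal (Γ.idealOf F) t ∧ p.2 ∈ Γ.fibMulIdeal (Γ.idealOf F) u ∧
    ∀ f ∈ F, ∀ (v : S) (h : t * f = v) (h' : u * f = v) (κ : Γ.fib f),
      Γ.mul h p.1 κ = Γ.mul h' p.2 κ}
  add_mem' := by
    rintro ⟨x, y⟩ ⟨x', y'⟩ ⟨h1, h2, h3⟩ ⟨h1', h2', h3'⟩
    refine ⟨add_mem h1 h1', add_mem h2 h2', fun f hf v h h' κ => ?_⟩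
    simp only [Prod.mk_add_mk, map_add, LinearMap.add_apply, h3 f hf v h h' κ, h3' f hf v h h' κ]
  zero_mem' := ⟨zero_mem _, zero_mem _, by simp⟩
  smul_mem' := by
    rintro c ⟨x, y⟩ ⟨h1, h2, h3⟩
    refine ⟨Submodule.smul_mem _ c h1, Submodule.smul_mem _ c h2, fun f hf v h h' κ => ?_⟩
    simp only [Prod.smul_mk, map_smul, LinearMap.smul_apply, h3 f hf v h h' κ]

variable {F : Set S} {t u s : S}

lemma rel_left {x : Γ.fib t} {y : Γ.fib u} (h : (x, y) ∈ Γ.rel F t u) :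
    x ∈ Γ.fibMulIdeal (Γ.idealOf F) t := h.1

lemma rel_right {x : Γ.fib t} {y : Γ.fib u} (h : (x, y) ∈ Γ.rel F t u) :
    y ∈ Γ.fibMulIdeal (Γ.idealOf F) u := h.2.1

lemma rel_mul {x : Γ.fib t} {y : Γ.fib u} (h : (x, y) ∈ Γ.rel F t u) {f v : S} (hf : f ∈ F)
    (h₁ : t * f = v) (h₂ : u * f = v) (κ : Γ.fib f) : Γ.mul h₁ x κ = Γ.mul h₂ y κ :=
  h.2.2 f hf v h₁ h₂ κ

lemma rel_symm {x : Γ.fib t} {y : Γ.fib u} (h : (x, y) ∈ Γ.rel F t u) : (y, x) ∈ Γ.rel F u t :=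
  ⟨h.2.1, h.1, fun f hf v h₁ h₂ κ => (h.2.2 f hf v h₂ h₁ κ).symm⟩

lemma rel_add {x x' : Γ.fib t} {y y' : Γ.fib u} (h : (x, y) ∈ Γ.rel F t u)
    (h' : (x', y') ∈ Γ.rel F t u) : (x + x', y + y') ∈ Γ.rel F t u := add_mem h h'

lemma rel_sub {x x' : Γ.fib t} {y y' : Γ.fib u} (h : (x, y) ∈ Γ.rel F t u)
    (h' : (x', y') ∈ Γ.rel F t u) : (x - x', y - y') ∈ Γ.rel F t u := sub_mem h h'

lemma rel_smul {x : Γ.fib t} {y : Γ.fib u} (h : (x, y) ∈ Γ.rel F t u) (c : ℂ) :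
    (c • x, c • y) ∈ Γ.rel F t u := Submodule.smul_mem _ c h

lemma rel_rsmul {x : Γ.fib t} {y : Γ.fib u} (h : (x, y) ∈ Γ.rel F t u) (a : A) :
    (rsmul x a, rsmul y a) ∈ Γ.rel F t u :=
  ⟨rsmul_mem_of_mem h.1 a, rsmul_mem_of_mem h.2.1 a, fun f hf v h₁ h₂ κ => by
    simp only [Γ.mul_balanced, rel_mul h hf h₁ h₂]⟩

lemma rel_lsmul {x : Γ.fib t} {y : Γ.fib u} (h : (x, y) ∈ Γ.rel F t u) (a : A) :
    (lsmul a x, lsmul a y) ∈ Γ.rel F t u :=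
  ⟨lsmul_mem_of_mem a h.1, lsmul_mem_of_mem a h.2.1, fun f hf v h₁ h₂ κ => by
    simp only [Γ.mul_lsmul_left, rel_mul h hf h₁ h₂]⟩

lemma rel_mul_left {x : Γ.fib t} {y : Γ.fib u} (h : (x, y) ∈ Γ.rel F t u) (ζ : Γ.fib s)
    {v w : S} (hv : s * t = v) (hw : s * u = w) (hF : F ⊆ agree t u) :
    (Γ.mul hv ζ x, Γ.mul hw ζ y) ∈ Γ.rel F v w := by
  refine ⟨mul_mem hv ζ h.1, mul_mem hw ζ h.2.1, fun f hf z h₁ h₂ κ => ?_⟩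
  have h3 : s * (t * f) = z := by rw [← _root_.mul_assoc, hv, h₁]
  simp only
  rw [Γ.mul_assoc hv h₁ rfl h3, Γ.mul_assoc hw h₂ (hF hf).2.symm h3,
    rel_mul h hf rfl (hF hf).2.symm]

lemma isClosed_rel : IsClosed (Γ.rel F t u : Set (Γ.fib t × Γ.fib u)) := by
  change IsClosed {p : Γ.fib t × Γ.fib u | p.1 ∈ Γ.fibMulIdeal (Γ.idealOf F) t ∧
    p.2 ∈ Γ.fibMulIdeal (Γ.idealOf F) u ∧ ∀ f ∈ F, ∀ (v : S) (h : t * f = v) (h' : u * f = v)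
      (κ : Γ.fib f), Γ.mul h p.1 κ = Γ.mul h' p.2 κ}
  simp only [Set.ofPred_forall, Set.ofPred_and]
  refine ((Γ.isClosed_fibMulIdeal _ t).preimage continuous_fst).inter
    (((Γ.isClosed_fibMulIdeal _ u).preimage continuous_snd).inter ?_)
  refine isClosed_iInter fun f => isClosed_iInter fun _ => isClosed_iInter fun v =>
    isClosed_iInter fun h => isClosed_iInter fun h' => isClosed_iInter fun κ => ?_
  exact isClosed_eq ((Γ.continuous_mul_left h κ).comp continuous_fst)
    ((Γ.continuous_mul_left h' κ).comp continuous_snd)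

/-- Elements of `fib t · I_F` are determined by their products with elements of `fib f`, `f ∈ F`;
so are their inner products. -/
lemma rinner_eq_of_mul_eq {x x' : Γ.fib t} {D : A} (hx' : x' ∈ Γ.fibMulIdeal (Γ.idealOf F) t)
    (hD : D ∈ Γ.idealOf F)
    (h : ∀ f ∈ F, ∀ κ κ' : Γ.fib f, rinner (A := A) (Γ.mul rfl x κ) (Γ.mul rfl x' κ')
      = rinner κ (lsmul D κ')) : rinner x x' = D := by
  rw [← sub_eq_zero]
  refine eq_zero_of_lsmul_eq_zero (F := F) (sub_mem (rinner_mem x hx') hD) fun f hf κ' => ?_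
  refine eq_zero_of_rinner (A := A) ?_
  have h2 : ∀ κ : Γ.fib f, rinner (A := A) κ (lsmul (rinner x x' - D) κ') = 0 := by
    intro κ
    rw [map_sub, LinearMap.sub_apply, map_sub, ← Γ.rinner_mul rfl, h f hf, sub_self]
  exact h2 _

lemma rel_rinner {x x' : Γ.fib t} {y y' : Γ.fib u} (hF : F ⊆ agree t u)
    (h : (x, y) ∈ Γ.rel F t u) (h' : (x', y') ∈ Γ.rel F t u) :
    rinner (A := A) x x' = rinner y y' := by
  refine rinner_eq_of_mul_eq (rel_left h') (rinner_mem y (rel_right h')) fun f hf κ κ' => ?_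
  rw [rel_mul h hf rfl (hF hf).2.symm, rel_mul h' hf rfl (hF hf).2.symm, Γ.rinner_mul]

lemma rel_norm {x : Γ.fib t} {y : Γ.fib u} (hF : F ⊆ agree t u) (h : (x, y) ∈ Γ.rel F t u) :
    ‖x‖ = ‖y‖ := by
  have h1 := norm_rinner_self (A := A) x
  rw [rel_rinner hF h h, norm_rinner_self] at h1
  exact ((mul_self_inj (norm_nonneg _) (norm_nonneg _)).mp h1).symm

lemma eq_of_mul_eq {x x' : Γ.fib t} (hx : x ∈ Γ.fibMulIdeal (Γ.idealOf F) t)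
    (hx' : x' ∈ Γ.fibMulIdeal (Γ.idealOf F) t)
    (h : ∀ f ∈ F, ∀ κ : Γ.fib f, Γ.mul rfl x κ = Γ.mul rfl x' κ) : x = x' := by
  rw [← sub_eq_zero]
  refine eq_zero_of_rinner (A := A) ?_
  refine rinner_eq_of_mul_eq (F := F) (sub_mem hx hx') (zero_mem _) fun f hf κ κ' => ?_
  simp [h f hf]

lemma rel_unique {x x' : Γ.fib t} {y : Γ.fib u} (hF : F ⊆ agree t u)
    (h : (x, y) ∈ Γ.rel F t u) (h' : (x', y) ∈ Γ.rel F t u) : x = x' :=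
  eq_of_mul_eq (rel_left h) (rel_left h') fun f hf κ => by
    rw [rel_mul h hf rfl (hF hf).2.symm, rel_mul h' hf rfl (hF hf).2.symm]

lemma isClosed_exists_rel (hF : F ⊆ agree t u) :
    IsClosed {y : Γ.fib u | ∃ x, (x, y) ∈ Γ.rel F t u} :=
  isClosed_setOf_exists_mem _ isClosed_rel 1 fun x y h => by rw [one_mul, rel_norm hF h]

/-- For `z ∈ fib (t f)` and `κ ∈ fib f`, there is an element `z κ⋆` of `fib t`. -/
lemma exists_mul_star {f v : S} (hv : t * f = v) (κ : Γ.fib f) (z : Γ.fib v) :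
    ∃ x ∈ Γ.fibMulIdeal (Γ.idealOf {f}) t, ∀ κ' : Γ.fib f,
      Γ.mul hv x κ' = rsmul z (rinner (A := A) κ κ') := by
  let R : Submodule ℂ (Γ.fib t × Γ.fib v) :=
    { carrier := {p | p.1 ∈ Γ.fibMulIdeal (Γ.idealOf {f}) t ∧ ∀ κ' : Γ.fib f,
        Γ.mul hv p.1 κ' = rsmul p.2 (rinner (A := A) κ κ')}
      add_mem' := by
        rintro ⟨x, y⟩ ⟨x', y'⟩ ⟨h1, h2⟩ ⟨h1', h2'⟩
        refine ⟨add_mem h1 h1', fun κ' => ?_⟩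
        simp only [Prod.mk_add_mk, map_add, LinearMap.add_apply, h2, h2']
      zero_mem' := ⟨zero_mem _, by simp⟩
      smul_mem' := by
        rintro c ⟨x, y⟩ ⟨h1, h2⟩
        refine ⟨Submodule.smul_mem _ c h1, fun κ' => ?_⟩
        simp only [Prod.smul_mk, map_smul, LinearMap.smul_apply, h2] }
  have hR : IsClosed (R : Set (Γ.fib t × Γ.fib v)) := by
    change IsClosed {p : Γ.fib t × Γ.fib v | p.1 ∈ Γ.fibMulIdeal (Γ.idealOf {f}) t ∧
      ∀ κ' : Γ.fib f, Γ.mul hv p.1 κ' = rsmul p.2 (rinner (A := A) κ κ')}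
    simp only [Set.ofPred_forall, Set.ofPred_and]
    refine ((Γ.isClosed_fibMulIdeal _ t).preimage continuous_fst).inter
      (isClosed_iInter fun κ' => ?_)
    exact isClosed_eq ((Γ.continuous_mul_left hv κ').comp continuous_fst)
      ((continuous_rsmul _).comp continuous_snd)
  have hnorm : ∀ x y, (x, y) ∈ R → ‖x‖ ≤ 2 * ‖κ‖ * ‖y‖ := by
    rintro x z ⟨h1, h2⟩
    have hv' := hv
    subst hv'
    -- for `x = z κ⋆`, the inner product `⟨x, x⟩` is `κ ⟨z, z⟩ κ⋆`
    have h3 : rinner (A := A) x x = linner (rsmul κ (rinner (A := A) z z)) κ := by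
      refine rinner_eq_of_mul_eq (F := {f}) h1
        (ClosedIdeal.subset_generated ⟨f, rfl, _, _, rfl⟩) ?_
      rintro _ rfl κ₁ κ₂
      rw [h2, h2, linner_lsmul_eq, rinner_rsmul_left, rinner_rsmul, rinner_rsmul, rinner_rsmul,
        star_rinner]
      simp only [_root_.mul_assoc]
    refine le_of_sq_le_sq ?_ (by positivity)
    rw [sq, ← norm_rinner_self (A := A), h3]
    have h4 : ‖rsmul κ (rinner (A := A) z z)‖ ≤ ‖κ‖ * (‖z‖ * ‖z‖) := by
      rw [← norm_rinner_self (A := A) z]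
      exact norm_rsmul_le _ _
    have h5 := norm_sesq_le (linner (A := A) (E := Γ.fib f)).flip
      (fun ξ => (norm_linner_self ξ).le) κ (rsmul κ (rinner (A := A) z z))
    calc _ ≤ 4 * (‖κ‖ * ‖rsmul κ (rinner (A := A) z z)‖) := h5
      _ ≤ 4 * (‖κ‖ * (‖κ‖ * (‖z‖ * ‖z‖))) := by gcongr
      _ = _ := by ring
  have hcl := isClosed_setOf_exists_mem R hR _ hnorm
  refine Γ.dense_induction hv (P := R.map (LinearMap.snd ℂ _ _)) ?_ ?_ z |>.elim ?_
  · convert hcl using 1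
    ext y
    exact ⟨fun ⟨⟨x, _⟩, hx, h⟩ => ⟨x, by cases h; exact hx⟩, fun ⟨x, hx⟩ => ⟨(x, y), hx, rfl⟩⟩
  · intro ξ κ₁
    refine ⟨(rsmul ξ (linner κ₁ κ), Γ.mul hv ξ κ₁), ⟨rsmul_mem _
      (ClosedIdeal.subset_generated ⟨f, rfl, _, _, rfl⟩), fun κ' => ?_⟩, rfl⟩
    simp only
    rw [Γ.mul_balanced, linner_lsmul_eq, Γ.mul_rsmul_right]
  · rintro ⟨x, _⟩ ⟨⟨hx, hx'⟩, h⟩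
    cases h
    exact ⟨x, hx, hx'⟩

/-- Elements of `fib t` and `fib u` that are supported on the ideal of `f` and have the same
products with elements of `fib f` have the same products with elements of `fib g` whenever this
makes sense. -/
lemma mul_eq_of_mul_eq {f g v w : S} (hf : f * f = f) (hg : g * g = g) (h₁ : t * f = v)
    (h₂ : u * f = v) (h₃ : t * g = w) (h₄ : u * g = w) {x : Γ.fib t} {y : Γ.fib u}
    (hx : x ∈ Γ.fibMulIdeal (Γ.idealOf {f}) t) (hy : y ∈ Γ.fibMulIdeal (Γ.idealOf {f}) u)
    (h : ∀ κ : Γ.fib f, Γ.mul h₁ x κ = Γ.mul h₂ y κ) (κ : Γ.fib g) :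
    Γ.mul h₃ x κ = Γ.mul h₄ y κ := by
  rw [idealOf_singleton] at hx hy
  have hmem : ∀ {s : S} (hs : s * g = w) {x : Γ.fib s},
      x ∈ Γ.fibMulIdeal (Γ.rangeIdeal f) s → Γ.mul hs x κ ∈ Γ.fibMulIdeal (Γ.idealOf {f}) w := by
    intro s hs x hx
    rw [mem_fibMulIdeal_iff, Γ.rinner_mul, idealOf_singleton, ← sourceIdeal_eq_rangeIdeal hf]
    have h1 : rinner x x ∈ Γ.sourceIdeal f := by
      rw [sourceIdeal_eq_rangeIdeal hf]
      exact rinner_mem x hx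
    have h2 := rinner_lsmul_mem (idem_comm hf hg) h1 κ κ
    exact sourceIdeal_mul_le rfl h2
  refine eq_of_mul_eq (hmem h₃ hx) (hmem h₄ hy) ?_
  intro f' hf' lam
  obtain rfl : f = f' := hf'.symm
  have e1 : t * (g * f) = w * f := by rw [← _root_.mul_assoc, h₃]
  have e2 : u * (g * f) = w * f := by rw [← _root_.mul_assoc, h₄]
  rw [Γ.mul_assoc h₃ rfl rfl e1, Γ.mul_assoc h₄ rfl rfl e2]
  refine Γ.dense_induction (idem_comm hf hg) (P := LinearMap.eqLocus (Γ.mul e1 x) (Γ.mul e2 y))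
    ?_ ?_ (Γ.mul rfl κ lam)
  · exact isClosed_eq (Γ.continuous_mul_right _ _) (Γ.continuous_mul_right _ _)
  · intro κ₁ κ₂
    have e3 : v * g = w * f := by
      rw [← h₁, ← h₃, _root_.mul_assoc, _root_.mul_assoc, idem_comm hf hg]
    change Γ.mul e1 x _ = Γ.mul e2 y _
    rw [← Γ.mul_assoc h₁ e3, ← Γ.mul_assoc h₂ e3, h]

/-- Every element of `fib u · I_F` corresponds to one of `fib t · I_F`. -/
theorem exists_rel (hF : F ⊆ agree t u) {y : Γ.fib u}
    (hy : y ∈ Γ.fibMulIdeal (Γ.idealOf F) u) : ∃ x, (x, y) ∈ Γ.rel F t u := by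
  have hcl := isClosed_exists_rel (Γ := Γ) hF
  have key : ∀ a ∈ Γ.idealOf F, ∀ η : Γ.fib u, ∃ x, (x, rsmul η a) ∈ Γ.rel F t u := by
    intro a ha
    refine ClosedIdeal.generated_induction (p := fun a => ∀ η : Γ.fib u,
      ∃ x, (x, rsmul η a) ∈ Γ.rel F t u) ?_ ?_ ?_ ?_ ?_ ?_ ?_ ha
    · exact fun η => ⟨0, by rw [map_zero]; exact zero_mem (Γ.rel F t u)⟩
    · intro a b ha hb η
      obtain ⟨x, hx⟩ := ha η
      obtain ⟨y, hy⟩ := hb η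
      exact ⟨x + y, by rw [map_add]; exact add_mem hx hy⟩
    · intro c a ha η
      obtain ⟨x, hx⟩ := ha η
      exact ⟨c • x, by rw [map_smul]; exact Submodule.smul_mem _ c hx⟩
    · simp only [Set.ofPred_forall]
      exact isClosed_iInter fun η => hcl.preimage (continuous_rsmul_left η)
    · intro a x hx η
      rw [rsmul_mul]; exact hx _
    · intro a x hx η
      obtain ⟨y, hy⟩ := hx η
      exact ⟨rsmul y a, by rw [rsmul_mul]; exact rel_rsmul hy a⟩
    · rintro _ ⟨f, hf, κ₁, κ₂, rfl⟩ η
      have htu := (hF hf).2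
      -- for `a = κ₁ κ₂⋆`, the element of `fib t` is `(η κ₁) κ₂⋆`, where `η κ₁` lies in
      -- `fib (u f) = fib (t f)`
      obtain ⟨x, hx, hxm⟩ := exists_mul_star htu κ₂ (Γ.mul rfl η κ₁)
      have hle : ∀ a ∈ Γ.idealOf {f}, a ∈ Γ.idealOf F := fun a ha =>
        idealOf_mono (Set.singleton_subset_iff.mpr hf) ha
      have hy0 : linner κ₁ κ₂ ∈ Γ.idealOf {f} :=
        ClosedIdeal.subset_generated ⟨f, rfl, _, _, rfl⟩
      refine ⟨x, fibMulIdeal_mono hle hx, rsmul_mem η (hle _ hy0), fun g hg w h h' κ => ?_⟩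
      refine mul_eq_of_mul_eq (hF hf).1 (hF hg).1 htu rfl h h' hx (rsmul_mem η hy0) ?_ κ
      intro κ'
      rw [hxm, Γ.mul_balanced, linner_lsmul_eq, Γ.mul_rsmul_right]
  exact fibMulIdeal_induction (p := fun y => ∃ x, (x, y) ∈ Γ.rel F t u)
    ⟨0, zero_mem (Γ.rel F t u)⟩ (fun _ _ ⟨x, hx⟩ ⟨y, hy⟩ => ⟨x + y, add_mem hx hy⟩)
    (fun c _ ⟨x, hx⟩ => ⟨c • x, Submodule.smul_mem _ c hx⟩) hcl (fun η a ha => key a ha η) hy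

/-- Identification over `F` implies identification over a larger set `G`: the partner `x` of `y`
over `G` is also a partner over `F`, and partners are unique. -/
lemma rel_mono {G : Set S} (hFG : F ⊆ G) (hG : G ⊆ agree t u) {x : Γ.fib t} {y : Γ.fib u}
    (h : (x, y) ∈ Γ.rel F t u) : (x, y) ∈ Γ.rel G t u := by
  have hle : ∀ a ∈ Γ.idealOf F, a ∈ Γ.idealOf G := fun a => idealOf_mono hFG
  obtain ⟨x', hx'⟩ := exists_rel hG (fibMulIdeal_mono hle (rel_right h))
  have h1 : x' ∈ Γ.fibMulIdeal (Γ.idealOf F) t := by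
    rw [mem_fibMulIdeal_iff, rel_rinner hG hx' hx']
    exact rinner_mem y (rel_right h)
  have h2 : x = x' := rel_unique (hFG.trans hG) h
    ⟨h1, rel_right h, fun f hf v h h' κ => hx'.2.2 f (hFG hf) v h h' κ⟩
  rw [h2]; exact hx'

/-- A pair that is identified with respect to `G` is identified with respect to a smaller set `F`
if it is supported there. -/
lemma rel_of_mem {G : Set S} (hFG : F ⊆ G) (hG : G ⊆ agree t u) {x : Γ.fib t} {y : Γ.fib u}
    (h : (x, y) ∈ Γ.rel G t u) (hy : y ∈ Γ.fibMulIdeal (Γ.idealOf F) u) :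
    (x, y) ∈ Γ.rel F t u := by
  refine ⟨?_, hy, fun f hf v h₁ h₂ κ => h.2.2 f (hFG hf) v h₁ h₂ κ⟩
  rw [mem_fibMulIdeal_iff, rel_rinner hG h h]
  exact rinner_mem y hy

end Action

namespace Action

open InverseMonoid HilbertBimodule

variable {S A : Type u} [InverseMonoid S] [NonUnitalCStarAlgebra A] {Γ : Action S A}

/-! ### The inclusions of the fibres over idempotents into the unit fibre -/

lemma mem_fibMulIdeal_idealOf {e : S} (he : e * e = e) (ζ : Γ.fib e) :
    ζ ∈ Γ.fibMulIdeal (Γ.idealOf {e}) e := by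
  rw [mem_fibMulIdeal_iff, idealOf_singleton]
  exact rinner_mem_rangeIdeal he ζ ζ

lemma singleton_subset_agree {e : S} (he : e * e = e) : {e} ⊆ agree 1 e :=
  Set.singleton_subset_iff.mpr ⟨he, by rw [one_mul, he]⟩

/-- The canonical inclusion of `fib e` into `A` is the identification of `fib 1` and `fib e`
over `e`. -/
lemma isUnitIncl_iff_rel {e : S} (h : NatLE e 1) (ζ : Γ.fib e) (b : A) :
    Γ.IsUnitIncl h ζ b ↔ (Γ.unit b, ζ) ∈ Γ.rel {e} 1 e := by
  constructor
  · rintro ⟨h1, h2⟩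
    refine ⟨by rw [idealOf_singleton]; exact unit_mem.mpr h1, mem_fibMulIdeal_idealOf h.idem ζ, ?_⟩
    intro f hf v h₁ h₂ κ
    obtain rfl : e = f := hf.symm
    obtain rfl : e = v := by rw [← h₁, one_mul]
    rw [Γ.unit_mul, h2]
  · intro hr
    have h1 := rel_left hr
    rw [idealOf_singleton, unit_mem] at h1
    refine ⟨h1, fun η => ?_⟩
    rw [← rel_mul hr rfl (one_mul e) h.idem, Γ.unit_mul]

lemma exists_isUnitIncl {e : S} (h : NatLE e 1) (ζ : Γ.fib e) : ∃ b, Γ.IsUnitIncl h ζ b := by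
  obtain ⟨x, hx⟩ := exists_rel (singleton_subset_agree h.idem) (mem_fibMulIdeal_idealOf h.idem ζ)
  refine ⟨Γ.unit.symm x, (isUnitIncl_iff_rel h ζ _).mpr ?_⟩
  rwa [LinearEquiv.apply_symm_apply]

lemma exists_isUnitIncl_of_mem {e : S} (h : NatLE e 1) {b : A} (hb : b ∈ Γ.rangeIdeal e) :
    ∃ ζ : Γ.fib e, Γ.IsUnitIncl h ζ b := by
  have hb' : Γ.unit b ∈ Γ.fibMulIdeal (Γ.idealOf {e}) 1 := by
    rw [idealOf_singleton]; exact unit_mem.mpr hb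
  obtain ⟨ζ, hζ⟩ := exists_rel (t := e)
    (by rw [agree_symm]; exact singleton_subset_agree h.idem) hb'
  exact ⟨ζ, (isUnitIncl_iff_rel h ζ b).mpr (rel_symm hζ)⟩

/-- If `e v = v`, then elements of `fib e` multiply `fib v` like their images in `A`. -/
lemma IsUnitIncl.mul_eq {e : S} {h : NatLE e 1} {ζ : Γ.fib e} {b : A} (hb : Γ.IsUnitIncl h ζ b)
    {v : S} (hv : e * v = v) (z : Γ.fib v) : Γ.mul hv ζ z = lsmul b z := by
  refine Γ.dense_induction hv (P := LinearMap.eqLocus (Γ.mul hv ζ) (lsmul b)) ?_ ?_ z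
  · exact isClosed_eq (Γ.continuous_mul_right _ _) (continuous_lsmul b)
  · intro κ z'
    change Γ.mul hv ζ (Γ.mul hv κ z') = lsmul b (Γ.mul hv κ z')
    rw [← Γ.mul_lsmul_left, hb.2, Γ.mul_assoc h.idem hv hv hv]

lemma IsUnitIncl.rsmul {e : S} {h : NatLE e 1} {ζ : Γ.fib e} {b : A} (hb : Γ.IsUnitIncl h ζ b)
    (a : A) : Γ.IsUnitIncl h (HilbertBimodule.rsmul ζ a) (b * a) := by
  rw [isUnitIncl_iff_rel] at hb ⊢
  rw [← Γ.rsmul_unit]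
  exact rel_rsmul hb a

/-- The elements `v ≤ 1, t` are the idempotents `v` with `t v = v`. -/
lemma commonIdeal_one (t : S) : Γ.commonIdeal 1 t = Γ.idealOf (agree 1 t) := by
  refine SetLike.ext fun a => ⟨ClosedIdeal.generated_le ?_, ClosedIdeal.generated_le ?_⟩
  · rintro a ⟨v, h1, h2, ha⟩
    have hv := h1.idem
    rw [sourceIdeal_eq_rangeIdeal hv] at ha
    have hva : v ∈ agree 1 t := ⟨hv, by rw [one_mul, (natLE_iff_of_idem hv).mp h2]⟩
    exact rangeIdeal_le_idealOf hva ha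
  · rintro _ ⟨f, ⟨hf, hft⟩, κ, κ', rfl⟩
    refine ClosedIdeal.subset_generated ⟨f, natLE_one_iff.mpr hf,
      (natLE_iff_of_idem hf).mpr ?_, linner_mem_sourceIdeal hf κ κ'⟩
    rw [← hft, one_mul]

/-- The isomorphism `ϑ_{1,t}` is the identification of `fib 1` and `fib t` over the idempotents `f`
with `t f = f`. -/
lemma thetaGraph_subset_rel {t : S} {y : Γ.fib t} {a : A} (h : (y, a) ∈ Γ.thetaGraph t) :
    (Γ.unit a, y) ∈ Γ.rel (agree 1 t) 1 t := by
  let P : Submodule ℂ (Γ.fib t × A) :=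
    { carrier := {p | (Γ.unit p.2, p.1) ∈ Γ.rel (agree 1 t) 1 t}
      add_mem' := by
        rintro ⟨x, a⟩ ⟨y, b⟩ hx hy
        change (Γ.unit (a + b), x + y) ∈ Γ.rel (agree 1 t) 1 t
        rw [map_add]; exact rel_add hx hy
      zero_mem' := by
        change (Γ.unit 0, (0 : Γ.fib t)) ∈ Γ.rel (agree 1 t) 1 t
        rw [map_zero]; exact zero_mem (Γ.rel _ _ _)
      smul_mem' := by
        rintro c ⟨x, a⟩ hx
        change (Γ.unit (c • a), c • x) ∈ Γ.rel (agree 1 t) 1 t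
        rw [map_smul]; exact rel_smul hx c }
  have hP : IsClosed (P : Set (Γ.fib t × A)) := isClosed_rel.preimage
    ((Γ.continuous_unit.comp continuous_snd).prodMk continuous_fst)
  refine (Submodule.topologicalClosure_minimal (t := P) _ (Submodule.span_le.mpr ?_) hP) h
  rintro _ ⟨e, h₁, h, ξ, ζ, b, c, hb, hc, rfl⟩
  have hte := h₁.mul_eq h
  have hsub : {e} ⊆ agree 1 t :=
    Set.singleton_subset_iff.mpr ⟨h₁.idem, by rw [one_mul, hte]⟩
  refine rel_mono hsub subset_rfl ⟨rel_left ((isUnitIncl_iff_rel h₁ _ c).mp hc),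
    rsmul_mem _ (by rw [idealOf_singleton]; exact hb.1), ?_⟩
  intro f hf v h₂ h₃ κ
  obtain rfl : e = f := hf.symm
  obtain rfl : e = v := by rw [← h₂, one_mul]
  rw [Γ.unit_mul, hc.2, Γ.mul_balanced, hb.2, Γ.mul_assoc hte h₁.idem h₁.idem h₃]

/-- The isomorphism `ϑ_{1,t}` is defined on all products `ξ a` with `a ∈ I_{1,t}`. -/
lemma exists_mem_thetaGraph {t : S} (ξ : Γ.fib t) {a : A} (ha : a ∈ Γ.commonIdeal 1 t) :
    ∃ c, (rsmul ξ a, c) ∈ Γ.thetaGraph t := by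
  let R : Submodule ℂ (A × Γ.fib t) := (Γ.thetaGraph t).comap
    ((LinearMap.snd ℂ A (Γ.fib t)).prod (LinearMap.fst ℂ A (Γ.fib t)))
  have hR : ∀ c y, (c, y) ∈ R ↔ (y, c) ∈ Γ.thetaGraph t := fun _ _ => Iff.rfl
  have hth : IsClosed (Γ.thetaGraph t : Set (Γ.fib t × A)) :=
    Submodule.isClosed_topologicalClosure _
  have hRc : IsClosed (R : Set (A × Γ.fib t)) := hth.preimage continuous_swap
  have hcl := isClosed_setOf_exists_mem R hRc 1 fun c y h => by
    rw [one_mul, ← Γ.norm_unit c, rel_norm subset_rfl (thetaGraph_subset_rel ((hR _ _).mp h))]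
  simp only [hR] at hcl
  have hmul : ∀ y c, (y, c) ∈ Γ.thetaGraph t → ∀ a : A,
      (rsmul y a, c * a) ∈ Γ.thetaGraph t := by
    intro y c h a
    let f : Γ.fib t × A →ₗ[ℂ] Γ.fib t × A :=
      LinearMap.prodMap (rsmul.flip a) ((LinearMap.mul ℂ A).flip a)
    have hf : Continuous f := ((continuous_rsmul a).comp continuous_fst).prodMk
      ((continuous_mul_const a).comp continuous_snd)
    refine (Submodule.topologicalClosure_minimal (t := (Γ.thetaGraph t).comap f) _
      (Submodule.span_le.mpr ?_) (hth.preimage hf)) h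
    rintro _ ⟨e, h₁, h, ξ, ζ, b, c, hb, hc, rfl⟩
    refine Submodule.le_topologicalClosure _ (Submodule.subset_span
      ⟨e, h₁, h, ξ, rsmul ζ a, b * a, c * a, hb.rsmul a, ?_, ?_⟩)
    · rw [Γ.mul_rsmul_right]; exact hc.rsmul a
    · simp [f, rsmul_mul]
  refine ClosedIdeal.generated_induction (p := fun a => ∀ ξ : Γ.fib t,
    ∃ c, (rsmul ξ a, c) ∈ Γ.thetaGraph t) ?_ ?_ ?_ ?_ ?_ ?_ ?_ ha ξ
  · exact fun ξ => ⟨0, by rw [map_zero]; exact zero_mem (Γ.thetaGraph t)⟩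
  · intro a b ha hb ξ
    obtain ⟨x, hx⟩ := ha ξ
    obtain ⟨y, hy⟩ := hb ξ
    exact ⟨x + y, by rw [map_add]; exact add_mem hx hy⟩
  · intro c a ha ξ
    obtain ⟨x, hx⟩ := ha ξ
    exact ⟨c • x, by rw [map_smul]; exact Submodule.smul_mem _ c hx⟩
  · simp only [Set.ofPred_forall]
    exact isClosed_iInter fun ξ => hcl.preimage (continuous_rsmul_left ξ)
  · intro a x hx ξ
    rw [rsmul_mul]; exact hx _
  · intro a x hx ξ
    obtain ⟨y, hy⟩ := hx ξ
    exact ⟨y * a, by rw [rsmul_mul]; exact hmul _ _ hy a⟩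
  · rintro a ⟨e, h₁, h₂, ha⟩ ξ
    rw [sourceIdeal_eq_rangeIdeal h₁.idem] at ha
    obtain ⟨ζ, hζ⟩ := exists_isUnitIncl_of_mem h₁ ha
    obtain ⟨c, hc⟩ := exists_isUnitIncl h₁ (Γ.mul (h₁.mul_eq h₂) ξ ζ)
    exact ⟨c, Submodule.le_topologicalClosure _ (Submodule.subset_span
      ⟨e, h₁, h₂, ξ, ζ, a, c, hζ, hc, rfl⟩)⟩

/-! ### The fibrewise kernel -/

variable {F : Set S} {t u s : S}

open Classical in
variable (Γ) in
/-- The isomorphism `ϑ_{t,u} : fib u · I_F → fib t · I_F`, extended arbitrarily to `fib u`. -/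
noncomputable def theta (F : Set S) (t u : S) (y : Γ.fib u) : Γ.fib t :=
  if h : ∃ x, (x, y) ∈ Γ.rel F t u then h.choose else 0

lemma theta_eq (hF : F ⊆ agree t u) {x : Γ.fib t} {y : Γ.fib u} (h : (x, y) ∈ Γ.rel F t u) :
    Γ.theta F t u y = x := by
  have hex : ∃ x, (x, y) ∈ Γ.rel F t u := ⟨x, h⟩
  rw [theta, dif_pos hex]
  exact rel_unique hF hex.choose_spec h

lemma rel_theta (hF : F ⊆ agree t u) {y : Γ.fib u} (hy : y ∈ Γ.fibMulIdeal (Γ.idealOf F) u) :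
    (Γ.theta F t u y, y) ∈ Γ.rel F t u := by
  obtain ⟨x, hx⟩ := exists_rel hF hy
  rwa [theta_eq hF hx]

lemma norm_theta (hF : F ⊆ agree t u) {y : Γ.fib u} (hy : y ∈ Γ.fibMulIdeal (Γ.idealOf F) u) :
    ‖Γ.theta F t u y‖ = ‖y‖ := rel_norm hF (rel_theta hF hy)

variable (Γ) in
/-- The left multiplier `d ↦ ⟨ξ, ϑ (η d)⟩` of the ideal `I_F`. -/
noncomputable def innerMult (F : Set S) (ξ : Γ.fib t) (η : Γ.fib u) (d : A) : A :=
  rinner ξ (Γ.theta F t u (rsmul η d))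

lemma isMult_innerMult (hF : F ⊆ agree t u) (ξ : Γ.fib t) (η : Γ.fib u) :
    IsMult (Γ.idealOf F) (Γ.innerMult F ξ η) where
  sub a ha b hb := by
    rw [innerMult, map_sub, theta_eq hF (rel_sub (rel_theta hF (rsmul_mem η ha))
      (rel_theta hF (rsmul_mem η hb))), map_sub]
    rfl
  mul a ha b := by
    rw [innerMult, rsmul_mul, theta_eq hF (rel_rsmul (rel_theta hF (rsmul_mem η ha)) b),
      rinner_rsmul]
    rfl
  mem a ha := rinner_mem _ (rel_left (rel_theta hF (rsmul_mem η ha)))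
  bound := by
    refine ⟨4 * (‖ξ‖ * ‖η‖), by positivity, fun a ha => ?_⟩
    refine (norm_rinner_le _ _).trans ?_
    rw [norm_theta hF (rsmul_mem η ha), _root_.mul_assoc, _root_.mul_assoc]
    gcongr
    exact norm_rsmul_le η a

lemma innerMult_mul_eq (ξ : Γ.fib t) (η : Γ.fib u) (a b : A) :
    Γ.innerMult F ξ (rsmul η b) a = Γ.innerMult F ξ η (b * a) := by
  rw [innerMult, innerMult, rsmul_mul]

lemma innerMult_eq_of_rel (hF : F ⊆ agree t u) (ξ : Γ.fib t) {η : Γ.fib u} {d : A} {x : Γ.fib t}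
    (h : (x, rsmul η d) ∈ Γ.rel F t u) : Γ.innerMult F ξ η d = rinner ξ x := by
  rw [innerMult, theta_eq hF h]

/-- The value at `φ` of the multiplier `⟨ξ, η⟩ ∈ A''`, considered on the ideal `I_F`. -/
noncomputable def kerOn (F : Set S) (ξ : Γ.fib t) (η : Γ.fib u) (φ : StrongDual ℂ A) : ℂ :=
  multEval (Γ.idealOf F) (Γ.innerMult F ξ η) φ

/-- The value at `φ` of the `A''`-valued inner product of `ξ ∈ fib t` and `η ∈ fib u`, that is, of
the weak conditional expectation of `(ξ δ_t)⋆ (η δ_u)`. -/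
noncomputable def ker (ξ : Γ.fib t) (η : Γ.fib u) (φ : StrongDual ℂ A) : ℂ :=
  kerOn (agree t u) ξ η φ

lemma kerOn_eq_of_rel (hF : F ⊆ agree t u) (ξ : Γ.fib t) {x : Γ.fib t} {y : Γ.fib u}
    (h : (x, y) ∈ Γ.rel F t u) (φ : StrongDual ℂ A) : kerOn F ξ y φ = φ (rinner ξ x) := by
  refine multEval_eq_apply (rinner_mem ξ (rel_left h)) (fun d hd => ?_) φ
  rw [innerMult_eq_of_rel hF ξ (rel_rsmul h d), rinner_rsmul]

lemma ker_eq_of_rel (hF : F ⊆ agree t u) (ξ : Γ.fib t) {x : Γ.fib t} {y : Γ.fib u}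
    (h : (x, y) ∈ Γ.rel F t u) (φ : StrongDual ℂ A) : ker ξ y φ = φ (rinner ξ x) :=
  kerOn_eq_of_rel subset_rfl ξ (rel_mono hF subset_rfl h) φ

lemma innerMult_mono {G : Set S} (hFG : F ⊆ G) (hG : G ⊆ agree t u) (ξ : Γ.fib t) (η : Γ.fib u)
    {d : A} (hd : d ∈ Γ.idealOf F) : Γ.innerMult F ξ η d = Γ.innerMult G ξ η d :=
  (innerMult_eq_of_rel hG ξ (rel_mono hFG hG
    (rel_theta (hFG.trans hG) (rsmul_mem η hd)))).symm

/-- If `η` is supported on the ideal of an idempotent `e`, then only the idempotents below `e`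
matter for the kernel. -/
lemma ker_eq_kerOn (hF : F ⊆ agree t u) (ξ : Γ.fib t) {η : Γ.fib u} {e : S} (he : e * e = e)
    (hη : rinner η η ∈ Γ.rangeIdeal e) (h : ∀ f ∈ agree t u, f * e ∈ F) (φ : StrongDual ℂ A) :
    ker ξ η φ = kerOn F ξ η φ := by
  rw [ker, kerOn, ← (isMult_innerMult subset_rfl ξ η).multEval_eq_of_le
    (L := Γ.idealOf F) (fun a => idealOf_mono hF)]
  · exact multEval_congr (fun d hd => (innerMult_mono hF subset_rfl ξ η hd).symm) φ
  · intro d hd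
    have hr := rel_theta (Γ := Γ) (F := agree t u) (t := t) subset_rfl (rsmul_mem η hd)
    refine rinner_mem ξ ?_
    rw [mem_fibMulIdeal_iff, rel_rinner subset_rfl hr hr]
    refine mem_idealOf_inter (F := agree t u) (G := {e}) (fun f hf => hf.1)
      (by rintro _ rfl; exact he) (by rintro f hf _ rfl; exact h f hf)
      (rinner_mem _ (rel_right hr)) ?_
    rw [idealOf_singleton]
    exact rinner_mem _ (rsmul_mem_of_mem (mem_fibMulIdeal_iff.mpr hη) d)

lemma ker_add_right (ξ : Γ.fib t) (η η' : Γ.fib u) (φ : StrongDual ℂ A) :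
    ker ξ (η + η') φ = ker ξ η φ + ker ξ η' φ := by
  rw [ker, ker, ker, kerOn, kerOn, kerOn,
    ← (isMult_innerMult subset_rfl ξ η).multEval_add (isMult_innerMult subset_rfl ξ η')]
  refine multEval_congr (fun d hd => ?_) φ
  rw [innerMult, map_add, LinearMap.add_apply, theta_eq subset_rfl
    (rel_add (rel_theta subset_rfl (rsmul_mem η hd)) (rel_theta subset_rfl (rsmul_mem η' hd))),
    map_add]
  rfl

lemma ker_smul_right (ξ : Γ.fib t) (c : ℂ) (η : Γ.fib u) (φ : StrongDual ℂ A) :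
    ker ξ (c • η) φ = c * ker ξ η φ := by
  rw [ker, ker, kerOn, kerOn, ← (isMult_innerMult subset_rfl ξ η).multEval_smul c]
  refine multEval_congr (fun d hd => ?_) φ
  rw [innerMult, map_smul, LinearMap.smul_apply, theta_eq subset_rfl
    (rel_smul (rel_theta subset_rfl (rsmul_mem η hd)) c), map_smul]
  rfl

lemma ker_add_left (ξ ξ' : Γ.fib t) (η : Γ.fib u) (φ : StrongDual ℂ A) :
    ker (ξ + ξ') η φ = ker ξ η φ + ker ξ' η φ := by
  rw [ker, ker, ker, kerOn, kerOn, kerOn,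
    ← (isMult_innerMult subset_rfl ξ η).multEval_add (isMult_innerMult subset_rfl ξ' η)]
  refine multEval_congr (fun d hd => ?_) φ
  simp [innerMult]

lemma ker_smul_left (ξ : Γ.fib t) (c : ℂ) (η : Γ.fib u) (φ : StrongDual ℂ A) :
    ker (c • ξ) η φ = conj c * ker ξ η φ := by
  rw [ker, ker, kerOn, kerOn, ← (isMult_innerMult subset_rfl ξ η).multEval_smul (conj c)]
  refine multEval_congr (fun d hd => ?_) φ
  simp [innerMult]

lemma ker_rsmul_right (ξ : Γ.fib t) (η : Γ.fib u) (b : A) (φ : StrongDual ℂ A) :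
    ker ξ (rsmul η b) φ = ker ξ η (rightShift φ b) := by
  rw [ker, ker, kerOn, kerOn, ← (isMult_innerMult subset_rfl ξ η).multEval_comp_mul_left b]
  exact multEval_congr (fun d hd => innerMult_mul_eq ξ η d b) φ

/-- The kernel satisfies `⟨ξ η, ξ₂ η₂⟩ = ⟨η, ⟨ξ, ξ₂⟩ η₂⟩`. The set `agree (s t) (s u)` may be larger
than `agree t u`, but `s u` only sees the ideal of its source idempotent, below which the two agree.
-/
lemma ker_mul_mul {t' u' : S} (ht : s * t = t') (hu : s * u = u') (ξ ξ' : Γ.fib s) (η : Γ.fib t)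
    (η' : Γ.fib u) (φ : StrongDual ℂ A) :
    ker (Γ.mul ht ξ η) (Γ.mul hu ξ' η') φ = ker η (lsmul (rinner (A := A) ξ ξ') η') φ := by
  have hsub : agree t u ⊆ agree t' u' := by
    rintro f ⟨hf, hf'⟩
    exact ⟨hf, by rw [← ht, ← hu, _root_.mul_assoc, _root_.mul_assoc, hf']⟩
  rw [ker_eq_kerOn hsub _ (e := u'⁻¹ * u') (inv_mul_idem u')
    (sourceIdeal_le_rangeIdeal (rinner_mem_sourceIdeal _ _))]
  · refine multEval_congr (fun d hd => ?_) φ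
    have h1 := rel_theta (Γ := Γ) (F := agree t u) (t := t) subset_rfl (rsmul_mem η' hd)
    have h2 := rel_mul_left h1 ξ' ht hu subset_rfl
    rw [Γ.mul_rsmul_right] at h2
    have h3 := rel_lsmul h1 (rinner (A := A) ξ ξ')
    rw [← lsmul_rsmul] at h3
    rw [innerMult_eq_of_rel hsub _ h2, innerMult_eq_of_rel subset_rfl _ h3, Γ.rinner_mul]
  · rintro f ⟨hf, hf'⟩
    -- both `t` and `u` times `f (u⁻¹ p u)` are equal to `p t f = p u f`, because `f (t⁻¹ p t)` and
    -- `f (u⁻¹ p u)` are both the source idempotent of this element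
    set p := s⁻¹ * s with hp
    have hpp : p * p = p := inv_mul_idem s
    have e1 : u'⁻¹ * u' = u⁻¹ * p * u := by
      rw [← hu, mul_inv_rev']; simp only [_root_.mul_assoc, hp]
    have hq : ∀ t : S, t⁻¹ * p * t * (t⁻¹ * p * t) = t⁻¹ * p * t := inv_mul_idem_mul hpp
    have e2 : p * t * f = p * u * f := by
      rw [hp, _root_.mul_assoc, _root_.mul_assoc, ← _root_.mul_assoc s, ht, hf', ← hu]
      simp only [_root_.mul_assoc]
    have e3 : ∀ t : S, t * (f * (t⁻¹ * p * t)) = p * t * f := by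
      intro t
      rw [idem_comm hf (hq t)]
      calc t * (t⁻¹ * p * t * f) = t * t⁻¹ * p * (t * f) := by simp only [_root_.mul_assoc]
        _ = p * (t * t⁻¹ * t) * f := by
            rw [idem_comm (mul_inv_idem t) hpp]; simp only [_root_.mul_assoc]
        _ = _ := by rw [mul_inv_mul_self]
    have e4 : ∀ t : S, (p * t * f)⁻¹ * (p * t * f) = f * (t⁻¹ * p * t) := by
      intro t
      rw [mul_inv_rev', inv_eq_self_of_idem hf, mul_inv_rev', inv_eq_self_of_idem hpp]
      calc f * (t⁻¹ * p) * (p * t * f) = f * (t⁻¹ * (p * p) * t) * f := by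
            simp only [_root_.mul_assoc]
        _ = f * (f * (t⁻¹ * p * t)) := by
            rw [hpp, _root_.mul_assoc, idem_comm (hq t) hf]
        _ = _ := by rw [← _root_.mul_assoc, hf]
    refine ⟨idem_mul hf (inv_mul_idem u'), ?_⟩
    rw [e1, e3, ← e4 u, ← e2, e4, e3]

/-- The kernel does not distinguish between the elements `κ ∈ fib e` and `b ∈ A` when they act from
the left. -/
lemma ker_isUnitIncl_mul {e v : S} {h : NatLE e 1} {κ : Γ.fib e} {b : A}
    (hb : Γ.IsUnitIncl h κ b) (hv : e * u = v) (ω : Γ.fib t) (η : Γ.fib u) (φ : StrongDual ℂ A) :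
    ker ω (Γ.mul hv κ η) φ = ker ω (lsmul b η) φ := by
  have he := h.idem
  -- both sides are supported on the ideal of the idempotent `q`, and `t f = u f` is equivalent to
  -- `t f = e u f` for `f ≤ q`; so both kernels may be computed over the set `F`
  set q := u⁻¹ * e * u with hq
  have hqq : q * q = q := inv_mul_idem_mul he u
  have huq : u * q = e * u := by
    calc u * q = u * u⁻¹ * e * u := by rw [hq]; simp only [_root_.mul_assoc]
      _ = e * (u * u⁻¹ * u) := by
          rw [idem_comm (mul_inv_idem u) he]; simp only [_root_.mul_assoc]
      _ = _ := by rw [mul_inv_mul_self]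
  set F : Set S := {f | f * f = f ∧ t * f = u * f ∧ e * u * f = u * f} with hF
  have hF1 : F ⊆ agree t v := fun f hf => ⟨hf.1, by rw [hf.2.1, ← hv, hf.2.2]⟩
  have hF2 : F ⊆ agree t u := fun f hf => ⟨hf.1, hf.2.1⟩
  have hF3 : F ⊆ agree u v := fun f hf => ⟨hf.1, by rw [← hv, hf.2.2]⟩
  have huqf : ∀ f, f * f = f → u * (f * q) = e * u * f := fun f hf => by
    rw [idem_comm hf hqq, ← _root_.mul_assoc, huq]
  have heuq : ∀ f, f * f = f → e * u * (f * q) = e * u * f := fun f hf => by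
    rw [_root_.mul_assoc, huqf f hf, ← _root_.mul_assoc, ← _root_.mul_assoc, he]
  rw [ker_eq_kerOn hF1 _ (e := q) hqq, ker_eq_kerOn hF2 _ (e := q) hqq]
  · refine multEval_congr (fun d hd => ?_) φ
    have h1 := rel_theta hF2 (rsmul_mem (lsmul b η) hd)
    refine (innerMult_eq_of_rel hF1 ω (x := Γ.theta F t u (rsmul (lsmul b η) d)) ?_)
    refine ⟨rel_left h1, rsmul_mem _ hd, fun f hf w h₁ h₂ lam => ?_⟩
    have h3 : u * f = w := by rw [← h₁, hf.2.1]
    have h4 : e * w = w := by rw [← h3, ← _root_.mul_assoc, hf.2.2]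
    simp only
    rw [rel_mul h1 hf h₁ h3, Γ.mul_balanced, Γ.mul_balanced, Γ.mul_lsmul_left,
      Γ.mul_assoc hv h₂ h3 h4, hb.mul_eq h4]
  · have h1 : star b * b ∈ Γ.sourceIdeal e := by
      rw [sourceIdeal_eq_rangeIdeal he]; exact ClosedIdeal.mul_mem_left _ _ hb.1
    have h2 := rinner_lsmul_mem hv h1 η η
    rw [mul_lsmul, rinner_lsmul, star_star] at h2
    have h3 := sourceIdeal_le_rangeIdeal h2
    rwa [← hv, inv_mul_of_idem_mul he] at h3
  · rintro f ⟨hf, hf'⟩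
    refine ⟨idem_mul hf hqq, ?_, by rw [heuq f hf, huqf f hf]⟩
    rw [← _root_.mul_assoc, hf', _root_.mul_assoc]
  · have h3 := sourceIdeal_le_rangeIdeal (rinner_mem_sourceIdeal (Γ.mul hv κ η) (Γ.mul hv κ η))
    have h4 : v⁻¹ * v = q := by rw [← hv, inv_mul_of_idem_mul he]
    rwa [h4] at h3
  · rintro f ⟨hf, hf'⟩
    refine ⟨idem_mul hf hqq, ?_, by rw [heuq f hf, huqf f hf]⟩
    rw [← _root_.mul_assoc, hf', huqf f hf, ← hv, _root_.mul_assoc (e * u), heuq f hf]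

end Action

namespace Action

open InverseMonoid HilbertBimodule

variable {S A : Type u} [InverseMonoid S] [NonUnitalCStarAlgebra A] {Γ : Action S A}
  {F : Set S} {t u s n : S}

/-! ### Positivity of the kernel -/

lemma rel_trans {x : Γ.fib t} {y : Γ.fib u} {z : Γ.fib s} (hF : F ⊆ agree t u)
    (h : (x, y) ∈ Γ.rel F t u) (h' : (y, z) ∈ Γ.rel F u s) : (x, z) ∈ Γ.rel F t s :=
  ⟨rel_left h, rel_right h', fun f hf v h₁ h₂ κ => by
    have h₃ : u * f = v := by rw [← (hF hf).2, h₁]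
    exact (rel_mul h hf h₁ h₃ κ).trans (rel_mul h' hf h₃ h₂ κ)⟩

/-- An element that is supported on the ideals of both `t ∼ u` and `u ∼ s` is supported on the ideal
of `t ∼ s`. -/
lemma mem_idealOf_agree_trans {a : A} (h : a ∈ Γ.idealOf (agree t u))
    (h' : a ∈ Γ.idealOf (agree u s)) : a ∈ Γ.idealOf (agree t s) := by
  refine mem_idealOf_inter (fun f hf => hf.1) (fun f hf => hf.1) ?_ h h'
  rintro f ⟨hf, hf'⟩ g ⟨hg, hg'⟩
  refine ⟨idem_mul hf hg, ?_⟩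
  rw [← _root_.mul_assoc, hf', _root_.mul_assoc, idem_comm hf hg, ← _root_.mul_assoc, hg',
    _root_.mul_assoc]

lemma ker_functional_sub (ξ : Γ.fib t) (η : Γ.fib u) (φ ψ : StrongDual ℂ A) :
    ker ξ η (φ - ψ) = ker ξ η φ - ker ξ η ψ := by
  have h := isMult_innerMult (Γ := Γ) (F := agree t u) subset_rfl ξ η
  have h1 : φ - ψ = φ + (-1 : ℂ) • ψ := by ext; simp [sub_eq_add_neg]
  rw [ker, kerOn, h1, h.multEval_functional_add, h.multEval_functional_smul]
  simp only [ker, kerOn]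
  ring

lemma ker_sub_right (ξ : Γ.fib t) (η η' : Γ.fib u) (φ : StrongDual ℂ A) :
    ker ξ (η - η') φ = ker ξ η φ - ker ξ η' φ := by
  have h : η - η' = η + (-1 : ℂ) • η' := by simp [sub_eq_add_neg]
  rw [h, ker_add_right, ker_smul_right]; ring

lemma ker_zero_right (ξ : Γ.fib t) (φ : StrongDual ℂ A) : ker ξ (0 : Γ.fib u) φ = 0 := by
  simpa using ker_sub_right ξ (0 : Γ.fib u) 0 φ

lemma ker_zero_left (η : Γ.fib u) (φ : StrongDual ℂ A) : ker (0 : Γ.fib t) η φ = 0 := by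
  simpa using ker_smul_left (0 : Γ.fib t) 0 η φ

lemma norm_innerMult_le (hF : F ⊆ agree t u) (ξ : Γ.fib t) (η : Γ.fib u) {d : A}
    (hd : d ∈ Γ.idealOf F) (hd1 : ‖d‖ ≤ 1) : ‖Γ.innerMult F ξ η d‖ ≤ 4 * (‖ξ‖ * ‖η‖) := by
  refine (norm_rinner_le _ _).trans ?_
  rw [norm_theta hF (rsmul_mem η hd)]
  gcongr
  exact (norm_rsmul_le η d).trans (mul_le_of_le_one_right (norm_nonneg _) hd1)

/-- If `x` is supported on the ideal of `n ∼ t`, then its inner product with `η` is supported on the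
ideal of `n ∼ u`, so that only the part `η a` of `η` matters if `a` is almost a unit for this ideal.
-/
lemma norm_ker_sub_rsmul_le {x : Γ.fib t} (hx : x ∈ Γ.fibMulIdeal (Γ.idealOf (agree n t)) t)
    (η : Γ.fib u) {a : A} {ψ : StrongDual ℂ A} {ε : ℝ} (hε : 0 ≤ ε)
    (h : ∀ c ∈ Γ.idealOf (agree n u), ‖ψ (c - c * a)‖ ≤ ε * ‖c‖) :
    ‖ker x (η - rsmul η a) ψ‖ ≤ ε * (4 * (‖x‖ * ‖η‖)) := by
  rw [ker_sub_right, ker_rsmul_right, ← ker_functional_sub]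
  refine (isMult_innerMult subset_rfl x η).norm_multEval_le _ fun d hd hd1 => ?_
  have h1 : Γ.innerMult (agree t u) x η d ∈ Γ.idealOf (agree n u) :=
    mem_idealOf_agree_trans (rinner_mem' hx _) ((isMult_innerMult subset_rfl x η).mem d hd)
  have h2 := h _ h1
  rw [map_sub] at h2
  refine h2.trans ?_
  gcongr
  exact norm_innerMult_le subset_rfl x η hd hd1

/-- The estimate `norm_ker_sub_rsmul_le` with the roles of the two variables exchanged. -/
lemma norm_ker_sub_rsmul_le' (ξ : Γ.fib t) {y : Γ.fib u}
    (hy : y ∈ Γ.fibMulIdeal (Γ.idealOf (agree n u)) u) {a : A} (ha : star a = a)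
    {ψ : StrongDual ℂ A} {ε : ℝ} (hε : 0 ≤ ε)
    (h : ∀ c ∈ Γ.idealOf (agree n t), ‖ψ (c - a * c)‖ ≤ ε * ‖c‖) :
    ‖ker (ξ - rsmul ξ a) y ψ‖ ≤ ε * (4 * (‖ξ‖ * ‖y‖)) := by
  refine (isMult_innerMult subset_rfl _ y).norm_multEval_le _ fun d hd hd1 => ?_
  have hr := rel_theta (Γ := Γ) (F := agree t u) (t := t) subset_rfl (rsmul_mem y hd)
  have h0 : Γ.innerMult (agree t u) ξ y d ∈ Γ.idealOf (agree n u) := by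
    refine rinner_mem ξ ?_
    rw [mem_fibMulIdeal_iff, rel_rinner subset_rfl hr hr]
    exact rinner_mem _ (rsmul_mem_of_mem hy d)
  have h1 : Γ.innerMult (agree t u) ξ y d ∈ Γ.idealOf (agree n t) := by
    have h1 : Γ.innerMult (agree t u) ξ y d ∈ Γ.idealOf (agree u t) := by
      rw [agree_symm (t := u)]
      exact (isMult_innerMult subset_rfl ξ y).mem d hd
    exact mem_idealOf_agree_trans h0 h1
  have h2 : Γ.innerMult (agree t u) (ξ - rsmul ξ a) y d
      = Γ.innerMult (agree t u) ξ y d - a * Γ.innerMult (agree t u) ξ y d := by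
    simp only [innerMult, map_sub, LinearMap.sub_apply, rinner_rsmul_left, ha]
  rw [h2]
  refine (h _ h1).trans ?_
  gcongr
  exact norm_innerMult_le subset_rfl ξ y hd hd1

/-- The kernel on elements that are identified with elements of a common fibre. -/
lemma ker_eq_of_rel_of_rel {y : Γ.fib n} {a : Γ.fib t} {y' : Γ.fib n} {a' : Γ.fib u}
    (h : (y, a) ∈ Γ.rel (agree n t) n t) (h' : (y', a') ∈ Γ.rel (agree n u) n u)
    (φ : StrongDual ℂ A) : ker a a' φ = φ (rinner y y') := by
  have hc : rinner y y' ∈ Γ.idealOf (agree t u) := by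
    refine mem_idealOf_agree_trans (u := n) ?_ (rinner_mem y (rel_left h'))
    rw [agree_symm]
    exact rinner_mem' (rel_left h) y'
  refine multEval_eq_apply hc (fun d hd => ?_) φ
  -- by support considerations, all identifications may be made over `H`, where they compose
  set H : Set S := {f | f * f = f ∧ n * f = t * f ∧ t * f = u * f} with hH
  have hr := rel_theta (Γ := Γ) (F := agree t u) (t := t) subset_rfl (rsmul_mem a' hd)
  have hr' := rel_rsmul h' d
  have hsupp : rsmul a' d ∈ Γ.fibMulIdeal (Γ.idealOf H) u := by
    rw [mem_fibMulIdeal_iff]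
    refine mem_idealOf_inter (F := agree n u) (G := agree t u) (fun f hf => hf.1)
      (fun f hf => hf.1) ?_ (rinner_mem _ (rel_right hr')) (rinner_mem _ (rel_right hr))
    rintro f ⟨hf, hf'⟩ g ⟨hg, hg'⟩
    have e1 : n * (f * g) = u * (f * g) := by rw [← _root_.mul_assoc, hf', _root_.mul_assoc]
    have e2 : t * (f * g) = u * (f * g) := by
      rw [idem_comm hf hg, ← _root_.mul_assoc, hg', _root_.mul_assoc]
    exact ⟨idem_mul hf hg, e1.trans e2.symm, e2⟩
  have h1 := rel_of_mem (F := H) (G := agree t u) (fun f hf => ⟨hf.1, hf.2.2⟩) subset_rfl hr hsupp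
  have h2 := rel_of_mem (F := H) (G := agree n u)
    (fun f hf => ⟨hf.1, hf.2.1.trans hf.2.2⟩) subset_rfl hr' hsupp
  have h3 : (rsmul y' d, _) ∈ Γ.rel H n t :=
    rel_trans (fun f hf => ⟨hf.1, hf.2.1.trans hf.2.2⟩) h2 (rel_symm h1)
  have h4 := rel_mono (G := agree n t) (fun f hf => ⟨hf.1, hf.2.1⟩) subset_rfl h3
  rw [innerMult, ← rel_rinner subset_rfl h h4, rinner_rsmul]

lemma rel_self (ξ : Γ.fib t) : (ξ, ξ) ∈ Γ.rel (agree t t) t t := by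
  have h : ξ ∈ Γ.fibMulIdeal (Γ.idealOf (agree t t)) t := by
    rw [mem_fibMulIdeal_iff]
    have hm : t⁻¹ * t ∈ agree t t := ⟨inv_mul_idem t, rfl⟩
    exact rangeIdeal_le_idealOf hm (sourceIdeal_le_rangeIdeal (rinner_mem_sourceIdeal ξ ξ))
  exact ⟨h, h, fun f _ v h₁ h₂ κ => rfl⟩

lemma nonneg_of_forall_approx {z : ℂ} {K : ℝ} (hK : 0 ≤ K)
    (h : ∀ ε : ℝ, 0 < ε → ∃ p : ℂ, 0 ≤ p ∧ ‖z - p‖ ≤ ε * K) : 0 ≤ z := by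
  have : z ∈ closure (Set.Ici (0 : ℂ)) := by
    rw [Metric.mem_closure_iff]
    intro ε hε
    obtain ⟨p, hp, hz⟩ := h (ε / (K + 1)) (by positivity)
    refine ⟨p, hp, ?_⟩
    rw [dist_eq_norm]
    refine hz.trans_lt ?_
    rw [div_mul_eq_mul_div, div_lt_iff₀ (by positivity)]
    nlinarith
  rwa [isClosed_Ici.closure_eq] at this

/-- The kernel is positive definite. By induction: for a fibre `n`, split each `ξ j` into its part
supported on the ideal of `n ∼ j`, which is identified with an element of `fib n`, and the rest.
The mixed terms vanish in the limit. -/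
theorem ker_sum_nonneg {ψ : StrongDual ℂ A} (hψ : IsPositive ψ) (I : Finset S) :
    ∀ ξ : ∀ t, Γ.fib t, 0 ≤ ∑ i ∈ I, ∑ j ∈ I, ker (ξ i) (ξ j) ψ := by
  classical
  induction I using Finset.induction_on with
  | empty => intro ξ; simp
  | insert n I hn ih =>
    intro ξ
    refine nonneg_of_forall_approx (K := ∑ i ∈ insert n I, ∑ j ∈ insert n I, 8 * (‖ξ i‖ * ‖ξ j‖))
      (Finset.sum_nonneg fun i _ => Finset.sum_nonneg fun j _ => by positivity) fun ε hε => ?_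
    have hu : ∀ j, ∃ e : A, IsGoodUnit e ∧ e ∈ Γ.idealOf (agree n j) ∧
        ∀ c ∈ Γ.idealOf (agree n j), ‖ψ (c - c * e)‖ ≤ ε * ‖c‖ := by
      intro j
      have hg := (Γ.idealOf (agree n j)).isGood_approxUnit
      obtain ⟨e, he⟩ := (hg.good.and (hg.eventually_norm_apply_sub_mul_le ψ hε)).exists
      exact ⟨e, he.1, e.2, he.2⟩
    choose e heg hem hec using hu
    have hec' : ∀ j, ∀ c ∈ Γ.idealOf (agree n j), ‖ψ (c - e j * c)‖ ≤ ε * ‖c‖ := by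
      intro j c hc
      have h1 := hec j (star c) (star_mem hc)
      have h2 : star c - star c * e j = star (c - e j * c) := by
        rw [star_sub, star_mul, (heg j).star_eq]
      rwa [h2, hψ.apply_star, RCLike.norm_conj, norm_star] at h1
    -- `a j` is almost the part of `ξ j` supported on the ideal of `n ∼ j`, and `b j` is the rest;
    -- as `b n = 0`, the induction hypothesis applies to `b`
    let a : ∀ j, Γ.fib j := Function.update (fun j => rsmul (ξ j) (e j)) n (ξ n)
    let b : ∀ j, Γ.fib j := Function.update (fun j => ξ j - rsmul (ξ j) (e j)) n 0
    have han : a n = ξ n := Function.update_self _ _ _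
    have hbn : b n = 0 := Function.update_self _ _ _
    have haj : ∀ j, j ≠ n → a j = rsmul (ξ j) (e j) := fun j hj => Function.update_of_ne hj _ _
    have hbj : ∀ j, j ≠ n → b j = ξ j - rsmul (ξ j) (e j) := fun j hj =>
      Function.update_of_ne hj _ _
    have hab : ∀ j, ξ j = a j + b j := by
      intro j
      rcases eq_or_ne j n with rfl | hj
      · rw [han, hbn, add_zero]
      · rw [haj j hj, hbj j hj]; abel
    have hna : ∀ j, ‖a j‖ ≤ ‖ξ j‖ := by
      intro j
      rcases eq_or_ne j n with rfl | hj
      · rw [han]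
      · rw [haj j hj]
        exact (norm_rsmul_le _ _).trans (mul_le_of_le_one_right (norm_nonneg _) (heg j).norm_le)
    have hy : ∀ j, ∃ y : Γ.fib n, (y, a j) ∈ Γ.rel (agree n j) n j := by
      intro j
      rcases eq_or_ne j n with rfl | hj
      · exact ⟨_, rel_self _⟩
      · rw [haj j hj]
        exact exists_rel subset_rfl (rsmul_mem _ (hem j))
    choose y hy using hy
    have hcr : ∀ i j, ‖ker (a i) (b j) ψ‖ ≤ ε * (4 * (‖ξ i‖ * ‖ξ j‖)) := by
      intro i j
      rcases eq_or_ne j n with rfl | hj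
      · rw [hbn, ker_zero_right, norm_zero]; positivity
      · rw [hbj j hj]
        refine (norm_ker_sub_rsmul_le (rel_right (hy i)) (ξ j) hε.le (hec j)).trans ?_
        gcongr
        exact hna i
    have hcl : ∀ i j, ‖ker (b i) (a j) ψ‖ ≤ ε * (4 * (‖ξ i‖ * ‖ξ j‖)) := by
      intro i j
      rcases eq_or_ne i n with rfl | hi
      · rw [hbn, ker_zero_left, norm_zero]; positivity
      · rw [hbj i hi]
        refine (norm_ker_sub_rsmul_le' (ξ i) (rel_right (hy j)) (heg i).star_eq hε.le
          (hec' i)).trans ?_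
        gcongr
        exact hna j
    -- each `a j` corresponds to `y j ∈ fib n`, so the sum for `a` is `ψ ⟨∑ y j, ∑ y j⟩`
    have hQa : ∑ i ∈ insert n I, ∑ j ∈ insert n I, ker (a i) (a j) ψ
        = ψ (rinner (∑ i ∈ insert n I, y i) (∑ j ∈ insert n I, y j)) := by
      simp only [map_sum, LinearMap.sum_apply]
      rw [Finset.sum_comm]
      exact Finset.sum_congr rfl fun i _ => Finset.sum_congr rfl fun j _ =>
        ker_eq_of_rel_of_rel (hy j) (hy i) ψ
    have hQb : ∑ i ∈ insert n I, ∑ j ∈ insert n I, ker (b i) (b j) ψ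
        = ∑ i ∈ I, ∑ j ∈ I, ker (b i) (b j) ψ := by
      simp only [Finset.sum_insert hn, hbn, ker_zero_left, ker_zero_right, zero_add,
        Finset.sum_const_zero]
    refine ⟨∑ i ∈ insert n I, ∑ j ∈ insert n I, ker (a i) (a j) ψ +
      ∑ i ∈ insert n I, ∑ j ∈ insert n I, ker (b i) (b j) ψ, add_nonneg ?_ ?_, ?_⟩
    · rw [hQa]
      obtain ⟨c, hc⟩ := rinner_self_nonneg (A := A) (∑ i ∈ insert n I, y i)
      rw [hc]
      exact hψ c
    · rw [hQb]; exact ih b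
    · have hQ : ∑ i ∈ insert n I, ∑ j ∈ insert n I, ker (ξ i) (ξ j) ψ -
          (∑ i ∈ insert n I, ∑ j ∈ insert n I, ker (a i) (a j) ψ +
          ∑ i ∈ insert n I, ∑ j ∈ insert n I, ker (b i) (b j) ψ)
          = ∑ i ∈ insert n I, ∑ j ∈ insert n I, (ker (a i) (b j) ψ + ker (b i) (a j) ψ) := by
        simp only [← Finset.sum_add_distrib, ← Finset.sum_sub_distrib]
        refine Finset.sum_congr rfl fun i _ => Finset.sum_congr rfl fun j _ => ?_
        rw [hab i, hab j, ker_add_right, ker_add_left, ker_add_left]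
        ring
      rw [hQ, Finset.mul_sum]
      refine (norm_sum_le _ _).trans (Finset.sum_le_sum fun i _ => ?_)
      rw [Finset.mul_sum]
      refine (norm_sum_le _ _).trans (Finset.sum_le_sum fun j _ => ?_)
      refine (norm_add_le _ _).trans ((add_le_add (hcr i j) (hcl i j)).trans (le_of_eq (by ring)))

end Action

/-- If `‖a‖ ≤ 1`, then `1 - a⋆ a = (1 - y)²` for some self-adjoint `y`. -/
lemma exists_one_sub_sq {A : Type u} [NonUnitalCStarAlgebra A] {a : A} (ha : ‖a‖ ≤ 1) :
    ∃ y : A, star y = y ∧ star a * a = y + y - y * y := by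
  have hsa : IsSelfAdjoint (star a * a) := IsSelfAdjoint.star_mul_self a
  have hn : ‖star a * a‖ ≤ 1 := by
    rw [CStarRing.norm_star_mul_self]
    exact mul_le_one₀ ha (norm_nonneg _) ha
  set f : ℝ → ℝ := fun x => 1 - Real.sqrt (1 - x) with hf
  have hfc : Continuous f := by fun_prop
  have hf0 : f 0 = 0 := by simp [hf]
  refine ⟨cfcₙ f (star a * a), (cfcₙ_predicate f (star a * a)).star_eq, ?_⟩
  rw [← cfcₙ_add f f _ hfc.continuousOn hf0 hfc.continuousOn hf0,
    ← cfcₙ_mul f f _ hfc.continuousOn hf0 hfc.continuousOn hf0,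
    ← cfcₙ_sub _ _ _ (by fun_prop) (by simp [hf0]) (by fun_prop) (by simp [hf0])]
  conv_lhs => rw [← cfcₙ_id' ℝ (star a * a)]
  refine cfcₙ_congr fun x hx => ?_
  have hx1 : x ≤ 1 := (le_abs_self x).trans
    ((NonUnitalIsometricContinuousFunctionalCalculus.norm_quasispectrum_le
      (star a * a) hx hsa).trans hn)
  have h1 : Real.sqrt (1 - x) * Real.sqrt (1 - x) = 1 - x :=
    Real.mul_self_sqrt (by linarith)
  simp only [hf]
  linear_combination h1

namespace Action

open InverseMonoid HilbertBimodule

variable {S A : Type u} [InverseMonoid S] [NonUnitalCStarAlgebra A]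

/-! ### The representation of an action defined by a positive definite kernel -/

/-- A positive definite kernel on the disjoint union of the fibres of an action, such that the
fibres of the action act on the resulting Hilbert space by left multiplication. The last condition
says that elements of fibres over idempotents act like their images in `A`. -/
structure PosKernel (Γ : Action S A) where
  form : ∀ t u, Γ.fib t →ₗ⋆[ℂ] Γ.fib u →ₗ[ℂ] ℂ
  sum_nonneg : ∀ (I : Finset S) (ξ : ∀ t, Γ.fib t), 0 ≤ ∑ i ∈ I, ∑ j ∈ I, form i j (ξ i) (ξ j)
  form_mul_mul : ∀ {s t u t' u' : S} (ht : s * t = t') (hu : s * u = u') (ξ ξ' : Γ.fib s)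
    (η : Γ.fib t) (η' : Γ.fib u), form t' u' (Γ.mul ht ξ η) (Γ.mul hu ξ' η')
      = form t u η (lsmul (rinner (A := A) ξ ξ') η')
  form_isUnitIncl_mul : ∀ {e t u v : S} {h : NatLE e 1} {κ : Γ.fib e} {b : A},
    Γ.IsUnitIncl h κ b → ∀ (hv : e * u = v) (ω : Γ.fib t) (η : Γ.fib u),
      form t v ω (Γ.mul hv κ η) = form t u ω (lsmul b η)

variable (Γ : Action S A)

open Classical in
/-- The algebraic direct sum of the fibres. -/
abbrev Alg : Type u := Π₀ t, Γ.fib t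

variable {Γ}

open Classical in
/-- The element of the algebraic direct sum given by an element of a fibre. -/
noncomputable def incl (t : S) : Γ.fib t →ₗ[ℂ] Γ.Alg := DFinsupp.lsingle t

lemma alg_induction {p : Γ.Alg → Prop} (v : Γ.Alg) (add : ∀ v w, p v → p w → p (v + w))
    (zero : p 0) (single : ∀ t ξ, p (incl t ξ)) : p v := by
  classical
  exact DFinsupp.induction v zero fun t ξ w _ _ hw => add _ _ (single t ξ) hw

open Classical in
lemma alg_eq_sum (v : Γ.Alg) : ∑ t ∈ DFinsupp.support v, incl t (v t) = v := by
  conv_rhs => rw [← DFinsupp.sum_single (f := v)]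
  rfl

open Classical in
/-- The linear map on the algebraic direct sum given by linear maps on the fibres. -/
noncomputable def algLift {N : Type*} [AddCommGroup N] [Module ℂ N]
    (f : ∀ t, Γ.fib t →ₗ[ℂ] N) : Γ.Alg →ₗ[ℂ] N := DFinsupp.lsum ℂ f

lemma algLift_incl {N : Type*} [AddCommGroup N] [Module ℂ N] (f : ∀ t, Γ.fib t →ₗ[ℂ] N) (t : S)
    (ξ : Γ.fib t) : algLift f (incl t ξ) = f t ξ := by
  classical
  exact DFinsupp.lsum_single (S := ℂ) f t ξ

lemma algHom_ext {N : Type*} [AddCommGroup N] [Module ℂ N] {f g : Γ.Alg →ₗ[ℂ] N}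
    (h : ∀ t ξ, f (incl t ξ) = g (incl t ξ)) : f = g :=
  LinearMap.ext fun v => alg_induction (p := fun v => f v = g v) v (fun v w hv hw => by
    rw [map_add, map_add, hv, hw])
    (by rw [map_zero, map_zero]) h

namespace PosKernel

variable (k : PosKernel Γ)

/-- The map `v ↦ k(ξ, v)` on the algebraic direct sum. -/
noncomputable def formRight (t : S) (ξ : Γ.fib t) : Γ.Alg →ₗ[ℂ] ℂ :=
  algLift fun u => k.form t u ξ

lemma formRight_incl (t u : S) (ξ : Γ.fib t) (η : Γ.fib u) :
    k.formRight t ξ (incl u η) = k.form t u ξ η := algLift_incl _ u η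

open Classical in
/-- The form given by the kernel, as an additive map in the first variable. -/
noncomputable def algFormAdd : Γ.Alg →+ (Γ.Alg →ₗ[ℂ] ℂ) :=
  DFinsupp.sumAddHom fun t =>
    { toFun := k.formRight t
      map_zero' := algHom_ext fun u η => by rw [formRight_incl]; simp
      map_add' := fun ξ ξ' => algHom_ext fun u η => by
        rw [LinearMap.add_apply, formRight_incl, formRight_incl, formRight_incl]
        simp }

lemma algFormAdd_incl (t : S) (ξ : Γ.fib t) : k.algFormAdd (incl t ξ) = k.formRight t ξ := by
  classical
  exact DFinsupp.sumAddHom_single _ t ξ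

/-- The sesquilinear form on the algebraic direct sum given by the kernel. -/
noncomputable def algForm : Γ.Alg →ₗ⋆[ℂ] Γ.Alg →ₗ[ℂ] ℂ :=
  { k.algFormAdd with
    map_smul' := by
      intro c v
      change k.algFormAdd (c • v) = conj c • k.algFormAdd v
      refine alg_induction (p := fun v => k.algFormAdd (c • v) = conj c • k.algFormAdd v) v ?_ ?_ ?_
      · intro v w hv hw
        rw [smul_add, map_add, map_add, hv, hw, smul_add]
      · simp
      · intro t ξ
        rw [← map_smul, algFormAdd_incl, algFormAdd_incl]
        refine algHom_ext fun u η => ?_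
        simp [formRight_incl] }

lemma algForm_incl (t u : S) (ξ : Γ.fib t) (η : Γ.fib u) :
    k.algForm (incl t ξ) (incl u η) = k.form t u ξ η := by
  rw [← formRight_incl, ← algFormAdd_incl]
  rfl

lemma algForm_nonneg (v : Γ.Alg) : 0 ≤ k.algForm v v := by
  classical
  have h : k.algForm v v = ∑ i ∈ DFinsupp.support v, ∑ j ∈ DFinsupp.support v,
      k.form i j (v i) (v j) := by
    conv_lhs => rw [← alg_eq_sum v]
    simp only [map_sum, LinearMap.sum_apply, algForm_incl]
    rw [Finset.sum_comm]
  rw [h]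
  exact k.sum_nonneg _ v

end PosKernel

/-- Left multiplication by `ξ ∈ fib t` on the algebraic direct sum. -/
noncomputable def algMul (t : S) (ξ : Γ.fib t) : Γ.Alg →ₗ[ℂ] Γ.Alg :=
  algLift fun u => (incl (t * u)).comp (Γ.mul rfl ξ)

lemma incl_congr {t u v : S} (h : t * u = v) (ξ : Γ.fib t) (η : Γ.fib u) :
    incl (t * u) (Γ.mul rfl ξ η) = incl v (Γ.mul h ξ η) := by subst h; rfl

lemma algMul_incl {t u v : S} (h : t * u = v) (ξ : Γ.fib t) (η : Γ.fib u) :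
    algMul t ξ (incl u η) = incl v (Γ.mul h ξ η) := by
  rw [algMul, algLift_incl, LinearMap.comp_apply, incl_congr h]

/-- Left multiplication by `a ∈ A` on the algebraic direct sum. -/
noncomputable def algLsmul (a : A) : Γ.Alg →ₗ[ℂ] Γ.Alg :=
  algLift fun u => (incl u).comp (lsmul a)

lemma algLsmul_incl (a : A) (u : S) (η : Γ.fib u) :
    algLsmul a (incl u η) = incl u (lsmul a η) := by
  rw [algLsmul, algLift_incl, LinearMap.comp_apply]

lemma algLsmul_smul (c : ℂ) (a : A) (v : Γ.Alg) : algLsmul (c • a) v = c • algLsmul a v := by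
  rw [← LinearMap.smul_apply]
  refine LinearMap.congr_fun (algHom_ext fun u η => ?_) v
  simp [algLsmul_incl]

lemma algLsmul_add (a b : A) (v : Γ.Alg) : algLsmul (a + b) v = algLsmul a v + algLsmul b v := by
  rw [← LinearMap.add_apply]
  refine LinearMap.congr_fun (algHom_ext fun u η => ?_) v
  simp [algLsmul_incl]

lemma algLsmul_sub (a b : A) (v : Γ.Alg) : algLsmul (a - b) v = algLsmul a v - algLsmul b v := by
  rw [← LinearMap.sub_apply]
  refine LinearMap.congr_fun (algHom_ext fun u η => ?_) v
  simp [algLsmul_incl]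

namespace PosKernel

variable (k : PosKernel Γ)

lemma form_lsmul_lsmul (t u : S) (a b : A) (η : Γ.fib t) (η' : Γ.fib u) :
    k.form t u (lsmul a η) (lsmul b η') = k.form t u η (lsmul (star a * b) η') := by
  rw [← Γ.unit_mul (one_mul t), ← Γ.unit_mul (one_mul u), k.form_mul_mul, Γ.rinner_unit]

lemma algForm_algMul (t : S) (ξ ξ' : Γ.fib t) (v w : Γ.Alg) :
    k.algForm (algMul t ξ v) (algMul t ξ' w) = k.algForm v (algLsmul (rinner (A := A) ξ ξ') w) := by
  refine alg_induction (p := fun v => k.algForm (algMul t ξ v) (algMul t ξ' w)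
    = k.algForm v (algLsmul (rinner (A := A) ξ ξ') w)) v ?_ (by simp) ?_
  · intro v w hv hw
    simp only [map_add, LinearMap.add_apply, hv, hw]
  · intro u η
    refine alg_induction (p := fun w => k.algForm (algMul t ξ (incl u η)) (algMul t ξ' w)
      = k.algForm (incl u η) (algLsmul (rinner (A := A) ξ ξ') w)) w ?_ (by simp) ?_
    · intro v w hv hw
      simp only [map_add, hv, hw]
    · intro u' η'
      rw [algMul_incl rfl, algMul_incl rfl, algLsmul_incl, algForm_incl, algForm_incl,
        k.form_mul_mul]

lemma algForm_algLsmul (a b : A) (v w : Γ.Alg) :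
    k.algForm (algLsmul a v) (algLsmul b w) = k.algForm v (algLsmul (star a * b) w) := by
  refine alg_induction (p := fun v => k.algForm (algLsmul a v) (algLsmul b w)
    = k.algForm v (algLsmul (star a * b) w)) v ?_ (by simp) ?_
  · intro v w hv hw
    simp only [map_add, LinearMap.add_apply, hv, hw]
  · intro u η
    refine alg_induction (p := fun w => k.algForm (algLsmul a (incl u η)) (algLsmul b w)
      = k.algForm (incl u η) (algLsmul (star a * b) w)) w ?_ (by simp) ?_
    · intro v w hv hw
      simp only [map_add, hv, hw]
    · intro u' η'
      rw [algLsmul_incl, algLsmul_incl, algLsmul_incl, algForm_incl, algForm_incl,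
        k.form_lsmul_lsmul]

section bound

variable {K : Type u} [NormedAddCommGroup K] [InnerProductSpace ℂ K]
  {j : Γ.Alg →ₗ[ℂ] K} (hj : ∀ v w, inner ℂ (j v) (j w) = k.algForm v w)
include hj

/-- Writing `1 - a⋆ a = (1 - y)²`, one has `‖a v‖² = ‖v‖² - ‖(1 - y) v‖²`; as `A` need not be
unital, the identity is multiplied out. -/
lemma norm_algLsmul_le_of_norm_le {a : A} (ha : ‖a‖ ≤ 1) (v : Γ.Alg) :
    ‖j (algLsmul a v)‖ ≤ ‖j v‖ := by
  obtain ⟨y, hy, hay⟩ := exists_one_sub_sq ha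
  refine le_of_sq_le_sq ?_ (norm_nonneg _)
  have h1 : ‖j (algLsmul a v)‖ ^ 2 = 2 * (inner ℂ (j v) (j (algLsmul y v))).re
      - ‖j (algLsmul y v)‖ ^ 2 := by
    have e1 := inner_self_eq_norm_sq (𝕜 := ℂ) (j (algLsmul a v))
    have e2 := inner_self_eq_norm_sq (𝕜 := ℂ) (j (algLsmul y v))
    rw [hj, algForm_algLsmul] at e1 e2
    rw [hay, algLsmul_sub, algLsmul_add, map_sub, map_add, map_sub, map_add] at e1
    rw [hy] at e2
    rw [← e1, ← e2, hj]
    simp only [RCLike.re_to_complex]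
    ring
  have h2 := norm_sub_sq (𝕜 := ℂ) (j v) (j (algLsmul y v))
  have h3 := sq_nonneg ‖j v - j (algLsmul y v)‖
  rw [h1]
  simp only [RCLike.re_to_complex] at h2
  linarith

lemma norm_algLsmul_le (a : A) (v : Γ.Alg) : ‖j (algLsmul a v)‖ ≤ ‖a‖ * ‖j v‖ := by
  rcases eq_or_ne a 0 with rfl | ha
  · have : algLsmul (0 : A) v = 0 := by simpa using algLsmul_smul 0 (0 : A) v
    simp [this]
  · have h0 : 0 < ‖a‖ := norm_pos_iff.mpr ha
    have h1 : ‖((‖a‖⁻¹ : ℝ) : ℂ) • a‖ ≤ 1 := by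
      rw [norm_smul, Complex.norm_real, norm_inv, norm_norm, inv_mul_cancel₀ h0.ne']
    have h2 := k.norm_algLsmul_le_of_norm_le hj h1 v
    rw [algLsmul_smul, map_smul, norm_smul, Complex.norm_real, norm_inv, norm_norm,
      inv_mul_le_iff₀ h0] at h2
    exact h2

lemma norm_algMul_le (t : S) (ξ : Γ.fib t) (v : Γ.Alg) : ‖j (algMul t ξ v)‖ ≤ ‖ξ‖ * ‖j v‖ := by
  refine le_of_sq_le_sq ?_ (by positivity)
  have e1 := inner_self_eq_norm_sq (𝕜 := ℂ) (j (algMul t ξ v))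
  rw [hj, algForm_algMul, ← hj] at e1
  rw [← e1]
  refine (RCLike.re_le_norm _).trans ((norm_inner_le_norm _ _).trans ?_)
  calc ‖j v‖ * ‖j (algLsmul (rinner (A := A) ξ ξ) v)‖
      ≤ ‖j v‖ * (‖rinner (A := A) ξ ξ‖ * ‖j v‖) := by
        gcongr; exact k.norm_algLsmul_le hj _ v
    _ = _ := by rw [norm_rinner_self]; ring

end bound

/-- The Gelfand–Naimark–Segal construction for a positive definite kernel: left multiplication on
the direct sum of the fibres extends to a representation on the Hilbert space of the kernel. The
form identity of the kernel is the relation for the right inner product; the relation for the left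
inner product then follows, because the kernel respects the inclusions of the fibres over
idempotents. -/
theorem exists_rep : ∃ (K : Type u) (_ : NormedAddCommGroup K) (_ : InnerProductSpace ℂ K)
    (_ : CompleteSpace K) (j : Γ.Alg →ₗ[ℂ] K) (ρ : Rep Γ (K →L[ℂ] K)), DenseRange j ∧
    (∀ v w, inner ℂ (j v) (j w) = k.algForm v w) ∧
    ∀ (t : S) (ξ : Γ.fib t) (v : Γ.Alg), ρ.map t ξ (j v) = j (algMul t ξ v) := by
  obtain ⟨K, i1, i2, i3, j, hd, hj⟩ := exists_hilbertSpace_of_form k.algForm k.algForm_nonneg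
  have hext : ∀ {T T' : K →L[ℂ] K}, (∀ t ξ, T (j (incl t ξ)) = T' (j (incl t ξ))) → T = T' := by
    intro T T' h
    have h1 : (T : K →ₗ[ℂ] K).comp j = (T' : K →ₗ[ℂ] K).comp j := algHom_ext h
    refine ContinuousLinearMap.ext fun x => ?_
    exact congrFun (hd.equalizer T.continuous T'.continuous
      (funext fun v => LinearMap.congr_fun h1 v)) x
  have hin : ∀ {x y : K}, (∀ t ξ, inner ℂ (j (incl t ξ)) x = inner ℂ (j (incl t ξ)) y) →
      x = y := by
    intro x y h
    refine ext_inner_left ℂ fun z => ?_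
    refine hd.induction_on (p := fun z => inner ℂ z x = inner ℂ z y) z
      (isClosed_eq (by fun_prop) (by fun_prop)) fun v => ?_
    exact alg_induction (p := fun v => inner ℂ (j v) x = inner ℂ (j v) y) v
      (fun v w hv hw => by rw [map_add, inner_add_left, inner_add_left, hv, hw]) (by simp) h
  let op : ∀ t, Γ.fib t → (K →L[ℂ] K) := fun t ξ => (j.comp (algMul t ξ)).extendOfNorm j
  have hop : ∀ t ξ v, op t ξ (j v) = j (algMul t ξ v) := fun t ξ v =>
    LinearMap.extendOfNorm_eq hd ⟨‖ξ‖, k.norm_algMul_le hj t ξ⟩ v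
  have hopn : ∀ t ξ, ‖op t ξ‖ ≤ ‖ξ‖ := fun t ξ =>
    LinearMap.opNorm_extendOfNorm_le hd (norm_nonneg _) (k.norm_algMul_le hj t ξ)
  have hopi : ∀ {t u v : S} (h : t * u = v) (ξ : Γ.fib t) (η : Γ.fib u),
      op t ξ (j (incl u η)) = j (incl v (Γ.mul h ξ η)) := fun h ξ η => by
    rw [hop, algMul_incl h]
  let opL : ∀ t, Γ.fib t →ₗ[ℂ] (K →L[ℂ] K) := fun t =>
    { toFun := op t
      map_add' := fun ξ ξ' => hext fun u η => by
        rw [hopi rfl, add_apply, hopi rfl, hopi rfl]; simp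
      map_smul' := fun c ξ => hext fun u η => by
        rw [hopi rfl, RingHom.id_apply, smul_apply, hopi rfl]; simp }
  have hopc : ∀ t, Continuous (op t) := fun t =>
    AddMonoidHomClass.continuous_of_bound (opL t) 1 fun ξ => by rw [one_mul]; exact hopn _ ξ
  have hmul : ∀ {t u v : S} (h : t * u = v) (ξ : Γ.fib t) (η : Γ.fib u),
      op v (Γ.mul h ξ η) = op t ξ * op u η := fun {t u v} h ξ η => hext fun s ζ => by
    change _ = op t ξ (op u η _)
    rw [hopi rfl, hopi rfl, hopi (t := t) (u := u * s) (v := v * s)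
      (by rw [← h, _root_.mul_assoc]), Γ.mul_assoc h rfl rfl]
  have hone : ∀ (a : A) (t : S) (η : Γ.fib t),
      op 1 (Γ.unit a) (j (incl t η)) = j (incl t (lsmul a η)) := fun a t η => by
    rw [hopi (one_mul t), Γ.unit_mul]
  have hrinner : ∀ (t : S) (ξ η : Γ.fib t),
      star (op t ξ) * op t η = op 1 (Γ.unit (rinner ξ η)) := fun t ξ η => hext fun u ζ =>
    hin fun u' ζ' => by
      change inner ℂ _ (star (op t ξ) (op t η _)) = _
      rw [ContinuousLinearMap.star_eq_adjoint,
        ContinuousLinearMap.adjoint_inner_right, hopi rfl, hopi rfl, hone, hj, hj, algForm_incl,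
        algForm_incl, k.form_mul_mul]
  have hunitMul : ∀ (a : A) (t : S) (ξ : Γ.fib t),
      op 1 (Γ.unit a) * op t ξ = op t (lsmul a ξ) := fun a t ξ => by
    rw [← hmul (one_mul t), Γ.unit_mul]
  have hmulUnit : ∀ (a : A) (t : S) (ξ : Γ.fib t),
      op t ξ * op 1 (Γ.unit a) = op t (rsmul ξ a) := fun a t ξ => by
    rw [← hmul (mul_one t), Γ.mul_unit]
  have hincl : ∀ {e : S} (h : NatLE e 1) (κ : Γ.fib e) (b : A), Γ.IsUnitIncl h κ b →
      op e κ = op 1 (Γ.unit b) := fun h κ b hb => hext fun u η => by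
    rw [hopi rfl, hone]
    refine hin fun t ω => ?_
    rw [hj, hj, algForm_incl, algForm_incl, k.form_isUnitIncl_mul hb]
  have hlinner : ∀ (t : S) (ξ η : Γ.fib t),
      op t ξ * star (op t η) = op 1 (Γ.unit (linner ξ η)) := by
    intro t ξ η
    -- `T` kills the range of `fib t`, hence that of `fib (t t⁻¹)`, which acts like the ideal
    -- `r(fib (t t⁻¹))`; this ideal contains the left inner products of `fib t`, so that `T T⋆ = 0`
    set T : K →L[ℂ] K := op t ξ * star (op t η) - op 1 (Γ.unit (linner ξ η)) with hT
    have hT1 : ∀ ζ : Γ.fib t, T * op t ζ = 0 := by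
      intro ζ
      rw [hT, sub_mul, _root_.mul_assoc, hrinner, hmulUnit, hunitMul, linner_lsmul_eq, sub_self]
    have hT2 : ∀ x : Γ.fib (t * t⁻¹), T * op (t * t⁻¹) x = 0 := by
      intro x
      refine Γ.dense_induction (t := t) (u := t⁻¹) rfl
        (P := LinearMap.ker ((LinearMap.mulLeft ℂ T).comp (opL (t * t⁻¹)))) ?_ ?_ x
      · exact isClosed_singleton.preimage ((continuous_const_mul T).comp (hopc (t * t⁻¹)))
      · intro ζ κ
        change T * op (t * t⁻¹) (Γ.mul rfl ζ κ) = 0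
        rw [hmul, ← _root_.mul_assoc, hT1, zero_mul]
    have hT3 : ∀ a ∈ Γ.rangeIdeal (t * t⁻¹), T * op 1 (Γ.unit a) = 0 := by
      intro a ha
      obtain ⟨κ, hκ⟩ := exists_isUnitIncl_of_mem (natLE_one_iff.mpr (mul_inv_idem t)) ha
      rw [← hincl _ κ a hκ, hT2]
    -- the relation for the right inner products only says that `op 1` respects the involution on
    -- products, which suffices by approximation
    have hstar : star (op 1 (Γ.unit (linner ξ η))) = op 1 (Γ.unit (linner η ξ)) := by
      have h1 : ∀ a b : A, star (op 1 (Γ.unit a)) * op 1 (Γ.unit b)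
          = op 1 (Γ.unit (star a * b)) := fun a b => by rw [hrinner, Γ.rinner_unit]
      have h2 : ∀ a b : A, star (op 1 (Γ.unit (star a * b))) = op 1 (Γ.unit (star b * a)) :=
        fun a b => by rw [← h1, star_mul, star_star, h1]
      have hc : Continuous fun a : A => op 1 (Γ.unit a) := (hopc 1).comp Γ.continuous_unit
      have hu := (Γ.rangeIdeal t).isGood_approxUnit.isApproximateUnit.tendsto_coe_mul
        (linner_mem_rangeIdeal ξ η)
      refine tendsto_nhds_unique ((continuous_star.comp hc).tendsto _ |>.comp hu) ?_
      rw [← star_linner ξ η]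
      refine ((hc.comp continuous_star).tendsto _ |>.comp hu).congr fun e => ?_
      simp only [Function.comp_apply]
      rw [← star_star (e : A), h2, star_mul, star_star]
    have hTT : T * star T = 0 := by
      conv_lhs => rw [hT, star_sub, star_mul, star_star, hstar, ← hT]
      rw [mul_sub, ← _root_.mul_assoc, hT1, zero_mul, zero_sub, neg_eq_zero]
      exact hT3 _ (rangeIdeal_le_mul_inv (linner_mem_rangeIdeal _ _))
    exact sub_eq_zero.mp ((CStarRing.mul_star_self_eq_zero_iff T).mp hTT)
  exact ⟨K, i1, i2, i3, j, ⟨opL, hmul, hrinner, hlinner⟩, hd, hj, hop⟩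

end PosKernel

end Action

namespace Action

open InverseMonoid HilbertBimodule

variable {S A : Type u} [InverseMonoid S] [NonUnitalCStarAlgebra A] {Γ : Action S A}

/-! ### The C⋆-algebra generated by a representation -/

namespace Rep

variable {B : Type v} [NonUnitalCStarAlgebra B] (ρ : Rep Γ B)

lemma continuous_map (t : S) : Continuous (ρ.map t) :=
  AddMonoidHomClass.continuous_of_bound (ρ.map t) 1 fun ξ => by
    rw [one_mul]; exact ρ.norm_map_le t ξ

lemma map_unit_mul {t : S} (a : A) (ξ : Γ.fib t) :
    ρ.map 1 (Γ.unit a) * ρ.map t ξ = ρ.map t (lsmul a ξ) := by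
  rw [← ρ.map_mul (one_mul t), Γ.unit_mul]

lemma map_mul_unit {t : S} (ξ : Γ.fib t) (a : A) :
    ρ.map t ξ * ρ.map 1 (Γ.unit a) = ρ.map t (rsmul ξ a) := by
  rw [← ρ.map_mul (mul_one t), Γ.mul_unit]

lemma map_unit_mul_unit (a b : A) :
    ρ.map 1 (Γ.unit a) * ρ.map 1 (Γ.unit b) = ρ.map 1 (Γ.unit (a * b)) := by
  rw [map_unit_mul, Γ.lsmul_unit]

lemma continuous_map_unit : Continuous fun a : A => ρ.map 1 (Γ.unit a) :=
  (ρ.continuous_map 1).comp Γ.continuous_unit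

/-- A representation cannot distinguish between an element of a fibre over an idempotent and its
image in `A`. -/
lemma map_isUnitIncl {e : S} {h : NatLE e 1} {κ : Γ.fib e} {b : A} (hb : Γ.IsUnitIncl h κ b) :
    ρ.map e κ = ρ.map 1 (Γ.unit b) := by
  -- `X` kills `ρ (fib e)`, hence the ideal `r(fib e)`, which acts nondegenerately on `κ` and `b`
  set X := ρ.map e κ - ρ.map 1 (Γ.unit b) with hX
  have hX1 : ∀ ζ : Γ.fib e, X * ρ.map e ζ = 0 := by
    intro ζ
    rw [hX, sub_mul, ← ρ.map_mul h.idem, map_unit_mul, hb.2, sub_self]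
  have hX2 : ∀ a ∈ Γ.rangeIdeal e, X * ρ.map 1 (Γ.unit a) = 0 := by
    intro a ha
    refine (ClosedIdeal.generated_induction (p := fun a => X * ρ.map 1 (Γ.unit a) = 0 ∧
      ∀ x, X * ρ.map 1 (Γ.unit (x * a)) = 0) ?_ ?_ ?_ ?_ ?_ ?_ ?_ ha).1
    · simp
    · rintro a b ⟨h1, h2⟩ ⟨h3, h4⟩
      refine ⟨by rw [map_add, map_add, mul_add, h1, h3, add_zero], fun x => ?_⟩
      rw [mul_add, map_add, map_add, mul_add, h2, h4, add_zero]
    · rintro c a ⟨h1, h2⟩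
      refine ⟨by rw [map_smul, map_smul, mul_smul_comm, h1, smul_zero], fun x => ?_⟩
      rw [mul_smul_comm, map_smul, map_smul, mul_smul_comm, h2, smul_zero]
    · have hc := ρ.continuous_map_unit
      rw [Set.ofPred_and, Set.ofPred_forall]
      exact (isClosed_singleton.preimage (hc.const_mul X)).inter (isClosed_iInter fun x =>
        isClosed_singleton.preimage ((hc.comp (continuous_const_mul x)).const_mul X))
    · rintro y a ⟨h1, h2⟩
      exact ⟨h2 y, fun x => by rw [← _root_.mul_assoc]; exact h2 _⟩
    · rintro y a ⟨h1, h2⟩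
      refine ⟨by rw [← map_unit_mul_unit, ← _root_.mul_assoc, h1, zero_mul], fun x => ?_⟩
      rw [← _root_.mul_assoc, ← map_unit_mul_unit, ← _root_.mul_assoc, h2, zero_mul]
    · rintro _ ⟨ζ, ζ', rfl⟩
      refine ⟨by rw [← ρ.map_linner, ← _root_.mul_assoc, hX1, zero_mul], fun x => ?_⟩
      rw [← linner_lsmul, ← ρ.map_linner, ← _root_.mul_assoc, hX1, zero_mul]
  have h1 : Tendsto (fun d : Γ.rangeIdeal e => ρ.map e (rsmul κ (d : A)))
      (Γ.rangeIdeal e).approxUnit (𝓝 (ρ.map e κ)) :=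
    ((ρ.continuous_map e).tendsto κ).comp (tendsto_rsmul (rinner_mem_rangeIdeal h.idem κ κ))
  have h2 : Tendsto (fun d : Γ.rangeIdeal e => ρ.map 1 (Γ.unit (b * d)))
      (Γ.rangeIdeal e).approxUnit (𝓝 (ρ.map 1 (Γ.unit b))) :=
    (ρ.continuous_map_unit.tendsto b).comp
      ((Γ.rangeIdeal e).isGood_approxUnit.isApproximateUnit.tendsto_mul_coe hb.1)
  refine tendsto_nhds_unique h1 (h2.congr fun d => ?_)
  rw [← map_mul_unit, ← map_unit_mul_unit, ← sub_eq_zero, ← sub_mul, ← neg_sub, neg_mul,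
    ← hX, hX2 d d.2, neg_zero]

/-- The adjoint of `ρ (ξ)`, `ξ ∈ fib t`, is a limit of elements of `ρ (fib t⁻¹)`. -/
lemma star_map_mem (t : S) (ξ : Γ.fib t) :
    star (ρ.map t ξ) ∈ (LinearMap.range (ρ.map t⁻¹)).topologicalClosure := by
  set R := (LinearMap.range (ρ.map t⁻¹)).topologicalClosure with hR
  have hRc : IsClosed (R : Set B) := Submodule.isClosed_topologicalClosure _
  have h1 : ∀ ζ : Γ.fib (t * t⁻¹), star (ρ.map t ξ) * ρ.map (t * t⁻¹) ζ ∈ R := by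
    intro ζ
    refine Γ.dense_induction (t := t) (u := t⁻¹) rfl (P := R.comap
      ((LinearMap.mulLeft ℂ (star (ρ.map t ξ))).comp (ρ.map (t * t⁻¹)))) ?_ ?_ ζ
    · exact hRc.preimage ((ρ.continuous_map _).const_mul _)
    · intro ξ' κ
      change star (ρ.map t ξ) * ρ.map (t * t⁻¹) (Γ.mul rfl ξ' κ) ∈ R
      rw [ρ.map_mul, ← _root_.mul_assoc, ρ.map_rinner, map_unit_mul]
      exact Submodule.le_topologicalClosure _ ⟨_, rfl⟩
  have h2 : ∀ a ∈ Γ.rangeIdeal (t * t⁻¹), star (ρ.map t ξ) * ρ.map 1 (Γ.unit a) ∈ R := by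
    intro a ha
    obtain ⟨κ, hκ⟩ := exists_isUnitIncl_of_mem (natLE_one_iff.mpr (mul_inv_idem t)) ha
    rw [← ρ.map_isUnitIncl hκ]
    exact h1 κ
  have hl : linner (A := A) ξ ξ ∈ Γ.rangeIdeal (t * t⁻¹) :=
    rangeIdeal_le_mul_inv (linner_mem_rangeIdeal ξ ξ)
  refine hRc.mem_of_tendsto (((continuous_star.comp (ρ.continuous_map t)).tendsto ξ).comp
    (tendsto_lsmul hl)) (Eventually.of_forall fun e => ?_)
  simp only [Function.comp_apply]
  have h3 : star (ρ.map 1 (Γ.unit (e : A))) = ρ.map 1 (Γ.unit (star (e : A))) :=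
    (map_star ρ.unitHom (e : A)).symm
  rw [← map_unit_mul, star_mul, h3]
  exact h2 _ (star_mem e.2)

/-- The linear map on the algebraic direct sum of the fibres given by a representation. -/
noncomputable def algMap : Γ.Alg →ₗ[ℂ] B := algLift ρ.map

lemma algMap_incl (t : S) (ξ : Γ.fib t) : ρ.algMap (incl t ξ) = ρ.map t ξ := algLift_incl _ t ξ

lemma map_mul_algMap (t : S) (ξ : Γ.fib t) (v : Γ.Alg) :
    ρ.map t ξ * ρ.algMap v = ρ.algMap (algMul t ξ v) := by
  have : (LinearMap.mulLeft ℂ (ρ.map t ξ)).comp ρ.algMap = ρ.algMap.comp (algMul t ξ) :=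
    algHom_ext fun u η => by
      simp only [LinearMap.comp_apply, LinearMap.mulLeft_apply]
      rw [algMap_incl, algMul_incl rfl, algMap_incl, ρ.map_mul]
  exact LinearMap.congr_fun this v

/-- The closure of the span of the ranges of the maps of a representation is a C⋆-algebra. -/
noncomputable def generated : NonUnitalStarSubalgebra ℂ B where
  __ := (LinearMap.range ρ.algMap).topologicalClosure
  mul_mem' {a b} ha hb := by
    set R := (LinearMap.range ρ.algMap).topologicalClosure with hR
    have hRc : IsClosed (R : Set B) := Submodule.isClosed_topologicalClosure _
    change a * b ∈ R
    have h1 : ∀ v w, ρ.algMap v * ρ.algMap w ∈ R := by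
      intro v w
      refine alg_induction (p := fun v => ρ.algMap v * ρ.algMap w ∈ R) v ?_ ?_ ?_
      · intro v v' hv hv'
        rw [map_add, add_mul]; exact R.add_mem hv hv'
      · rw [map_zero, zero_mul]; exact R.zero_mem
      · intro t ξ
        rw [algMap_incl, map_mul_algMap]
        exact Submodule.le_topologicalClosure _ ⟨_, rfl⟩
    have h2 : ∀ v, ∀ b ∈ R, ρ.algMap v * b ∈ R := by
      intro v b hb
      have : R ≤ R.comap (LinearMap.mulLeft ℂ (ρ.algMap v)) :=
        Submodule.topologicalClosure_minimal _ (by rintro _ ⟨w, rfl⟩; exact h1 v w)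
          (hRc.preimage (continuous_const_mul _))
      exact this hb
    have : R ≤ R.comap (LinearMap.mulRight ℂ b) :=
      Submodule.topologicalClosure_minimal _ (by rintro _ ⟨w, rfl⟩; exact h2 w b hb)
        (hRc.preimage (continuous_mul_const _))
    exact this ha
  star_mem' {a} ha := by
    set R := (LinearMap.range ρ.algMap).topologicalClosure with hR
    have hRc : IsClosed (R : Set B) := Submodule.isClosed_topologicalClosure _
    change star a ∈ R
    have h1 : ∀ v, star (ρ.algMap v) ∈ R := by
      intro v
      refine alg_induction (p := fun v => star (ρ.algMap v) ∈ R) v ?_ ?_ ?_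
      · intro v v' hv hv'
        rw [map_add, star_add]; exact R.add_mem hv hv'
      · rw [map_zero, star_zero]; exact R.zero_mem
      · intro t ξ
        rw [algMap_incl]
        refine Submodule.topologicalClosure_mono ?_ (ρ.star_map_mem t ξ)
        rintro _ ⟨η, rfl⟩
        exact ⟨incl _ η, ρ.algMap_incl _ η⟩
    refine closure_minimal (t := star ⁻¹' (R : Set B)) ?_ (hRc.preimage continuous_star) ha
    rintro _ ⟨v, rfl⟩
    exact h1 v

lemma isClosed_generated : IsClosed (ρ.generated : Set B) :=
  Submodule.isClosed_topologicalClosure _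

lemma map_mem_generated (t : S) (ξ : Γ.fib t) : ρ.map t ξ ∈ ρ.generated :=
  subset_closure ⟨incl t ξ, ρ.algMap_incl t ξ⟩

end Rep

/-! ### The algebraic direct sum of the fibres is dense in the full crossed product -/

variable (Γ) in
/-- The inclusion of the full crossed product into the product of all representations. -/
noncomputable def fullVal : Γ.Full →⋆ₙₐ[ℂ] Γ.RepProd where
  toFun x := x.1
  map_smul' _ _ := rfl
  map_zero' := rfl
  map_add' _ _ := rfl
  map_mul' _ _ := rfl
  map_star' _ := rfl

lemma isClosedEmbedding_fullVal : IsClosedEmbedding Γ.fullVal :=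
  (NonUnitalStarSubalgebra.isClosed_topologicalClosure
    (NonUnitalStarAlgebra.adjoin ℂ {x | ∃ t ξ, x = Γ.prodRep t ξ})).isClosedEmbedding_subtypeVal

variable (Γ) in
/-- A closed star subalgebra that contains the images of the fibres is the full crossed product. -/
lemma full_eq_top {D : NonUnitalStarSubalgebra ℂ Γ.Full} (hD : IsClosed (D : Set Γ.Full))
    (h : ∀ t ξ, Γ.delta t ξ ∈ D) (x : Γ.Full) : x ∈ D := by
  have h1 : Γ.fullSubalgebra ≤ D.map Γ.fullVal := by
    refine NonUnitalStarSubalgebra.topologicalClosure_minimal _ ?_ ?_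
    · refine NonUnitalStarAlgebra.adjoin_le ?_
      rintro _ ⟨t, ξ, rfl⟩
      exact ⟨Γ.delta t ξ, h t ξ, rfl⟩
    · exact isClosedEmbedding_fullVal.isClosedMap _ hD
  obtain ⟨y, hy, hyx⟩ := h1 x.2
  have : y = x := Subtype.ext hyx
  exact this ▸ hy

variable (Γ) in
/-- The canonical map from the algebraic direct sum of the fibres to the full crossed product. -/
noncomputable abbrev toFull : Γ.Alg →ₗ[ℂ] Γ.Full := Γ.deltaRep.algMap

lemma toFull_incl (t : S) (ξ : Γ.fib t) : Γ.toFull (incl t ξ) = Γ.delta t ξ :=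
  Γ.deltaRep.algMap_incl t ξ

variable (Γ) in
lemma denseRange_toFull : DenseRange Γ.toFull := fun x =>
  Γ.full_eq_top Γ.deltaRep.isClosed_generated Γ.deltaRep.map_mem_generated x

lemma continuous_starHom {B : Type*} {C : Type*} [NonUnitalCStarAlgebra B]
    [NonUnitalCStarAlgebra C] (f : B →⋆ₙₐ[ℂ] C) : Continuous f :=
  AddMonoidHomClass.continuous_of_bound f 1 fun x => by
    rw [one_mul]; exact NonUnitalStarAlgHom.norm_apply_le f x

lemma integrate_toFull {B : Type u} [NonUnitalCStarAlgebra B] (ρ : Rep Γ B) (v : Γ.Alg) :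
    integrate ρ (Γ.toFull v) = ρ.algMap v := by
  have : ((integrate ρ : Γ.Full →⋆ₙₐ[ℂ] B) : Γ.Full →ₗ[ℂ] B).comp Γ.toFull = ρ.algMap :=
    algHom_ext fun t ξ => by
      rw [LinearMap.comp_apply, toFull_incl, ρ.algMap_incl]; rfl
  exact LinearMap.congr_fun this v

/-- Bounded linear maps on the full crossed product are determined by their values on the fibres. -/
lemma full_ext {N : Type*} [AddCommGroup N] [Module ℂ N] [TopologicalSpace N] [T2Space N]
    {f g : Γ.Full →ₗ[ℂ] N} (hf : Continuous f) (hg : Continuous g)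
    (h : ∀ t ξ, f (Γ.delta t ξ) = g (Γ.delta t ξ)) (x : Γ.Full) : f x = g x := by
  have : f.comp Γ.toFull = g.comp Γ.toFull := algHom_ext fun t ξ => by
    rw [LinearMap.comp_apply, LinearMap.comp_apply, toFull_incl, h]
  exact congrFun (Γ.denseRange_toFull.equalizer hf hg
    (funext fun v => LinearMap.congr_fun this v)) x

end Action

/-- Positive functionals separate the elements of a C⋆-algebra. -/
lemma eq_zero_of_forall_isPositive {B : Type*} [NonUnitalCStarAlgebra B] {z : B}
    (h : ∀ τ : StrongDual ℂ B, IsPositive τ → τ (star z * z) = 0) : z = 0 := by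
  refine SeparatingDual.eq_zero_of_forall_dual_eq_zero (R := ℂ) fun φ => ?_
  obtain ⟨τ, hτ, -, hle⟩ := exists_isPositive_dominating φ
  have h1 := hle z
  rw [h τ hτ, Complex.zero_re] at h1
  have h2 : ‖φ z‖ = 0 := by nlinarith [norm_nonneg (φ z)]
  exact norm_eq_zero.mp h2

/-- The C⋆-algebra `B` as an ideal in itself. -/
def ClosedIdeal.whole (B : Type u) [NonUnitalCStarAlgebra B] : ClosedIdeal B where
  __ := (⊤ : Submodule ℂ B)
  isClosed' := isClosed_univ
  mul_mem_left' _ _ _ := trivial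
  mul_mem_right' _ _ _ := trivial

/-- A `⋆`-homomorphism as a linear map. -/
def starHomLinear {B C : Type*} [NonUnitalCStarAlgebra B] [NonUnitalCStarAlgebra C]
    (f : B →⋆ₙₐ[ℂ] C) : B →ₗ[ℂ] C where
  toFun := f
  map_add' := map_add f
  map_smul' := map_smul f

namespace Action

open InverseMonoid HilbertBimodule

variable {S A : Type u} [InverseMonoid S] [NonUnitalCStarAlgebra A] {Γ : Action S A}

/-! ### Representations built from positive functionals -/

/-- The positive definite kernel `τ (f (ξ)⋆ f (η))` for a positive functional `τ`. -/
noncomputable def PosKernel.ofMaps {B : Type v} [NonUnitalCStarAlgebra B] (τ : StrongDual ℂ B)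
    (hτ : IsPositive τ) (f : ∀ t, Γ.fib t →ₗ[ℂ] B)
    (h1 : ∀ {s t u t' u' : S} (ht : s * t = t') (hu : s * u = u') (ξ ξ' : Γ.fib s)
      (η : Γ.fib t) (η' : Γ.fib u), star (f t' (Γ.mul ht ξ η)) * f u' (Γ.mul hu ξ' η')
        = star (f t η) * f u (lsmul (rinner (A := A) ξ ξ') η'))
    (h2 : ∀ {e u v : S} {h : NatLE e 1} {κ : Γ.fib e} {b : A}, Γ.IsUnitIncl h κ b →
      ∀ (hv : e * u = v) (η : Γ.fib u), f v (Γ.mul hv κ η) = f u (lsmul b η)) :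
    PosKernel Γ where
  form t u := LinearMap.mk₂'ₛₗ (starRingEnd ℂ) (RingHom.id ℂ)
    (fun ξ η => τ (star (f t ξ) * f u η)) (by simp [add_mul])
    (by simp [smul_mul_assoc]) (by simp [mul_add]) (by simp [mul_smul_comm])
  sum_nonneg I ξ := by
    simp only [LinearMap.mk₂'ₛₗ_apply]
    have := hτ (∑ i ∈ I, f i (ξ i))
    rwa [star_sum, Finset.sum_mul_sum, map_sum, Finset.sum_congr rfl fun _ _ => map_sum τ _ _]
      at this
  form_mul_mul ht hu ξ ξ' η η' := congrArg τ (h1 ht hu ξ ξ' η η')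
  form_isUnitIncl_mul hb hv ω η := congrArg (fun x => τ (star _ * x)) (h2 hb hv η)

/-- The Gelfand–Naimark–Segal representation for the kernel `τ (f (ξ)⋆ f (η))`. -/
lemma exists_rep_ofMaps {B : Type v} [NonUnitalCStarAlgebra B] (τ : StrongDual ℂ B)
    (hτ : IsPositive τ) (f : ∀ t, Γ.fib t →ₗ[ℂ] B)
    (h1 : ∀ {s t u t' u' : S} (ht : s * t = t') (hu : s * u = u') (ξ ξ' : Γ.fib s)
      (η : Γ.fib t) (η' : Γ.fib u), star (f t' (Γ.mul ht ξ η)) * f u' (Γ.mul hu ξ' η')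
        = star (f t η) * f u (lsmul (rinner (A := A) ξ ξ') η'))
    (h2 : ∀ {e u v : S} {h : NatLE e 1} {κ : Γ.fib e} {b : A}, Γ.IsUnitIncl h κ b →
      ∀ (hv : e * u = v) (η : Γ.fib u), f v (Γ.mul hv κ η) = f u (lsmul b η)) :
    ∃ (K : Type u) (_ : NormedAddCommGroup K) (_ : InnerProductSpace ℂ K)
      (_ : CompleteSpace K) (j : Γ.Alg →ₗ[ℂ] K) (ρ : Rep Γ (K →L[ℂ] K)), DenseRange j ∧
      (∀ v w, inner ℂ (j v) (j w) = τ (star (algLift f v) * algLift f w)) ∧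
      ∀ (t : S) (ξ : Γ.fib t) (v : Γ.Alg), ρ.map t ξ (j v) = j (algMul t ξ v) := by
  obtain ⟨K, i1, i2, i3, j, ρ, hd, hj, hρ⟩ := (PosKernel.ofMaps τ hτ f h1 h2).exists_rep
  refine ⟨K, i1, i2, i3, j, ρ, hd, fun v w => ?_, hρ⟩
  rw [hj]
  set k := PosKernel.ofMaps τ hτ f h1 h2 with hk
  refine alg_induction (p := fun v => k.algForm v w = τ (star (algLift f v) * algLift f w)) v
    (fun v v' hv hv' => ?_) (by simp) fun t ξ => ?_
  · rw [map_add, LinearMap.add_apply, hv, hv', map_add, star_add, add_mul, map_add]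
  · refine alg_induction (p := fun w => k.algForm (incl t ξ) w
      = τ (star (algLift f (incl t ξ)) * algLift f w)) w
      (fun v v' hv hv' => ?_) (by simp) fun u η => ?_
    · rw [map_add, hv, hv', map_add, mul_add, map_add]
    · rw [k.algForm_incl, algLift_incl, algLift_incl]; rfl

/-! ### The sequence of full crossed products -/

lemma full_induction {P : Submodule ℂ Γ.Full} (hP : IsClosed (P : Set Γ.Full))
    (h : ∀ t ξ, Γ.delta t ξ ∈ P) (x : Γ.Full) : x ∈ P := by
  refine Γ.denseRange_toFull.induction_on (p := fun x => x ∈ P) x hP fun v => ?_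
  refine alg_induction (p := fun v => Γ.toFull v ∈ P) v (fun v w hv hw => ?_) ?_ fun t ξ => ?_
  · rw [map_add]; exact P.add_mem hv hw
  · rw [map_zero]; exact P.zero_mem
  · rw [toFull_incl]; exact h t ξ

lemma full_starHom_ext {C : Type*} [NonUnitalCStarAlgebra C] {f g : Γ.Full →⋆ₙₐ[ℂ] C}
    (h : ∀ t ξ, f (Γ.delta t ξ) = g (Γ.delta t ξ)) (x : Γ.Full) : f x = g x :=
  full_ext (f := starHomLinear f) (g := starHomLinear g) (continuous_starHom f)
    (continuous_starHom g) h x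

variable {I : ClosedIdeal A} (hI : Γ.IsInvariant I)

/-- An element of `fib t · I` as an element of the fibre of the restricted action. -/
def restrictMk {t : S} (ξ : Γ.fib t) (h : ξ ∈ Γ.fibMulIdeal I t) : (Γ.restrictIdeal I hI).fib t :=
  (⟨ξ, h⟩ : Γ.fibMulIdeal I t)

lemma inclHom_map_mem {t : S} (ξ : (Γ.restrictIdeal I hI).fib t) :
    (Γ.inclHom I hI).map t ξ ∈ Γ.fibMulIdeal I t :=
  Subtype.property (p := fun x => x ∈ Γ.fibMulIdeal I t) ξ

lemma quotHom_full_surjective : Function.Surjective (Γ.quotHom I hI).full := by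
  intro y
  let P : Submodule ℂ (Γ.restrictQuot I hI).Full :=
    LinearMap.range (starHomLinear (Γ.quotHom I hI).full)
  have hP : IsClosed (P : Set (Γ.restrictQuot I hI).Full) :=
    isClosed_range_starHom (Γ.quotHom I hI).full
  refine full_induction hP ?_ y
  intro t
  refine quot_ind fun ξ => ?_
  exact ⟨Γ.delta t ξ, rfl⟩

lemma quotHom_full_inclHom_full (x : (Γ.restrictIdeal I hI).Full) :
    (Γ.quotHom I hI).full ((Γ.inclHom I hI).full x) = 0 := by
  let f : (Γ.restrictIdeal I hI).Full →⋆ₙₐ[ℂ] (Γ.restrictQuot I hI).Full :=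
    (Γ.quotHom I hI).full.comp (Γ.inclHom I hI).full
  refine full_ext (f := starHomLinear f) (g := 0)
    (continuous_starHom f) continuous_const (fun t ξ => ?_) x
  have h : Γ.quotMk I t ((Γ.inclHom I hI).map t ξ) = 0 :=
    quotMk_eq_zero.mpr (inclHom_map_mem hI ξ)
  change (Γ.restrictQuot I hI).delta t (Γ.quotMk I t ((Γ.inclHom I hI).map t ξ)) = 0
  rw [h]; exact map_zero _

/-- The range of `ι ⋊ S`. -/
noncomputable def rangeIncl : ClosedIdeal Γ.Full where
  __ := LinearMap.range (starHomLinear (Γ.inclHom I hI).full)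
  isClosed' := isClosed_range_starHom (Γ.inclHom I hI).full
  mul_mem_left' a := by
    rintro _ ⟨x, rfl⟩
    set f : (Γ.restrictIdeal I hI).Full →ₗ[ℂ] Γ.Full := starHomLinear (Γ.inclHom I hI).full with hf
    have hR : IsClosed (LinearMap.range f : Set Γ.Full) :=
      isClosed_range_starHom (Γ.inclHom I hI).full
    have hfc : Continuous f := continuous_starHom (Γ.inclHom I hI).full
    change a * f x ∈ LinearMap.range f
    refine full_induction (P := (LinearMap.range f).comap (LinearMap.mulRight ℂ (f x)))
      (hR.preimage (continuous_mul_const _)) (fun t ξ => ?_) a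
    change Γ.delta t ξ * f x ∈ LinearMap.range f
    refine full_induction (P := ((LinearMap.range f).comap
      (LinearMap.mulLeft ℂ (Γ.delta t ξ))).comap f)
      (hR.preimage ((continuous_const_mul _).comp hfc)) (fun u η => ?_) x
    refine ⟨(Γ.restrictIdeal I hI).delta (t * u)
      (restrictMk hI (Γ.mul rfl ξ ((Γ.inclHom I hI).map u η))
        (mul_mem rfl ξ (inclHom_map_mem hI η))), ?_⟩
    exact Γ.deltaRep.map_mul rfl ξ ((Γ.inclHom I hI).map u η)
  mul_mem_right' a := by
    rintro _ ⟨x, rfl⟩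
    set f : (Γ.restrictIdeal I hI).Full →ₗ[ℂ] Γ.Full := starHomLinear (Γ.inclHom I hI).full with hf
    have hR : IsClosed (LinearMap.range f : Set Γ.Full) :=
      isClosed_range_starHom (Γ.inclHom I hI).full
    have hfc : Continuous f := continuous_starHom (Γ.inclHom I hI).full
    change f x * a ∈ LinearMap.range f
    refine full_induction (P := (LinearMap.range f).comap (LinearMap.mulLeft ℂ (f x)))
      (hR.preimage (continuous_const_mul _)) (fun t ξ => ?_) a
    change f x * Γ.delta t ξ ∈ LinearMap.range f
    refine full_induction (P := ((LinearMap.range f).comap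
      (LinearMap.mulRight ℂ (Γ.delta t ξ))).comap f)
      (hR.preimage ((continuous_mul_const _).comp hfc)) (fun u η => ?_) x
    refine ⟨(Γ.restrictIdeal I hI).delta (u * t)
      (restrictMk hI (Γ.mul rfl ((Γ.inclHom I hI).map u η) ξ)
        (mul_mem' hI rfl (inclHom_map_mem hI η) ξ)), ?_⟩
    exact Γ.deltaRep.map_mul rfl ((Γ.inclHom I hI).map u η) ξ

lemma mem_rangeIncl {x : Γ.Full} :
    x ∈ rangeIncl hI ↔ ∃ y, (Γ.inclHom I hI).full y = x := Iff.rfl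

/-- A representation that vanishes on `fib t · I` for all `t` factors through the restriction of the
action to `A / I`. -/
noncomputable def Rep.quotLift {B : Type v} [NonUnitalCStarAlgebra B] (ρ : Rep Γ B)
    (h : ∀ t, ∀ ξ ∈ Γ.fibMulIdeal I t, ρ.map t ξ = 0) : Rep (Γ.restrictQuot I hI) B where
  map t := (Γ.fibMulIdeal I t).liftQ (ρ.map t) (h t)
  map_mul hv := quot_ind fun ξ => quot_ind fun η => ρ.map_mul hv ξ η
  map_rinner t := quot_ind fun ξ => quot_ind fun η => ρ.map_rinner t ξ η
  map_linner t := quot_ind fun ξ => quot_ind fun η => ρ.map_linner t ξ η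

/-- Exactness of the sequence of full crossed products in the middle: a positive functional on
`(A ⋊ S) / (I ⋊ S)` gives a representation of the action that vanishes on `fib t · I` and hence
factors through the action on `A / I`. -/
theorem mem_rangeIncl_of_quotHom_full_eq_zero {x : Γ.Full} (hx : (Γ.quotHom I hI).full x = 0) :
    x ∈ rangeIncl hI := by
  set J := rangeIncl hI with hJ
  let q : Γ.Full →⋆ₙₐ[ℂ] J.Quot := J.mkHom
  have hq0 : ∀ y, q y = 0 ↔ y ∈ J := fun y => ClosedIdeal.Quot.mk_eq_zero
  have hqs : Function.Surjective q := ClosedIdeal.Quot.mk_surjective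
  let f : ∀ t, Γ.fib t →ₗ[ℂ] J.Quot := fun t => (starHomLinear q).comp (Γ.delta t)
  have hf : ∀ t ξ, f t ξ = q (Γ.deltaRep.map t ξ) := fun t ξ => rfl
  have hfI : ∀ t, ∀ ξ ∈ Γ.fibMulIdeal I t, f t ξ = 0 := fun t ξ hξ =>
    (hq0 _).mpr ⟨(Γ.restrictIdeal I hI).delta t (restrictMk hI ξ hξ), rfl⟩
  have hF : ∀ v, algLift f v = q (Γ.toFull v) := fun v => by
    have : algLift f = (starHomLinear q).comp Γ.toFull := algHom_ext fun t ξ => by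
      rw [algLift_incl]
      change q (Γ.delta t ξ) = q (Γ.toFull (incl t ξ))
      rw [toFull_incl]
    rw [this]; rfl
  have key : ∀ τ : StrongDual ℂ J.Quot, IsPositive τ → ∀ v w,
      τ (star (q (Γ.toFull v)) * (q x * q (Γ.toFull w))) = 0 := by
    intro τ hτ v w
    obtain ⟨K, i1, i2, i3, j, ρ, hd, hj, hρ⟩ := exists_rep_ofMaps τ hτ f
      (fun ht hu ξ ξ' η η' => by
        simp only [hf]
        rw [Γ.deltaRep.map_mul, Γ.deltaRep.map_mul, ← Rep.map_unit_mul, ← Γ.deltaRep.map_rinner,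
          ← map_star, ← map_star, ← map_mul, ← map_mul, star_mul]
        simp only [_root_.mul_assoc])
      (fun hb hv η => by
        simp only [hf]
        rw [Γ.deltaRep.map_mul, Γ.deltaRep.map_isUnitIncl hb, Rep.map_unit_mul])
    have hρ0 : ∀ t, ∀ ξ ∈ Γ.fibMulIdeal I t, ρ.map t ξ = 0 := by
      intro t ξ hξ
      have h1 : ∀ w, ρ.map t ξ (j w) = 0 := by
        intro w
        rw [hρ, ← inner_self_eq_zero (𝕜 := ℂ), hj]
        have : algLift f (algMul t ξ w) = 0 := by
          refine alg_induction (p := fun w => algLift f (algMul t ξ w) = 0) w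
            (fun v w hv hw => by rw [map_add, map_add, hv, hw, add_zero]) (by simp) fun u η => ?_
          rw [algMul_incl rfl, algLift_incl]
          exact hfI _ _ (mul_mem' hI rfl hξ η)
        rw [this, mul_zero, map_zero]
      exact ContinuousLinearMap.ext fun y => hd.induction_on (p := fun y => ρ.map t ξ y = 0) y
        (isClosed_singleton.preimage (ρ.map t ξ).continuous) h1
    let σ : (Γ.restrictQuot I hI).Full →⋆ₙₐ[ℂ] (K →L[ℂ] K) := integrate (ρ.quotLift hI hρ0)
    let σ' : Γ.Full →⋆ₙₐ[ℂ] (K →L[ℂ] K) := integrate ρ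
    have h1 : σ' x = 0 := by
      have : σ' x = σ ((Γ.quotHom I hI).full x) :=
        full_starHom_ext (f := σ') (g := σ.comp (Γ.quotHom I hI).full) (fun t ξ => rfl) x
      rw [this, hx, map_zero]
    let g1 : Γ.Full →ₗ[ℂ] ℂ :=
      { toFun := fun y => inner ℂ (j v) (σ' y (j w))
        map_add' := fun y z => by rw [map_add, add_apply, inner_add_right]
        map_smul' := fun c y => by
          rw [map_smul, smul_apply, inner_smul_right]; rfl }
    let g2 : Γ.Full →ₗ[ℂ] ℂ :=
      { toFun := fun y => τ (star (q (Γ.toFull v)) * (q y * q (Γ.toFull w)))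
        map_add' := fun y z => by rw [map_add, add_mul, mul_add, map_add]
        map_smul' := fun c y => by rw [map_smul, smul_mul_assoc, mul_smul_comm, map_smul]; rfl }
    have h2 : g1 x = g2 x := by
      have hσc := continuous_starHom σ'
      have hqc := continuous_starHom q
      refine full_ext ?_ ?_ (fun t ξ => ?_) x
      · exact continuous_const.inner (hσc.clm_apply continuous_const)
      · exact τ.continuous.comp ((hqc.mul continuous_const).const_mul _)
      · change inner ℂ (j v) (ρ.map t ξ (j w)) = τ (_ * (q (Γ.deltaRep.map t ξ) * _))
        rw [hρ, hj, hF, hF, ← map_mul, Rep.map_mul_algMap]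
    have h3 : g1 x = 0 := by
      change inner ℂ (j v) (σ' x (j w)) = 0
      rw [h1, zero_apply, inner_zero_right]
    exact h2.symm.trans h3
  have hdense : DenseRange fun v => q (Γ.toFull v) :=
    hqs.denseRange.comp Γ.denseRange_toFull (continuous_starHom q)
  have h1 : ∀ w, q x * q (Γ.toFull w) = 0 := by
    intro w
    refine eq_zero_of_forall_isPositive fun τ hτ => ?_
    refine hdense.induction_on (p := fun y => τ (star y * (q x * q (Γ.toFull w))) = 0)
      (q x * q (Γ.toFull w)) ?_ fun v => key τ hτ v w
    exact isClosed_singleton.preimage (τ.continuous.comp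
      (continuous_star.mul continuous_const))
  have h2 : q x * star (q x) = 0 :=
    hdense.induction_on (p := fun y => q x * y = 0) (star (q x))
      (isClosed_singleton.preimage (continuous_const_mul _)) h1
  rw [← hq0]
  exact (CStarRing.mul_star_self_eq_zero_iff _).mp h2

/-- The sequence of full crossed products is exact in the middle. -/
theorem exact_full : Function.Exact (Γ.inclHom I hI).full (Γ.quotHom I hI).full := fun x =>
  ⟨fun hx => (mem_rangeIncl hI).mp (mem_rangeIncl_of_quotHom_full_eq_zero hI hx), by
    rintro ⟨y, rfl⟩; exact quotHom_full_inclHom_full hI y⟩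

end Action

namespace Action

open InverseMonoid HilbertBimodule

variable {S A : Type u} [InverseMonoid S] [NonUnitalCStarAlgebra A] {Γ : Action S A}
  {I : ClosedIdeal A} (hI : Γ.IsInvariant I)

/-! ### The ideals of the restricted action -/

include hI in
/-- The ideal `I_F` of the restricted action contains `I_F · I`. -/
lemma mul_mem_restrictIdeal_idealOf {F : Set S} {b : A} (hb : b ∈ Γ.idealOf F) (d : I) :
    (⟨b * d, I.mul_mem_left b d.2⟩ : I) ∈ (Γ.restrictIdeal I hI).idealOf F := by
  set R := (Γ.restrictIdeal I hI).idealOf F with hR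
  have key : ∀ d₁ d₂ : I, (⟨d₁ * b * d₂, I.mul_mem_left _ d₂.2⟩ : I) ∈ R := by
    refine ClosedIdeal.generated_induction (p := fun b => ∀ d₁ d₂ : I,
      (⟨d₁ * b * d₂, I.mul_mem_left _ d₂.2⟩ : I) ∈ R) ?_ ?_ ?_ ?_ ?_ ?_ ?_ hb
    · intro d₁ d₂
      convert zero_mem R using 1
      exact Subtype.ext (by simp)
    · intro a b ha hb d₁ d₂
      convert add_mem (ha d₁ d₂) (hb d₁ d₂) using 1
      exact Subtype.ext (by simp [mul_add, add_mul])
    · intro c a ha d₁ d₂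
      convert SMulMemClass.smul_mem c (ha d₁ d₂) using 1
      exact Subtype.ext (by simp [mul_smul_comm, smul_mul_assoc])
    · simp only [Set.ofPred_forall]
      refine isClosed_iInter fun d₁ => isClosed_iInter fun d₂ => ?_
      refine R.isClosed.preimage (Continuous.subtype_mk ?_ _)
      exact (continuous_const_mul _).mul continuous_const
    · intro a b hb d₁ d₂
      convert hb ⟨d₁ * a, I.mul_mem_right a d₁.2⟩ d₂ using 1
      exact Subtype.ext (by simp [_root_.mul_assoc])
    · intro a b hb d₁ d₂
      convert hb d₁ ⟨a * d₂, I.mul_mem_left a d₂.2⟩ using 1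
      exact Subtype.ext (by simp [_root_.mul_assoc])
    · rintro _ ⟨f, hf, κ, κ', rfl⟩ d₁ d₂
      refine ClosedIdeal.subset_generated ⟨f, hf, restrictMk hI (lsmul (d₁ : A) κ)
        (lsmul_mem hI d₁.2 κ), restrictMk hI (lsmul (star (d₂ : A)) κ')
        (lsmul_mem hI (star_mem d₂.2) κ'), Subtype.ext ?_⟩
      change (d₁ : A) * linner κ κ' * d₂
        = linner (lsmul (d₁ : A) κ) (lsmul (star (d₂ : A)) κ')
      rw [linner_lsmul_right, linner_lsmul, star_star]
  have h1 : Tendsto (fun e : I => (⟨e * b * d, I.mul_mem_left _ d.2⟩ : I)) I.approxUnit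
      (𝓝 ⟨b * d, I.mul_mem_left b d.2⟩) := by
    rw [tendsto_subtype_rng]
    simp only [_root_.mul_assoc]
    exact I.isGood_approxUnit.isApproximateUnit.tendsto_coe_mul (I.mul_mem_left b d.2)
  exact R.isClosed.mem_of_tendsto h1 (Eventually.of_forall fun e => key e d)

lemma mem_idealOf_of_restrictIdeal {F : Set S} {b : I}
    (hb : b ∈ (Γ.restrictIdeal I hI).idealOf F) : (b : A) ∈ Γ.idealOf F := by
  refine ClosedIdeal.generated_induction (p := fun b : I => (b : A) ∈ Γ.idealOf F)
    (zero_mem _) (fun _ _ => add_mem) (fun c _ h => SMulMemClass.smul_mem c h)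
    ((Γ.idealOf F).isClosed.preimage continuous_subtype_val)
    (fun a _ h => (Γ.idealOf F).mul_mem_left _ h) (fun a _ h => (Γ.idealOf F).mul_mem_right _ h)
    ?_ hb
  rintro _ ⟨f, hf, κ, κ', rfl⟩
  exact ClosedIdeal.subset_generated
    ⟨f, hf, (Γ.inclHom I hI).map f κ, (Γ.inclHom I hI).map f κ', rfl⟩

lemma IsUnitIncl.restrictIdeal {e : S} {h : NatLE e 1} {κ : Γ.fib e} {b : A}
    (hb : Γ.IsUnitIncl h κ b) (d : I) :
    (Γ.restrictIdeal I hI).IsUnitIncl h (restrictMk hI (HilbertBimodule.rsmul κ (d : A))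
      (rsmul_mem κ d.2)) ⟨b * d, I.mul_mem_left b d.2⟩ := by
  refine ⟨?_, fun η => Subtype.ext ((hb.rsmul (d : A)).2 ((Γ.inclHom I hI).map e η))⟩
  rw [← idealOf_singleton]
  refine mul_mem_restrictIdeal_idealOf hI ?_ d
  rw [idealOf_singleton]
  exact hb.1

/-! ### Extending representations of the restricted action -/

lemma tendsto_restrictMk_lsmul {t : S} {x : Γ.fib t} (hx : x ∈ Γ.fibMulIdeal I t) :
    Tendsto (fun e : I => restrictMk hI (lsmul (e : A) x) (lsmul_mem_of_mem _ hx)) I.approxUnit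
      (𝓝 (restrictMk hI x hx)) :=
  tendsto_subtype_rng.mpr (tendsto_lsmul (linner_mem hI hx x))

section extend

variable {B : Type v} [NonUnitalCStarAlgebra B] (π : Rep (Γ.restrictIdeal I hI) B)

/-- The map `ξ ↦ π (ξ c)` on `fib t`. -/
noncomputable def repShift (c : I) (t : S) : Γ.fib t →ₗ[ℂ] B where
  toFun ξ := π.map t (restrictMk hI (rsmul ξ (c : A)) (rsmul_mem ξ c.2))
  map_add' ξ η := by
    rw [← map_add]
    exact congrArg (π.map t) (Subtype.ext (by simp [restrictMk]; rfl))
  map_smul' z ξ := by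
    rw [RingHom.id_apply, ← map_smul]
    exact congrArg (π.map t) (Subtype.ext (by simp [restrictMk]; rfl))

lemma repShift_apply (c : I) (t : S) (ξ : Γ.fib t) :
    repShift hI π c t ξ = π.map t (restrictMk hI (rsmul ξ (c : A)) (rsmul_mem ξ c.2)) := rfl

/-- The identity `π (ξ x)⋆ π (ξ₂ y) = π (x)⋆ π (⟨ξ, ξ₂⟩ y)`, where only `x` and `y`, and not `ξ` and
`ξ₂`, belong to the restricted action: inserting an approximate unit `e` of `I` turns `ξ` into
`ξ e`. -/
lemma star_map_mul_mul {s t u t' u' : S} (ht : s * t = t') (hu : s * u = u') (ξ ξ' : Γ.fib s)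
    {x : Γ.fib t} {y : Γ.fib u} (hx : x ∈ Γ.fibMulIdeal I t) (hy : y ∈ Γ.fibMulIdeal I u) :
    star (π.map t' (restrictMk hI (Γ.mul ht ξ x) (mul_mem ht ξ hx)))
        * π.map u' (restrictMk hI (Γ.mul hu ξ' y) (mul_mem hu ξ' hy))
      = star (π.map t (restrictMk hI x hx)) * π.map u (restrictMk hI
          (lsmul (rinner (A := A) ξ ξ') y) (lsmul_mem_of_mem _ hy)) := by
  have tend : ∀ {r w v : S} (h : r * w = v) (ζ : Γ.fib r) {z : Γ.fib w}
      (hz : z ∈ Γ.fibMulIdeal I w), Tendsto (fun e : I => π.map v (restrictMk hI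
        (Γ.mul h ζ (lsmul (e : A) z)) (mul_mem h ζ (lsmul_mem_of_mem _ hz)))) I.approxUnit
        (𝓝 (π.map v (restrictMk hI (Γ.mul h ζ z) (mul_mem h ζ hz)))) := by
    intro r w v h ζ z hz
    refine ((π.continuous_map v).tendsto _).comp (tendsto_subtype_rng.mpr ?_)
    exact ((Γ.continuous_mul_right h ζ).tendsto z).comp (tendsto_lsmul (linner_mem hI hz z))
  have fac : ∀ {r w v : S} (h : r * w = v) (ζ : Γ.fib r) {z : Γ.fib w}
      (hz : z ∈ Γ.fibMulIdeal I w) (e : I), π.map v (restrictMk hI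
        (Γ.mul h ζ (lsmul (e : A) z)) (mul_mem h ζ (lsmul_mem_of_mem _ hz)))
        = π.map r (restrictMk hI (rsmul ζ (e : A)) (rsmul_mem ζ e.2))
          * π.map w (restrictMk hI z hz) := by
    intro r w v h ζ z hz e
    rw [← π.map_mul h]
    exact congrArg (π.map v) (Subtype.ext (Γ.mul_balanced h ζ (e : A) z).symm)
  have h1 := ((continuous_star.tendsto _).comp (tend ht ξ hx)).mul (tend hu ξ' hy)
  have t1 : ∀ {w : S} {z : Γ.fib w} (hz : z ∈ Γ.fibMulIdeal I w),
      Tendsto (fun e : I => π.map w (restrictMk hI (lsmul (e : A) z) (lsmul_mem_of_mem _ hz)))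
        I.approxUnit (𝓝 (π.map w (restrictMk hI z hz))) := fun hz =>
    ((π.continuous_map _).tendsto _).comp (tendsto_restrictMk_lsmul hI hz)
  have t2 : Tendsto (fun e : I => π.map u (restrictMk hI (lsmul (rinner (A := A) ξ ξ')
      (lsmul (e : A) y)) (lsmul_mem_of_mem _ (lsmul_mem_of_mem _ hy)))) I.approxUnit
      (𝓝 (π.map u (restrictMk hI (lsmul (rinner (A := A) ξ ξ') y) (lsmul_mem_of_mem _ hy)))) := by
    refine ((π.continuous_map u).tendsto _).comp (tendsto_subtype_rng.mpr ?_)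
    exact ((continuous_lsmul _).tendsto y).comp (tendsto_lsmul (linner_mem hI hy y))
  have h2 := ((continuous_star.tendsto _).comp (t1 hx)).mul t2
  refine tendsto_nhds_unique h1 (h2.congr fun e => ?_)
  simp only [Function.comp_apply]
  have hl : ∀ {w : S} {z : Γ.fib w} (hz : z ∈ Γ.fibMulIdeal I w) (a : I),
      π.map w (restrictMk hI (lsmul (a : A) z) (lsmul_mem_of_mem _ hz))
        = π.map 1 ((Γ.restrictIdeal I hI).unit a) * π.map w (restrictMk hI z hz) :=
    fun hz a => (π.map_unit_mul a (restrictMk hI _ hz)).symm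
  have hs : star (π.map 1 ((Γ.restrictIdeal I hI).unit e))
      = π.map 1 ((Γ.restrictIdeal I hI).unit (star e)) := (map_star π.unitHom e).symm
  have hr := π.map_rinner s (restrictMk hI (rsmul ξ (e : A)) (rsmul_mem ξ e.2))
    (restrictMk hI (rsmul ξ' (e : A)) (rsmul_mem ξ' e.2))
  rw [fac ht ξ hx, fac hu ξ' hy, hl hx e, star_mul, star_mul, hs]
  have e1 : π.map u (restrictMk hI (lsmul (rinner (A := A) ξ ξ') (lsmul (e : A) y))
      (lsmul_mem_of_mem _ (lsmul_mem_of_mem _ hy)))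
      = π.map 1 ((Γ.restrictIdeal I hI).unit ⟨rinner (A := A) ξ ξ' * e, I.mul_mem_left _ e.2⟩)
        * π.map u (restrictMk hI y hy) := by
    rw [π.map_unit_mul]
    exact congrArg (π.map u) (Subtype.ext (mul_lsmul _ _ _).symm)
  rw [e1, _root_.mul_assoc, ← _root_.mul_assoc (π.map 1 _), π.map_unit_mul_unit,
    _root_.mul_assoc, ← _root_.mul_assoc (star (π.map s _)), hr]
  congr 3
  refine congrArg (Γ.restrictIdeal I hI).unit (Subtype.ext ?_)
  change star (e : A) * (rinner (A := A) ξ ξ' * e) = rinner (rsmul ξ (e : A)) (rsmul ξ' (e : A))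
  rw [rinner_rsmul, rinner_rsmul_left, _root_.mul_assoc]

lemma map_mul_isUnitIncl {e u v : S} {h : NatLE e 1} {κ : Γ.fib e} {b : A}
    (hb : Γ.IsUnitIncl h κ b) (hv : e * u = v) {y : Γ.fib u} (hy : y ∈ Γ.fibMulIdeal I u) :
    π.map v (restrictMk hI (Γ.mul hv κ y) (mul_mem hv κ hy))
      = π.map u (restrictMk hI (lsmul b y) (lsmul_mem_of_mem b hy)) := by
  have t1 : Tendsto (fun d : I => π.map v (restrictMk hI (Γ.mul hv κ (lsmul (d : A) y))
      (mul_mem hv κ (lsmul_mem_of_mem _ hy)))) I.approxUnit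
      (𝓝 (π.map v (restrictMk hI (Γ.mul hv κ y) (mul_mem hv κ hy)))) := by
    refine ((π.continuous_map v).tendsto _).comp (tendsto_subtype_rng.mpr ?_)
    exact ((Γ.continuous_mul_right hv κ).tendsto y).comp (tendsto_lsmul (linner_mem hI hy y))
  have t2 : Tendsto (fun d : I => π.map u (restrictMk hI (lsmul b (lsmul (d : A) y))
      (lsmul_mem_of_mem _ (lsmul_mem_of_mem _ hy)))) I.approxUnit
      (𝓝 (π.map u (restrictMk hI (lsmul b y) (lsmul_mem_of_mem b hy)))) := by
    refine ((π.continuous_map u).tendsto _).comp (tendsto_subtype_rng.mpr ?_)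
    exact ((continuous_lsmul _).tendsto y).comp (tendsto_lsmul (linner_mem hI hy y))
  refine tendsto_nhds_unique t1 (t2.congr fun d => ?_)
  have h1 := π.map_isUnitIncl (hb.restrictIdeal hI d)
  have h2 := congrArg (fun x => x * π.map u (restrictMk hI y hy)) h1
  simp only [π.map_unit_mul] at h2
  rw [← π.map_mul hv] at h2
  refine Eq.trans ?_ (h2.symm.trans ?_)
  · exact congrArg (π.map u) (Subtype.ext (mul_lsmul _ _ _).symm)
  · exact congrArg (π.map v) (Subtype.ext (Γ.mul_balanced hv κ (d : A) y))

end extend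

lemma repShift_mul {B : Type v} [NonUnitalCStarAlgebra B] (π : Rep (Γ.restrictIdeal I hI) B)
    (c : I) (t : S) (ξ : (Γ.restrictIdeal I hI).fib t) (w : Γ.Alg) :
    algLift (repShift hI π c) (algMul t ((Γ.inclHom I hI).map t ξ) w)
      = π.map t ξ * algLift (repShift hI π c) w := by
  have : (algLift (repShift hI π c)).comp (algMul t ((Γ.inclHom I hI).map t ξ))
      = (LinearMap.mulLeft ℂ (π.map t ξ)).comp (algLift (repShift hI π c)) :=
    algHom_ext fun u η => by
      rw [LinearMap.comp_apply, LinearMap.comp_apply, algMul_incl rfl, algLift_incl, algLift_incl,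
        LinearMap.mulLeft_apply, repShift_apply, repShift_apply, ← π.map_mul rfl]
      exact congrArg (π.map (t * u)) (Subtype.ext (Γ.mul_rsmul_right rfl _ η (c : A)).symm)
  exact LinearMap.congr_fun this w

/-- A positive functional `τ` on `I ⋊ S` gives the kernel `τ ((ξ c)⋆ (η c))`, `c ∈ I`, on the
fibres of the action on `A`, and hence a representation of `A ⋊ S`. Elements of `I ⋊ S` that become
zero in `A ⋊ S` act by zero in it. -/
lemma apply_eq_zero_of_inclHom_full_eq_zero {y : (Γ.restrictIdeal I hI).Full}
    (hy : (Γ.inclHom I hI).full y = 0) {τ : StrongDual ℂ (Γ.restrictIdeal I hI).Full}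
    (hτ : IsPositive τ) (c : I) (v w : Γ.Alg) :
    τ (star (algLift (repShift hI (Γ.restrictIdeal I hI).deltaRep c) v)
      * (y * algLift (repShift hI (Γ.restrictIdeal I hI).deltaRep c) w)) = 0 := by
  set π := (Γ.restrictIdeal I hI).deltaRep with hπ
  set F := algLift (repShift hI π c) with hF
  obtain ⟨K, i1, i2, i3, j, ρ, hd, hj, hρ⟩ := exists_rep_ofMaps τ hτ (repShift hI π c)
    (fun {s t u t' u'} ht hu ξ ξ' η η' => by
      have h := star_map_mul_mul hI π ht hu ξ ξ' (rsmul_mem η c.2) (rsmul_mem η' c.2)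
      have e1 : ∀ {r p : S} (h : s * r = p) (ζ : Γ.fib s) (z : Γ.fib r),
          repShift hI π c p (Γ.mul h ζ z) = π.map p (restrictMk hI (Γ.mul h ζ (rsmul z (c : A)))
            (mul_mem h ζ (rsmul_mem z c.2))) := fun h ζ z =>
        congrArg (π.map _) (Subtype.ext (Γ.mul_rsmul_right h ζ z (c : A)).symm)
      rw [e1, e1, h]
      exact congrArg (fun x => star _ * π.map u x) (Subtype.ext (lsmul_rsmul _ η' _).symm))
    (fun {e u v h κ b} hb hv η => by
      have h := map_mul_isUnitIncl hI π hb hv (rsmul_mem η c.2)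
      refine Eq.trans ?_ (h.trans ?_)
      · exact congrArg (π.map _) (Subtype.ext (Γ.mul_rsmul_right hv κ η (c : A)).symm)
      · exact congrArg (π.map u) (Subtype.ext (lsmul_rsmul b η (c : A)).symm))
  let σ : (Γ.restrictIdeal I hI).Full →⋆ₙₐ[ℂ] (K →L[ℂ] K) :=
    (integrate ρ).comp (Γ.inclHom I hI).full
  let g1 : (Γ.restrictIdeal I hI).Full →ₗ[ℂ] ℂ :=
    { toFun := fun y => inner ℂ (j v) (σ y (j w))
      map_add' := fun y z => by rw [map_add, add_apply, inner_add_right]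
      map_smul' := fun c y => by rw [map_smul, smul_apply, inner_smul_right]; rfl }
  let g2 : (Γ.restrictIdeal I hI).Full →ₗ[ℂ] ℂ :=
    { toFun := fun y => τ (star (F v) * (y * F w))
      map_add' := fun y z => by rw [add_mul, mul_add, map_add]
      map_smul' := fun c y => by rw [smul_mul_assoc, mul_smul_comm, map_smul]; rfl }
  have h2 : g1 y = g2 y := by
    have hσc := continuous_starHom σ
    refine full_ext ?_ ?_ (fun t ξ => ?_) y
    · exact continuous_const.inner (hσc.clm_apply continuous_const)
    · exact τ.continuous.comp ((continuous_mul_const _).const_mul _)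
    · change inner ℂ (j v) (ρ.map t ((Γ.inclHom I hI).map t ξ) (j w)) = τ (_ * (π.map t ξ * _))
      rw [hρ, hj, repShift_mul]
  have h3 : g1 y = 0 := by
    change inner ℂ (j v) (integrate ρ ((Γ.inclHom I hI).full y) (j w)) = 0
    rw [hy, map_zero, zero_apply, inner_zero_right]
  exact h2.symm.trans h3

/-- Every element of the kernel of `ι ⋊ S` annihilates the products `w c` with `w ∈ I ⋊ S` and
`c ∈ I`, because positive functionals separate elements, and such products are dense. -/
theorem inclHom_full_injective : Function.Injective (Γ.inclHom I hI).full := by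
  rw [injective_iff_map_eq_zero]
  set Δ := Γ.restrictIdeal I hI with hΔ
  intro y hy
  let L : Δ.Alg →ₗ[ℂ] Γ.Alg := algLift fun t => (incl t).comp ((Γ.inclHom I hI).map t)
  have hL : ∀ (c : I) (v : Δ.Alg), algLift (repShift hI Δ.deltaRep c) (L v)
      = Δ.toFull v * Δ.deltaRep.map 1 (Δ.unit c) := by
    intro c v
    have : (algLift (repShift hI Δ.deltaRep c)).comp L
        = (LinearMap.mulRight ℂ (Δ.deltaRep.map 1 (Δ.unit c))).comp Δ.toFull :=
      algHom_ext fun t ξ => by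
        simp only [LinearMap.comp_apply, LinearMap.mulRight_apply, L]
        rw [algLift_incl, Δ.deltaRep.algMap_incl, LinearMap.comp_apply, algLift_incl,
          Rep.map_mul_unit]
        rfl
    exact LinearMap.congr_fun this v
  have h1 : ∀ (c : I) (w : Δ.Alg), y * (Δ.toFull w * Δ.deltaRep.map 1 (Δ.unit c)) = 0 := by
    intro c w
    set C := Δ.deltaRep.map 1 (Δ.unit c) with hC
    have h2 : y * (Δ.toFull w * C) = (y * Δ.toFull w) * C := (_root_.mul_assoc _ _ _).symm
    refine eq_zero_of_forall_isPositive fun τ hτ => ?_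
    rw [h2, ← h2]
    nth_rw 1 [h2]
    refine Δ.denseRange_toFull.induction_on
      (p := fun x => τ (star (x * C) * (y * (Δ.toFull w * C))) = 0) (y * Δ.toFull w) ?_ fun v => ?_
    · exact isClosed_singleton.preimage (τ.continuous.comp
        ((continuous_star.comp (continuous_mul_const C)).mul continuous_const))
    · rw [hC, ← hL, ← hL]
      exact apply_eq_zero_of_inclHom_full_eq_zero hI hy hτ c _ _
  have h2 : ∀ t (ξ : Δ.fib t), y * Δ.delta t ξ = 0 := by
    intro t ξ
    have hξ : rinner ξ ξ ∈ ClosedIdeal.whole I := trivial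
    have ht := ((continuous_const_mul y).comp (Δ.deltaRep.continuous_map t)).tendsto ξ |>.comp
      (tendsto_rsmul hξ)
    refine tendsto_nhds_unique ht (tendsto_const_nhds.congr fun e => ?_)
    simp only [Function.comp_apply]
    rw [← Rep.map_mul_unit, ← Δ.deltaRep.algMap_incl]
    exact (h1 _ _).symm
  have h3 : y * star y = 0 :=
    full_induction (P := LinearMap.ker (LinearMap.mulLeft ℂ y))
      (isClosed_singleton.preimage (continuous_const_mul y)) h2 (star y)
  exact (CStarRing.mul_star_self_eq_zero_iff _).mp h3

end Action

/-! ### Approximation of functionals by positive functionals -/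

/-- Every bounded functional is a norm limit of functionals `ψ (a⋆ · e)` with positive `ψ` and
with control on the norms of the vectors of `a` and `e` in the representation for `ψ`. -/
theorem exists_isPositive_approx {A : Type u} [NonUnitalCStarAlgebra A] (φ : StrongDual ℂ A)
    {ε : ℝ} (hε : 0 < ε) : ∃ ψ : StrongDual ℂ A, IsPositive ψ ∧ ∃ a e : A,
      ‖φ - rightShift (leftShift ψ (star a)) e‖ ≤ ε ∧ (ψ (star a * a)).re ≤ (1 + ε) ^ 2 ∧
        (ψ (star e * e)).re ≤ ‖φ‖ ^ 2 := by
  obtain ⟨ψ, hψ, hψn, hle⟩ := exists_isPositive_dominating φ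
  obtain ⟨K, i1, i2, i3, j, hd, hj⟩ := exists_hilbertSpace_of_form
    (LinearMap.mk₂'ₛₗ (starRingEnd ℂ) (RingHom.id ℂ) (fun a b : A => ψ (star a * b))
      (by simp [add_mul]) (by simp [smul_mul_assoc]) (by simp [mul_add]) (by simp [mul_smul_comm]))
    hψ
  simp only [LinearMap.mk₂'ₛₗ_apply] at hj
  have hjn : ∀ a, ‖j a‖ ^ 2 = (ψ (star a * a)).re := fun a => by
    rw [← hj, ← inner_self_eq_norm_sq (𝕜 := ℂ)]; rfl
  have hψb : ∀ a, (ψ (star a * a)).re ≤ ‖φ‖ ^ 2 * ‖a‖ ^ 2 := fun a => by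
    refine (Complex.re_le_norm _).trans ((ψ.le_opNorm _).trans ?_)
    rw [CStarRing.norm_star_mul_self, ← sq]
    gcongr
  have hjb : ∀ a, ‖j a‖ ≤ ‖φ‖ * ‖a‖ := fun a => by
    refine le_of_sq_le_sq ?_ (by positivity)
    rw [hjn, mul_pow]; exact hψb a
  have hφj : ∀ a, ‖(φ : A →ₗ[ℂ] ℂ) a‖ ≤ 1 * ‖j a‖ := fun a => by
    rw [one_mul]
    refine le_of_sq_le_sq ?_ (norm_nonneg _)
    rw [hjn]; exact hle a
  set θ : K →L[ℂ] ℂ := (φ : A →ₗ[ℂ] ℂ).extendOfNorm j with hθ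
  have hθj : ∀ a, θ (j a) = φ a := fun a => LinearMap.extendOfNorm_eq hd ⟨1, hφj⟩ a
  have hθn : ‖θ‖ ≤ 1 := LinearMap.opNorm_extendOfNorm_le hd zero_le_one hφj
  set h : K := (InnerProductSpace.toDual ℂ K).symm θ with hh
  have hhn : ‖h‖ ≤ 1 := by rw [hh, LinearIsometryEquiv.norm_map]; exact hθn
  set δ := min ε (ε / (2 * (‖φ‖ + 1))) with hδ
  have hδ0 : 0 < δ := lt_min hε (by positivity)
  obtain ⟨a, ha⟩ := hd.exists_dist_lt h hδ0
  rw [dist_eq_norm] at ha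
  -- the vector of `a` almost represents `φ` in the Hilbert space of `ψ`; an approximate unit then
  -- gives `e` with `ψ (a⋆ · e)` close to `ψ (a⋆ ·)`
  obtain ⟨e, he, hen⟩ := (((ClosedIdeal.whole A).isGood_approxUnit.eventually_norm_apply_sub_mul_le
    (leftShift ψ (star a)) (half_pos hε)).and
      (ClosedIdeal.whole A).isGood_approxUnit.norm_le).exists
  refine ⟨ψ, hψ, a, e, ContinuousLinearMap.opNorm_le_bound _ hε.le fun c => ?_, ?_, ?_⟩
  · have h1 : ‖φ c - leftShift ψ (star a) c‖ ≤ ε / 2 * ‖c‖ := by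
      have h2 : φ c - leftShift ψ (star a) c = inner ℂ (h - j a) (j c) := by
        rw [inner_sub_left, hj, hh, InnerProductSpace.toDual_symm_apply, hθj]; rfl
      rw [h2]
      calc ‖inner ℂ (h - j a) (j c)‖ ≤ ‖h - j a‖ * ‖j c‖ := norm_inner_le_norm _ _
        _ ≤ ε / (2 * (‖φ‖ + 1)) * (‖φ‖ * ‖c‖) := by
            gcongr
            · exact ha.le.trans (min_le_right _ _)
            · exact hjb c
        _ ≤ ε / (2 * (‖φ‖ + 1)) * ((‖φ‖ + 1) * ‖c‖) := by gcongr; linarith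
        _ = ε / 2 * ‖c‖ := by field_simp
    have h2 := he c trivial
    have h3 : (φ - rightShift (leftShift ψ (star a)) e) c = (φ c - leftShift ψ (star a) c)
        + leftShift ψ (star a) (c - c * e) := by
      rw [map_sub, sub_apply, rightShift_apply]; ring
    rw [h3]
    refine (norm_add_le _ _).trans ?_
    linarith
  · rw [← hjn]
    gcongr
    calc ‖j a‖ = ‖h - (h - j a)‖ := by rw [sub_sub_cancel]
      _ ≤ ‖h‖ + ‖h - j a‖ := norm_sub_le _ _
      _ ≤ 1 + ε := add_le_add hhn (ha.le.trans (min_le_left _ _))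
  · refine (hψb e).trans ?_
    have : ‖(e : A)‖ ^ 2 ≤ 1 := pow_le_one₀ (norm_nonneg _) hen
    exact mul_le_of_le_one_right (by positivity) this

lemma exists_extension_of_denseRange {V E F : Type*} [AddCommGroup V] [Module ℂ V]
    [NormedAddCommGroup E] [NormedSpace ℂ E] [NormedAddCommGroup F] [NormedSpace ℂ F]
    [CompleteSpace F] (f : V →ₗ[ℂ] F) (e : V →ₗ[ℂ] E) (hd : DenseRange e) {C : ℝ}
    (h : ∀ v, ‖f v‖ ≤ C * ‖e v‖) : ∃ W : E →L[ℂ] F, ∀ v, W (e v) = f v :=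
  ⟨f.extendOfNorm e, fun v => LinearMap.extendOfNorm_eq hd ⟨C, h⟩ v⟩

namespace Action

open InverseMonoid HilbertBimodule

variable {S A : Type u} [InverseMonoid S] [NonUnitalCStarAlgebra A] {Γ : Action S A}

/-! ### The weak conditional expectation on the fibres -/

variable {t u s : S}

variable (Γ) in
/-- The multiplier `d ↦ ϑ_{1,t} (ξ d)` of the ideal `I_{1,t}`. -/
noncomputable def expMult (t : S) (ξ : Γ.fib t) (d : A) : A :=
  Γ.unit.symm (Γ.theta (agree 1 t) 1 t (rsmul ξ d))

lemma rel_expMult (ξ : Γ.fib t) {d : A} (hd : d ∈ Γ.idealOf (agree 1 t)) :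
    (Γ.unit (Γ.expMult t ξ d), rsmul ξ d) ∈ Γ.rel (agree 1 t) 1 t := by
  rw [expMult, LinearEquiv.apply_symm_apply]
  exact rel_theta subset_rfl (rsmul_mem ξ hd)

lemma expMult_eq {ξ : Γ.fib t} {d a : A} (h : (Γ.unit a, rsmul ξ d) ∈ Γ.rel (agree 1 t) 1 t) :
    Γ.expMult t ξ d = a := by
  rw [expMult, theta_eq subset_rfl h, LinearEquiv.symm_apply_apply]

lemma norm_expMult_le (ξ : Γ.fib t) {d : A} (hd : d ∈ Γ.idealOf (agree 1 t)) :
    ‖Γ.expMult t ξ d‖ ≤ ‖ξ‖ * ‖d‖ := by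
  rw [← Γ.norm_unit, rel_norm subset_rfl (rel_expMult ξ hd)]
  exact norm_rsmul_le ξ d

lemma isMult_expMult (ξ : Γ.fib t) : IsMult (Γ.idealOf (agree 1 t)) (Γ.expMult t ξ) where
  sub a ha b hb := expMult_eq (by
    rw [map_sub, map_sub]; exact rel_sub (rel_expMult ξ ha) (rel_expMult ξ hb))
  mul a ha b := expMult_eq (by
    rw [rsmul_mul, ← Γ.rsmul_unit]; exact rel_rsmul (rel_expMult ξ ha) b)
  mem a ha := unit_mem.mp (rel_left (rel_expMult ξ ha))
  bound := ⟨‖ξ‖, norm_nonneg _, fun a ha => norm_expMult_le ξ ha⟩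

lemma norm_multEval_expMult_le (ξ : Γ.fib t) (φ : StrongDual ℂ A) :
    ‖multEval (Γ.idealOf (agree 1 t)) (Γ.expMult t ξ) φ‖ ≤ ‖ξ‖ * ‖φ‖ := by
  refine (isMult_expMult ξ).norm_multEval_le φ fun d hd hd1 => ?_
  refine (φ.le_opNorm _).trans ?_
  rw [mul_comm]
  gcongr
  exact (norm_expMult_le ξ hd).trans (mul_le_of_le_one_right (norm_nonneg _) hd1)

variable (Γ) in
/-- The weak conditional expectation on the fibre over `t`. -/
noncomputable def fibExp (t : S) : Γ.fib t →ₗ[ℂ] StrongDual ℂ (StrongDual ℂ A) where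
  toFun ξ := LinearMap.mkContinuous
    { toFun := fun φ => multEval (Γ.idealOf (agree 1 t)) (Γ.expMult t ξ) φ
      map_add' := fun φ ψ => (isMult_expMult ξ).multEval_functional_add φ ψ
      map_smul' := fun c φ => (isMult_expMult ξ).multEval_functional_smul c φ }
    ‖ξ‖ (norm_multEval_expMult_le ξ)
  map_add' ξ η := by
    ext φ
    change multEval _ _ φ = multEval _ _ φ + multEval _ _ φ
    rw [← (isMult_expMult ξ).multEval_add (isMult_expMult η)]
    exact multEval_congr (fun d hd => expMult_eq (by
      rw [map_add, map_add, LinearMap.add_apply]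
      exact rel_add (rel_expMult ξ hd) (rel_expMult η hd))) φ
  map_smul' c ξ := by
    ext φ
    change multEval _ _ φ = c * multEval _ _ φ
    rw [← (isMult_expMult ξ).multEval_smul c]
    exact multEval_congr (fun d hd => expMult_eq (by
      rw [map_smul, map_smul, LinearMap.smul_apply]
      exact rel_smul (rel_expMult ξ hd) c)) φ

lemma fibExp_apply (ξ : Γ.fib t) (φ : StrongDual ℂ A) :
    Γ.fibExp t ξ φ = multEval (Γ.idealOf (agree 1 t)) (Γ.expMult t ξ) φ := rfl

lemma ker_unit_left (a : A) (ξ : Γ.fib t) (φ : StrongDual ℂ A) :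
    ker (Γ.unit a) ξ φ = Γ.fibExp t ξ (leftShift φ (star a)) := by
  rw [fibExp_apply, ker, kerOn, ← multEval_mul_left]
  refine multEval_congr (fun d hd => ?_) φ
  rw [innerMult_eq_of_rel subset_rfl _ (rel_expMult ξ hd), Γ.rinner_unit]

lemma ker_unit_rsmul (a b : A) (ξ : Γ.fib t) (φ : StrongDual ℂ A) :
    ker (Γ.unit a) (rsmul ξ b) φ = Γ.fibExp t ξ (rightShift (leftShift φ (star a)) b) := by
  rw [ker_rsmul_right, ker_unit_left]
  congr 1
  ext c
  change φ (star a * c * b) = φ (star a * (c * b))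
  rw [_root_.mul_assoc]

variable (Γ) in
/-- The positive definite kernel on the fibres that a positive functional `ψ` on `A` yields through
the weak conditional expectation. -/
noncomputable def expKernel (ψ : StrongDual ℂ A) (hψ : IsPositive ψ) : PosKernel Γ where
  form _ _ := LinearMap.mk₂'ₛₗ (starRingEnd ℂ) (RingHom.id ℂ) (fun ξ η => ker ξ η ψ)
    (fun ξ ξ' η => ker_add_left ξ ξ' η ψ) (fun c ξ η => ker_smul_left ξ c η ψ)
    (fun ξ η η' => ker_add_right ξ η η' ψ) (fun c ξ η => ker_smul_right ξ c η ψ)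
  sum_nonneg I ξ := ker_sum_nonneg hψ I ξ
  form_mul_mul ht hu ξ ξ' η η' := ker_mul_mul ht hu ξ ξ' η η' ψ
  form_isUnitIncl_mul hb hv ω η := ker_isUnitIncl_mul hb hv ω η ψ

/-- The representation of the action that a positive functional on `A` yields. -/
lemma exists_rep_of_isPositive {ψ : StrongDual ℂ A} (hψ : IsPositive ψ) :
    ∃ (K : Type u) (_ : NormedAddCommGroup K) (_ : InnerProductSpace ℂ K)
      (_ : CompleteSpace K) (j : Γ.Alg →ₗ[ℂ] K) (ρ : Rep Γ (K →L[ℂ] K)), DenseRange j ∧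
      (∀ (t u : S) (ξ : Γ.fib t) (η : Γ.fib u),
        inner ℂ (j (incl t ξ)) (j (incl u η)) = ker ξ η ψ) ∧
      ∀ {t u v : S} (h : t * u = v) (ξ : Γ.fib t) (η : Γ.fib u),
        ρ.map t ξ (j (incl u η)) = j (incl v (Γ.mul h ξ η)) := by
  obtain ⟨K, i1, i2, i3, j, ρ, hd, hj, hρ⟩ := (Γ.expKernel ψ hψ).exists_rep
  refine ⟨K, i1, i2, i3, j, ρ, hd, fun t u ξ η => ?_, fun h ξ η => ?_⟩
  · rw [hj, PosKernel.algForm_incl]; rfl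
  · rw [hρ, algMul_incl h]

lemma inner_rep_unit {K : Type u} [NormedAddCommGroup K] [InnerProductSpace ℂ K] [CompleteSpace K]
    {j : Γ.Alg →ₗ[ℂ] K} {ρ : Rep Γ (K →L[ℂ] K)} {ψ : StrongDual ℂ A}
    (hj : ∀ (t u : S) (ξ : Γ.fib t) (η : Γ.fib u),
        inner ℂ (j (incl t ξ)) (j (incl u η)) = ker ξ η ψ)
    (hρ : ∀ {t u v : S} (h : t * u = v) (ξ : Γ.fib t) (η : Γ.fib u),
        ρ.map t ξ (j (incl u η)) = j (incl v (Γ.mul h ξ η))) (a b : A) (ξ : Γ.fib t) :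
    inner ℂ (j (incl 1 (Γ.unit a))) (ρ.map t ξ (j (incl 1 (Γ.unit b))))
      = Γ.fibExp t ξ (rightShift (leftShift ψ (star a)) b) := by
  rw [hρ (mul_one t), Γ.mul_unit, hj, ker_unit_rsmul]

lemma norm_sq_unit {K : Type u} [NormedAddCommGroup K] [InnerProductSpace ℂ K]
    {j : Γ.Alg →ₗ[ℂ] K} {ψ : StrongDual ℂ A}
    (hj : ∀ (t u : S) (ξ : Γ.fib t) (η : Γ.fib u),
        inner ℂ (j (incl t ξ)) (j (incl u η)) = ker ξ η ψ) (a : A) :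
    ‖j (incl 1 (Γ.unit a))‖ ^ 2 = (ψ (star a * a)).re := by
  rw [← inner_self_eq_norm_sq (𝕜 := ℂ), hj, ker_eq_of_rel subset_rfl _ (rel_self _),
    Γ.rinner_unit]
  rfl

/-! ### The weak conditional expectation on the full crossed product -/

variable (Γ) in
/-- The weak conditional expectation on the algebraic direct sum of the fibres. -/
noncomputable def algExp : Γ.Alg →ₗ[ℂ] StrongDual ℂ (StrongDual ℂ A) :=
  algLift (N := StrongDual ℂ (StrongDual ℂ A)) Γ.fibExp

/-- The weak conditional expectation is contractive: on functionals `ψ (a⋆ · e)` with `ψ` positive,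
it is a matrix coefficient of the representation for `ψ`, and such functionals approximate all
others. -/
lemma norm_algExp_le (v : Γ.Alg) : ‖Γ.algExp v‖ ≤ 1 * ‖Γ.toFull v‖ := by
  refine ContinuousLinearMap.opNorm_le_bound _ (by positivity) fun φ => ?_
  rw [one_mul]
  have hcont : Tendsto (fun ε : ℝ => ‖Γ.algExp v‖ * ε + (1 + ε) * ‖φ‖ * ‖Γ.toFull v‖)
      (𝓝[>] 0) (𝓝 (‖Γ.algExp v‖ * 0 + (1 + 0) * ‖φ‖ * ‖Γ.toFull v‖)) := by
    refine Tendsto.mono_left ?_ nhdsWithin_le_nhds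
    exact Continuous.tendsto (by fun_prop) 0
  have h0 : ‖Γ.algExp v‖ * 0 + (1 + 0) * ‖φ‖ * ‖Γ.toFull v‖ = ‖Γ.toFull v‖ * ‖φ‖ := by ring
  rw [h0] at hcont
  refine ge_of_tendsto hcont ?_
  filter_upwards [self_mem_nhdsWithin] with ε (hε : 0 < ε)
  obtain ⟨ψ, hψ, a, e, h1, h2, h3⟩ := exists_isPositive_approx φ hε
  obtain ⟨K, i1, i2, i3, j, ρ, hd, hj, hρ⟩ := exists_rep_of_isPositive (Γ := Γ) hψ
  set χ := rightShift (leftShift ψ (star a)) e with hχ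
  have h4 : Γ.algExp v χ = inner ℂ (j (incl 1 (Γ.unit a)))
      (integrate ρ (Γ.toFull v) (j (incl 1 (Γ.unit e)))) := by
    rw [integrate_toFull]
    refine alg_induction (p := fun v => Γ.algExp v χ = inner ℂ (j (incl 1 (Γ.unit a)))
      (ρ.algMap v (j (incl 1 (Γ.unit e))))) v (fun v w hv hw => ?_) (by simp) fun t ξ => ?_
    · rw [map_add, map_add, add_apply, add_apply, hv, hw, inner_add_right]
    · rw [ρ.algMap_incl, inner_rep_unit hj hρ, algExp, algLift_incl]
  have h5 : ‖Γ.algExp v χ‖ ≤ (1 + ε) * ‖φ‖ * ‖Γ.toFull v‖ := by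
    have ha : ‖j (incl 1 (Γ.unit a))‖ ≤ 1 + ε :=
      le_of_sq_le_sq (by rw [norm_sq_unit hj]; exact h2) (by positivity)
    have he : ‖j (incl 1 (Γ.unit e))‖ ≤ ‖φ‖ :=
      le_of_sq_le_sq (by rw [norm_sq_unit hj]; exact h3) (by positivity)
    rw [h4]
    calc _ ≤ ‖j (incl 1 (Γ.unit a))‖ * ‖integrate ρ (Γ.toFull v) (j (incl 1 (Γ.unit e)))‖ :=
          norm_inner_le_norm _ _
      _ ≤ ‖j (incl 1 (Γ.unit a))‖ * (‖integrate ρ (Γ.toFull v)‖ * ‖j (incl 1 (Γ.unit e))‖) := by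
          gcongr; exact ContinuousLinearMap.le_opNorm _ _
      _ ≤ (1 + ε) * (‖Γ.toFull v‖ * ‖φ‖) := by
          gcongr
          exact NonUnitalStarAlgHom.norm_apply_le (integrate ρ) _
      _ = _ := by ring
  have h6 : Γ.algExp v φ = Γ.algExp v (φ - χ) + Γ.algExp v χ := by
    rw [map_sub, sub_add_cancel]
  rw [h6]
  refine (norm_add_le _ _).trans (add_le_add ?_ h5)
  exact (ContinuousLinearMap.le_opNorm _ _).trans (by gcongr)

variable (Γ) in
/-- There is a bounded linear map on the full crossed product that extends the maps on the
fibres. -/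
lemma exists_expectation : ∃ W : Γ.Full →L[ℂ] StrongDual ℂ (StrongDual ℂ A),
    ∀ t ξ, W (Γ.delta t ξ) = Γ.fibExp t ξ := by
  obtain ⟨W, hW⟩ := exists_extension_of_denseRange (E := Γ.Full)
    (F := StrongDual ℂ (StrongDual ℂ A)) Γ.algExp Γ.toFull Γ.denseRange_toFull norm_algExp_le
  refine ⟨W, fun t ξ => ?_⟩
  rw [← toFull_incl, hW, algExp, algLift_incl]

/-- The conditions on a weak conditional expectation determine it on the fibres. -/
lemma IsWeakExpectation.apply_delta {W : Γ.Full →L[ℂ] StrongDual ℂ (StrongDual ℂ A)}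
    (hW : Γ.IsWeakExpectation W) (t : S) (ξ : Γ.fib t) :
    W (Γ.delta t ξ) = Γ.fibExp t ξ := by
  ext φ
  set J := Γ.commonIdeal 1 t with hJ
  have hm : IsMult J (Γ.expMult t ξ) := by rw [hJ, commonIdeal_one]; exact isMult_expMult ξ
  have h1 : Γ.fibExp t ξ φ = multEval J (Γ.expMult t ξ) φ := by rw [hJ, commonIdeal_one]; rfl
  rw [h1]
  have hu := J.isGood_approxUnit
  refine tendsto_nhds_unique ?_ (hm.tendsto_approxUnit φ)
  rw [Metric.tendsto_nhds]
  intro ε hε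
  filter_upwards [hW t ξ J.approxUnit hu.isApproximateUnit hu.norm_le φ ε hε] with d hd
  obtain ⟨a, ha, h⟩ := hd
  rwa [expMult_eq (thetaGraph_subset_rel ha), dist_eq_norm]

lemma isWeakExpectation_of_delta {W : Γ.Full →L[ℂ] StrongDual ℂ (StrongDual ℂ A)}
    (hW : ∀ t ξ, W (Γ.delta t ξ) = Γ.fibExp t ξ) : Γ.IsWeakExpectation W := by
  intro t ξ l hl hn φ ε hε
  rw [hW]
  have hm : IsMult (Γ.commonIdeal 1 t) (Γ.expMult t ξ) := by
    rw [commonIdeal_one]; exact isMult_expMult ξ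
  have h1 : Γ.fibExp t ξ φ = multEval (Γ.commonIdeal 1 t) (Γ.expMult t ξ) φ := by
    rw [commonIdeal_one]; rfl
  rw [h1]
  filter_upwards [(Metric.tendsto_nhds.mp (hm.tendsto_multEval φ hl hn)) ε hε] with d hd
  obtain ⟨a, ha⟩ := exists_mem_thetaGraph ξ d.2
  refine ⟨a, ha, ?_⟩
  rwa [expMult_eq (thetaGraph_subset_rel ha), dist_eq_norm] at hd

variable (Γ) in
theorem isWeakExpectation_weakExpectation : Γ.IsWeakExpectation Γ.weakExpectation := by
  have h : ∃ W, Γ.IsWeakExpectation W :=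
    ⟨_, isWeakExpectation_of_delta Γ.exists_expectation.choose_spec⟩
  rw [weakExpectation, dif_pos h]
  exact h.choose_spec

lemma weakExpectation_delta (t : S) (ξ : Γ.fib t) :
    Γ.weakExpectation (Γ.delta t ξ) = Γ.fibExp t ξ :=
  Γ.isWeakExpectation_weakExpectation.apply_delta t ξ

end Action

/-- A functional, evaluated at a bounded net in the ideal that converges to a multiplier pointwise,
converges to its value at the multiplier. -/
lemma IsMult.tendsto_of_tendsto_mul {A : Type u} [NonUnitalCStarAlgebra A] {J : ClosedIdeal A}
    {m : A → A} (hm : IsMult J m) (φ : StrongDual ℂ A) {X : Type*} {l : Filter X} {y : X → A}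
    {C : ℝ} (hy : ∀ᶠ x in l, y x ∈ J ∧ ‖y x‖ ≤ C)
    (h : ∀ d ∈ J, Tendsto (fun x => y x * d) l (𝓝 (m d))) :
    Tendsto (fun x => φ (y x)) l (𝓝 (multEval J m φ)) := by
  rw [Metric.tendsto_nhds]
  intro ε hε
  obtain ⟨e, he1, he2⟩ := ((J.isGood_approxUnit.eventually_norm_apply_sub_mul_le φ
    (ε := ε / (4 * (|C| + 1))) (by positivity)).and
    ((Metric.tendsto_nhds.mp (hm.tendsto_approxUnit φ)) (ε / 4) (by positivity))).exists
  have h1 := (Metric.tendsto_nhds.mp ((φ.continuous.tendsto _).comp (h e e.2))) (ε / 4)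
    (by positivity)
  filter_upwards [hy, h1] with x hx hx1
  have h2 : dist (φ (y x)) (φ (y x * e)) ≤ ε / 4 := by
    rw [dist_eq_norm, ← map_sub]
    refine (he1 _ hx.1).trans ?_
    calc ε / (4 * (|C| + 1)) * ‖y x‖ ≤ ε / (4 * (|C| + 1)) * (|C| + 1) := by
          gcongr; linarith [hx.2, le_abs_self C]
      _ = ε / 4 := by field_simp
  simp only [Function.comp_apply] at hx1
  linarith [dist_triangle4 (φ (y x)) (φ (y x * e)) (φ (m e)) (multEval J m φ)]

namespace Action

open InverseMonoid HilbertBimodule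

variable {S A : Type u} [InverseMonoid S] [NonUnitalCStarAlgebra A] {Γ : Action S A}

/-! ### The null space of the weak conditional expectation -/

variable {t u s v : S}

/-- The range idempotent of an element that is fixed by `s` is fixed by `s`. -/
lemma mul_inv_mem_agree {w : S} (h : s * w = w) : w * w⁻¹ ∈ agree 1 s :=
  ⟨mul_inv_idem w, by rw [one_mul, ← _root_.mul_assoc, h]⟩

/-- If `s f = f`, then `t` and `s t` agree on the source idempotent of `f t`. -/
lemma inv_mul_mem_agree (h : s * t = v) {f : S} (hf : f ∈ agree 1 s) :
    (f * t)⁻¹ * (f * t) ∈ agree t v := by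
  refine ⟨inv_mul_idem _, ?_⟩
  have hff : f * f = f := hf.1
  have hsf : s * f = f := by rw [← hf.2, one_mul]
  have h1 : t * ((f * t)⁻¹ * (f * t)) = f * t := by
    rw [inv_mul_of_idem_mul hff]
    calc t * (t⁻¹ * f * t) = (t * t⁻¹ * f) * t := by simp only [_root_.mul_assoc]
      _ = f * (t * t⁻¹ * t) := by
        rw [idem_comm (mul_inv_idem t) hff, _root_.mul_assoc]
      _ = f * t := by rw [mul_inv_mul_self]
  rw [← h, _root_.mul_assoc, h1, ← _root_.mul_assoc, hsf]

lemma rinner_lsmul_mem_agree (h : s * t = v) {b : A} (hb : b ∈ Γ.idealOf (agree 1 s))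
    (η η' : Γ.fib t) : rinner η (lsmul b η') ∈ Γ.idealOf (agree t v) := by
  refine ClosedIdeal.generated_induction (p := fun b => ∀ η η' : Γ.fib t,
    rinner η (lsmul b η') ∈ Γ.idealOf (agree t v)) ?_ ?_ ?_ ?_ ?_ ?_ ?_ hb η η'
  · simp
  · intro a b ha hb η η'
    rw [map_add, LinearMap.add_apply, map_add]; exact add_mem (ha _ _) (hb _ _)
  · intro c a ha η η'
    rw [map_smul, LinearMap.smul_apply, map_smul]; exact SMulMemClass.smul_mem c (ha _ _)
  · simp only [Set.ofPred_forall]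
    exact isClosed_iInter fun η => isClosed_iInter fun η' => isClosed_setOf_mem
      ((continuous_rinner η).comp (continuous_lsmul_left η'))
  · intro c a ha η η'
    rw [mul_lsmul, rinner_lsmul]; exact ha _ _
  · intro c a ha η η'
    rw [mul_lsmul]; exact ha _ _
  · rintro _ ⟨f, hf, κ, κ', rfl⟩ η η'
    have h1 := rinner_lsmul_mem (t := f) (u := t) rfl (linner_mem_sourceIdeal hf.1 κ κ') η η'
    exact rangeIdeal_le_idealOf (inv_mul_mem_agree h hf) (sourceIdeal_le_rangeIdeal h1)

lemma linner_rsmul_mem_agree (h : s * t = v) {b : A} (hb : b ∈ Γ.idealOf (agree t v))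
    (η η' : Γ.fib t) : linner (rsmul η b) η' ∈ Γ.idealOf (agree 1 s) := by
  refine ClosedIdeal.generated_induction (p := fun b => ∀ η η' : Γ.fib t,
    linner (rsmul η b) η' ∈ Γ.idealOf (agree 1 s)) ?_ ?_ ?_ ?_ ?_ ?_ ?_ hb η η'
  · simp
  · intro a b ha hb η η'
    rw [map_add, map_add, LinearMap.add_apply]; exact add_mem (ha _ _) (hb _ _)
  · intro c a ha η η'
    rw [map_smul, map_smul, LinearMap.smul_apply]; exact SMulMemClass.smul_mem c (ha _ _)
  · simp only [Set.ofPred_forall]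
    exact isClosed_iInter fun η => isClosed_iInter fun η' => isClosed_setOf_mem
      ((continuous_linner η').comp (continuous_rsmul_left η))
  · intro c a ha η η'
    rw [rsmul_mul]; exact ha _ _
  · intro c a ha η η'
    rw [rsmul_mul, linner_rsmul]; exact ha _ _
  · rintro _ ⟨e, he, κ, κ', rfl⟩ η η'
    have h1 := linner_rsmul_mem (t := t) (u := e) rfl (linner_mem_rangeIdeal κ κ') η η'
    refine rangeIdeal_le_idealOf (mul_inv_mem_agree ?_) (rangeIdeal_le_mul_inv h1)
    rw [← _root_.mul_assoc, h, he.2]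

/-- The identification of a part of `fib s` with an ideal of `A` is compatible with the
multiplication by `fib t`. -/
lemma rel_mul_right (h : s * t = v) {a : A} {y : Γ.fib s}
    (hr : (Γ.unit a, y) ∈ Γ.rel (agree 1 s) 1 s) (η : Γ.fib t) :
    (lsmul a η, Γ.mul h y η) ∈ Γ.rel (agree t v) t v := by
  have ha : a ∈ Γ.idealOf (agree 1 s) := unit_mem.mp (rel_left hr)
  have haa : star a * a ∈ Γ.idealOf (agree 1 s) := ClosedIdeal.mul_mem_left _ _ ha
  refine ⟨?_, ?_, ?_⟩
  · rw [mem_fibMulIdeal_iff]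
    exact rinner_lsmul_mem_agree h ha _ η
  · rw [mem_fibMulIdeal_iff, Γ.rinner_mul, ← rel_rinner subset_rfl hr hr, Γ.rinner_unit]
    exact rinner_lsmul_mem_agree h haa _ η
  · intro e he w h₁ h₂ κ
    have hw : s * w = w := by rw [← h₁, ← _root_.mul_assoc, h, ← he.2]
    rw [Γ.mul_lsmul_left, Γ.mul_assoc h h₂ h₁ hw]
    set f := w * w⁻¹ with hf
    have hfw : f * w = w := mul_inv_mul_self w
    have hfs := mul_inv_mem_agree hw
    refine Γ.dense_induction hfw (P := LinearMap.eqLocus (lsmul a) (Γ.mul hw y)) ?_ ?_ _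
    · exact isClosed_eq (continuous_lsmul a) (Γ.continuous_mul_right _ _)
    · intro κ' z
      change lsmul a (Γ.mul hfw κ' z) = Γ.mul hw y (Γ.mul hfw κ' z)
      have hsf : s * f = f := by rw [← hfs.2, one_mul]
      rw [← Γ.mul_lsmul_left, ← Γ.unit_mul (one_mul f), rel_mul hr hfs (one_mul f) hsf,
        Γ.mul_assoc hsf hfw hfw hw]

/-- The functional `c ↦ ψ ⟨η, c η⟩`. -/
noncomputable def innerShift (ψ : StrongDual ℂ A) (η : Γ.fib t) : StrongDual ℂ A :=
  ψ.comp { (rinner η).comp (lsmul.flip η) with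
    cont := (continuous_rinner η).comp (continuous_lsmul_left η) }

lemma innerShift_apply (ψ : StrongDual ℂ A) (η : Γ.fib t) (c : A) :
    innerShift ψ η c = ψ (rinner η (lsmul c η)) := rfl

/-- The weak conditional expectation determines the kernel also away from the unit fibre:
`⟨η, ζ η⟩` is obtained by applying `c ↦ ⟨η, c η⟩` to the weak expectation of `ζ`. Hence all diagonal
matrix coefficients of the representations for positive functionals factor through it. -/
lemma ker_mul_eq_fibExp (h : s * t = v) (ζ : Γ.fib s) (η : Γ.fib t) (ψ : StrongDual ℂ A) :
    ker η (Γ.mul h ζ η) ψ = Γ.fibExp s ζ (innerShift ψ η) := by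
  set J := Γ.idealOf (agree 1 s) with hJ
  have h1 : Tendsto (fun d : J => innerShift ψ η (Γ.expMult s ζ d)) J.approxUnit
      (𝓝 (Γ.fibExp s ζ (innerShift ψ η))) := (isMult_expMult ζ).tendsto_approxUnit _
  refine tendsto_nhds_unique ?_ h1
  simp only [innerShift_apply]
  refine (isMult_innerMult subset_rfl η (Γ.mul h ζ η)).tendsto_of_tendsto_mul ψ
    (C := 4 * (‖η‖ * (‖ζ‖ * ‖η‖))) ?_ ?_
  · filter_upwards [J.isGood_approxUnit.norm_le] with d hd
    refine ⟨rinner_lsmul_mem_agree h ((isMult_expMult ζ).mem _ d.2) _ _, ?_⟩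
    refine (norm_rinner_le _ _).trans ?_
    gcongr
    refine (norm_lsmul_le _ _).trans ?_
    gcongr
    exact (norm_expMult_le ζ d.2).trans (mul_le_of_le_one_right (norm_nonneg _) hd)
  · intro d hd
    have hη : linner (rsmul η d) (rsmul η d) ∈ J := linner_rsmul_mem_agree h hd _ _
    have hθ := rel_theta (Γ := Γ) (F := agree t v) (t := t) subset_rfl
      (rsmul_mem (Γ.mul h ζ η) hd)
    rw [← Γ.mul_rsmul_right] at hθ
    have h2 : Tendsto (fun e : J => lsmul (Γ.expMult s ζ e) (rsmul η d)) J.approxUnit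
        (𝓝 (Γ.theta (agree t v) t v (Γ.mul h ζ (rsmul η d)))) := by
      rw [tendsto_iff_norm_sub_tendsto_zero]
      have h3 := tendsto_iff_norm_sub_tendsto_zero.mp
        (((Γ.continuous_mul_right h ζ).tendsto _).comp (tendsto_lsmul hη))
      refine h3.congr fun e => ?_
      rw [Function.comp_apply, ← Γ.mul_balanced]
      exact (rel_norm subset_rfl
        (rel_sub (rel_mul_right h (rel_expMult ζ e.2) (rsmul η d)) hθ)).symm
    have h4 := ((continuous_rinner (A := A) η).tendsto _).comp h2
    rw [Γ.mul_rsmul_right] at h4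
    refine h4.congr fun e => ?_
    rw [Function.comp_apply, ← lsmul_rsmul, rinner_rsmul]

section rep

variable {K : Type u} [NormedAddCommGroup K] [InnerProductSpace ℂ K] [CompleteSpace K]
    {j : Γ.Alg →ₗ[ℂ] K} {ρ : Rep Γ (K →L[ℂ] K)} {ψ : StrongDual ℂ A}
    (hj : ∀ (t u : S) (ξ : Γ.fib t) (η : Γ.fib u),
        inner ℂ (j (incl t ξ)) (j (incl u η)) = ker ξ η ψ)
    (hρ : ∀ {t u v : S} (h : t * u = v) (ξ : Γ.fib t) (η : Γ.fib u),
        ρ.map t ξ (j (incl u η)) = j (incl v (Γ.mul h ξ η)))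

lemma weakExpectation_eq_inner (x : Γ.Full) (φ : StrongDual ℂ A) (k k' : K)
    (h : ∀ t ξ, inner ℂ k (ρ.map t ξ k') = Γ.fibExp t ξ φ) :
    inner ℂ k (integrate ρ x k') = Γ.weakExpectation x φ := by
  let g1 : Γ.Full →ₗ[ℂ] ℂ :=
    { toFun := fun y => inner ℂ k (integrate ρ y k')
      map_add' := fun y z => by rw [map_add, add_apply, inner_add_right]
      map_smul' := fun c y => by rw [map_smul, smul_apply, inner_smul_right]; rfl }
  let g2 : Γ.Full →ₗ[ℂ] ℂ :=
    { toFun := fun y => Γ.weakExpectation y φ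
      map_add' := fun y z => by rw [map_add, add_apply]
      map_smul' := fun c y => by rw [map_smul, smul_apply]; rfl }
  refine full_ext (f := g1) (g := g2) ?_ ?_ (fun t ξ => ?_) x
  · exact continuous_const.inner ((continuous_starHom (integrate ρ)).clm_apply continuous_const)
  · exact (Γ.weakExpectation.continuous).clm_apply continuous_const
  · change inner ℂ k (ρ.map t ξ k') = Γ.weakExpectation (Γ.delta t ξ) φ
    rw [weakExpectation_delta, h]

include hj hρ in
/-- The representation for a positive functional vanishes where the weak conditional expectation
of `b⋆ b` vanishes. -/
lemma integrate_eq_zero (hd : DenseRange j) {b : Γ.Full}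
    (hb : Γ.weakExpectation (star b * b) = 0) : integrate ρ b = 0 := by
  have h1 : ∀ v, integrate ρ b (j v) = 0 := by
    intro v
    refine alg_induction (p := fun v => integrate ρ b (j v) = 0) v
      (fun v w hv hw => by rw [map_add, map_add, hv, hw, add_zero]) (by simp) fun t η => ?_
    have h2 := weakExpectation_eq_inner (star b * b) (innerShift ψ η) (j (incl t η))
      (j (incl t η)) (ρ := ρ) (fun s ζ => by rw [hρ rfl, hj, ker_mul_eq_fibExp])
    rw [hb, zero_apply] at h2
    have h3 : integrate ρ (star b * b) =
        ContinuousLinearMap.adjoint (integrate ρ b) ∘L integrate ρ b := by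
      rw [← ContinuousLinearMap.star_eq_adjoint, ← map_star]
      exact map_mul (integrate ρ) _ _
    rw [h3, ContinuousLinearMap.comp_apply, ContinuousLinearMap.adjoint_inner_right] at h2
    exact inner_self_eq_zero.mp h2
  exact ContinuousLinearMap.ext fun y => hd.induction_on (p := fun y => integrate ρ b y = 0) y
    (isClosed_singleton.preimage (integrate ρ b).continuous) h1

end rep

variable (Γ) in
/-- The ideal of all `b` with `E (x b y) = 0` for all `x` and `y`. -/
def expNull : ClosedIdeal Γ.Full where
  carrier := {b | ∀ x y, Γ.weakExpectation (x * b * y) = 0}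
  add_mem' := fun {a b} ha hb x y => by
    rw [mul_add, add_mul, map_add, ha, hb, add_zero]
  zero_mem' x y := by rw [mul_zero, zero_mul, map_zero]
  smul_mem' c b hb x y := by
    rw [mul_smul_comm, smul_mul_assoc, map_smul, hb]
    exact smul_zero (A := StrongDual ℂ (StrongDual ℂ A)) c
  isClosed' := by
    simp only [Set.ofPred_forall]
    exact isClosed_iInter fun x => isClosed_iInter fun y => isClosed_singleton.preimage
      (Γ.weakExpectation.continuous.comp ((continuous_const_mul x).mul continuous_const))
  mul_mem_left' a b hb x y := by rw [← _root_.mul_assoc]; exact hb _ _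
  mul_mem_right' a b hb x y := by
    rw [← _root_.mul_assoc, _root_.mul_assoc]; exact hb _ _

/-- If the weak expectation of `b⋆ b` vanishes, then `b` is zero in the representations for all
positive functionals on `A`, and these determine the weak expectation of `x b y`. -/
theorem mem_expNull {b : Γ.Full} : b ∈ Γ.expNull ↔ Γ.weakExpectation (star b * b) = 0 := by
  constructor
  · intro hb
    have hu := (ClosedIdeal.whole Γ.Full).isGood_approxUnit.isApproximateUnit.tendsto_mul_coe
      (a := star b * b) trivial
    refine tendsto_nhds_unique ((Γ.weakExpectation.continuous.tendsto _).comp hu)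
      (tendsto_const_nhds.congr fun e => ?_)
    exact (hb _ _).symm
  · intro hb x y
    set z := x * b * y with hz
    ext φ
    rw [zero_apply]
    refine norm_le_zero_iff.mp (le_of_forall_pos_le_add fun ε hε => ?_)
    set δ := ε / (‖Γ.weakExpectation z‖ + 1) with hδ
    have hδ0 : 0 < δ := by positivity
    obtain ⟨ψ, hψ, a, e, h1, -, -⟩ := exists_isPositive_approx φ hδ0
    obtain ⟨K, i1, i2, i3, j, ρ, hd, hj, hρ⟩ := exists_rep_of_isPositive (Γ := Γ) hψ
    set χ := rightShift (leftShift ψ (star a)) e with hχ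
    have h2 : Γ.weakExpectation z χ = 0 := by
      rw [← weakExpectation_eq_inner z χ (j (incl 1 (Γ.unit a))) (j (incl 1 (Γ.unit e)))
        (fun t ξ => inner_rep_unit hj hρ a e ξ), hz, map_mul, map_mul,
        integrate_eq_zero hj hρ hd hb, mul_zero, zero_mul, zero_apply, inner_zero_right]
    have h3 : Γ.weakExpectation z φ = Γ.weakExpectation z (φ - χ) := by
      rw [map_sub, h2, sub_zero]
    rw [h3, zero_add]
    calc _ ≤ ‖Γ.weakExpectation z‖ * ‖φ - χ‖ := ContinuousLinearMap.le_opNorm _ _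
      _ ≤ (‖Γ.weakExpectation z‖ + 1) * δ := by gcongr; linarith
      _ = ε := by rw [hδ]; field_simp

lemma nullIdeal_eq_expNull : Γ.nullIdeal = Γ.expNull := by
  refine SetLike.ext fun b => ⟨ClosedIdeal.generated_le fun b hb => mem_expNull.mpr hb, fun hb =>
    ClosedIdeal.subset_generated (mem_expNull.mp hb)⟩

/-- The kernel of the quotient map onto the reduced crossed product is the null space of the weak
conditional expectation. -/
theorem regular_eq_zero_iff {b : Γ.Full} :
    Γ.regular b = 0 ↔ Γ.weakExpectation (star b * b) = 0 := by
  rw [← mem_expNull, ← nullIdeal_eq_expNull]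
  exact ClosedIdeal.Quot.mk_eq_zero

end Action

namespace Action

open InverseMonoid HilbertBimodule

variable {S A : Type u} [InverseMonoid S] [NonUnitalCStarAlgebra A] {Γ : Action S A}
  {I : ClosedIdeal A} (hI : Γ.IsInvariant I)

/-! ### Naturality of the weak conditional expectation -/

variable {t : S}

lemma tendsto_expMult_coe_mul (ξ : Γ.fib t) {d : A} (hd : d ∈ Γ.idealOf (agree 1 t)) :
    Tendsto (fun e : Γ.idealOf (agree 1 t) => Γ.expMult t ξ e * d)
      (Γ.idealOf (agree 1 t)).approxUnit (𝓝 (Γ.expMult t ξ d)) := by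
  have hm := isMult_expMult ξ
  rw [tendsto_iff_norm_sub_tendsto_zero]
  have h1 := tendsto_iff_norm_sub_tendsto_zero.mp
    ((Γ.idealOf (agree 1 t)).isGood_approxUnit.isApproximateUnit.tendsto_coe_mul hd)
  have h2 := h1.const_mul ‖ξ‖
  rw [mul_zero] at h2
  refine squeeze_zero (fun _ => norm_nonneg _) (fun e => ?_) h2
  have he := (Γ.idealOf (agree 1 t)).mul_mem_right d e.2
  rw [← hm.mul _ e.2, ← hm.sub _ he _ hd]
  exact norm_expMult_le ξ (sub_mem he hd)

include hI in
/-- The ideal `I_F` of the restricted action is the intersection of `I_F` with `I`; one inclusion is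
`mem_idealOf_of_restrictIdeal`. -/
lemma mk_mem_restrictIdeal_idealOf {F : Set S} {b : A} (hb : b ∈ Γ.idealOf F) (hbI : b ∈ I) :
    (⟨b, hbI⟩ : I) ∈ (Γ.restrictIdeal I hI).idealOf F := by
  have h1 : Tendsto (fun e : I => (⟨b * e, I.mul_mem_left b e.2⟩ : I)) I.approxUnit
      (𝓝 ⟨b, hbI⟩) :=
    tendsto_subtype_rng.mpr (I.isGood_approxUnit.isApproximateUnit.tendsto_mul_coe hbI)
  exact ((Γ.restrictIdeal I hI).idealOf F).isClosed.mem_of_tendsto h1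
    (Eventually.of_forall fun e => mul_mem_restrictIdeal_idealOf hI hb e)

lemma expMult_mem {ξ : Γ.fib t} (hξ : ξ ∈ Γ.fibMulIdeal I t) {d : A}
    (hd : d ∈ Γ.idealOf (agree 1 t)) : Γ.expMult t ξ d ∈ I := by
  have h := rel_expMult ξ hd
  rw [← unit_mem (Γ := Γ), mem_fibMulIdeal_iff, rel_rinner subset_rfl h h]
  exact rinner_mem _ (rsmul_mem_of_mem hξ d)

lemma expMult_restrictIdeal (ξ : (Γ.restrictIdeal I hI).fib t) {d : I}
    (hd : d ∈ (Γ.restrictIdeal I hI).idealOf (agree 1 t)) :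
    (((Γ.restrictIdeal I hI).expMult t ξ d : I) : A)
      = Γ.expMult t ((Γ.inclHom I hI).map t ξ) d := by
  have hd' := mem_idealOf_of_restrictIdeal hI hd
  have h := rel_expMult ((Γ.inclHom I hI).map t ξ) hd'
  have ha := expMult_mem (inclHom_map_mem hI ξ) hd'
  have haJ := mk_mem_restrictIdeal_idealOf hI ((isMult_expMult _).mem _ hd') ha
  refine congrArg Subtype.val (expMult_eq (Γ := Γ.restrictIdeal I hI) (a := ⟨_, ha⟩) ⟨?_, ?_, ?_⟩)
  · exact unit_mem.mpr haJ
  · exact rsmul_mem (Γ := Γ.restrictIdeal I hI) ξ hd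
  · intro f hf v h₁ h₂ κ
    exact Subtype.ext (rel_mul h hf h₁ h₂ ((Γ.inclHom I hI).map f κ))

/-- Both sides are limits along an approximate unit of the ideal `I_{1,t}` of `A`. It need not lie
in `I`, but the values of `ϑ_{1,t}` do, and they converge to the multiplier of the smaller ideal. -/
theorem fibExp_inclHom (ξ : (Γ.restrictIdeal I hI).fib t) (φ : StrongDual ℂ A) :
    Γ.fibExp t ((Γ.inclHom I hI).map t ξ) φ
      = (Γ.restrictIdeal I hI).fibExp t ξ (φ.comp I.inclL) := by
  set η := (Γ.inclHom I hI).map t ξ with hη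
  set J := Γ.idealOf (agree 1 t) with hJ
  have hη' : η ∈ Γ.fibMulIdeal I t := inclHom_map_mem hI ξ
  refine tendsto_nhds_unique ((isMult_expMult η).tendsto_approxUnit φ) ?_
  refine (isMult_expMult (Γ := Γ.restrictIdeal I hI) ξ).tendsto_of_tendsto_mul (φ.comp I.inclL)
    (y := fun e : J => (⟨Γ.expMult t η e, expMult_mem hη' e.2⟩ : I)) (C := ‖η‖) ?_ ?_
  · filter_upwards [J.isGood_approxUnit.norm_le] with e he
    exact ⟨mk_mem_restrictIdeal_idealOf hI ((isMult_expMult _).mem _ e.2) _,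
      (norm_expMult_le η e.2).trans (mul_le_of_le_one_right (norm_nonneg _) he)⟩
  · intro d hd
    rw [tendsto_subtype_rng, expMult_restrictIdeal hI ξ hd]
    exact tendsto_expMult_coe_mul η (mem_idealOf_of_restrictIdeal hI hd)

lemma mk_mem_restrictQuot_idealOf {F : Set S} {b : A} (hb : b ∈ Γ.idealOf F) :
    ClosedIdeal.Quot.mk I b ∈ (Γ.restrictQuot I hI).idealOf F := by
  refine ClosedIdeal.generated_induction
    (p := fun b => ClosedIdeal.Quot.mk I b ∈ (Γ.restrictQuot I hI).idealOf F)
    ?_ ?_ ?_ ?_ ?_ ?_ ?_ hb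
  · rw [map_zero]; exact zero_mem _
  · intro a b ha hb; rw [map_add]; exact add_mem ha hb
  · intro c a ha; rw [map_smul]; exact SMulMemClass.smul_mem c ha
  · exact isClosed_setOf_mem I.mkL.continuous
  · intro a b hb; rw [ClosedIdeal.Quot.mk_mul]; exact ClosedIdeal.mul_mem_left _ _ hb
  · intro a b hb; rw [ClosedIdeal.Quot.mk_mul]; exact ClosedIdeal.mul_mem_right _ _ hb
  · rintro _ ⟨f, hf, κ, κ', rfl⟩
    exact ClosedIdeal.subset_generated ⟨f, hf, Γ.quotMk I f κ, Γ.quotMk I f κ', rfl⟩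

/-- The quotient map sends the ideal of `F` onto the corresponding ideal of the quotient action:
its image is closed, as the range of a `⋆`-homomorphism. -/
lemma exists_mk_eq_of_mem_idealOf {F : Set S} {c : I.Quot}
    (hc : c ∈ (Γ.restrictQuot I hI).idealOf F) :
    ∃ b ∈ Γ.idealOf F, ClosedIdeal.Quot.mk I b = c := by
  let f : Γ.idealOf F →⋆ₙₐ[ℂ] I.Quot :=
    I.mkHom.comp (NonUnitalStarSubalgebraClass.subtype (Γ.idealOf F))
  let R : ClosedIdeal I.Quot :=
    { LinearMap.range (starHomLinear f) with
      isClosed' := isClosed_range_starHom f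
      mul_mem_left' := by
        rintro a _ ⟨b, rfl⟩
        obtain ⟨a, rfl⟩ := ClosedIdeal.Quot.mk_surjective a
        exact ⟨⟨a * b, ClosedIdeal.mul_mem_left _ _ b.2⟩, rfl⟩
      mul_mem_right' := by
        rintro a _ ⟨b, rfl⟩
        obtain ⟨a, rfl⟩ := ClosedIdeal.Quot.mk_surjective a
        exact ⟨⟨b * a, ClosedIdeal.mul_mem_right _ _ b.2⟩, rfl⟩ }
  have h : c ∈ R := by
    refine ClosedIdeal.generated_le ?_ hc
    rintro _ ⟨f, hf, κ, κ', rfl⟩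
    obtain ⟨κ, rfl⟩ := quotMk_surjective f κ
    obtain ⟨κ', rfl⟩ := quotMk_surjective f κ'
    exact ⟨⟨linner κ κ', ClosedIdeal.subset_generated ⟨f, hf, κ, κ', rfl⟩⟩, rfl⟩
  obtain ⟨b, rfl⟩ := h
  exact ⟨b, b.2, rfl⟩

lemma expMult_restrictQuot (ξ : Γ.fib t) {d : A} (hd : d ∈ Γ.idealOf (agree 1 t)) :
    (Γ.restrictQuot I hI).expMult t ((Γ.quotHom I hI).map t ξ) (ClosedIdeal.Quot.mk I d)
      = ClosedIdeal.Quot.mk I (Γ.expMult t ξ d) := by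
  have h := rel_expMult ξ hd
  have ha := (isMult_expMult ξ).mem _ hd
  refine expMult_eq (Γ := Γ.restrictQuot I hI) ⟨?_, ?_, ?_⟩
  · exact unit_mem.mpr (mk_mem_restrictQuot_idealOf hI ha)
  · exact rsmul_mem (Γ := Γ.restrictQuot I hI) _ (mk_mem_restrictQuot_idealOf hI hd)
  · intro f hf v h₁ h₂
    exact quot_ind fun κ => congrArg (Γ.quotMk I v) (rel_mul h hf h₁ h₂ κ)

/-- The values of `ϑ_{1,t}` at an approximate unit of `I_{1,t}` are mapped to elements that converge
to the multiplier for the quotient action. -/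
theorem fibExp_quotHom (ξ : Γ.fib t) (φ : StrongDual ℂ I.Quot) :
    (Γ.restrictQuot I hI).fibExp t ((Γ.quotHom I hI).map t ξ) φ = Γ.fibExp t ξ (φ.comp I.mkL) := by
  set J := Γ.idealOf (agree 1 t) with hJ
  refine (tendsto_nhds_unique ((isMult_expMult ξ).tendsto_approxUnit (φ.comp I.mkL)) ?_).symm
  refine (isMult_expMult (Γ := Γ.restrictQuot I hI) ((Γ.quotHom I hI).map t ξ))
    |>.tendsto_of_tendsto_mul φ (y := fun e : J => ClosedIdeal.Quot.mk I (Γ.expMult t ξ e))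
      (C := ‖ξ‖) ?_ ?_
  · filter_upwards [J.isGood_approxUnit.norm_le] with e he
    exact ⟨mk_mem_restrictQuot_idealOf hI ((isMult_expMult _).mem _ e.2),
      (ClosedIdeal.Quot.norm_mk_le _).trans
        ((norm_expMult_le ξ e.2).trans (mul_le_of_le_one_right (norm_nonneg _) he))⟩
  · intro c hc
    obtain ⟨d, hd, rfl⟩ := exists_mk_eq_of_mem_idealOf hI hc
    rw [expMult_restrictQuot hI ξ hd]
    exact (I.mkL.continuous.tendsto _).comp (tendsto_expMult_coe_mul ξ hd)

theorem weakExpectation_inclHom (b : (Γ.restrictIdeal I hI).Full) (φ : StrongDual ℂ A) :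
    Γ.weakExpectation ((Γ.inclHom I hI).full b) φ
      = (Γ.restrictIdeal I hI).weakExpectation b (φ.comp I.inclL) := by
  let g1 : (Γ.restrictIdeal I hI).Full →ₗ[ℂ] ℂ :=
    { toFun := fun y => Γ.weakExpectation ((Γ.inclHom I hI).full y) φ
      map_add' := fun y z => by rw [map_add, map_add, add_apply]
      map_smul' := fun c y => by rw [map_smul, map_smul, smul_apply]; rfl }
  let g2 : (Γ.restrictIdeal I hI).Full →ₗ[ℂ] ℂ :=
    { toFun := fun y => (Γ.restrictIdeal I hI).weakExpectation y (φ.comp I.inclL)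
      map_add' := fun y z => by rw [map_add, add_apply]
      map_smul' := fun c y => by rw [map_smul, smul_apply]; rfl }
  refine full_ext (f := g1) (g := g2) ?_ ?_ (fun t ξ => ?_) b
  · exact (Γ.weakExpectation.continuous.comp
      (continuous_starHom (Γ.inclHom I hI).full)).clm_apply continuous_const
  · exact ((Γ.restrictIdeal I hI).weakExpectation.continuous).clm_apply continuous_const
  · change Γ.weakExpectation (Γ.delta t ((Γ.inclHom I hI).map t ξ)) φ
      = (Γ.restrictIdeal I hI).weakExpectation ((Γ.restrictIdeal I hI).delta t ξ) _
    rw [weakExpectation_delta, weakExpectation_delta, fibExp_inclHom]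

theorem weakExpectation_quotHom (b : Γ.Full) (φ : StrongDual ℂ I.Quot) :
    (Γ.restrictQuot I hI).weakExpectation ((Γ.quotHom I hI).full b) φ
      = Γ.weakExpectation b (φ.comp I.mkL) := by
  let g1 : Γ.Full →ₗ[ℂ] ℂ :=
    { toFun := fun y => (Γ.restrictQuot I hI).weakExpectation ((Γ.quotHom I hI).full y) φ
      map_add' := fun y z => by rw [map_add, map_add, add_apply]
      map_smul' := fun c y => by rw [map_smul, map_smul, smul_apply]; rfl }
  let g2 : Γ.Full →ₗ[ℂ] ℂ :=
    { toFun := fun y => Γ.weakExpectation y (φ.comp I.mkL)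
      map_add' := fun y z => by rw [map_add, add_apply]
      map_smul' := fun c y => by rw [map_smul, smul_apply]; rfl }
  refine full_ext (f := g1) (g := g2) ?_ ?_ (fun t ξ => ?_) b
  · exact ((Γ.restrictQuot I hI).weakExpectation.continuous.comp
      (continuous_starHom (Γ.quotHom I hI).full)).clm_apply continuous_const
  · exact (Γ.weakExpectation.continuous).clm_apply continuous_const
  · change (Γ.restrictQuot I hI).weakExpectation
      ((Γ.restrictQuot I hI).delta t ((Γ.quotHom I hI).map t ξ)) φ
        = Γ.weakExpectation (Γ.delta t ξ) _
    rw [weakExpectation_delta, weakExpectation_delta, fibExp_quotHom]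

end Action

/-- The `⋆`-homomorphism on the quotient by an ideal on which a given `⋆`-homomorphism vanishes. -/
noncomputable def ClosedIdeal.liftHom {B : Type u} {C : Type v} [NonUnitalCStarAlgebra B]
    [NonUnitalCStarAlgebra C] (J : ClosedIdeal B) (f : B →⋆ₙₐ[ℂ] C) (h : ∀ b ∈ J, f b = 0) :
    J.Quot →⋆ₙₐ[ℂ] C where
  toFun := J.toSubmodule.liftQ (starHomLinear f) h
  map_smul' := map_smul (J.toSubmodule.liftQ (starHomLinear f) h)
  map_zero' := map_zero (J.toSubmodule.liftQ (starHomLinear f) h)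
  map_add' := map_add (J.toSubmodule.liftQ (starHomLinear f) h)
  map_mul' x y := by
    obtain ⟨a, rfl⟩ := Quot.mk_surjective x
    obtain ⟨b, rfl⟩ := Quot.mk_surjective y
    exact map_mul f a b
  map_star' x := by
    obtain ⟨a, rfl⟩ := Quot.mk_surjective x
    exact map_star f a

namespace Action

open InverseMonoid HilbertBimodule

variable {S A : Type u} [InverseMonoid S] [NonUnitalCStarAlgebra A] {Γ : Action S A}
  {I : ClosedIdeal A} (hI : Γ.IsInvariant I)

/-! ### Descent to the reduced crossed products -/

lemma regular_surjective : Function.Surjective Γ.regular := ClosedIdeal.Quot.mk_surjective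

/-- A `⋆`-homomorphism between full crossed products that respects the kernels of the canonical
surjections descends to the reduced crossed products. -/
lemma exists_reduced_hom {B : Type u} [NonUnitalCStarAlgebra B] {Δ : Action S B}
    (f : Γ.Full →⋆ₙₐ[ℂ] Δ.Full) (h : ∀ b, Γ.regular b = 0 → Δ.regular (f b) = 0) :
    ∃ g : Γ.Reduced →⋆ₙₐ[ℂ] Δ.Reduced, ∀ b, g (Γ.regular b) = Δ.regular (f b) :=
  ⟨Γ.nullIdeal.liftHom (Δ.regular.comp f) fun b hb => h b (ClosedIdeal.Quot.mk_eq_zero.mpr hb),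
    fun _ => rfl⟩

/-- Functionals on an ideal extend, so that the intertwining relation detects the kernel. -/
lemma regular_inclHom_full_eq_zero_iff (b : (Γ.restrictIdeal I hI).Full) :
    Γ.regular ((Γ.inclHom I hI).full b) = 0 ↔ (Γ.restrictIdeal I hI).regular b = 0 := by
  rw [regular_eq_zero_iff, regular_eq_zero_iff, ← map_star, ← map_mul]
  constructor
  · intro h
    ext φ
    obtain ⟨ψ, hψ, -⟩ := exists_extension_norm_eq I.toSubmodule φ
    have hφ : φ = ψ.comp I.inclL := ContinuousLinearMap.ext fun x => (hψ x).symm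
    rw [hφ, ← weakExpectation_inclHom, h]
    rfl
  · intro h
    ext φ
    rw [weakExpectation_inclHom, h]
    rfl

lemma regular_quotHom_full_eq_zero {b : Γ.Full} (hb : Γ.regular b = 0) :
    (Γ.restrictQuot I hI).regular ((Γ.quotHom I hI).full b) = 0 := by
  rw [regular_eq_zero_iff] at hb ⊢
  rw [← map_star, ← map_mul]
  ext φ
  rw [weakExpectation_quotHom, hb]
  rfl

end Action

end ISG

theorem mainTheorem10 {S A : Type u} [InverseMonoid S] [NonUnitalCStarAlgebra A]
    (Γ : ISG.Action S A) (I : ClosedIdeal A) (hI : Γ.IsInvariant I) :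
    -- the sequence of full crossed products is exact
    (Function.Injective (Γ.inclHom I hI).full ∧
      Function.Exact (Γ.inclHom I hI).full (Γ.quotHom I hI).full ∧
      Function.Surjective (Γ.quotHom I hI).full) ∧
    -- the weak conditional expectations that define the reduced crossed products exist,
    -- and the kernel of the canonical surjection `Λ` is `{b | E (b⋆ b) = 0}`
    (((Γ.restrictIdeal I hI).IsWeakExpectation (Γ.restrictIdeal I hI).weakExpectation ∧
      ∀ b, (Γ.restrictIdeal I hI).regular b = 0 ↔
        (Γ.restrictIdeal I hI).weakExpectation (star b * b) = 0) ∧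
     (Γ.IsWeakExpectation Γ.weakExpectation ∧
      ∀ b, Γ.regular b = 0 ↔ Γ.weakExpectation (star b * b) = 0) ∧
     ((Γ.restrictQuot I hI).IsWeakExpectation (Γ.restrictQuot I hI).weakExpectation ∧
      ∀ b, (Γ.restrictQuot I hI).regular b = 0 ↔
        (Γ.restrictQuot I hI).weakExpectation (star b * b) = 0)) ∧
    -- the maps between the full crossed products intertwine the weak conditional expectations
    (∀ b φ, Γ.weakExpectation ((Γ.inclHom I hI).full b) φ =
      (Γ.restrictIdeal I hI).weakExpectation b (φ.comp I.inclL)) ∧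
    (∀ b φ, (Γ.restrictQuot I hI).weakExpectation ((Γ.quotHom I hI).full b) φ =
      Γ.weakExpectation b (φ.comp I.mkL)) ∧
    -- they descend to the reduced crossed products
    ∃ (ιr : (Γ.restrictIdeal I hI).Reduced →⋆ₙₐ[ℂ] Γ.Reduced)
      (κr : Γ.Reduced →⋆ₙₐ[ℂ] (Γ.restrictQuot I hI).Reduced),
      (∀ b, ιr ((Γ.restrictIdeal I hI).regular b) = Γ.regular ((Γ.inclHom I hI).full b)) ∧
      (∀ b, κr (Γ.regular b) = (Γ.restrictQuot I hI).regular ((Γ.quotHom I hI).full b)) ∧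
      Function.Injective ιr ∧ Function.Surjective κr ∧ ∀ x, κr (ιr x) = 0 := by
  obtain ⟨ιr, hι⟩ := Action.exists_reduced_hom (Γ.inclHom I hI).full fun b hb =>
    (Action.regular_inclHom_full_eq_zero_iff hI b).mpr hb
  obtain ⟨κr, hκ⟩ := Action.exists_reduced_hom (Γ.quotHom I hI).full fun b hb =>
    Action.regular_quotHom_full_eq_zero hI hb
  refine ⟨⟨Action.inclHom_full_injective hI, Action.exact_full hI,
      Action.quotHom_full_surjective hI⟩,
    ⟨⟨Action.isWeakExpectation_weakExpectation _, fun _ => Action.regular_eq_zero_iff⟩,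
      ⟨Action.isWeakExpectation_weakExpectation _, fun _ => Action.regular_eq_zero_iff⟩,
      ⟨Action.isWeakExpectation_weakExpectation _, fun _ => Action.regular_eq_zero_iff⟩⟩,
    Action.weakExpectation_inclHom hI, Action.weakExpectation_quotHom hI,
    ιr, κr, hι, hκ, ?_, ?_, ?_⟩
  · rw [injective_iff_map_eq_zero]
    intro x hx
    obtain ⟨b, rfl⟩ := Action.regular_surjective x
    rw [hι] at hx
    exact (Action.regular_inclHom_full_eq_zero_iff hI b).mp hx
  · intro y
    obtain ⟨c, rfl⟩ := Action.regular_surjective y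
    obtain ⟨b, rfl⟩ := Action.quotHom_full_surjective hI c
    exact ⟨_, hκ b⟩
  · intro x
    obtain ⟨b, rfl⟩ := Action.regular_surjective x
    rw [hι, hκ, Action.quotHom_full_inclHom_full, map_zero]
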